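/- Let $g\in C^\infty(\mathbb R/2\pi\mathbb Z;\mathbb C)$ be such that $\mathrm{Im}\,g$ has exactly two critical points, a minimum $a$ and a maximum $b$, $a<b<a+2\pi$, $\mathrm{Im}\,g(a)<\mathrm{Im}\,g(b)$, both nondegenerate ($\mathrm{Im}\,g''(a)\neq0\neq\mathrm{Im}\,g''(b)$). For $h>0$ let $P_h=hD_x+g(x)$, $D_x=\frac1i\frac{d}{dx}$, on $L^2(S^1)$, $S^1=\mathbb R/2\pi\mathbb Z$, with scalar product $(u|v)=\int_{S^1}u\bar v\,dx$ and domain $H^1(S^1)$; let $p(x,\xi)=\xi+g(x)$, $\Sigma=\overline{p(T^*S^1)}$, $d(z)=\mathrm{dist}(z,\partial\Sigma)$, $\langle \mathrm{Im}\,g\rangle=\frac1{2\pi}\int_0^{2\pi}\mathrm{Im}\,g\,dx$ and $\{F,G\}=F'_\xi G'_x-F'_xG'_\xi$. For $z\in\mathring\Sigma$ let $x_\pm=x_\pm(z)$ be the points with $\mathrm{Im}\,g(x_\pm)=\mathrm{Im}\,z$, $\pm\mathrm{Im}\,g'(x_\pm)<0$, represented by real numbers with $x_--2\pi<x_+<x_-$;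 put $\rho_\pm=(x_\pm,\mathrm{Re}\,z-\mathrm{Re}\,g(x_\pm))$ and $$S(z)=\min\Big(\mathrm{Im}\int_{x_+}^{x_-}(z-g(y))\,dy,\ \mathrm{Im}\int_{x_+}^{x_--2\pi}(z-g(y))\,dy\Big).$$ Let $e_0=e_0(z)$, $f_0=f_0(z)$ be $L^2$-normalized eigenfunctions for the smallest eigenvalue of $Q(z)=(P_h-z)^*(P_h-z)$ and of $\widetilde Q(z)=(P_h-z)(P_h-z)^*$, respectively (domains $H^2(S^1)$). Let $R,M\in\mathbb R$ and $C,c>0$. There are $A,h_0>0$ and constants $B_\beta$ ($\beta\in\mathbb N^2$), depending only on $g,R,C,c,M$, such that the following holds for all $0<h<h_0$. Let $\Omega\subset\Sigma$ be open, contained in the disc $\{|z|<R\}$, with $d(z)\ge A h^{2/3}$ for $z\in\Omega$ ($\Omega$ may depend on $h$). Let $\chi\in C^\infty(S^1;\mathbb C)$ (possibly depending on $h$) satisfy $|\chi|\le M$ and, for every $z\in\Omega$, $\chi=1$ at all points at distance at most $c\,d(z)^{1/2}$ from $x_-(z)$ and $\chi=0$ at all points at distance at most $c\,d(z)^{1/2}$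 from $x_+(z)$. (If $\Omega$ has compact closure in $\mathring\Sigma$ and is independent of $h$, as is $\chi$, this means, for suitable $c$ and $M$, that $\chi=1$ in a neighbourhood of $\overline{\{x_-(z):z\in\Omega\}}$ and $\chi=0$ in a neighbourhood of $\overline{\{x_+(z):z\in\Omega\}}$.) Then there is a real function $K(z)=K(z;h)$, smooth on $\Omega'=\{z\in\Omega:|\mathrm{Im}\,z-\langle\mathrm{Im}\,g\rangle|>1/C\}$, such that for all $z\in\Omega'$ $$|([P_h,\chi]e_0|f_0)|=\sqrt h\left(\frac{\frac i2\{p,\bar p\}(\rho_+)\,\frac i2\{\bar p,p\}(\rho_-)}{\pi^2}\right)^{1/4}(1+K(z;h))\,e^{-S(z)/h}$$ and, for all $\beta=(\beta_1,\beta_2)\in\mathbb N^2$ with $|\beta|=\beta_1+\beta_2$, $$|\partial_z^{\beta_1}\partial_{\bar z}^{\beta_2}K(z;h)|\le B_\beta\, d(z)^{\frac{|\beta|-3}{2}}\,h^{1-|\beta|}.$$ -/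

import Mathlib

open scoped ContDiff ComplexConjugate

noncomputable section

namespace Hager

/-! Functions on the circle `ℝ / 2πℤ` are `2π`-periodic functions on `ℝ`. -/

/-- The coefficient `g` of Hager's model: smooth, `2π`-periodic, `Im g` has exactly two critical
points per period, the minimum `a` and the maximum `b`, and both are nondegenerate. -/
structure IsPotential (g : ℝ → ℂ) (a b : ℝ) : Prop where
  smooth : ContDiff ℝ ∞ g
  periodic : Function.Periodic g (2 * Real.pi)
  a_lt_b : a < b
  b_lt : b < a + 2 * Real.pi
  im_lt : (g a).im < (g b).im
  crit_iff : ∀ x ∈ Set.Ico a (a + 2 * Real.pi),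
    (deriv (fun y => (g y).im) x = 0 ↔ x = a ∨ x = b)
  nondeg_a : deriv (deriv (fun y => (g y).im)) a ≠ 0
  nondeg_b : deriv (deriv (fun y => (g y).im)) b ≠ 0

/-! ### Symbol, Poisson bracket, and the range of the symbol -/

/-- `p(x, ξ) = ξ + g(x)`. -/
def symbol (g : ℝ → ℂ) (x ξ : ℝ) : ℂ := (ξ : ℂ) + g x

/-- `{F, G} = F'_ξ G'_x - F'_x G'_ξ` at the point `(x, ξ)`. -/
def poisson (F G : ℝ → ℝ → ℂ) (x ξ : ℝ) : ℂ :=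
  deriv (fun η => F x η) ξ * deriv (fun y => G y ξ) x
    - deriv (fun y => F y ξ) x * deriv (fun η => G x η) ξ

/-- `Σ`, the closure of the range of `p`. -/
def sigma (g : ℝ → ℂ) : Set ℂ :=
  closure (Set.range fun q : ℝ × ℝ => symbol g q.1 q.2)

/-- `d(z) = dist(z, ∂Σ)`. -/
def bdist (g : ℝ → ℂ) (z : ℂ) : ℝ := Metric.infDist z (frontier (sigma g))

/-- The mean value of `Im g` over a period. -/
def meanIm (g : ℝ → ℂ) : ℝ := (2 * Real.pi)⁻¹ * ∫ x in (0 : ℝ)..(2 * Real.pi), (g x).im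

/-! ### The points `x_±(z)`, the action `S(z)` and the leading coefficient -/

/-- `(xp, xm)` are real representatives of `(x_+(z), x_-(z))` with `x_- - 2π < x_+ < x_-`.
For `z` in the interior of `Σ` they exist and are unique up to a common translation
by a multiple of `2π`. -/
structure IsTurningPair (g : ℝ → ℂ) (z : ℂ) (xp xm : ℝ) : Prop where
  im_xp : (g xp).im = z.im
  im_xm : (g xm).im = z.im
  deriv_xp : deriv (fun y => (g y).im) xp < 0
  deriv_xm : 0 < deriv (fun y => (g y).im) xm
  lower : xm - 2 * Real.pi < xp
  upper : xp < xm

/-- `S(z) = min (Im ∫_{x_+}^{x_-} (z - g), Im ∫_{x_+}^{x_- - 2π} (z - g))`. -/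
def action (g : ℝ → ℂ) (z : ℂ) (xp xm : ℝ) : ℝ :=
  min (∫ y in xp..xm, (z - g y)).im (∫ y in xp..(xm - 2 * Real.pi), (z - g y)).im

/-- `(i/2) {p, p̄}(ρ_+) · (i/2) {p̄, p}(ρ_-)` with `ρ_± = (x_±, Re z - Re g(x_±))`. This complex
number is real and positive, so that its real part is the number itself. -/
def bracketProd (g : ℝ → ℂ) (z : ℂ) (xp xm : ℝ) : ℝ :=
  ((Complex.I / 2 * poisson (symbol g) (fun x ξ => conj (symbol g x ξ)) xp (z.re - (g xp).re)) *
    (Complex.I / 2 *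
      poisson (fun x ξ => conj (symbol g x ξ)) (symbol g) xm (z.re - (g xm).re))).re

/-! ### The operators -/

/-- The scalar product `(u | v)` of `L²(S¹)`, linear in the first argument. -/
def scalar (u v : ℝ → ℂ) : ℂ := ∫ x in (0 : ℝ)..(2 * Real.pi), u x * conj (v x)

/-- `u` is (the continuous representative of) an element of `H¹(S¹)`: it is periodic and the
primitive of a function that is square integrable over a period. -/
def InH1 (u : ℝ → ℂ) : Prop :=
  Function.Periodic u (2 * Real.pi) ∧
    ∃ v : ℝ → ℂ, Function.Periodic v (2 * Real.pi) ∧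
      MeasureTheory.MemLp v 2
        (MeasureTheory.volume.restrict (Set.Ioc (0 : ℝ) (2 * Real.pi))) ∧
      ∀ x, u x = u 0 + ∫ t in (0 : ℝ)..x, v t

/-- `u` is (the `C¹` representative of) an element of `H²(S¹)`. -/
def InH2 (u : ℝ → ℂ) : Prop := InH1 u ∧ Differentiable ℝ u ∧ InH1 (deriv u)

/-- `P_h u = h D_x u + g u`, with `D_x = (1/i) d/dx`. -/
def P (h : ℝ) (g u : ℝ → ℂ) (x : ℝ) : ℂ := h * (1 / Complex.I * deriv u x) + g x * u x

/-- The adjoint `P_h^* u = h D_x u + ḡ u`. -/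
def Padj (h : ℝ) (g u : ℝ → ℂ) (x : ℝ) : ℂ :=
  h * (1 / Complex.I * deriv u x) + conj (g x) * u x

/-- `(P_h - z) u`. -/
def Pz (h : ℝ) (g : ℝ → ℂ) (z : ℂ) (u : ℝ → ℂ) (x : ℝ) : ℂ := P h g u x - z * u x

/-- `(P_h - z)^* u`. -/
def PzAdj (h : ℝ) (g : ℝ → ℂ) (z : ℂ) (u : ℝ → ℂ) (x : ℝ) : ℂ := Padj h g u x - conj z * u x

/-- `Q(z) = (P_h - z)^* (P_h - z)`. -/
def Q (h : ℝ) (g : ℝ → ℂ) (z : ℂ) (u : ℝ → ℂ) : ℝ → ℂ := PzAdj h g z (Pz h g z u)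

/-- `Q̃(z) = (P_h - z) (P_h - z)^*`. -/
def Qtilde (h : ℝ) (g : ℝ → ℂ) (z : ℂ) (u : ℝ → ℂ) : ℝ → ℂ := Pz h g z (PzAdj h g z u)

/-- The commutator `[P_h, χ] u = P_h (χ u) - χ P_h u`. -/
def commutator (h : ℝ) (g χ u : ℝ → ℂ) (x : ℝ) : ℂ :=
  P h g (fun y => χ y * u y) x - χ x * P h g u x

/-- `u ∈ H²(S¹)` is an `L²`-normalized eigenfunction of `T` with the eigenvalue `t`. -/
def IsNormalizedEigenfunction (T : (ℝ → ℂ) → ℝ → ℂ) (t : ℝ) (u : ℝ → ℂ) : Prop :=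
  InH2 u ∧ scalar u u = 1 ∧ ∀ᵐ x : ℝ, T u x = (t : ℂ) * u x

/-- `u` is a normalized eigenfunction of `T` with respect to its smallest eigenvalue. -/
def IsGroundState (T : (ℝ → ℂ) → ℝ → ℂ) (u : ℝ → ℂ) : Prop :=
  ∃ t : ℝ, IsNormalizedEigenfunction T t u ∧
    ∀ (s : ℝ) (v : ℝ → ℂ), IsNormalizedEigenfunction T s v → t ≤ s

/-! ### The cutoff and the derivatives in `z` -/

/-- A cutoff `χ ∈ C^∞(S¹)`, bounded by `M`, which is `1` near the points `x_-(z)` and `0` near the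
points `x_+(z)`, `z ∈ Ω`. The neighbourhoods are measured in units of `d(z)^{1/2}`, the order of
magnitude of `x_-(z) - x_+(z)` when `z` approaches `∂Σ`. If `Ω` is relatively compact in the
interior of `Σ` and `χ` is fixed, then suitable `c > 0` and `M` exist as soon as `χ = 1` in a
neighbourhood of the closure of `{x_-(z)}` and `χ = 0` in one of the closure of `{x_+(z)}`. -/
structure IsCutoff (g : ℝ → ℂ) (Ω : Set ℂ) (c M : ℝ) (χ : ℝ → ℂ) : Prop where
  smooth : ContDiff ℝ ∞ χ
  periodic : Function.Periodic χ (2 * Real.pi)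
  bound : ∀ x, ‖χ x‖ ≤ M
  eq_one : ∀ z ∈ Ω, ∀ xp xm : ℝ, IsTurningPair g z xp xm →
    ∀ x, |x - xm| ≤ c * √(bdist g z) → χ x = 1
  eq_zero : ∀ z ∈ Ω, ∀ xp xm : ℝ, IsTurningPair g z xp xm →
    ∀ x, |x - xp| ≤ c * √(bdist g z) → χ x = 0

/-- `∂_z = (∂_{Re z} - i ∂_{Im z}) / 2`. -/
def dz (f : ℂ → ℂ) (z : ℂ) : ℂ := (fderiv ℝ f z 1 - Complex.I * fderiv ℝ f z Complex.I) / 2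

/-- `∂_{z̄} = (∂_{Re z} + i ∂_{Im z}) / 2`. -/
def dzbar (f : ℂ → ℂ) (z : ℂ) : ℂ :=
  (fderiv ℝ f z 1 + Complex.I * fderiv ℝ f z Complex.I) / 2

end Hager

end

noncomputable section

namespace Hager

open Real intervalIntegral
open Complex (I I_ne_zero I_sq abs_im_le_norm abs_re_le_norm add_re conjCLE conjLIE conj_I
  conj_conj conj_eq_iff_re conj_im conj_ofNat conj_ofReal continuous_conj continuous_im
  continuous_re exp_conj im imCLM mul_conj neg_re normSq_eq_norm_sq norm_I norm_conj norm_exp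
  norm_real ofRealCLM ofReal_exp ofReal_im ofReal_inv ofReal_mul ofReal_ne_zero ofReal_neg
  ofReal_one ofReal_re ofReal_sub ofReal_zero reCLM reCLM_apply re_le_norm re_mul_ofReal
  re_ofReal_mul sub_im sub_re)
open Complex renaming exp → cexp, exp_add → cexp_add, exp_ne_zero → cexp_ne_zero
open Function (Periodic)
open Set (Icc Icc_subset_Icc Ici Ico Iic Ioc Ioo Ioo_subset_Icc_self MapsTo mem_Icc mem_univ uIcc
  uIcc_of_le univ)
open Metric (ball closedBall isOpen_ball mem_ball_self mem_closedBall)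
open MeasureTheory (Integrable IntegrableOn volume)

/-! ### Cauchy estimates and derivatives of symbols -/

/-- Cauchy estimates for all iterated derivatives of a holomorphic map between normed spaces. -/
theorem norm_iteratedFDeriv_le_of_bounded_on_ball {E : Type} [NormedAddCommGroup E]
    [NormedSpace ℂ E] (n : ℕ) :
    ∀ {F : Type} [NormedAddCommGroup F] [NormedSpace ℂ F] {f : E → F} {c : E} {r B : ℝ},
      0 < r → ContDiffOn ℂ ω f (ball c r) → (∀ x ∈ ball c r, ‖f x‖ ≤ B) →
      ‖iteratedFDeriv ℂ n f c‖ ≤ 4^n * 2^(n^2) * B / r^n := by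
  induction n with
  | zero =>
    intro F _ _ f c r B hr _ hB
    simpa using hB c (mem_ball_self hr)
  | succ n ih =>
    intro F _ _ f c r B hr hf hB
    have hB0 : 0 ≤ B := (norm_nonneg _).trans (hB c (mem_ball_self hr))
    have hsub : ball c (r / 2) ⊆ ball c r :=
      Metric.ball_subset_ball (by linarith)
    have h1 : ContDiffOn ℂ ω (fderiv ℂ f) (ball c (r / 2)) :=
      (hf.mono hsub).fderiv_of_isOpen isOpen_ball (by simp)
    have h2 : ∀ x ∈ ball c (r / 2), ‖fderiv ℂ f x‖ ≤ 4 * B / r := by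
      intro x hx
      have hs : ball x (r / 2) ⊆ ball c r := by
        apply Metric.ball_subset_ball'
        have := Metric.mem_ball.1 hx
        linarith
      have hd : DifferentiableOn ℂ f (ball x (r / 2)) :=
        (hf.mono hs).differentiableOn (by simp)
      have := Complex.norm_fderiv_le_div_of_mapsTo_ball (R₂ := 2 * B) hd (fun w hw => by
        rw [mem_closedBall, dist_eq_norm]
        have a1 := hB w (hs hw)
        have a2 := hB x (hsub hx)
        exact (norm_sub_le _ _).trans (by linarith)) (by linarith)
      refine this.trans_eq ?_
      field_simp; ring
    have h3 := ih (half_pos hr) h1 h2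
    rw [norm_iteratedFDeriv_fderiv] at h3
    refine h3.trans ?_
    have e : (4:ℝ)^n * 2^(n^2) * (4 * B / r) / (r / 2)^n
        = 4^(n + 1) * 2^(n^2 + n) * B / r^(n + 1) := by
      rw [div_pow]
      field_simp
      ring
    rw [e]
    gcongr
    · norm_num
    · nlinarith

theorem norm_iteratedFDeriv_comp_fderiv_le (m : (ℂ →L[ℝ] ℂ) →ₗ[ℝ] ℂ) (hm : ∀ A, ‖m A‖ ≤ ‖A‖)
    {f : ℂ → ℂ} {z : ℂ} (hf : ContDiffAt ℝ ∞ f z) (n : ℕ) :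
    ContDiffAt ℝ ∞ (fun w => m (fderiv ℝ f w)) z ∧
      ‖iteratedFDeriv ℝ n (fun w => m (fderiv ℝ f w)) z‖ ≤ ‖iteratedFDeriv ℝ (n + 1) f z‖ := by
  let l := m.mkContinuous 1 fun A => by simpa using hm A
  have hfd : ContDiffAt ℝ ∞ (fderiv ℝ f) z := hf.fderiv_right (by simp)
  refine ⟨l.contDiff.contDiffAt.comp z hfd, ?_⟩
  refine (l.norm_iteratedFDeriv_comp_left hfd (n := n) (by exact_mod_cast le_top)).trans ?_
  rw [norm_iteratedFDeriv_fderiv]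
  exact mul_le_of_le_one_left (norm_nonneg _) (LinearMap.mkContinuous_norm_le _ zero_le_one _)

theorem norm_wirtinger_le (A : ℂ →L[ℝ] ℂ) :
    ‖(A 1 - I * A I) / 2‖ ≤ ‖A‖ ∧ ‖(A 1 + I * A I) / 2‖ ≤ ‖A‖ := by
  have h1 : ‖A 1‖ ≤ ‖A‖ := by simpa using A.le_opNorm 1
  have h2 : ‖I * A I‖ ≤ ‖A‖ := by simpa using A.le_opNorm I
  have h3 := norm_sub_le (A 1) (I * A I)
  have h4 := norm_add_le (A 1) (I * A I)
  rw [norm_div, norm_div, Complex.norm_ofNat]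
  constructor <;> linarith

theorem norm_iteratedFDeriv_dz_le {f : ℂ → ℂ} {z : ℂ} (hf : ContDiffAt ℝ ∞ f z) (n : ℕ) :
    ContDiffAt ℝ ∞ (dz f) z ∧ ‖iteratedFDeriv ℝ n (dz f) z‖ ≤ ‖iteratedFDeriv ℝ (n + 1) f z‖ :=
  norm_iteratedFDeriv_comp_fderiv_le
    { toFun := fun A => (A 1 - I * A I) / 2
      map_add' := fun A B => by simp; ring
      map_smul' := fun c A => by simp; ring } (fun A => (norm_wirtinger_le A).1) hf n

theorem norm_iteratedFDeriv_dzbar_le {f : ℂ → ℂ} {z : ℂ} (hf : ContDiffAt ℝ ∞ f z) (n : ℕ) :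
    ContDiffAt ℝ ∞ (dzbar f) z ∧
      ‖iteratedFDeriv ℝ n (dzbar f) z‖ ≤ ‖iteratedFDeriv ℝ (n + 1) f z‖ :=
  norm_iteratedFDeriv_comp_fderiv_le
    { toFun := fun A => (A 1 + I * A I) / 2
      map_add' := fun A B => by simp; ring
      map_smul' := fun c A => by simp; ring } (fun A => (norm_wirtinger_le A).2) hf n

/-- The Wirtinger derivatives of order `(j, k)` are bounded by the full derivative of order
`j + k`. -/
theorem norm_dz_dzbar_le {f : ℂ → ℂ} {z : ℂ} (hf : ContDiffAt ℝ ∞ f z) (j k : ℕ) :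
    ‖(dz^[j] (dzbar^[k] f)) z‖ ≤ ‖iteratedFDeriv ℝ (j + k) f z‖ := by
  have hk : ∀ k, ContDiffAt ℝ ∞ (dzbar^[k] f) z ∧
      ∀ n, ‖iteratedFDeriv ℝ n (dzbar^[k] f) z‖ ≤ ‖iteratedFDeriv ℝ (n + k) f z‖ := by
    intro k
    induction k with
    | zero => exact ⟨hf, fun n => le_rfl⟩
    | succ k ih =>
      rw [Function.iterate_succ_apply']
      refine ⟨(norm_iteratedFDeriv_dzbar_le ih.1 0).1, fun n => ?_⟩
      refine (norm_iteratedFDeriv_dzbar_le ih.1 n).2.trans ((ih.2 (n + 1)).trans_eq ?_)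
      rw [show n + 1 + k = n + (k + 1) by ring]
  have hj : ∀ j, ContDiffAt ℝ ∞ (dz^[j] (dzbar^[k] f)) z ∧
      ∀ n, ‖iteratedFDeriv ℝ n (dz^[j] (dzbar^[k] f)) z‖ ≤
        ‖iteratedFDeriv ℝ (n + j + k) f z‖ := by
    intro j
    induction j with
    | zero => exact ⟨(hk k).1, fun n => (hk k).2 n⟩
    | succ j ih =>
      rw [Function.iterate_succ_apply']
      refine ⟨(norm_iteratedFDeriv_dz_le ih.1 0).1, fun n => ?_⟩
      refine (norm_iteratedFDeriv_dz_le ih.1 n).2.trans ((ih.2 (n + 1)).trans_eq ?_)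
      rw [show n + 1 + j + k = n + (j + 1) + k by ring]
  have := (hj j).2 0
  rw [zero_add] at this
  simpa using this

theorem abs_exp_sub_one_le_abs_mul_exp_abs (x : ℝ) :
    |exp x - 1| ≤ |x| * exp |x| := by
  rcases le_total 0 x with hx | hx
  · have h := add_one_le_exp (-x)
    have h2 : exp (-x) * exp x = 1 := by rw [← exp_add]; simp
    have h3 := exp_pos x
    rw [abs_of_nonneg hx, abs_of_nonneg (by linarith [add_one_le_exp x])]
    nlinarith
  · have h := add_one_le_exp x
    have h2 : exp x ≤ 1 := exp_le_one_iff.2 hx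
    have h3 : 1 ≤ exp |x| := one_le_exp (abs_nonneg x)
    rw [abs_of_nonpos (by linarith)]
    rw [abs_of_nonpos hx] at h3 ⊢
    nlinarith

/-- If the derivatives of `f` at `z` are `O(ε ρ⁻ⁱ)` with `ε ≤ 1`, so are those of `exp f - 1`. -/
theorem norm_iteratedFDeriv_exp_sub_one_le (n : ℕ) (C0 : ℝ) (hC0 : 0 ≤ C0) :
    ∃ C1 : ℝ, ∀ {f : ℂ → ℝ} {z : ℂ} {ε ρ : ℝ}, 0 < ε → ε ≤ 1 → 0 < ρ → ContDiffAt ℝ ∞ f z →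
      (∀ i ≤ n, ‖iteratedFDeriv ℝ i f z‖ ≤ C0 * ε / ρ^i) →
      ‖iteratedFDeriv ℝ n (fun w => exp (f w) - 1) z‖ ≤ C1 * ε / ρ^n := by
  set D : ℝ := C0 + 1
  refine ⟨n.factorial * (D * exp C0) * D^n, ?_⟩
  intro f z ε ρ hε hε1 hρ hf hb
  have hD1 : 1 ≤ D := by simp [D, hC0]
  let g : ℝ → ℝ := fun u => (exp (ε * u) - 1) * ε⁻¹
  let k : ℂ → ℝ := fun w => ε⁻¹ * f w
  obtain ⟨U, hU, -, hUf⟩ : ∃ u ∈ nhdsWithin z (insert z univ), z ∈ u ∧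
      ContDiffOn ℝ n f u := by
    have := (hf.of_le (m := n) (by exact_mod_cast le_top)).contDiffWithinAt (s := univ)
    obtain ⟨u, hu, hu'⟩ := this.contDiffOn le_rfl (by simp)
    exact ⟨u, hu, mem_of_mem_nhdsWithin (by simp) hu, hu'.2⟩
  have hU' : U ∈ nhds z := by simpa [nhdsWithin_univ] using hU
  obtain ⟨r, hr, hrU⟩ := Metric.mem_nhds_iff.1 hU'
  set s := ball z r
  have hzs : z ∈ s := mem_ball_self hr
  have hs : IsOpen s := isOpen_ball
  have hk : ContDiffOn ℝ n k s := contDiffOn_const.mul (hUf.mono hrU)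
  have hkat : ContDiffAt ℝ ∞ f z := hf
  have hg : ContDiff ℝ n g := by fun_prop
  have hkd : ∀ i ≤ n, ‖iteratedFDeriv ℝ i k z‖ ≤ C0 / ρ^i := by
    intro i hi
    have e : k = fun w => ε⁻¹ • f w := rfl
    have : iteratedFDeriv ℝ i k z = ε⁻¹ • iteratedFDeriv ℝ i f z := by
      exact iteratedFDeriv_const_smul_apply (a := ε⁻¹)
        (hf.of_le (m := i) (by exact_mod_cast le_top))
    rw [this, norm_smul, norm_inv, norm_of_nonneg hε.le]
    calc ε⁻¹ * ‖iteratedFDeriv ℝ i f z‖ ≤ ε⁻¹ * (C0 * ε / ρ^i) := by gcongr; exact hb i hi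
      _ = C0 / ρ^i := by field_simp
  have hk0 : |k z| ≤ C0 := by
    have := hkd 0 (Nat.zero_le _)
    simpa using this
  have hexp : exp (ε * k z) ≤ exp C0 := by
    apply exp_le_exp.2
    have := (abs_le.1 hk0)
    nlinarith
  have hgd : ∀ i ≤ n, ‖iteratedFDeriv ℝ i g (k z)‖ ≤ D * exp C0 := by
    intro i _
    have hexp0 := exp_pos C0
    rw [norm_iteratedFDeriv_eq_norm_iteratedDeriv]
    rcases Nat.eq_zero_or_pos i with rfl | hi
    · simp only [iteratedDeriv_zero, g, norm_eq_abs, abs_mul, abs_inv, abs_of_pos hε]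
      have h1 : |exp (ε * k z) - 1| ≤ |ε * k z| * exp |ε * k z| := by
        exact abs_exp_sub_one_le_abs_mul_exp_abs (ε * k z)
      have h2 : |ε * k z| ≤ C0 := by
        rw [abs_mul, abs_of_pos hε]; nlinarith [abs_nonneg (k z)]
      calc |exp (ε * k z) - 1| * ε⁻¹ ≤ (|ε * k z| * exp |ε * k z|) * ε⁻¹ := by gcongr
        _ = |k z| * exp |ε * k z| := by
          rw [abs_mul, abs_of_pos hε]; field_simp
        _ ≤ D * exp C0 := by
          gcongr
          simp only [D]; linarith
    · obtain ⟨i, rfl⟩ : ∃ j, i = j + 1 := ⟨i - 1, by omega⟩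
      have e : ∀ j : ℕ, iteratedDeriv (j + 1) g = fun u => ε^j * exp (ε * u) := by
        intro j
        induction j with
        | zero =>
          funext u
          rw [zero_add, iteratedDeriv_one]
          have : HasDerivAt g (exp (ε * u) * (ε * 1) * ε⁻¹) u :=
            ((((hasDerivAt_id u).const_mul ε).exp).sub_const 1).mul_const ε⁻¹
          rw [this.deriv]; field_simp
        | succ j ih =>
          rw [iteratedDeriv_succ, ih]
          funext u
          have : HasDerivAt (fun u => ε^j * exp (ε * u))
              (ε^j * (exp (ε * u) * (ε * 1))) u :=
            (((hasDerivAt_id u).const_mul ε).exp).const_mul _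
          rw [this.deriv]; ring
      rw [e, norm_eq_abs, abs_of_pos (by positivity)]
      have : ε^i ≤ 1 := pow_le_one₀ hε.le hε1
      calc ε^i * exp (ε * k z) ≤ 1 * exp C0 := by gcongr
        _ ≤ D * exp C0 := by gcongr
  have hmain := norm_iteratedFDerivWithin_comp_le (n := n) (N := n) (C := D * exp C0)
    (D := D / ρ) hg.contDiffOn hk le_rfl uniqueDiffOn_univ hs.uniqueDiffOn
    (Set.mapsTo_univ k s) hzs
    (fun i hi => by rw [iteratedFDerivWithin_univ]; exact hgd i hi)
    (fun i hi hin => by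
      rw [iteratedFDerivWithin_of_isOpen i hs hzs]
      refine (hkd i hin).trans ?_
      rw [div_pow]
      gcongr
      calc C0 ≤ D := by simp [D]
        _ ≤ D^i := le_self_pow₀ hD1 (by omega))
  rw [iteratedFDerivWithin_of_isOpen n hs hzs] at hmain
  have efin : (fun w => exp (f w) - 1) = fun w => ε • (g ∘ k) w := by
    funext w
    simp only [g, k, Function.comp, smul_eq_mul]
    rw [show ε * (ε⁻¹ * f w) = f w by field_simp]
    field_simp
  have hgk : ContDiffAt ℝ n (g ∘ k) z :=
    hg.contDiffAt.comp z ((hk z hzs).contDiffAt (hs.mem_nhds hzs))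
  rw [efin]
  have : iteratedFDeriv ℝ n (fun w => ε • (g ∘ k) w) z = ε • iteratedFDeriv ℝ n (g ∘ k) z :=
    iteratedFDeriv_const_smul_apply (a := ε) hgk
  rw [this, norm_smul, norm_of_nonneg hε.le]
  calc ε * ‖iteratedFDeriv ℝ n (g ∘ k) z‖
      ≤ ε * (n.factorial * (D * exp C0) * (D / ρ)^n) := by gcongr
    _ = _ := by rw [div_pow]; ring

/-! ### The fundamental solution, as a holomorphic function of the parameters -/

/-- The data of the first order system `h e' = (G - y) e + λ f`, `h f' = -(G - y) f - e` on
`[0, L]`, with complex parameters `λ`, `y`. -/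
structure Sys where
  L : ℝ
  h : ℝ
  G : C(ℝ, ℝ)
  hL : 0 < L
  hh : 0 < h

namespace Sys

variable (D : Sys)

/-- The Banach algebra of continuous functions on the interval `[0, L]`. -/
def X : Type := BoundedContinuousFunction (Icc 0 D.L) ℂ

instance : NormedCommRing D.X :=
  inferInstanceAs (NormedCommRing (BoundedContinuousFunction (Icc 0 D.L) ℂ))
instance : NormedAlgebra ℂ D.X :=
  inferInstanceAs (NormedAlgebra ℂ (BoundedContinuousFunction (Icc 0 D.L) ℂ))
instance : CompleteSpace D.X :=
  inferInstanceAs (CompleteSpace (BoundedContinuousFunction (Icc 0 D.L) ℂ))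
instance : CoeFun D.X fun _ => Icc 0 D.L → ℂ :=
  ⟨fun u => (show BoundedContinuousFunction (Icc 0 D.L) ℂ from u)⟩

/-- A continuous function as an element of the algebra. -/
def ofFun (f : Icc 0 D.L → ℂ) (hf : Continuous f) : D.X :=
  BoundedContinuousFunction.mkOfCompact ⟨f, hf⟩

variable {D} in
@[ext] theorem X.ext {u v : D.X} (h : ∀ x, u x = v x) : u = v := BoundedContinuousFunction.ext h

variable (x : Icc 0 D.L) (u v : D.X)
@[simp] theorem ofFun_apply (f : Icc 0 D.L → ℂ) (hf : Continuous f) : D.ofFun f hf x = f x := rfl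
@[simp] theorem add_apply : (u + v) x = u x + v x := rfl
@[simp] theorem sub_apply : (u - v) x = u x - v x := rfl
@[simp] theorem neg_apply : (-u) x = -u x := rfl
@[simp] theorem mul_apply : (u * v) x = u x * v x := rfl
@[simp] theorem one_apply : (1 : D.X) x = 1 := rfl
@[simp] theorem zero_apply : (0 : D.X) x = 0 := rfl
@[simp] theorem smul_apply (c : ℂ) : (c • u) x = c * u x := rfl

theorem norm_apply_le : ‖u x‖ ≤ ‖u‖ := BoundedContinuousFunction.norm_coe_le_norm _ x

theorem norm_le {C : ℝ} (hC : 0 ≤ C) : ‖u‖ ≤ C ↔ ∀ x, ‖u x‖ ≤ C :=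
  BoundedContinuousFunction.norm_le hC

theorem continuous_coe : Continuous fun x => u x :=
  (show BoundedContinuousFunction (Icc 0 D.L) ℂ from u).continuous

/-- Evaluation at a point. -/
def ev : D.X →L[ℂ] ℂ :=
  LinearMap.mkContinuous
    { toFun := fun u => u x, map_add' := fun _ _ => rfl, map_smul' := fun _ _ => rfl } 1
    (fun u => by rw [one_mul]; exact D.norm_apply_le x u)

@[simp] theorem ev_apply : D.ev x u = u x := rfl

/-- The point of `[0, L]` closest to `s`. -/
def pt (s : ℝ) : Icc 0 D.L := Set.projIcc 0 D.L D.hL.le s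

theorem continuous_pt : Continuous D.pt := continuous_projIcc (h := D.hL.le)

theorem pt_val {s : ℝ} (hs : s ∈ Icc 0 D.L) : (D.pt s : ℝ) = s := by
  simp [pt, Set.projIcc_of_mem D.hL.le hs]

theorem pt_coe (x : Icc 0 D.L) : D.pt x = x := Set.projIcc_val D.hL.le x

theorem continuous_ext (u : D.X) : Continuous fun s => u (D.pt s) :=
  (D.continuous_coe u).comp D.continuous_pt

/-- The primitive vanishing at `0`, divided by `h`. -/
def prim : D.X →L[ℂ] D.X :=
  LinearMap.mkContinuous
    { toFun := fun u => D.ofFun (fun x => (D.h : ℂ)⁻¹ * ∫ s in 0..x, u (D.pt s)) (by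
        have : Continuous fun x : ℝ => ∫ s in 0..x, u (D.pt s) :=
          continuous_primitive (fun a b => (D.continuous_ext u).intervalIntegrable a b) 0
        exact continuous_const.mul (this.comp continuous_subtype_val))
      map_add' := fun u v => by
        ext x
        simp only [ofFun_apply, add_apply]
        rw [integral_add ((D.continuous_ext u).intervalIntegrable _ _)
          ((D.continuous_ext v).intervalIntegrable _ _), mul_add]
      map_smul' := fun c u => by
        ext x
        simp only [ofFun_apply, smul_apply, RingHom.id_apply]
        rw [integral_const_mul]; ring }
    (D.h⁻¹ * D.L) (fun u => by
      refine (D.norm_le _ (by have := D.hh; have := D.hL; positivity)).2 fun x => ?_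
      simp only [LinearMap.coe_mk, AddHom.coe_mk, ofFun_apply, norm_mul, norm_inv]
      rw [norm_real, norm_eq_abs, abs_of_pos D.hh, mul_assoc]
      have := D.hh
      gcongr
      have h1 := norm_integral_le_of_norm_le_const (a := (0 : ℝ)) (b := x)
        (f := fun s => u (D.pt s)) (C := ‖u‖) (fun s _ => D.norm_apply_le _ u)
      refine h1.trans ?_
      rw [sub_zero, abs_of_nonneg x.2.1, mul_comm]
      gcongr
      exact x.2.2)

theorem prim_apply (u : D.X) (x : Icc 0 D.L) :
    D.prim u x = (D.h : ℂ)⁻¹ * ∫ s in 0..x, u (D.pt s) := rfl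

/-- The complex phase `φ_y(x) = ∫₀ˣ G - y x`. -/
def phase (y : ℂ) (x : ℝ) : ℂ := ((∫ s in 0..x, D.G s : ℝ) : ℂ) - y * x

theorem hasDerivAt_phase (y : ℂ) (x : ℝ) : HasDerivAt (D.phase y) (D.G x - y) x := by
  have h1 : HasDerivAt (fun x => ∫ s in 0..x, D.G s) (D.G x) x :=
    (D.G.continuous.integral_hasStrictDerivAt _ _).hasDerivAt
  have h2 : HasDerivAt (fun x : ℝ => y * (x : ℂ)) (y * 1) x :=
    (ofRealCLM.hasDerivAt (x := x)).const_mul y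
  have := h1.ofReal_comp.sub h2
  simpa [phase] using! this

theorem continuous_phase (y : ℂ) : Continuous (D.phase y) :=
  continuous_iff_continuousAt.2 fun x => (D.hasDerivAt_phase y x).continuousAt

theorem phase_zero (y : ℂ) : D.phase y 0 = 0 := by simp [phase]

/-- `e^{2φ/h}` as a function on the line. -/
def alf (y : ℂ) (x : ℝ) : ℂ := cexp (2 / D.h * D.phase y x)

/-- `e^{-2φ/h}` as a function on the line. -/
def bef (y : ℂ) (x : ℝ) : ℂ := cexp (-(2 / D.h * D.phase y x))

theorem continuous_alf (y : ℂ) : Continuous (D.alf y) := by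
  have := D.continuous_phase y
  unfold alf; fun_prop

theorem continuous_bef (y : ℂ) : Continuous (D.bef y) := by
  have := D.continuous_phase y
  unfold bef; fun_prop

/-- `2φ/h` in the algebra of continuous functions. -/
def ph0 (y : ℂ) : D.X :=
  D.ofFun (fun x => 2 / D.h * D.phase 0 x)
    (continuous_const.mul ((D.continuous_phase 0).comp continuous_subtype_val)) -
  y • D.ofFun (fun x => 2 / D.h * ((x : ℝ) : ℂ)) (by fun_prop)

theorem ph0_apply (y : ℂ) (x : Icc 0 D.L) : D.ph0 y x = 2 / D.h * D.phase y x := by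
  simp [ph0, phase]; ring

theorem contDiff_ph0 : ContDiff ℂ ω D.ph0 := by
  unfold ph0
  exact contDiff_const.sub (contDiff_id.smul contDiff_const)

theorem contDiff_exp_X : ContDiff ℂ ω (NormedSpace.exp : D.X → D.X) := by
  have : AnalyticOnNhd ℂ (NormedSpace.exp : D.X → D.X) univ := fun x _ => NormedSpace.exp_analytic x
  exact contDiffOn_univ.1 this.contDiffOn_of_completeSpace

theorem exp_X_apply (u : D.X) (x : Icc 0 D.L) : NormedSpace.exp u x = cexp (u x) := by
  let ev : D.X →+* ℂ :=
    { toFun := fun v => v x, map_one' := rfl, map_mul' := fun _ _ => rfl, map_zero' := rfl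
      map_add' := fun _ _ => rfl }
  have hev : Continuous ev := (D.ev x).continuous
  let _ : NormedAlgebra ℚ D.X := NormedAlgebra.restrictScalars ℚ ℂ D.X
  have := NormedSpace.map_exp ev hev u
  rw [Complex.exp_eq_exp_ℂ]
  exact this

/-- `e^{2φ/h}` in the algebra of continuous functions. -/
def al (y : ℂ) : D.X := NormedSpace.exp (D.ph0 y)

/-- `e^{-2φ/h}` in the algebra of continuous functions. -/
def be (y : ℂ) : D.X := NormedSpace.exp (-D.ph0 y)

theorem al_apply (y : ℂ) (x : Icc 0 D.L) : D.al y x = D.alf y x := by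
  rw [al, exp_X_apply, ph0_apply, alf]

theorem be_apply (y : ℂ) (x : Icc 0 D.L) : D.be y x = D.bef y x := by
  rw [be, exp_X_apply, neg_apply, ph0_apply, bef]

theorem contDiff_al : ContDiff ℂ ω D.al := D.contDiff_exp_X.comp D.contDiff_ph0

theorem contDiff_be : ContDiff ℂ ω D.be := D.contDiff_exp_X.comp D.contDiff_ph0.neg

/-- The operator `1 + λ I β I α`, with `I` the primitive. -/
def op (p : ℂ × ℂ) : D.X →L[ℂ] D.X :=
  1 + p.1 • (D.prim ∘L (ContinuousLinearMap.mul ℂ D.X (D.be p.2)) ∘L D.prim ∘L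
    (ContinuousLinearMap.mul ℂ D.X (D.al p.2)))

theorem op_apply (p : ℂ × ℂ) (u : D.X) :
    D.op p u = u + p.1 • D.prim (D.be p.2 * D.prim (D.al p.2 * u)) := by
  simp [op]

theorem contDiff_op : ContDiff ℂ ω D.op := by
  have h1 : ContDiff ℂ ω fun p : ℂ × ℂ => ContinuousLinearMap.mul ℂ D.X (D.be p.2) :=
    (ContinuousLinearMap.mul ℂ D.X).contDiff.comp (D.contDiff_be.comp contDiff_snd)
  have h2 : ContDiff ℂ ω fun p : ℂ × ℂ => ContinuousLinearMap.mul ℂ D.X (D.al p.2) :=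
    (ContinuousLinearMap.mul ℂ D.X).contDiff.comp (D.contDiff_al.comp contDiff_snd)
  unfold op
  exact contDiff_const.add (contDiff_fst.smul
    (contDiff_const.clm_comp (h1.clm_comp (contDiff_const.clm_comp h2))))

/-- The exponential weight `e^{Kx}`. -/
def weight (K : ℝ) : D.X := D.ofFun (fun x => (exp (K * x) : ℂ)) (by fun_prop)

theorem weight_mul (K : ℝ) : D.weight (-K) * D.weight K = 1 := by
  ext x
  simp only [weight, mul_apply, ofFun_apply, one_apply]
  rw [← ofReal_mul, ← exp_add]; simp

theorem norm_weighted_prim_le {K : ℝ} (hK : 0 < K) (u : D.X) :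
    ‖D.weight (-K) * D.prim (D.weight K * u)‖ ≤ D.h⁻¹ * K⁻¹ * ‖u‖ := by
  have hh := D.hh
  refine (D.norm_le _ (by positivity)).2 fun x => ?_
  simp only [mul_apply, prim_apply, norm_mul, norm_inv]
  rw [norm_real, norm_eq_abs, abs_of_pos D.hh]
  have e1 : ‖D.weight (-K) x‖ = exp (-K * x) := by
    simp only [weight, ofFun_apply]
    rw [norm_real, norm_of_nonneg (exp_pos _).le]
  have h1 : ‖∫ s in 0..x, D.weight K (D.pt s) * u (D.pt s)‖ ≤ ∫ s in 0..x, exp (K * s) * ‖u‖ := by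
    apply norm_integral_le_of_norm_le x.2.1
    · refine Filter.Eventually.of_forall fun s hs => ?_
      have hsI : s ∈ Icc 0 D.L := ⟨hs.1.le, hs.2.trans x.2.2⟩
      rw [norm_mul]
      have : ‖D.weight K (D.pt s)‖ = exp (K * s) := by
        simp only [weight, ofFun_apply]
        rw [norm_real, norm_eq_abs, abs_of_pos (exp_pos _), D.pt_val hsI]
      rw [this]
      gcongr
      exact D.norm_apply_le _ u
    · exact Continuous.intervalIntegrable (by fun_prop) _ _
  have h2 : ∫ s in 0..x, exp (K * s) * ‖u‖ = K⁻¹ * (exp (K * x) - 1) * ‖u‖ := by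
    rw [integral_mul_const, integral_comp_mul_left (fun s => exp s) hK.ne', integral_exp]
    simp
  rw [e1]
  have h3 : exp (-K * x) * exp (K * x) = 1 := by rw [← exp_add]; simp
  calc exp (-K * x) * (D.h⁻¹ * ‖∫ s in 0..x, D.weight K (D.pt s) * u (D.pt s)‖)
      ≤ exp (-K * x) * (D.h⁻¹ * (K⁻¹ * (exp (K * x) - 1) * ‖u‖)) := by rw [← h2]; gcongr
    _ = D.h⁻¹ * K⁻¹ * ‖u‖ * (exp (-K * x) * exp (K * x) - exp (-K * x)) := by ring
    _ ≤ D.h⁻¹ * K⁻¹ * ‖u‖ * 1 := by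
        rw [h3]
        gcongr
        linarith [exp_pos (-K * (x : ℝ))]
    _ = _ := mul_one _

theorem isUnit_op (p : ℂ × ℂ) : IsUnit (D.op p) := by
  have hh := D.hh
  set c : ℝ := ‖p.1‖ * ‖D.be p.2‖ * ‖D.al p.2‖ * D.h⁻¹ * D.h⁻¹ with hc
  have hc0 : 0 ≤ c := by positivity
  set K : ℝ := c + 1
  have hK : 0 < K := by positivity
  let W : D.X →L[ℂ] D.X := ContinuousLinearMap.mul ℂ D.X (D.weight K)
  let W' : D.X →L[ℂ] D.X := ContinuousLinearMap.mul ℂ D.X (D.weight (-K))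
  have hW'W : W' * W = 1 := by
    ext1 u
    change D.weight (-K) * (D.weight K * u) = u
    rw [← mul_assoc, weight_mul, one_mul]
  have hWW' : W * W' = 1 := by
    ext1 u
    change D.weight K * (D.weight (-K) * u) = u
    rw [← mul_assoc, mul_comm (D.weight K), weight_mul, one_mul]
  let T : D.X →L[ℂ] D.X := p.1 • (D.prim ∘L (ContinuousLinearMap.mul ℂ D.X (D.be p.2)) ∘L
    D.prim ∘L (ContinuousLinearMap.mul ℂ D.X (D.al p.2)))
  have hT : D.op p = W * (1 - (-(W' * T * W))) * W' := by
    have : W * (1 - (-(W' * T * W))) * W' = W * W' + (W * W') * T * (W * W') := by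
      simp only [sub_neg_eq_add, mul_add, add_mul, mul_one, mul_assoc]
    rw [this, hWW']
    simp [op, T]
  have hnorm : ‖-(W' * T * W)‖ ≤ c * K⁻¹ * K⁻¹ := by
    rw [norm_neg]
    refine ContinuousLinearMap.opNorm_le_bound _ (by positivity) fun u => ?_
    have e : (W' * T * W) u = p.1 • (D.weight (-K) * D.prim (D.weight K *
        (D.be p.2 * (D.weight (-K) * D.prim (D.weight K * (D.al p.2 * u)))))) := by
      change D.weight (-K) * (p.1 • D.prim (D.be p.2 * D.prim (D.al p.2 * (D.weight K * u)))) = _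
      have e1 : D.weight K * (D.be p.2 * (D.weight (-K) * D.prim (D.weight K * (D.al p.2 * u))))
          = D.be p.2 * D.prim (D.al p.2 * (D.weight K * u)) := by
        have := D.weight_mul K
        calc _ = (D.weight (-K) * D.weight K) * (D.be p.2 * D.prim (D.weight K * (D.al p.2 * u)))
              := by ring
          _ = _ := by rw [this, one_mul, mul_left_comm (D.weight K) (D.al p.2) u]
      rw [e1, mul_smul_comm]
    rw [e, norm_smul]
    have b1 := D.norm_weighted_prim_le hK
      (D.be p.2 * (D.weight (-K) * D.prim (D.weight K * (D.al p.2 * u))))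
    have b2 := D.norm_weighted_prim_le hK (D.al p.2 * u)
    have b3 := norm_mul_le (D.be p.2) (D.weight (-K) * D.prim (D.weight K * (D.al p.2 * u)))
    have b4 := norm_mul_le (D.al p.2) u
    calc _ ≤ ‖p.1‖ * (D.h⁻¹ * K⁻¹ * (‖D.be p.2‖ * (D.h⁻¹ * K⁻¹ * (‖D.al p.2‖ * ‖u‖)))) := by
          refine mul_le_mul_of_nonneg_left (b1.trans ?_) (norm_nonneg _)
          refine mul_le_mul_of_nonneg_left (b3.trans ?_) (by positivity)
          refine mul_le_mul_of_nonneg_left (b2.trans ?_) (by positivity)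
          exact mul_le_mul_of_nonneg_left b4 (by positivity)
      _ = _ := by rw [hc]; ring
  have hlt : ‖-(W' * T * W)‖ < 1 := by
    refine hnorm.trans_lt ?_
    have hK1 : 1 ≤ K := by simp only [K]; linarith
    have : K⁻¹ ≤ 1 := inv_le_one_of_one_le₀ hK1
    calc c * K⁻¹ * K⁻¹ ≤ c * K⁻¹ * 1 := by gcongr
      _ < 1 := by rw [mul_one, ← div_eq_mul_inv, div_lt_one hK]; simp [K]
  have hWu : IsUnit W := ⟨⟨W, W', hWW', hW'W⟩, rfl⟩
  have hWu' : IsUnit W' := ⟨⟨W', W, hW'W, hWW'⟩, rfl⟩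
  rw [hT]
  exact (hWu.mul (isUnit_one_sub_of_norm_lt_one hlt)).mul hWu'

/-- The resolvent `(1 + λ I β I α)⁻¹`. -/
def res (p : ℂ × ℂ) : D.X →L[ℂ] D.X := Ring.inverse (D.op p)

theorem contDiff_res : ContDiff ℂ ω D.res := by
  rw [contDiff_iff_contDiffAt]
  intro p
  obtain ⟨u, hu⟩ := D.isUnit_op p
  have := contDiffAt_ringInverse ℂ (n := ω) u
  rw [hu] at this
  exact this.comp p D.contDiff_op.contDiffAt

theorem op_res (p : ℂ × ℂ) (u : D.X) : D.op p (D.res p u) = u := by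
  have := Ring.mul_inverse_cancel _ (D.isUnit_op p)
  exact congrArg (fun T : D.X →L[ℂ] D.X => T u) this

/-- The fundamental solution in the variables `(e^{-φ/h} e, e^{φ/h} f)` is
`((p₁, λ r), (q₁, q₂))`. -/
def p1 (p : ℂ × ℂ) : D.X := D.res p 1

def q1 (p : ℂ × ℂ) : D.X := -D.prim (D.al p.2 * D.p1 p)

def r (p : ℂ × ℂ) : D.X := D.res p (D.prim (D.be p.2))

def q2 (p : ℂ × ℂ) : D.X := 1 - p.1 • D.prim (D.al p.2 * D.r p)

theorem contDiff_p1 : ContDiff ℂ ω D.p1 := D.contDiff_res.clm_apply contDiff_const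

theorem contDiff_r : ContDiff ℂ ω D.r :=
  D.contDiff_res.clm_apply (D.prim.contDiff.comp (D.contDiff_be.comp contDiff_snd))

theorem contDiff_q1 : ContDiff ℂ ω D.q1 :=
  (D.prim.contDiff.comp ((D.contDiff_al.comp contDiff_snd).mul D.contDiff_p1)).neg

theorem contDiff_q2 : ContDiff ℂ ω D.q2 :=
  contDiff_const.sub (contDiff_fst.smul
    (D.prim.contDiff.comp ((D.contDiff_al.comp contDiff_snd).mul D.contDiff_r)))

theorem p1_eq (p : ℂ × ℂ) : D.p1 p = 1 + p.1 • D.prim (D.be p.2 * D.q1 p) := by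
  have := D.op_res p 1
  rw [op_apply] at this
  change D.p1 p + p.1 • D.prim (D.be p.2 * D.prim (D.al p.2 * D.p1 p)) = 1 at this
  rw [q1, mul_neg, map_neg, smul_neg, ← this]
  abel

theorem r_eq (p : ℂ × ℂ) : D.r p = D.prim (D.be p.2 * D.q2 p) := by
  have := D.op_res p (D.prim (D.be p.2))
  rw [op_apply] at this
  change D.r p + p.1 • D.prim (D.be p.2 * D.prim (D.al p.2 * D.r p)) = _ at this
  rw [q2, mul_sub, mul_one, map_sub, ← this, mul_smul_comm, map_smul]
  abel

theorem p1_zero (y : ℂ) : D.p1 (0, y) = 1 := by rw [p1_eq]; simp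
theorem q2_zero (y : ℂ) : D.q2 (0, y) = 1 := by rw [q2]; simp
theorem q1_zero (y : ℂ) : D.q1 (0, y) = -D.prim (D.al y) := by rw [q1, p1_zero]; simp
theorem r_zero (y : ℂ) : D.r (0, y) = D.prim (D.be y) := by rw [r_eq, q2_zero]; simp

end Sys

namespace Sys

variable (D : Sys)

/-- `(P, Q)` solves `h P' = λ e^{-2φ/h} Q`, `h Q' = -e^{2φ/h} P` on `[0, L]`. -/
def IsSol (p : ℂ × ℂ) (P Q : ℝ → ℂ) : Prop :=
  ∀ x ∈ Icc 0 D.L, HasDerivWithinAt P ((D.h : ℂ)⁻¹ * (p.1 * D.bef p.2 x * Q x)) (Icc 0 D.L) x ∧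
    HasDerivWithinAt Q (-((D.h : ℂ)⁻¹ * (D.alf p.2 x * P x))) (Icc 0 D.L) x

theorem hasDerivWithinAt_prim (v : D.X) {x : ℝ} (hx : x ∈ Icc 0 D.L) :
    HasDerivWithinAt (fun x => D.prim v (D.pt x)) ((D.h : ℂ)⁻¹ * v (D.pt x)) (Icc 0 D.L) x := by
  have hc := D.continuous_ext v
  have h1 : HasDerivAt (fun x => (D.h : ℂ)⁻¹ * ∫ s in 0..x, v (D.pt s))
      ((D.h : ℂ)⁻¹ * v (D.pt x)) x :=
    ((hc.integral_hasStrictDerivAt _ _).hasDerivAt).const_mul _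
  refine h1.hasDerivWithinAt.congr (fun y hy => ?_) ?_
  · rw [prim_apply, D.pt_val hy]
  · rw [prim_apply, D.pt_val hx]

theorem al_pt (y : ℂ) {x : ℝ} (hx : x ∈ Icc 0 D.L) : D.al y (D.pt x) = D.alf y x := by
  rw [al_apply, D.pt_val hx]

theorem be_pt (y : ℂ) {x : ℝ} (hx : x ∈ Icc 0 D.L) : D.be y (D.pt x) = D.bef y x := by
  rw [be_apply, D.pt_val hx]

theorem isSol_fst (p : ℂ × ℂ) :
    D.IsSol p (fun x => D.p1 p (D.pt x)) (fun x => D.q1 p (D.pt x)) := by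
  intro x hx
  constructor
  · have h := ((D.hasDerivWithinAt_prim (D.be p.2 * D.q1 p) hx).const_mul p.1).const_add 1
    rw [mul_apply, D.be_pt _ hx] at h
    convert! h using 1
    · funext x; rw [D.p1_eq p]; rfl
    · ring
  · have h := (D.hasDerivWithinAt_prim (D.al p.2 * D.p1 p) hx).neg
    rw [mul_apply, D.al_pt _ hx] at h
    exact h

theorem isSol_snd (p : ℂ × ℂ) :
    D.IsSol p (fun x => p.1 * D.r p (D.pt x)) (fun x => D.q2 p (D.pt x)) := by
  intro x hx
  constructor
  · have h := (D.hasDerivWithinAt_prim (D.be p.2 * D.q2 p) hx).const_mul p.1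
    rw [mul_apply, D.be_pt _ hx] at h
    convert! h using 1
    · funext x; rw [D.r_eq p]
    · ring
  · have h := ((D.hasDerivWithinAt_prim (D.al p.2 * D.r p) hx).const_mul p.1).const_sub 1
    rw [mul_apply, D.al_pt _ hx] at h
    convert! h using 1
    ring

theorem prim_pt_zero (v : D.X) : D.prim v (D.pt 0) = 0 := by
  rw [prim_apply, D.pt_val ⟨le_rfl, D.hL.le⟩]; simp

@[simp] theorem p1_pt_zero (p : ℂ × ℂ) : D.p1 p (D.pt 0) = 1 := by rw [p1_eq]; simp [prim_pt_zero]
@[simp] theorem q1_pt_zero (p : ℂ × ℂ) : D.q1 p (D.pt 0) = 0 := by rw [q1]; simp [prim_pt_zero]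
@[simp] theorem r_pt_zero (p : ℂ × ℂ) : D.r p (D.pt 0) = 0 := by rw [r_eq]; simp [prim_pt_zero]
@[simp] theorem q2_pt_zero (p : ℂ × ℂ) : D.q2 p (D.pt 0) = 1 := by rw [q2]; simp [prim_pt_zero]

variable {D}

theorem IsSol.lin {p : ℂ × ℂ} {P Q P' Q' : ℝ → ℂ} (h : D.IsSol p P Q) (h' : D.IsSol p P' Q')
    (a b : ℂ) : D.IsSol p (fun x => P x * a + P' x * b) (fun x => Q x * a + Q' x * b) := by
  intro x hx
  refine ⟨(((h x hx).1.mul_const a).add ((h' x hx).1.mul_const b)).congr_deriv ?_,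
    (((h x hx).2.mul_const a).add ((h' x hx).2.mul_const b)).congr_deriv ?_⟩ <;> ring

theorem IsSol.wronskian {p : ℂ × ℂ} {P Q P' Q' : ℝ → ℂ} (h : D.IsSol p P Q)
    (h' : D.IsSol p P' Q') {x : ℝ} (hx : x ∈ Icc 0 D.L) :
    P x * Q' x - P' x * Q x = P 0 * Q' 0 - P' 0 * Q 0 := by
  have hd : ∀ x ∈ Icc 0 D.L,
      HasDerivWithinAt (fun x => P x * Q' x - P' x * Q x) 0 (Icc 0 D.L) x := by
    intro x hx
    exact (((h x hx).1.mul (h' x hx).2).sub ((h' x hx).1.mul (h x hx).2)).congr_deriv (by ring)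
  have := (convex_Icc 0 D.L).norm_image_sub_le_of_norm_hasDerivWithin_le (C := 0) hd
    (fun x _ => by simp) ⟨le_rfl, D.hL.le⟩ hx
  rw [zero_mul] at this
  exact sub_eq_zero.1 (norm_le_zero_iff.1 this)

variable (D) in
/-- The determinant of the fundamental solution is `1`. -/
theorem det_eq_one (p : ℂ × ℂ) {x : ℝ} (hx : x ∈ Icc 0 D.L) :
    D.p1 p (D.pt x) * D.q2 p (D.pt x) - p.1 * D.r p (D.pt x) * D.q1 p (D.pt x) = 1 := by
  have := (D.isSol_fst p).wronskian (D.isSol_snd p) hx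
  simpa using this

theorem IsSol.eq_fst {p : ℂ × ℂ} {P Q : ℝ → ℂ} (h : D.IsSol p P Q) {x : ℝ} (hx : x ∈ Icc 0 D.L) :
    P x = D.p1 p (D.pt x) * P 0 + p.1 * D.r p (D.pt x) * Q 0 := by
  have h1 := h.wronskian (D.isSol_snd p) hx
  have h2 := (D.isSol_fst p).wronskian h hx
  have h3 := D.det_eq_one p hx
  simp only [p1_pt_zero, q1_pt_zero, r_pt_zero, q2_pt_zero] at h1 h2
  linear_combination D.p1 p (D.pt x) * h1 + p.1 * D.r p (D.pt x) * h2 - P x * h3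

theorem IsSol.eq_snd {p : ℂ × ℂ} {P Q : ℝ → ℂ} (h : D.IsSol p P Q) {x : ℝ} (hx : x ∈ Icc 0 D.L) :
    Q x = D.q1 p (D.pt x) * P 0 + D.q2 p (D.pt x) * Q 0 := by
  have h1 := h.wronskian (D.isSol_snd p) hx
  have h2 := (D.isSol_fst p).wronskian h hx
  have h3 := D.det_eq_one p hx
  simp only [p1_pt_zero, q1_pt_zero, r_pt_zero, q2_pt_zero] at h1 h2
  linear_combination D.q1 p (D.pt x) * h1 + D.q2 p (D.pt x) * h2 - Q x * h3

variable (D)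

theorem alf_mul_bef (y : ℂ) (x : ℝ) : D.alf y x * D.bef y x = 1 := by
  rw [alf, bef, ← cexp_add]; simp

theorem norm_alf (y : ℂ) (x : ℝ) : ‖D.alf y x‖ = exp (2 / D.h * (D.phase y x).re) := by
  rw [alf, norm_exp]
  congr 1
  rw [show (2 / D.h : ℂ) = ((2 / D.h : ℝ) : ℂ) by push_cast; rfl, re_ofReal_mul]

theorem norm_bef (y : ℂ) (x : ℝ) : ‖D.bef y x‖ = exp (-(2 / D.h * (D.phase y x).re)) := by
  rw [bef, norm_exp]
  congr 1
  rw [show (2 / D.h : ℂ) = ((2 / D.h : ℝ) : ℂ) by push_cast; rfl, neg_re,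
    re_ofReal_mul]

theorem norm_alf_mul_norm_bef (y : ℂ) (x : ℝ) : ‖D.alf y x‖ * ‖D.bef y x‖ = 1 := by
  rw [← norm_mul, alf_mul_bef, norm_one]

theorem hasDerivAt_phase_re (y : ℂ) (x : ℝ) :
    HasDerivAt (fun x => (D.phase y x).re) (D.G x - y.re) x := by
  have := reCLM.hasFDerivAt.comp_hasDerivAt x (D.hasDerivAt_phase y x)
  simpa using! this

/-- The energy of a solution. -/
def energy (p : ℂ × ℂ) (P Q : ℝ → ℂ) (x : ℝ) : ℝ :=
  ‖D.alf p.2 x‖ * ‖P x‖^2 + ‖p.1‖ * (‖D.bef p.2 x‖ * ‖Q x‖^2)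

/-- The exponential growth rate of the energy. -/
def rate (p : ℂ × ℂ) (x : ℝ) : ℝ := √((D.G x - p.2.re)^2 + ‖p.1‖)

theorem continuous_rate (p : ℂ × ℂ) : Continuous (D.rate p) := by unfold rate; fun_prop

variable {D}

theorem hasDerivWithinAt_norm_sq {f : ℝ → ℂ} {f' : ℂ} {s : Set ℝ} {x : ℝ}
    (h : HasDerivWithinAt f f' s x) :
    HasDerivWithinAt (fun x => ‖f x‖^2) (2 * (conj (f x) * f').re) s x := by
  have := h.norm_sq
  convert! this using 2
  simp [Complex.inner, mul_comm]

theorem quadratic_form_le {v t a b : ℝ} :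
    v * (a^2 - b^2) + 2 * t * (a * b) ≤ √(v^2 + t^2) * (a^2 + b^2) := by
  have h0 : 0 ≤ v^2 + t^2 := by positivity
  apply le_of_abs_le
  apply abs_le_of_sq_le_sq _ (by positivity)
  rw [mul_pow, sq_sqrt h0]
  nlinarith [sq_nonneg (t * (a^2 - b^2) - v * (2 * (a * b)))]

theorem IsSol.energy_le {p : ℂ × ℂ} {P Q : ℝ → ℂ} (h : D.IsSol p P Q) {x1 x2 : ℝ}
    (h0 : 0 ≤ x1) (h12 : x1 ≤ x2) (h2 : x2 ≤ D.L) :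
    D.energy p P Q x2 ≤ D.energy p P Q x1 * exp (2 / D.h * ∫ s in x1..x2, D.rate p s) := by
  have hh := D.hh
  let W : ℝ → ℝ := fun x => ∫ s in x1..x, D.rate p s
  have hW : ∀ x, HasDerivAt W (D.rate p x) x := fun x =>
    ((D.continuous_rate p).integral_hasStrictDerivAt _ _).hasDerivAt
  let F : ℝ → ℝ := fun x => D.energy p P Q x * exp (-(2 / D.h * W x))
  have hsub : Icc x1 x2 ⊆ Icc 0 D.L := Icc_subset_Icc h0 h2
  have hA : ∀ x, HasDerivAt (fun x => ‖D.alf p.2 x‖)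
      (‖D.alf p.2 x‖ * (2 / D.h * (D.G x - p.2.re))) x := by
    intro x
    simp only [norm_alf]
    exact ((D.hasDerivAt_phase_re p.2 x).const_mul (2 / D.h)).exp
  have hB : ∀ x, HasDerivAt (fun x => ‖D.bef p.2 x‖)
      (‖D.bef p.2 x‖ * (-(2 / D.h * (D.G x - p.2.re)))) x := by
    intro x
    simp only [norm_bef]
    exact ((D.hasDerivAt_phase_re p.2 x).const_mul (2 / D.h)).neg.exp
  have hF : ∀ x ∈ Icc x1 x2, ∃ F', F' ≤ 0 ∧ HasDerivWithinAt F F' (Icc 0 D.L) x := by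
    intro x hx
    obtain ⟨hP, hQ⟩ := h x (hsub hx)
    have d1 := (hA x).hasDerivWithinAt (s := Icc 0 D.L) |>.mul (hasDerivWithinAt_norm_sq hP)
    have d2 := ((hB x).hasDerivWithinAt (s := Icc 0 D.L) |>.mul
      (hasDerivWithinAt_norm_sq hQ)).const_mul ‖p.1‖
    have d3 := (((hW x).const_mul (2 / D.h)).neg.exp).hasDerivWithinAt (s := Icc 0 D.L)
    refine ⟨_, ?_, (d1.add d2).mul d3⟩
    simp only [Pi.add_apply, Pi.mul_apply, Pi.neg_apply]
    set u := (conj (P x) * ((D.h : ℂ)⁻¹ * (p.1 * D.bef p.2 x * Q x))).re with hu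
    set w := (conj (Q x) * (-((D.h : ℂ)⁻¹ * (D.alf p.2 x * P x)))).re with hw
    have i1 : u ≤ D.h⁻¹ * (‖p.1‖ * ‖D.bef p.2 x‖ * ‖P x‖ * ‖Q x‖) := by
      refine (re_le_norm _).trans_eq ?_
      simp only [norm_mul, norm_inv, norm_real, norm_of_nonneg hh.le, RCLike.norm_conj]
      ring
    have i2 : w ≤ D.h⁻¹ * (‖D.alf p.2 x‖ * ‖P x‖ * ‖Q x‖) := by
      refine (re_le_norm _).trans_eq ?_
      simp only [norm_mul, norm_inv, norm_neg, norm_real, norm_of_nonneg hh.le, RCLike.norm_conj]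
      ring
    have hAB := D.norm_alf_mul_norm_bef p.2 x
    have hrate : D.rate p x = √((D.G x - p.2.re)^2 + √‖p.1‖^2) := by
      rw [sq_sqrt (norm_nonneg _)]; rfl
    have i3 := quadratic_form_le (v := D.G x - p.2.re) (t := √‖p.1‖) (a := √‖D.alf p.2 x‖ * ‖P x‖)
      (b := √‖p.1‖ * √‖D.bef p.2 x‖ * ‖Q x‖)
    rw [← hrate] at i3
    clear_value u w
    have hA0 := norm_nonneg (D.alf p.2 x)
    have hB0 := norm_nonneg (D.bef p.2 x)
    have hl0 := norm_nonneg p.1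
    set A := ‖D.alf p.2 x‖
    set B := ‖D.bef p.2 x‖
    set l := ‖p.1‖
    have hl2 := sq_sqrt hl0
    have hsAB : √A * √B = 1 := by rw [← sqrt_mul hA0, hAB, sqrt_one]
    rw [show 2 * √l * (√A * ‖P x‖ * (√l * √B * ‖Q x‖)) = 2 * √l^2 * (√A * √B) * (‖P x‖ * ‖Q x‖) by
      ring, hsAB, mul_pow, mul_pow, mul_pow, sq_sqrt hA0, sq_sqrt hB0, hl2] at i3
    have j1 := mul_le_mul_of_nonneg_left i1 hA0
    have j2 := mul_le_mul_of_nonneg_left i2 (mul_nonneg hl0 hB0)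
    have j3 := mul_le_mul_of_nonneg_left i3 (by positivity : 0 ≤ D.h⁻¹)
    have e1 : A * (D.h⁻¹ * (l * B * ‖P x‖ * ‖Q x‖)) = D.h⁻¹ * l * (‖P x‖ * ‖Q x‖) := by
      linear_combination (D.h⁻¹ * l * (‖P x‖ * ‖Q x‖)) * hAB
    have e2 : l * B * (D.h⁻¹ * (A * ‖P x‖ * ‖Q x‖)) = D.h⁻¹ * l * (‖P x‖ * ‖Q x‖) := by
      linear_combination (D.h⁻¹ * l * (‖P x‖ * ‖Q x‖)) * hAB
    rw [e1] at j1
    rw [e2] at j2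
    refine Eq.trans_le ?_ (mul_nonpos_of_nonpos_of_nonneg (sub_nonpos.2 (add_le_add
      (add_le_add j1 j2) j3)) (by positivity : 0 ≤ 2 * exp (-(2 / D.h * W x))))
    ring
  choose! F' hF' hd using hF
  have hanti : AntitoneOn F (Icc x1 x2) :=
    antitoneOn_of_hasDerivWithinAt_nonpos (convex_Icc _ _)
      (fun x hx => (hd x hx).continuousWithinAt.mono hsub)
      (fun x hx => (hd x (interior_subset hx)).mono (interior_subset.trans hsub))
      fun x hx => hF' x (interior_subset hx)
  have := hanti ⟨le_rfl, h12⟩ ⟨h12, le_rfl⟩ h12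
  simp only [F, W, integral_same, mul_zero, neg_zero, exp_zero, mul_one] at this
  rw [exp_neg, ← div_eq_mul_inv, div_le_iff₀ (exp_pos _)] at this
  exact this

end Sys

namespace Sys

variable (D : Sys)

/-! ### The monodromy -/

theorem mem_zero : (0 : ℝ) ∈ Icc 0 D.L := ⟨le_rfl, D.hL.le⟩
theorem mem_L : D.L ∈ Icc 0 D.L := ⟨D.hL.le, le_rfl⟩

/-- `E = e^{Φ/h}`, with `Φ = φ(L)`. -/
def EE (y : ℂ) : ℂ := cexp ((D.h : ℂ)⁻¹ * D.phase y D.L)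

theorem EE_ne_zero (y : ℂ) : D.EE y ≠ 0 := cexp_ne_zero _

theorem EE_sq (y : ℂ) : D.EE y^2 = D.alf y D.L := by
  rw [EE, alf, ← Complex.exp_nat_mul]; congr 1; push_cast; ring

theorem contDiff_EE : ContDiff ℂ ω D.EE := by
  unfold EE phase
  exact Complex.contDiff_exp.comp
    (contDiff_const.mul (contDiff_const.sub (contDiff_id.mul contDiff_const)))

/-- The value of an element of the algebra at the right end point. -/
abbrev atL (u : D.X) : ℂ := u (D.pt D.L)

/-- The trace of the monodromy. -/
def tr (p : ℂ × ℂ) : ℂ := D.EE p.2 * D.atL (D.p1 p) + D.atL (D.q2 p) * (D.EE p.2)⁻¹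

theorem contDiff_atL {f : ℂ × ℂ → D.X} (hf : ContDiff ℂ ω f) :
    ContDiff ℂ ω fun p => D.atL (f p) := (D.ev (D.pt D.L)).contDiff.comp hf

theorem contDiff_EE_snd : ContDiff ℂ ω fun p : ℂ × ℂ => D.EE p.2 := D.contDiff_EE.comp contDiff_snd

theorem contDiff_EE_snd_inv : ContDiff ℂ ω fun p : ℂ × ℂ => (D.EE p.2)⁻¹ :=
  D.contDiff_EE_snd.inv fun p => D.EE_ne_zero p.2

theorem contDiff_tr : ContDiff ℂ ω D.tr :=
  (D.contDiff_EE_snd.mul (D.contDiff_atL D.contDiff_p1)).add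
    ((D.contDiff_atL D.contDiff_q2).mul D.contDiff_EE_snd_inv)

/-- Minus the lower left entry of the monodromy based at `x`. -/
def nn (p : ℂ × ℂ) : D.X :=
  -(D.be p.2 * ((D.EE p.2 * D.atL (D.p1 p)) • (D.q1 p * D.q2 p)
    - (D.EE p.2 * p.1 * D.atL (D.r p)) • (D.q1 p * D.q1 p)
    + ((D.EE p.2)⁻¹ * D.atL (D.q1 p)) • (D.q2 p * D.q2 p)
    - ((D.EE p.2)⁻¹ * D.atL (D.q2 p)) • (D.q1 p * D.q2 p)))

/-- The upper right entry of the monodromy based at `x`, divided by `λ`. -/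
def mm (p : ℂ × ℂ) : D.X :=
  D.al p.2 * ((D.EE p.2 * D.atL (D.r p)) • (D.p1 p * D.p1 p)
    - (D.EE p.2 * D.atL (D.p1 p)) • (D.p1 p * D.r p)
    + ((D.EE p.2)⁻¹ * D.atL (D.q2 p)) • (D.r p * D.p1 p)
    - ((D.EE p.2)⁻¹ * p.1 * D.atL (D.q1 p)) • (D.r p * D.r p))

theorem contDiff_nn_mm : ContDiff ℂ ω D.nn ∧ ContDiff ℂ ω D.mm := by
  have h1 := D.contDiff_atL D.contDiff_p1
  have h2 := D.contDiff_atL D.contDiff_q1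
  have h3 := D.contDiff_atL D.contDiff_r
  have h4 := D.contDiff_atL D.contDiff_q2
  have h5 := D.contDiff_EE_snd
  have h6 := D.contDiff_EE_snd_inv
  have q1 := D.contDiff_q1
  have q2 := D.contDiff_q2
  have p1 := D.contDiff_p1
  have r := D.contDiff_r
  have be := D.contDiff_be.comp (contDiff_snd (E := ℂ) (F := ℂ))
  have al := D.contDiff_al.comp (contDiff_snd (E := ℂ) (F := ℂ))
  have h10 : ContDiff ℂ ω (fun p : ℂ × ℂ => p.1) := contDiff_fst
  exact ⟨(be.mul (((((h5.mul h1).smul (q1.mul q2)).sub (((h5.mul h10).mul h3).smul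
    (q1.mul q1))).add ((h6.mul h2).smul (q2.mul q2))).sub ((h6.mul h4).smul (q1.mul q2)))).neg,
    al.mul (((((h5.mul h3).smul (p1.mul p1)).sub ((h5.mul h1).smul
    (p1.mul r))).add ((h6.mul h4).smul (r.mul p1))).sub (((h6.mul h10).mul h2).smul (r.mul r)))⟩

theorem nn_apply (p : ℂ × ℂ) (x : Icc 0 D.L) :
    D.nn p x = -(D.be p.2 x * (D.q1 p x * (D.EE p.2 * (D.atL (D.p1 p) * D.q2 p x
      - p.1 * D.atL (D.r p) * D.q1 p x)) + D.q2 p x * ((D.atL (D.q1 p) * D.q2 p x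
      - D.atL (D.q2 p) * D.q1 p x) * (D.EE p.2)⁻¹))) := by
  simp only [nn, neg_apply, mul_apply, add_apply, sub_apply, smul_apply]
  ring

theorem mm_apply (p : ℂ × ℂ) (x : Icc 0 D.L) :
    D.mm p x = D.al p.2 x * (D.p1 p x * (D.EE p.2 * (D.atL (D.r p) * D.p1 p x
      - D.atL (D.p1 p) * D.r p x)) + D.r p x * ((D.atL (D.q2 p) * D.p1 p x
      - p.1 * D.atL (D.q1 p) * D.r p x) * (D.EE p.2)⁻¹)) := by
  simp only [mm, mul_apply, add_apply, sub_apply, smul_apply]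
  ring

/-- The total growth factor over a period. -/
def growth (p : ℂ × ℂ) : ℝ := exp (D.h⁻¹ * ∫ s in 0..D.L, D.rate p s)

theorem growth_sq (p : ℂ × ℂ) : D.growth p^2 = exp (2 / D.h * ∫ s in 0..D.L, D.rate p s) := by
  rw [growth, ← exp_nat_mul]; congr 1; push_cast; ring

theorem growth_pos (p : ℂ × ℂ) : 0 < D.growth p := exp_pos _

theorem norm_alf_zero (y : ℂ) : ‖D.alf y 0‖ = 1 := by rw [norm_alf, phase_zero]; simp
theorem norm_bef_zero (y : ℂ) : ‖D.bef y 0‖ = 1 := by rw [norm_bef, phase_zero]; simp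

theorem norm_alf_L (y : ℂ) : ‖D.alf y D.L‖ = ‖D.EE y‖^2 := by rw [← EE_sq, norm_pow]

theorem norm_bef_L (y : ℂ) : ‖D.bef y D.L‖ = (‖D.EE y‖^2)⁻¹ := by
  rw [← norm_alf_L]
  exact eq_inv_of_mul_eq_one_right (D.norm_alf_mul_norm_bef y D.L)

theorem norm_EE_mul_p1_le (p : ℂ × ℂ) : ‖D.EE p.2 * D.atL (D.p1 p)‖ ≤ D.growth p := by
  have h := (D.isSol_fst p).energy_le le_rfl D.hL.le le_rfl
  rw [← growth_sq] at h
  simp only [energy, p1_pt_zero, q1_pt_zero, norm_alf_zero, norm_one, norm_zero, norm_alf_L] at h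
  refine le_of_sq_le_sq ?_ (D.growth_pos p).le
  rw [norm_mul, mul_pow]
  have : 0 ≤ ‖p.1‖ * (‖D.bef p.2 D.L‖ * ‖D.q1 p (D.pt D.L)‖^2) := by positivity
  simp only [one_pow, mul_one, ne_eq, OfNat.ofNat_ne_zero, not_false_eq_true, zero_pow, mul_zero,
    add_zero, one_mul] at h
  linarith

theorem norm_q2_mul_EE_inv_le {p : ℂ × ℂ} (hp : p.1 ≠ 0) :
    ‖D.atL (D.q2 p) * (D.EE p.2)⁻¹‖ ≤ D.growth p := by
  have h := (D.isSol_snd p).energy_le le_rfl D.hL.le le_rfl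
  rw [← growth_sq] at h
  simp only [energy, r_pt_zero, q2_pt_zero, norm_bef_zero, norm_one, norm_bef_L] at h
  refine le_of_sq_le_sq ?_ (D.growth_pos p).le
  rw [norm_mul, mul_pow, norm_inv, inv_pow]
  have h1 : 0 ≤ ‖D.alf p.2 D.L‖ * ‖p.1 * D.r p (D.pt D.L)‖^2 := by positivity
  simp only [one_pow, mul_one, mul_zero, norm_zero, ne_eq, OfNat.ofNat_ne_zero, not_false_eq_true,
    zero_pow, zero_add] at h
  have h2 : 0 < ‖p.1‖ := norm_pos_iff.2 hp
  refine le_of_mul_le_mul_left ?_ h2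
  rw [mul_comm (‖D.q2 p (D.pt D.L)‖^2)]
  linarith

theorem norm_tr_le {p : ℂ × ℂ} (hp : p.1 ≠ 0) : ‖D.tr p‖ ≤ 2 * D.growth p := by
  have h1 := D.norm_EE_mul_p1_le p
  have h2 := D.norm_q2_mul_EE_inv_le hp
  exact (norm_add_le _ _).trans (by linarith)

theorem tr_zero (y : ℂ) : D.tr (0, y) = D.EE y + (D.EE y)⁻¹ := by simp [tr, atL, p1_zero, q2_zero]

theorem nn_zero (y : ℂ) (x : Icc 0 D.L) : D.nn (0, y) x = D.be y x * (D.EE y * D.prim (D.al y) x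
      + (D.EE y)⁻¹ * (D.atL (D.prim (D.al y)) - D.prim (D.al y) x)) := by
  rw [nn_apply, p1_zero, q2_zero, q1_zero]
  simp only [atL, one_apply, neg_apply]
  ring

/-- Minus the derivative of the trace of the monodromy with respect to `λ` at `λ = 0`. -/
def jj (y : ℂ) : ℂ := D.EE y * D.atL (D.prim (D.be y * D.prim (D.al y))) +
  (D.EE y)⁻¹ * D.atL (D.prim (D.al y * D.prim (D.be y)))

theorem hasDerivAt_tr_zero (y : ℂ) : HasDerivAt (fun l : ℂ => D.tr (l, y)) (-D.jj y) 0 := by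
  have hd : ∀ f : ℂ × ℂ → D.X, ContDiff ℂ ω f → ContinuousAt (fun l : ℂ => f (l, y)) 0 :=
    fun f hf => (hf.continuous.comp (by fun_prop)).continuousAt
  have h1 : HasDerivAt (fun l : ℂ => D.atL (D.p1 (l, y)))
      (D.atL (D.prim (D.be y * D.q1 (0, y)))) 0 := by
    rw [hasDerivAt_iff_tendsto_slope_zero]
    have hc : ContinuousAt (fun l : ℂ => D.atL (D.prim (D.be y * D.q1 (l, y)))) 0 :=
      (D.ev _).continuous.continuousAt.comp (D.prim.continuous.continuousAt.comp
        (continuousAt_const.mul (hd _ D.contDiff_q1)))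
    refine Filter.Tendsto.congr' ?_ (hc.tendsto.mono_left nhdsWithin_le_nhds)
    filter_upwards [self_mem_nhdsWithin] with l hl
    rw [zero_add, D.p1_eq (l, y), D.p1_eq (0, y)]
    simp only [atL, add_apply, one_apply, smul_apply, smul_eq_mul, zero_mul, add_zero]
    rw [add_sub_cancel_left, inv_mul_cancel_left₀ hl]
  have h2 : HasDerivAt (fun l : ℂ => D.atL (D.q2 (l, y)))
      (-D.atL (D.prim (D.al y * D.r (0, y)))) 0 := by
    rw [hasDerivAt_iff_tendsto_slope_zero]
    have hc : ContinuousAt (fun l : ℂ => -D.atL (D.prim (D.al y * D.r (l, y)))) 0 :=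
      ((D.ev _).continuous.continuousAt.comp (D.prim.continuous.continuousAt.comp
        (continuousAt_const.mul (hd _ D.contDiff_r)))).neg
    refine Filter.Tendsto.congr' ?_ (hc.tendsto.mono_left nhdsWithin_le_nhds)
    filter_upwards [self_mem_nhdsWithin] with l hl
    have hl' : l ≠ 0 := hl
    simp only [zero_add, q2, atL, sub_apply, one_apply, smul_apply, smul_eq_mul, zero_mul, sub_zero]
    field_simp
    ring
  refine ((h1.const_mul (D.EE y)).add (h2.mul_const (D.EE y)⁻¹)).congr_deriv ?_
  rw [jj, q1_zero, r_zero, mul_neg, map_neg]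
  simp only [atL, neg_apply]
  ring

end Sys

namespace Sys

variable (D : Sys)

/-! ### Floquet solutions -/

/-- The entries of the monodromy based at `0`. -/
def M11 (p : ℂ × ℂ) : ℂ := D.EE p.2 * D.atL (D.p1 p)
def M12 (p : ℂ × ℂ) : ℂ := D.EE p.2 * (p.1 * D.atL (D.r p))
def M21 (p : ℂ × ℂ) : ℂ := D.atL (D.q1 p) * (D.EE p.2)⁻¹
def M22 (p : ℂ × ℂ) : ℂ := D.atL (D.q2 p) * (D.EE p.2)⁻¹

theorem tr_eq (p : ℂ × ℂ) : D.tr p = D.M11 p + D.M22 p := rfl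

theorem det_monodromy (p : ℂ × ℂ) : D.M11 p * D.M22 p - D.M12 p * D.M21 p = 1 := by
  have h := D.det_eq_one p D.mem_L
  have hE := D.EE_ne_zero p.2
  rw [← h, M11, M12, M21, M22]
  simp only [atL]
  field_simp

theorem nn_eq (p : ℂ × ℂ) (x : Icc 0 D.L) :
    D.nn p x = -(D.be p.2 x * (D.M11 p * D.q1 p x * D.q2 p x - D.M12 p * D.q1 p x^2
      + D.M21 p * D.q2 p x^2 - D.M22 p * D.q1 p x * D.q2 p x)) := by
  rw [nn_apply, M11, M12, M21, M22]; ring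

theorem lam_mul_mm_eq (p : ℂ × ℂ) (x : Icc 0 D.L) :
    p.1 * D.mm p x = D.al p.2 x * (D.M12 p * D.p1 p x^2
      + (D.M22 p - D.M11 p) * D.p1 p x * (p.1 * D.r p x) - D.M21 p * (p.1 * D.r p x)^2) := by
  rw [mm_apply, M11, M12, M21, M22]; ring

theorem conj_phase {y : ℂ} (hy : conj y = y) (x : ℝ) : conj (D.phase y x) = D.phase y x := by
  simp [phase, hy]

theorem conj_alf {y : ℂ} (hy : conj y = y) (x : ℝ) : conj (D.alf y x) = D.alf y x := by
  rw [alf, ← exp_conj, map_mul, map_div₀, conj_ofReal, conj_phase D hy, conj_ofNat]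

theorem conj_bef {y : ℂ} (hy : conj y = y) (x : ℝ) : conj (D.bef y x) = D.bef y x := by
  rw [bef, ← exp_conj, map_neg, map_mul, map_div₀, conj_ofReal, conj_phase D hy, conj_ofNat]

theorem conj_EE {y : ℂ} (hy : conj y = y) : conj (D.EE y) = D.EE y := by
  rw [EE, ← exp_conj]; simp [conj_phase D hy]

variable {D}

theorem IsSol.conj {p : ℂ × ℂ} (h1 : conj p.1 = p.1) (h2 : conj p.2 = p.2) {P Q : ℝ → ℂ}
    (h : D.IsSol p P Q) : D.IsSol p (fun x => conj (P x)) (fun x => conj (Q x)) := by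
  intro x hx
  obtain ⟨hP, hQ⟩ := h x hx
  have a := conjCLE.toContinuousLinearMap.hasFDerivAt.comp_hasDerivWithinAt x hP
  have b := conjCLE.toContinuousLinearMap.hasFDerivAt.comp_hasDerivWithinAt x hQ
  refine ⟨?_, ?_⟩
  · convert! a using 1
    simp [h1, conj_bef D h2]
  · convert! b using 1
    simp [conj_alf D h2]

variable (D)

theorem conj_fundamental {p : ℂ × ℂ} (h1 : conj p.1 = p.1) (h2 : conj p.2 = p.2) (h0 : p.1 ≠ 0)
    (x : Icc 0 D.L) :
    conj (D.p1 p x) = D.p1 p x ∧ conj (D.q1 p x) = D.q1 p x ∧ conj (D.r p x) = D.r p x ∧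
      conj (D.q2 p x) = D.q2 p x := by
  have s1 := (D.isSol_fst p).conj h1 h2
  have s2 := (D.isSol_snd p).conj h1 h2
  have a1 := s1.eq_fst x.2
  have a2 := s1.eq_snd x.2
  have a3 := s2.eq_fst x.2
  have a4 := s2.eq_snd x.2
  simp only [p1_pt_zero, q1_pt_zero, r_pt_zero, q2_pt_zero, map_one, map_zero, mul_one, mul_zero,
    add_zero, zero_add, map_mul, h1, D.pt_coe] at a1 a2 a3 a4
  exact ⟨a1, a2, mul_left_cancel₀ h0 a3, a4⟩

theorem conj_tr {p : ℂ × ℂ} (h1 : conj p.1 = p.1) (h2 : conj p.2 = p.2) (h0 : p.1 ≠ 0) :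
    conj (D.tr p) = D.tr p := by
  obtain ⟨b1, b2, b3, b4⟩ := D.conj_fundamental h1 h2 h0 (D.pt D.L)
  simp only [tr, atL, map_mul, map_add, map_inv₀, b1, b4, D.conj_EE h2]

theorem conj_monodromy {p : ℂ × ℂ} (h1 : conj p.1 = p.1) (h2 : conj p.2 = p.2) (h0 : p.1 ≠ 0) :
    (conj (D.M11 p) = D.M11 p ∧ conj (D.M22 p) = D.M22 p) ∧
      conj (D.M12 p) = D.M12 p ∧ conj (D.M21 p) = D.M21 p := by
  obtain ⟨b1, b2, b3, b4⟩ := D.conj_fundamental h1 h2 h0 (D.pt D.L)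
  simp only [M11, M12, M21, M22, atL, map_mul, map_inv₀, b1, b2, b3, b4, h1, D.conj_EE h2, and_self]

/-- A Floquet solution with multiplier `u`. -/
structure IsFloquet (p : ℂ × ℂ) (u : ℂ) (P Q : ℝ → ℂ) : Prop where
  sol : D.IsSol p P Q
  fst : D.EE p.2 * P D.L = u * P 0
  snd : Q D.L * (D.EE p.2)⁻¹ = u * Q 0

variable {D} {p : ℂ × ℂ} {u : ℂ} {P Q : ℝ → ℂ}

theorem IsFloquet.eqn_fst (h : D.IsFloquet p u P Q) : D.M11 p * P 0 + D.M12 p * Q 0 = u * P 0 := by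
  rw [← h.fst, h.sol.eq_fst D.mem_L, M11, M12]; ring

theorem IsFloquet.eqn_snd (h : D.IsFloquet p u P Q) : D.M21 p * P 0 + D.M22 p * Q 0 = u * Q 0 := by
  rw [← h.snd, h.sol.eq_snd D.mem_L, M21, M22]; ring

theorem IsFloquet.tr_eq (h : D.IsFloquet p u P Q) (h0 : P 0 ≠ 0 ∨ Q 0 ≠ 0) (hu : u ≠ 0) :
    D.tr p = u + u⁻¹ := by
  have e1 := h.eqn_fst
  have e2 := h.eqn_snd
  have hd := D.det_monodromy p
  have key : 1 - u * D.tr p + u^2 = 0 := by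
    rw [Sys.tr_eq]
    rcases h0 with h0 | h0
    · apply mul_right_cancel₀ h0
      linear_combination (D.M22 p - u) * e1 - D.M12 p * e2 - P 0 * hd
    · apply mul_right_cancel₀ h0
      linear_combination (D.M11 p - u) * e2 - D.M21 p * e1 - Q 0 * hd
  field_simp
  linear_combination -key

theorem IsFloquet.monodromy_ne (h : D.IsFloquet p u P Q) (h0 : P 0 ≠ 0 ∨ Q 0 ≠ 0)
    (h1 : conj p.1 = p.1) (h2 : conj p.2 = p.2) (hp : p.1 ≠ 0) (hu : u * conj u = 1)
    (hn : ∃ x, D.nn p x ≠ 0) : D.M12 p ≠ 0 ∨ D.M21 p ≠ 0 := by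
  by_contra! hcon
  obtain ⟨m12, m21⟩ := hcon
  obtain ⟨x, hx⟩ := hn
  obtain ⟨⟨c1, c2⟩, -⟩ := D.conj_monodromy h1 h2 hp
  have e1 := h.eqn_fst
  have e2 := h.eqn_snd
  have hd := D.det_monodromy p
  rw [m12, zero_mul, add_zero] at e1
  rw [m21, zero_mul, zero_add] at e2
  rw [m12, zero_mul, sub_zero] at hd
  have hEq : D.M11 p = D.M22 p := by
    rcases h0 with h0 | h0
    · have : D.M11 p = u := mul_right_cancel₀ h0 e1
      rw [← this, c1] at hu
      have h3 : D.M11 p ≠ 0 := left_ne_zero_of_mul_eq_one hu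
      exact mul_left_cancel₀ h3 (hu.trans hd.symm)
    · have : D.M22 p = u := mul_right_cancel₀ h0 e2
      rw [← this, c2] at hu
      have h3 : D.M22 p ≠ 0 := left_ne_zero_of_mul_eq_one hu
      exact mul_right_cancel₀ h3 (hd.trans hu.symm)
  apply hx
  rw [nn_eq, m12, m21, hEq]
  ring

/-- The densities of a Floquet solution are the off-diagonal entries of the monodromy, up to a
constant factor. -/
theorem IsFloquet.density (h : D.IsFloquet p u P Q) (h0 : P 0 ≠ 0 ∨ Q 0 ≠ 0)
    (h1 : conj p.1 = p.1) (h2 : conj p.2 = p.2) (hp : p.1 ≠ 0) (hu : u * conj u = 1)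
    (hn : ∃ x, D.nn p x ≠ 0) :
    ∃ k : ℂ, ∀ x : Icc 0 D.L, D.al p.2 x * (P x * conj (P x)) = k * (p.1 * D.mm p x) ∧
      D.be p.2 x * (Q x * conj (Q x)) = k * D.nn p x := by
  have hne := h.monodromy_ne h0 h1 h2 hp hu hn
  have hu0 : u ≠ 0 := left_ne_zero_of_mul_eq_one hu
  have hui : u⁻¹ = conj u := inv_eq_of_mul_eq_one_right hu
  have ht := h.tr_eq h0 hu0
  rw [hui, Sys.tr_eq] at ht
  obtain ⟨⟨c1, c2⟩, c3, c4⟩ := D.conj_monodromy h1 h2 hp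
  have e1 := h.eqn_fst
  have e2 := h.eqn_snd
  have e3 := congrArg conj e1
  have e4 := congrArg conj e2
  simp only [map_add, map_mul, c1, c2, c3, c4] at e3 e4
  set a := P 0
  set b := Q 0
  set a' := conj a
  set b' := conj b
  set v := conj u
  have hM22 : D.M22 p = u + v - D.M11 p := by linear_combination ht
  have R1 : D.M12 p * (b * b') = -D.M21 p * (a * a') := by
    linear_combination b' * e1 + a * e4 - (a * b') * hM22
  have R2 : D.M12 p * (a * b' + b * a') = (D.M22 p - D.M11 p) * (a * a') := by
    linear_combination a' * e1 + a * e3 - (a * a') * hM22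
  have R3 : -D.M21 p * (a * b' + b * a') = (D.M22 p - D.M11 p) * (b * b') := by
    linear_combination -b' * e2 - b * e4 + (b * b') * hM22
  have key : ∀ x : Icc 0 D.L,
      (D.M12 p * (D.al p.2 x * (P x * conj (P x))) = (a * a') * (p.1 * D.mm p x) ∧
      D.M12 p * (D.be p.2 x * (Q x * conj (Q x))) = (a * a') * D.nn p x) ∧
      (-D.M21 p * (D.al p.2 x * (P x * conj (P x))) = (b * b') * (p.1 * D.mm p x) ∧
      -D.M21 p * (D.be p.2 x * (Q x * conj (Q x))) = (b * b') * D.nn p x) := by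
    intro x
    obtain ⟨a1, a2, a3, a4⟩ := D.conj_fundamental h1 h2 hp x
    have f1 := h.sol.eq_fst x.2
    have f2 := h.sol.eq_snd x.2
    have f3 := congrArg conj f1
    have f4 := congrArg conj f2
    simp only [map_add, map_mul, D.pt_coe, a1, a2, a3, a4, h1] at f1 f2 f3 f4
    rw [lam_mul_mm_eq, nn_eq, f3, f4, f1, f2]
    change (D.M12 p * (D.al p.2 x * ((D.p1 p x * a + p.1 * D.r p x * b) *
      (D.p1 p x * a' + p.1 * D.r p x * b'))) = _ ∧ D.M12 p * (D.be p.2 x *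
      ((D.q1 p x * a + D.q2 p x * b) * (D.q1 p x * a' + D.q2 p x * b'))) = _) ∧
      (-D.M21 p * (D.al p.2 x * ((D.p1 p x * a + p.1 * D.r p x * b) *
      (D.p1 p x * a' + p.1 * D.r p x * b'))) = _ ∧ -D.M21 p * (D.be p.2 x *
      ((D.q1 p x * a + D.q2 p x * b) * (D.q1 p x * a' + D.q2 p x * b'))) = _)
    refine ⟨⟨?_, ?_⟩, ?_, ?_⟩
    · linear_combination D.al p.2 x * ((p.1 * D.r p x)^2 * R1 + D.p1 p x * (p.1 * D.r p x) * R2)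
    · linear_combination D.be p.2 x * (D.q2 p x^2 * R1 + D.q1 p x * D.q2 p x * R2)
    · linear_combination D.al p.2 x * (-D.p1 p x^2 * R1 + D.p1 p x * (p.1 * D.r p x) * R3)
    · linear_combination D.be p.2 x * (-D.q1 p x^2 * R1 + D.q1 p x * D.q2 p x * R3)
  rcases hne with hne | hne
  · refine ⟨a * a' / D.M12 p, fun x => ⟨?_, ?_⟩⟩
    · rw [div_mul_eq_mul_div, eq_div_iff hne, ← (key x).1.1]; ring
    · rw [div_mul_eq_mul_div, eq_div_iff hne, ← (key x).1.2]; ring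
  · have hne' : -D.M21 p ≠ 0 := neg_ne_zero.2 hne
    refine ⟨b * b' / -D.M21 p, fun x => ⟨?_, ?_⟩⟩
    · rw [div_mul_eq_mul_div, eq_div_iff hne', ← (key x).2.1]; ring
    · rw [div_mul_eq_mul_div, eq_div_iff hne', ← (key x).2.2]; ring

/-- Floquet solutions with the same multiplier are proportional. -/
theorem IsFloquet.proportional {P' Q' : ℝ → ℂ} (h : D.IsFloquet p u P Q)
    (h' : D.IsFloquet p u P' Q') (h0 : P 0 ≠ 0 ∨ Q 0 ≠ 0)
    (h1 : conj p.1 = p.1) (h2 : conj p.2 = p.2) (hp : p.1 ≠ 0) (hu : u * conj u = 1)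
    (hn : ∃ x, D.nn p x ≠ 0) :
    ∃ k : ℂ, ∀ x ∈ Icc 0 D.L, P' x = k * P x ∧ Q' x = k * Q x := by
  have hne := h.monodromy_ne h0 h1 h2 hp hu hn
  have e1 := h.eqn_fst
  have e2 := h.eqn_snd
  have e3 := h'.eqn_fst
  have e4 := h'.eqn_snd
  have hW : P 0 * Q' 0 = P' 0 * Q 0 := by
    rcases hne with hne | hne
    · apply mul_left_cancel₀ hne
      linear_combination P 0 * e3 - P' 0 * e1
    · apply mul_left_cancel₀ hne
      linear_combination Q' 0 * e2 - Q 0 * e4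
  obtain ⟨k, k1, k2⟩ : ∃ k : ℂ, P' 0 = k * P 0 ∧ Q' 0 = k * Q 0 := by
    rcases h0 with h0 | h0
    · refine ⟨P' 0 / P 0, by field_simp, ?_⟩
      rw [div_mul_eq_mul_div, eq_div_iff h0]; linear_combination hW
    · refine ⟨Q' 0 / Q 0, ?_, by field_simp⟩
      rw [div_mul_eq_mul_div, eq_div_iff h0]; linear_combination -hW
  refine ⟨k, fun x hx => ⟨?_, ?_⟩⟩
  · rw [h'.sol.eq_fst hx, h.sol.eq_fst hx, k1, k2]; ring
  · rw [h'.sol.eq_snd hx, h.sol.eq_snd hx, k1, k2]; ring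

/-- If the trace of the monodromy is `u + u⁻¹`, there is a Floquet solution. -/
theorem exists_isFloquet (hu : u ≠ 0) (ht : D.tr p = u + u⁻¹) :
    ∃ P Q : ℝ → ℂ, D.IsFloquet p u P Q ∧ (P 0 ≠ 0 ∨ Q 0 ≠ 0) := by
  have hd := D.det_monodromy p
  rw [Sys.tr_eq] at ht
  have hchar : (D.M11 p - u) * (D.M22 p - u) = D.M12 p * D.M21 p := by
    have : u * (D.M11 p + D.M22 p) = u^2 + 1 := by rw [ht]; field_simp
    linear_combination hd - this
  obtain ⟨a, b, h0, e1, e2⟩ : ∃ a b : ℂ, (a ≠ 0 ∨ b ≠ 0) ∧ D.M11 p * a + D.M12 p * b = u * a ∧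
      D.M21 p * a + D.M22 p * b = u * b := by
    by_cases h1 : D.M12 p = 0 ∧ u - D.M11 p = 0
    · by_cases h2 : D.M21 p = 0 ∧ u - D.M22 p = 0
      · refine ⟨1, 0, Or.inl one_ne_zero, ?_, ?_⟩
        · linear_combination -h1.2
        · rw [h2.1]; ring
      · refine ⟨u - D.M22 p, D.M21 p, ?_, ?_, ?_⟩
        · by_contra! hc; exact h2 ⟨hc.2, hc.1⟩
        · linear_combination -hchar
        · ring
    · refine ⟨D.M12 p, u - D.M11 p, ?_, ?_, ?_⟩
      · by_contra! hc; exact h1 ⟨hc.1, hc.2⟩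
      · ring
      · linear_combination -hchar
  refine ⟨_, _, ⟨(D.isSol_fst p).lin (D.isSol_snd p) a b, ?_, ?_⟩, ?_⟩
  · simp only [p1_pt_zero, r_pt_zero]
    rw [M11, M12] at e1
    linear_combination e1
  · simp only [q1_pt_zero, q2_pt_zero]
    rw [M21, M22] at e2
    linear_combination e2
  · simpa using h0

end Sys

/-! ### Eigenfunctions as periodic solutions of a first order system -/

/-- `(P - z) u = F` and `(P - z)^* F = t u`, with `u`, `F` periodic. -/
structure IsEig (h : ℝ) (g : ℝ → ℂ) (z : ℂ) (t : ℝ) (u F : ℝ → ℂ) : Prop where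
  per_u : Periodic u (2 * π)
  per_F : Periodic F (2 * π)
  deriv_u : ∀ x, HasDerivAt u (I / h * (F x - (g x - z) * u x)) x
  deriv_F : ∀ x, HasDerivAt F (I / h * (t * u x - (conj (g x) - conj z) * F x)) x

theorem InH1.exists_ae_hasDerivAt {w : ℝ → ℂ} (hw : InH1 w) :
    ∃ v : ℝ → ℂ, (∀ x, w x = w 0 + ∫ s in 0..x, v s) ∧ ∀ᵐ x : ℝ, HasDerivAt w (v x) x := by
  obtain ⟨-, v, hper, hL2, hv⟩ := hw
  refine ⟨v, hv, ?_⟩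
  have h1 : IntegrableOn v (Ioc (0 : ℝ) (2 * π)) := hL2.integrable (by norm_num)
  have h2 : IntervalIntegrable v volume 0 (2 * π) :=
    (intervalIntegrable_iff_integrableOn_Ioc_of_le two_pi_pos.le).2 h1
  have h3 : ∀ a b, IntervalIntegrable v volume a b := fun a b =>
    Function.Periodic.intervalIntegrable₀ hper two_pi_pos.ne' h2 a b
  have h4 : MeasureTheory.LocallyIntegrable v volume := by
    intro x
    refine ⟨Ioc (x - 1) (x + 1), Ioc_mem_nhds (by linarith) (by linarith), ?_⟩
    exact (intervalIntegrable_iff_integrableOn_Ioc_of_le (by linarith)).1 (h3 _ _)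
  filter_upwards [LocallyIntegrable.ae_hasDerivAt_integral h4] with x hx
  have := (hx 0).const_add (w 0)
  exact this.congr_of_eventuallyEq (Filter.Eventually.of_forall hv)

theorem inH1_of_hasDerivAt {u u' : ℝ → ℂ} (hp : Periodic u (2 * π))
    (hd : ∀ x, HasDerivAt u (u' x) x) (hc : Continuous u') : InH1 u := by
  refine ⟨hp, u', ?_, ?_, fun x => ?_⟩
  · intro x
    have h1 := (hd (x + 2 * π)).comp_add_const x (2 * π)
    have h2 : (fun x => u (x + 2 * π)) = u := funext hp
    rw [h2] at h1
    exact h1.unique (hd x)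
  · obtain ⟨B, hB⟩ := isCompact_Icc.exists_bound_of_continuousOn
      (hc.continuousOn (s := Icc 0 (2 * π)))
    refine MeasureTheory.MemLp.of_bound hc.aestronglyMeasurable B ?_
    refine (MeasureTheory.ae_restrict_iff' measurableSet_Ioc).2 (Filter.Eventually.of_forall ?_)
    exact fun x hx => hB x ⟨hx.1.le, hx.2⟩
  · rw [integral_eq_sub_of_hasDerivAt (fun y _ => hd y) (hc.intervalIntegrable _ _)]
    ring

variable {h : ℝ} {g : ℝ → ℂ} {z : ℂ} {t : ℝ} {u F : ℝ → ℂ}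

theorem Pz_eq_iff (hh : 0 < h) (d u F : ℂ) (gx : ℂ) :
    (h * (1 / I * d) + gx * u - z * u = F) ↔ d = I / h * (F - (gx - z) * u) := by
  have hh' : (h : ℂ) ≠ 0 := ofReal_ne_zero.2 hh.ne'
  have hI := I_ne_zero
  constructor
  · rintro rfl
    field_simp
    ring
  · rintro rfl
    field_simp
    ring

/-- The eigenfunctions of `Q(z)` are classical solutions. -/
theorem IsNormalizedEigenfunction.isEig (hh : 0 < h) (hg : ContDiff ℝ ∞ g)
    (hp : Periodic g (2 * π)) (hu : IsNormalizedEigenfunction (Q h g z) t u) :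
    IsEig h g z t u (Pz h g z u) := by
  obtain ⟨⟨hu1, hud, hu2⟩, -, hae⟩ := hu
  have hh' : (h : ℂ) ≠ 0 := ofReal_ne_zero.2 hh.ne'
  have hgd : Differentiable ℝ g := hg.differentiable (by simp)
  have hgc' : Continuous (deriv g) := hg.continuous_deriv (by simp)
  obtain ⟨v, hv, hvd⟩ := hu2.exists_ae_hasDerivAt
  set w := deriv u with hw
  have hF : ∀ x, Pz h g z u x = h * (1 / I * w x) + g x * u x - z * u x := fun x => rfl
  have hwc : Continuous w := by
    obtain ⟨-, v', hper, hL2, hv'⟩ := hu2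
    have h1 : IntegrableOn v' (Ioc (0 : ℝ) (2 * π)) := hL2.integrable (by norm_num)
    have h2 : IntervalIntegrable v' volume 0 (2 * π) :=
      (intervalIntegrable_iff_integrableOn_Ioc_of_le two_pi_pos.le).2 h1
    have h3 := continuous_primitive (fun a b =>
      Function.Periodic.intervalIntegrable₀ hper two_pi_pos.ne' h2 a b) 0
    rw [funext hv']
    exact continuous_const.add h3
  have huc : Continuous u := hud.continuous
  have hgc := hg.continuous
  have hFc : Continuous (Pz h g z u) := by rw [funext hF]; fun_prop
  let k : ℝ → ℂ := fun x => I / h * ((I / h * (t * u x - (conj (g x) - conj z) *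
    Pz h g z u x)) - (deriv g x * u x + g x * w x - z * w x))
  have hkc : Continuous k := by
    have : Continuous fun x => conj (g x) := continuous_conj.comp hgc
    fun_prop
  have hvk : ∀ᵐ x : ℝ, v x = k x := by
    filter_upwards [hvd, hae] with x hx hxe
    have h1 : HasDerivAt (Pz h g z u)
        (h * (1 / I * v x) + (deriv g x * u x + g x * w x) - z * w x) x := by
      rw [funext hF]
      exact (((hx.const_mul _).const_mul _).add ((hgd x).hasDerivAt.mul (hud x).hasDerivAt)).sub
        ((hud x).hasDerivAt.const_mul z)
    have h2 : h * (1 / I * deriv (Pz h g z u) x) + conj (g x) * Pz h g z u x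
      - conj z * Pz h g z u x = t * u x := hxe
    rw [Pz_eq_iff hh, h1.deriv] at h2
    simp only [k]
    rw [← h2]
    field_simp
    ring
  have hwk : ∀ x, HasDerivAt w (k x) x := by
    intro x
    have h1 : ∀ x, w x = w 0 + ∫ s in 0..x, k s := by
      intro x
      rw [hv x]
      congr 1
      refine integral_congr_ae ?_
      filter_upwards [hvk] with x hx _ using hx
    rw [funext h1]
    exact ((hkc.integral_hasStrictDerivAt _ _).hasDerivAt).const_add _
  have hwp : Periodic w (2 * π) := hu2.1
  refine ⟨hu1.1, fun x => ?_, fun x => ?_, fun x => ?_⟩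
  · rw [hF, hF, hwp x, hu1.1 x, hp x]
  · rw [← (Pz_eq_iff hh (w x) (u x) _ (g x)).1 (hF x).symm]
    exact (hud x).hasDerivAt
  · have h1 : HasDerivAt (Pz h g z u)
        (h * (1 / I * k x) + (deriv g x * u x + g x * w x) - z * w x) x := by
      rw [funext hF]
      exact ((((hwk x).const_mul _).const_mul _).add
        ((hgd x).hasDerivAt.mul (hud x).hasDerivAt)).sub ((hud x).hasDerivAt.const_mul z)
    refine h1.congr_deriv ?_
    simp only [k]
    field_simp
    ring

theorem IsEig.continuous_u (e : IsEig h g z t u F) : Continuous u :=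
  continuous_iff_continuousAt.2 fun x => (e.deriv_u x).continuousAt

theorem IsEig.continuous_F (e : IsEig h g z t u F) : Continuous F :=
  continuous_iff_continuousAt.2 fun x => (e.deriv_F x).continuousAt

theorem IsEig.Pz_eq (hh : 0 < h) (e : IsEig h g z t u F) : Pz h g z u = F := by
  funext x
  exact (Pz_eq_iff hh _ _ _ _).2 (e.deriv_u x).deriv

theorem IsEig.isNormalizedEigenfunction (hh : 0 < h) (hg : ContDiff ℝ ∞ g)
    (e : IsEig h g z t u F) (hu : scalar u u = 1) :
    IsNormalizedEigenfunction (Q h g z) t u := by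
  have huc := e.continuous_u
  have hFc := e.continuous_F
  have hgc := hg.continuous
  have hgd : Differentiable ℝ g := hg.differentiable (by simp)
  have hgc' : Continuous (deriv g) := hg.continuous_deriv (by simp)
  have hu1 : deriv u = fun x => I / h * (F x - (g x - z) * u x) :=
    funext fun x => (e.deriv_u x).deriv
  have h1 : InH1 u := inH1_of_hasDerivAt e.per_u e.deriv_u (by fun_prop)
  have hup : Periodic (deriv u) (2 * π) := by
    intro x
    have h1 := (e.deriv_u (x + 2 * π)).comp_add_const x (2 * π)
    have h2 : (fun x => u (x + 2 * π)) = u := funext e.per_u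
    rw [h2] at h1
    rw [(e.deriv_u (x + 2 * π)).deriv, (e.deriv_u x).deriv]
    exact h1.unique (e.deriv_u x)
  refine ⟨⟨h1, fun x => (e.deriv_u x).differentiableAt, ?_⟩, hu, Filter.Eventually.of_forall ?_⟩
  · have hcg : Continuous fun x => conj (g x) := continuous_conj.comp hgc
    refine inH1_of_hasDerivAt (u' := fun x => I / h * ((I / h *
      (t * u x - (conj (g x) - conj z) * F x)) - (deriv g x * u x + (g x - z) *
      (I / h * (F x - (g x - z) * u x))))) hup (fun x => ?_) ?_
    · rw [hu1]
      exact (((e.deriv_F x).sub (((hgd x).hasDerivAt.sub_const z).mul (e.deriv_u x))).const_mul _)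
    · fun_prop
  · intro x
    change PzAdj h g z (Pz h g z u) x = _
    rw [e.Pz_eq hh]
    exact (Pz_eq_iff hh _ _ _ _).2 (e.deriv_F x).deriv

theorem Qtilde_eq : Qtilde h g z = Q h (fun x => conj (g x)) (conj z) := by
  funext u x
  simp only [Qtilde, Q, PzAdj, Pz, Padj, P, conj_conj]
  rfl

theorem IsEig.swap (e : IsEig h g z t u F) :
    IsEig h (fun x => conj (g x)) (conj z) t F (fun x => t * u x) where
  per_u := e.per_F
  per_F := fun x => by simp only [e.per_u x]
  deriv_u := fun x => e.deriv_F x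
  deriv_F := fun x => by
    refine ((e.deriv_u x).const_mul (t : ℂ)).congr_deriv ?_
    simp only [conj_conj]; ring

theorem IsEig.swap' (e : IsEig h (fun x => conj (g x)) (conj z) t u F) :
    IsEig h g z t F (fun x => t * u x) := by
  have := e.swap
  simpa only [conj_conj] using this

theorem IsEig.const_mul (e : IsEig h g z t u F) (c : ℂ) :
    IsEig h g z t (fun x => c * u x) (fun x => c * F x) where
  per_u := fun x => by simp only [e.per_u x]
  per_F := fun x => by simp only [e.per_F x]
  deriv_u := fun x => ((e.deriv_u x).const_mul c).congr_deriv (by ring)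
  deriv_F := fun x => ((e.deriv_F x).const_mul c).congr_deriv (by ring)

theorem IsEig.hasDerivAt_mul_conj (e : IsEig h g z t u F) (x : ℝ) :
    HasDerivAt (fun x => u x * conj (F x))
      (I / h * (F x * conj (F x) - t * (u x * conj (u x)))) x := by
  have h1 : HasDerivAt (fun x => conj (F x))
      (conj (I / h * (t * u x - (conj (g x) - conj z) * F x))) x :=
    conjCLE.toContinuousLinearMap.hasFDerivAt.comp_hasDerivAt x (e.deriv_F x)
  refine ((e.deriv_u x).mul h1).congr_deriv ?_
  simp only [map_mul, map_div₀, map_sub, conj_I, conj_ofReal, conj_conj]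
  ring

theorem IsEig.scalar_F (hh : 0 < h) (e : IsEig h g z t u F) : scalar F F = t * scalar u u := by
  have hh' : (h : ℂ) ≠ 0 := ofReal_ne_zero.2 hh.ne'
  have huc := e.continuous_u
  have hFc := e.continuous_F
  have huc' : Continuous fun x => conj (u x) := continuous_conj.comp huc
  have hFc' : Continuous fun x => conj (F x) := continuous_conj.comp hFc
  have h1 := integral_eq_sub_of_hasDerivAt (a := 0) (b := 2 * π)
    (fun x _ => e.hasDerivAt_mul_conj x) (Continuous.intervalIntegrable (by fun_prop) _ _)
  have e1 := e.per_u 0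
  have e2 := e.per_F 0
  rw [zero_add] at e1 e2
  rw [e1, e2, sub_self, integral_const_mul, integral_sub
    (Continuous.intervalIntegrable (by fun_prop) _ _)
    (Continuous.intervalIntegrable (by fun_prop) _ _), integral_const_mul] at h1
  have hI : I / h ≠ 0 := div_ne_zero I_ne_zero hh'
  exact sub_eq_zero.1 ((mul_eq_zero.1 h1).resolve_left hI)

theorem scalar_self (u : ℝ → ℂ) : scalar u u = ((∫ x in 0..(2 * π), ‖u x‖^2 : ℝ) : ℂ) := by
  rw [scalar, ← intervalIntegral.integral_ofReal]
  congr 1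
  funext x
  rw [mul_conj, normSq_eq_norm_sq]

theorem scalar_const_mul (c : ℂ) (u v : ℝ → ℂ) :
    scalar (fun x => c * u x) (fun x => c * v x) = c * conj c * scalar u v := by
  simp only [scalar]
  rw [← integral_const_mul]
  congr 1
  funext x
  simp only [map_mul]; ring

theorem scalar_self_ne_zero {u : ℝ → ℂ} (hc : Continuous u)
    (hp : Periodic u (2 * π)) {x : ℝ} (hx : u x ≠ 0) :
    0 < ∫ x in 0..(2 * π), ‖u x‖^2 := by
  have hper : Periodic (fun x => ‖u x‖^2) (2 * π) := fun x => by simp only [hp x]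
  have := hper.intervalIntegral_add_eq 0 x
  rw [zero_add] at this
  rw [this]
  refine integral_pos (by linarith [two_pi_pos]) (by fun_prop)
    (fun y _ => by positivity) ⟨x, ⟨le_rfl, by linarith [two_pi_pos]⟩, ?_⟩
  have := norm_pos_iff.2 hx
  positivity

/-! ### The gauge transformation -/

/-- The system on a period starting at `x0`. -/
def sysOf (h : ℝ) (hh : 0 < h) (g : ℝ → ℂ) (hg : Continuous g) (x0 : ℝ) : Sys where
  L := 2 * π
  h := h
  G := ⟨fun x => (g (x0 + x)).im, by fun_prop⟩
  hL := two_pi_pos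
  hh := hh

/-- The phase of the gauge transformation. -/
def gauge (h : ℝ) (g : ℝ → ℂ) (z : ℂ) (x0 x : ℝ) : ℝ := ∫ s in 0..x, h⁻¹ * ((g (x0 + s)).re - z.re)

theorem hasDerivAt_gauge {h : ℝ} {g : ℝ → ℂ} (hg : Continuous g) (z : ℂ) (x0 x : ℝ) :
    HasDerivAt (gauge h g z x0) (h⁻¹ * ((g (x0 + x)).re - z.re)) x := by
  have hc : Continuous fun s => h⁻¹ * ((g (x0 + s)).re - z.re) := by fun_prop
  exact (hc.integral_hasStrictDerivAt _ _).hasDerivAt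

theorem gauge_zero (h : ℝ) (g : ℝ → ℂ) (z : ℂ) (x0 : ℝ) : gauge h g z x0 0 = 0 := by simp [gauge]

/-- A periodic extension of a function with matching end values is differentiable. -/
theorem hasDerivAt_of_periodic_of_eqOn {e e' f f' : ℝ → ℂ} {T : ℝ} (hT : 0 < T)
    (he : Periodic e T) (he' : Periodic e' T)
    (hef : ∀ y ∈ Ico 0 T, e y = f y) (hef' : ∀ y ∈ Ico 0 T, e' y = f' y)
    (hd : ∀ x ∈ Icc 0 T, HasDerivWithinAt f (f' x) (Icc 0 T) x) (h0 : f T = f 0)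
    (h1 : f' T = f' 0) (x : ℝ) : HasDerivAt e (e' x) x := by
  suffices H : ∀ x ∈ Ico 0 T, HasDerivAt e (f' x) x by
    obtain ⟨n, hn⟩ : ∃ n : ℤ, x - n • T ∈ Ico 0 T := by
      refine ⟨toIcoDiv hT 0 x, ?_⟩
      simpa using sub_toIcoDiv_zsmul_mem_Ico hT 0 x
    have h2 := H _ hn
    rw [← hef' _ hn, he'.sub_zsmul_eq n] at h2
    have h3 : (fun s => e (s - n • T)) = e := funext fun s => he.sub_zsmul_eq n
    rw [← h3]
    exact h2.comp_sub_const x _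
  intro x hx
  have hz : (0 : ℝ) ∈ Ico 0 T := ⟨le_rfl, hT⟩
  rcases hx.1.eq_or_lt with rfl | hx0
  · have hr : HasDerivWithinAt e (f' 0) (Ici 0) 0 := by
      have h2 := (hd 0 ⟨le_rfl, hT.le⟩).mono_of_mem_nhdsWithin (s := Ici 0) (Icc_mem_nhdsGE hT)
      refine h2.congr_of_eventuallyEq ?_ (hef 0 hz)
      filter_upwards [Ico_mem_nhdsGE hT] with y hy using hef y hy
    have hl : HasDerivWithinAt e (f' 0) (Iic 0) 0 := by
      have h2 := (hd T ⟨hT.le, le_rfl⟩).mono_of_mem_nhdsWithin (s := Iic T) (Icc_mem_nhdsLE hT)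
      have h3 : HasDerivWithinAt (fun x => f (x + T)) (f' T) (Iic 0) 0 := by
        have h4 : HasDerivWithinAt f (f' T) (Iic T) (0 + T) := by rwa [zero_add]
        have := HasDerivWithinAt.scomp (g₁ := f) (0 : ℝ) h4
          ((hasDerivAt_id (0 : ℝ)).add_const T).hasDerivWithinAt
          (s := Iic 0) (fun y (hy : y ≤ 0) => by simpa using hy)
        rw [one_smul] at this
        exact this
      rw [h1] at h3
      have hm : ∀ y ∈ Ioc (-T) 0, e y = f (y + T) := by
        intro y hy
        rcases hy.2.eq_or_lt with rfl | hy0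
        · rw [zero_add, h0, hef 0 hz]
        · rw [← he y, hef _ ⟨by linarith [hy.1], by linarith⟩]
      refine h3.congr_of_eventuallyEq ?_ (hm 0 ⟨by linarith, le_rfl⟩)
      filter_upwards [Ioc_mem_nhdsLE (neg_lt_zero.2 hT)] with y hy using hm y hy
    have := hr.union hl
    rwa [Set.union_comm, Set.Iic_union_Ici, hasDerivWithinAt_univ] at this
  · have h2 := (hd x ⟨hx0.le, hx.2.le⟩).hasDerivAt (Icc_mem_nhds hx0 hx.2)
    refine h2.congr_of_eventuallyEq ?_
    filter_upwards [Ico_mem_nhds hx0 hx.2] with y hy using hef y hy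

variable {h : ℝ} {g : ℝ → ℂ} {z : ℂ} {t : ℝ} {u F : ℝ → ℂ}

variable (hh : 0 < h) (hg : Continuous g) (x0 : ℝ)

local notation "§" => sysOf h hh g hg x0

/-- The first component in the gauge of the system. -/
def gaugeP (u : ℝ → ℂ) (z : ℂ) (x : ℝ) : ℂ :=
  cexp (-((h : ℂ)⁻¹ * §.phase z.im x) + I * gauge h g z x0 x) * u (x0 + x)

/-- The second component in the gauge of the system. -/
def gaugeQ (F : ℝ → ℂ) (z : ℂ) (x : ℝ) : ℂ :=
  cexp ((h : ℂ)⁻¹ * §.phase z.im x + I * gauge h g z x0 x) * (I * F (x0 + x))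

theorem hasDerivAt_gaugeP (e : IsEig h g z t u F) (x : ℝ) :
    HasDerivAt (gaugeP hh hg x0 u z) ((h : ℂ)⁻¹ * (§.bef z.im x * gaugeQ hh hg x0 F z x)) x := by
  have hh' : (h : ℂ) ≠ 0 := ofReal_ne_zero.2 hh.ne'
  have h1 := (((§.hasDerivAt_phase z.im x).const_mul (h : ℂ)⁻¹).neg.add
    ((hasDerivAt_gauge (h := h) hg z x0 x).ofReal_comp.const_mul I)).cexp.mul
    ((e.deriv_u (x0 + x)).comp_const_add x0 x)
  refine h1.congr_deriv ?_
  have h2 : §.bef z.im x * cexp ((h : ℂ)⁻¹ * §.phase z.im x + I * gauge h g z x0 x) =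
      cexp (-((h : ℂ)⁻¹ * §.phase z.im x) + I * gauge h g z x0 x) := by
    rw [Sys.bef, ← cexp_add]
    congr 1
    change -(2 / (h : ℂ) * _) + _ = _
    ring
  rw [gaugeQ, ← mul_assoc (§.bef _ _), h2]
  simp only [Pi.add_apply, Pi.neg_apply]
  have h3 : (g (x0 + x) - z) = (((g (x0 + x)).re - z.re : ℝ) : ℂ) +
      I * (((g (x0 + x)).im : ℂ) - z.im) := by
    apply Complex.ext <;> simp
  rw [h3]
  change _ * (-((h : ℂ)⁻¹ * ((((g (x0 + x)).im : ℝ) : ℂ) - z.im)) + _) * _ + _ = _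
  push_cast
  linear_combination (-(cexp (-((h : ℂ)⁻¹ * §.phase z.im x) +
        I * gauge h g z x0 x)) * (h : ℂ)⁻¹ * ((((g (x0 + x)).im : ℝ) : ℂ) - z.im) *
        u (x0 + x)) * I_sq

theorem hasDerivAt_gaugeQ (e : IsEig h g z t u F) (x : ℝ) :
    HasDerivAt (gaugeQ hh hg x0 F z) (-((h : ℂ)⁻¹ * (§.alf z.im x *
      (t * gaugeP hh hg x0 u z x)))) x := by
  have hh' : (h : ℂ) ≠ 0 := ofReal_ne_zero.2 hh.ne'
  have h1 := (((§.hasDerivAt_phase z.im x).const_mul (h : ℂ)⁻¹).add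
    ((hasDerivAt_gauge (h := h) hg z x0 x).ofReal_comp.const_mul I)).cexp.mul
    (((e.deriv_F (x0 + x)).comp_const_add x0 x).const_mul I)
  refine h1.congr_deriv ?_
  have h2 : §.alf z.im x * cexp (-((h : ℂ)⁻¹ * §.phase z.im x) + I * gauge h g z x0 x) =
      cexp ((h : ℂ)⁻¹ * §.phase z.im x + I * gauge h g z x0 x) := by
    rw [Sys.alf, ← cexp_add]
    congr 1
    change (2 / (h : ℂ) * _) + _ = _
    ring
  have h4 : §.alf z.im x * (t * gaugeP hh hg x0 u z x) = cexp ((h : ℂ)⁻¹ * §.phase z.im x +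
        I * gauge h g z x0 x) * (t * u (x0 + x)) := by
    rw [gaugeP, ← h2]; ring
  rw [h4]
  simp only [Pi.add_apply]
  have h3 : (conj (g (x0 + x)) - conj z) = (((g (x0 + x)).re - z.re : ℝ) : ℂ) -
      I * (((g (x0 + x)).im : ℂ) - z.im) := by
    apply Complex.ext <;> simp
    ring
  rw [h3]
  change _ * (((h : ℂ)⁻¹ * ((((g (x0 + x)).im : ℝ) : ℂ) - z.im)) + _) * _ + _ = _
  push_cast
  linear_combination (cexp (((h : ℂ)⁻¹ * §.phase z.im x) +
        I * gauge h g z x0 x) * (h : ℂ)⁻¹ * (t * u (x0 + x) + I *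
        (((((g (x0 + x)).im : ℝ) : ℂ) - z.im) * F (x0 + x)))) * I_sq

/-- The Floquet multiplier of periodic functions. -/
def multiplier (h : ℝ) (g : ℝ → ℂ) (z : ℂ) (x0 : ℝ) : ℂ := cexp (I * gauge h g z x0 (2 * π))

theorem multiplier_ne_zero (h : ℝ) (g : ℝ → ℂ) (z : ℂ) (x0 : ℝ) : multiplier h g z x0 ≠ 0 :=
  cexp_ne_zero _

theorem multiplier_mul_conj (h : ℝ) (g : ℝ → ℂ) (z : ℂ) (x0 : ℝ) :
    multiplier h g z x0 * conj (multiplier h g z x0) = 1 := by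
  rw [multiplier, ← exp_conj, ← cexp_add]; simp

theorem multiplier_add_inv (h : ℝ) (g : ℝ → ℂ) (z : ℂ) (x0 : ℝ) :
    multiplier h g z x0 + (multiplier h g z x0)⁻¹ = 2 * Complex.cos (gauge h g z x0 (2 * π)) := by
  rw [multiplier, ← Complex.exp_neg, Complex.two_cos, mul_comm I, neg_mul]

theorem gaugeP_zero : gaugeP hh hg x0 u z 0 = u x0 := by simp [gaugeP, gauge_zero, Sys.phase_zero]

theorem gaugeQ_zero : gaugeQ hh hg x0 F z 0 = I * F x0 := by
  simp [gaugeQ, gauge_zero, Sys.phase_zero]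

theorem gaugeP_L (hu : Periodic u (2 * π)) : §.EE z.im * gaugeP hh hg x0 u z (2 * π) =
      multiplier h g z x0 * gaugeP hh hg x0 u z 0 := by
  rw [gaugeP_zero, gaugeP, hu x0, Sys.EE, multiplier, ← mul_assoc, ← cexp_add]
  congr 2
  change (h : ℂ)⁻¹ * §.phase z.im (2 * π) + _ = _
  ring

theorem gaugeQ_L (hF : Periodic F (2 * π)) : gaugeQ hh hg x0 F z (2 * π) * (§.EE z.im)⁻¹ =
      multiplier h g z x0 * gaugeQ hh hg x0 F z 0 := by
  rw [gaugeQ_zero, gaugeQ, hF x0, Sys.EE, multiplier, ← Complex.exp_neg, mul_right_comm, ← cexp_add]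
  congr 2
  change _ + -((h : ℂ)⁻¹ * §.phase z.im (2 * π)) = _
  ring

theorem IsEig.isFloquet (e : IsEig h g z t u F) (ht : t ≠ 0) :
    §.IsFloquet (t, z.im) (multiplier h g z x0) (gaugeP hh hg x0 u z)
      (fun x => (t : ℂ)⁻¹ * gaugeQ hh hg x0 F z x) := by
  have ht' : (t : ℂ) ≠ 0 := ofReal_ne_zero.2 ht
  refine ⟨fun x _ => ⟨?_, ?_⟩, gaugeP_L hh hg x0 e.per_u, ?_⟩
  · refine (hasDerivAt_gaugeP hh hg x0 e x).hasDerivWithinAt.congr_deriv ?_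
    change _ = (h : ℂ)⁻¹ * (t * _ * _)
    field_simp
  · refine ((hasDerivAt_gaugeQ hh hg x0 e x).const_mul _).hasDerivWithinAt.congr_deriv ?_
    change _ = -((h : ℂ)⁻¹ * _)
    field_simp
  · have := gaugeQ_L hh hg x0 (z := z) e.per_F
    change (t : ℂ)⁻¹ * gaugeQ hh hg x0 F z (2 * π) * _ = _
    rw [mul_assoc, this]; ring

theorem gaugeP_mul_conj (x : ℝ) : §.alf z.im x *
    (gaugeP hh hg x0 u z x * conj (gaugeP hh hg x0 u z x)) = u (x0 + x) * conj (u (x0 + x)) := by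
  rw [gaugeP, map_mul, ← exp_conj, Sys.alf]
  simp only [map_add, map_neg, map_mul, map_inv₀, conj_ofReal, conj_I,
    Sys.conj_phase _ (conj_ofReal _)]
  rw [mul_mul_mul_comm, ← mul_assoc, ← cexp_add, ← cexp_add]
  convert one_mul _
  rw [Complex.exp_eq_one_iff]
  refine ⟨0, ?_⟩
  change (2 / (h : ℂ) * _) + _ = _
  push_cast
  ring

theorem gaugeQ_mul_conj (x : ℝ) : §.bef z.im x *
    (gaugeQ hh hg x0 F z x * conj (gaugeQ hh hg x0 F z x)) = F (x0 + x) * conj (F (x0 + x)) := by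
  rw [gaugeQ, map_mul, ← exp_conj, Sys.bef]
  simp only [map_add, map_mul, map_inv₀, conj_ofReal, conj_I, Sys.conj_phase _ (conj_ofReal _)]
  rw [mul_mul_mul_comm, ← mul_assoc, ← cexp_add, ← cexp_add]
  have : I * F (x0 + x) * (-I * conj (F (x0 + x))) = F (x0 + x) * conj (F (x0 + x)) := by
    linear_combination (-(F (x0 + x) * conj (F (x0 + x)))) * I_sq
  rw [this]
  convert one_mul _
  rw [Complex.exp_eq_one_iff]
  refine ⟨0, ?_⟩
  change -(2 / (h : ℂ) * _) + _ = _
  push_cast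
  ring

theorem IsEig.eq_zero (e : IsEig h g z t u F) (hE : §.EE z.im ≠ 1)
    (hu : scalar u u ≠ 0) (hE0 : 0 < (§.EE z.im).re) : t ≠ 0 := by
  rintro rfl
  have hFc := e.continuous_F
  have h0 : ∀ x, F x = 0 := by
    intro x
    by_contra hx
    have h1 := scalar_self_ne_zero hFc e.per_F hx
    have h2 := e.scalar_F hh
    rw [scalar_self F, ofReal_zero, zero_mul, Complex.ofReal_eq_zero] at h2
    exact h1.ne' h2
  have hP : ∀ x, HasDerivAt (gaugeP hh hg x0 u z) 0 x := fun x =>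
    (hasDerivAt_gaugeP hh hg x0 e x).congr_deriv (by simp [gaugeQ, h0])
  have hconst : ∀ x, gaugeP hh hg x0 u z x = gaugeP hh hg x0 u z 0 := fun x =>
    is_const_of_deriv_eq_zero (fun x => (hP x).differentiableAt) (fun x => (hP x).deriv) x 0
  have h1 := gaugeP_L hh hg x0 (z := z) e.per_u
  rw [hconst, gaugeP_zero] at h1
  have hux : u x0 = 0 := by
    by_contra hux
    have h2 := mul_right_cancel₀ hux h1
    have h3 := congrArg norm h2
    have h4 : ‖multiplier h g z x0‖ = 1 := by
      rw [multiplier, mul_comm, Complex.norm_exp_ofReal_mul_I]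
    rw [h4] at h3
    have h5 := Sys.conj_EE § (conj_ofReal z.im)
    obtain ⟨r, hr⟩ := Complex.conj_eq_iff_real.1 h5
    rw [hr, norm_real, norm_eq_abs] at h3
    rw [hr, ofReal_re] at hE0
    rw [abs_of_pos hE0] at h3
    rw [hr, h3] at hE
    exact hE ofReal_one
  apply hu
  have h2 : ∀ x, u x = 0 := by
    intro x
    have h3 := hconst (x - x0)
    rw [gaugeP_zero, hux, gaugeP, add_sub_cancel] at h3
    exact (mul_eq_zero.1 h3).resolve_left (cexp_ne_zero _)
  simp [scalar, h2]

theorem eq_of_periodic_of_eqOn {f1 f2 : ℝ → ℂ} {T x0 : ℝ} (hT : 0 < T)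
    (h₁ : Periodic f1 T) (h₂ : Periodic f2 T)
    (h : ∀ x ∈ Icc 0 T, f1 (x0 + x) = f2 (x0 + x)) (x : ℝ) : f1 x = f2 x := by
  have hn := sub_toIcoDiv_zsmul_mem_Ico hT x0 x
  rw [← h₁.sub_zsmul_eq (toIcoDiv hT x0 x), ← h₂.sub_zsmul_eq (toIcoDiv hT x0 x)]
  have := h (x - toIcoDiv hT x0 x • T - x0) ⟨by linarith [hn.1], by linarith [hn.2]⟩
  rwa [add_sub_cancel] at this

theorem scalar_eq_shift {u v : ℝ → ℂ} (hu : Periodic u (2 * π)) (hv : Periodic v (2 * π)) (x0 : ℝ) :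
    scalar u v = ∫ x in 0..(2 * π), u (x0 + x) * conj (v (x0 + x)) := by
  have hp : Periodic (fun x => u x * conj (v x)) (2 * π) := fun x => by simp only [hu x, hv x]
  have h1 := hp.intervalIntegral_add_eq 0 x0
  rw [zero_add] at h1
  rw [scalar, h1]
  have := integral_comp_add_left (a := 0) (b := 2 * π) (fun x => u x * conj (v x)) x0
  rw [add_zero] at this
  exact this.symm

namespace Sys

variable (D : Sys)

/-- The mean over the interval, up to a constant factor. -/
def tot : D.X →L[ℂ] ℂ := (D.ev (D.pt D.L)).comp D.prim

theorem tot_apply (v : D.X) : D.tot v = (D.h : ℂ)⁻¹ * ∫ s in 0..D.L, v (D.pt s) := by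
  change D.prim v (D.pt D.L) = _
  rw [prim_apply, D.pt_val D.mem_L]

/-- The difference of the means of `v` with respect to the two densities. -/
def ww (v : D.X) (p : ℂ × ℂ) : ℂ :=
  D.tot (v * D.nn p) / D.tot (D.nn p) - D.tot (v * D.mm p) / D.tot (D.mm p)

theorem EE_eq_ofReal (y : ℝ) : D.EE y = (exp (D.h⁻¹ * ((∫ s in 0..D.L, D.G s) - y * D.L)) : ℝ) := by
  rw [EE, phase]; push_cast; rfl

end Sys

theorem IsEig.ne_zero (hh : 0 < h) (hg : Continuous g) (x0 : ℝ) (e : IsEig h g z t u F) (ht : t ≠ 0) (hu : scalar u u ≠ 0) :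
    u x0 ≠ 0 ∨ F x0 ≠ 0 := by
  by_contra! hc
  apply hu
  have hf := e.isFloquet hh hg x0 ht
  have h1 : ∀ x ∈ Icc 0 (2 * π), u (x0 + x) = (fun _ => (0 : ℂ)) (x0 + x) := by
    intro x hx
    have h2 := hf.sol.eq_fst hx
    rw [gaugeP_zero, gaugeQ_zero, hc.1, hc.2, mul_zero, mul_zero, mul_zero, mul_zero, add_zero,
      gaugeP] at h2
    exact (mul_eq_zero.1 h2).resolve_left (cexp_ne_zero _)
  have h3 := eq_of_periodic_of_eqOn (f2 := fun _ => 0) two_pi_pos e.per_u (fun _ => rfl) h1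
  simp [scalar, h3]

theorem IsEig.nonneg (hh : 0 < h) (e : IsEig h g z t u F) (hu : scalar u u = 1) : 0 ≤ t := by
  have h1 := e.scalar_F hh
  rw [hu, mul_one, scalar_self] at h1
  rw [← Complex.ofReal_inj.1 h1]
  exact integral_nonneg two_pi_pos.le fun x _ => by positivity

theorem IsEig.tr_eq (e : IsEig h g z t u F) (ht : t ≠ 0) (hu : scalar u u ≠ 0) :
    §.tr (t, z.im) = 2 * Complex.cos (gauge h g z x0 (2 * π)) := by
  have hf := e.isFloquet hh hg x0 ht
  rw [hf.tr_eq ?_ (multiplier_ne_zero _ _ _ _), multiplier_add_inv]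
  rw [gaugeP_zero, gaugeQ_zero]
  rcases e.ne_zero hh hg x0 ht hu with h1 | h1
  · exact Or.inl h1
  · exact Or.inr (mul_ne_zero (inv_ne_zero (ofReal_ne_zero.2 ht)) (mul_ne_zero I_ne_zero h1))

/-- A root of the characteristic equation is an eigenvalue. -/
theorem exists_isEig (hp : Periodic g (2 * π)) (ht : t ≠ 0)
    (hroot : §.tr (t, z.im) = 2 * Complex.cos (gauge h g z x0 (2 * π))) :
    ∃ u F, IsEig h g z t u F ∧ scalar u u = 1 := by
  set D := § with hD
  have hh' : (h : ℂ) ≠ 0 := ofReal_ne_zero.2 hh.ne'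
  have ht' : (t : ℂ) ≠ 0 := ofReal_ne_zero.2 ht
  rw [← multiplier_add_inv] at hroot
  obtain ⟨P, Q, hf, h0⟩ := Sys.exists_isFloquet (multiplier_ne_zero _ _ _ _) hroot
  let f1 : ℝ → ℂ := fun x => cexp ((h : ℂ)⁻¹ * D.phase z.im x - I * gauge h g z x0 x) * P x
  let f2 : ℝ → ℂ := fun x => cexp (-((h : ℂ)⁻¹ * D.phase z.im x) -
    I * gauge h g z x0 x) * (-I * t * Q x)
  have hgz : ∀ x, g (x0 + x) - z = (((g (x0 + x)).re - z.re : ℝ) : ℂ) +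
      I * (((g (x0 + x)).im : ℂ) - z.im) := by
    intro x; apply Complex.ext <;> simp
  have hgz' : ∀ x, (conj (g (x0 + x)) - conj z) = (((g (x0 + x)).re - z.re : ℝ) : ℂ) -
      I * (((g (x0 + x)).im : ℂ) - z.im) := by
    intro x
    apply Complex.ext <;> simp
    ring
  have d1 : ∀ x ∈ Icc 0 (2 * π), HasDerivWithinAt f1
      (I / h * (f2 x - (g (x0 + x) - z) * f1 x)) (Icc 0 (2 * π)) x := by
    intro x hx
    have h1 := ((((D.hasDerivAt_phase z.im x).const_mul (h : ℂ)⁻¹).sub ((hasDerivAt_gauge (h := h)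
      hg z x0 x).ofReal_comp.const_mul I)).cexp.hasDerivWithinAt).mul (hf.sol x hx).1
    refine h1.congr_deriv ?_
    have h2 : cexp ((h : ℂ)⁻¹ * D.phase z.im x - I * gauge h g z x0 x) *
        D.bef z.im x = cexp (-((h : ℂ)⁻¹ * D.phase z.im x) -
        I * gauge h g z x0 x) := by
      rw [Sys.bef, ← cexp_add]
      congr 1
      change _ + -(2 / (h : ℂ) * _) = _
      ring
    simp only [f1, f2, hgz, ← h2]
    simp only [Pi.sub_apply]
    change _ * (((h : ℂ)⁻¹ * ((((g (x0 + x)).im : ℝ) : ℂ) - z.im)) - _) * _ +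
      _ * ((h : ℂ)⁻¹ * (t * _ * _)) = _
    push_cast
    linear_combination (cexp ((h : ℂ)⁻¹ * D.phase z.im x - I * gauge h g z x0 x) *
      (h : ℂ)⁻¹ * (D.bef z.im x * t * Q x + (((g (x0 + x)).im : ℂ) - z.im) * P x)) * I_sq
  have d2 : ∀ x ∈ Icc 0 (2 * π), HasDerivWithinAt f2
      (I / h * (t * f1 x - (conj (g (x0 + x)) - conj z) * f2 x))
      (Icc 0 (2 * π)) x := by
    intro x hx
    have h1 := ((((D.hasDerivAt_phase z.im x).const_mul (h : ℂ)⁻¹).neg.sub ((hasDerivAt_gauge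
      (h := h) hg z x0 x).ofReal_comp.const_mul I)).cexp.hasDerivWithinAt).mul
      ((hf.sol x hx).2.const_mul (-I * t))
    refine h1.congr_deriv ?_
    have h2 : cexp (-((h : ℂ)⁻¹ * D.phase z.im x) - I * gauge h g z x0 x) *
        D.alf z.im x = cexp ((h : ℂ)⁻¹ * D.phase z.im x -
        I * gauge h g z x0 x) := by
      rw [Sys.alf, ← cexp_add]
      congr 1
      change _ + (2 / (h : ℂ) * _) = _
      ring
    simp only [f1, f2, hgz', ← h2]
    simp only [Pi.sub_apply, Pi.neg_apply]
    change _ * (-((h : ℂ)⁻¹ * ((((g (x0 + x)).im : ℝ) : ℂ) - z.im)) - _) * _ +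
      _ * (-I * t * -((h : ℂ)⁻¹ * _)) = _
    push_cast
    linear_combination (cexp (-((h : ℂ)⁻¹ * D.phase z.im x) - I *
      gauge h g z x0 x) * (h : ℂ)⁻¹ * t * I * Q x *
      (((g (x0 + x)).im : ℂ) - z.im)) * I_sq
  have e1 : f1 (2 * π) = f1 0 := by
    have h1 := hf.fst
    simp only [f1, Sys.phase_zero, gauge_zero]
    rw [Complex.exp_sub]
    change D.EE z.im / multiplier h g z x0 * P D.L = _
    rw [div_mul_eq_mul_div, h1, mul_div_cancel_left₀ _ (multiplier_ne_zero _ _ _ _)]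
    simp
  have e2 : f2 (2 * π) = f2 0 := by
    have h1 := hf.snd
    simp only [f2, Sys.phase_zero, gauge_zero]
    rw [Complex.exp_sub, Complex.exp_neg]
    change (D.EE z.im)⁻¹ / multiplier h g z x0 * (-I * t * Q D.L) = _
    have : (D.EE z.im)⁻¹ / multiplier h g z x0 * (-I * t * Q D.L) =
      -I * t * ((Q D.L * (D.EE z.im)⁻¹) / multiplier h g z x0) := by ring
    rw [this, h1, mul_div_cancel_left₀ _ (multiplier_ne_zero _ _ _ _)]
    simp
  let m : ℝ → ℝ := fun x => toIcoMod two_pi_pos 0 x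
  have hm : Periodic m (2 * π) := fun x => toIcoMod_add_right _ _ _
  have hm1 : ∀ y ∈ Ico 0 (2 * π), m y = y := fun y hy =>
    (toIcoMod_eq_self two_pi_pos).2 (by simpa using hy)
  have hmg : ∀ x, g (x0 + m x) = g (x0 + x) := by
    intro x
    have : x0 + m x = x0 + x - toIcoDiv two_pi_pos 0 x • (2 * π) := by simp only [m, toIcoMod]; ring
    rw [this, hp.sub_zsmul_eq]
  have hg0 : g (x0 + 2 * π) = g (x0 + 0) := by rw [hp, add_zero]
  have D1 := hasDerivAt_of_periodic_of_eqOn (e := fun x => f1 (m x)) (e' := fun x =>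
    I / h * (f2 (m x) - (g (x0 + m x) - z) * f1 (m x))) two_pi_pos
    (fun x => by simp only [hm x]) (fun x => by simp only [hm x])
    (fun y hy => by simp only [hm1 y hy]) (fun y hy => by simp only [hm1 y hy])
    d1 e1 (by simp only [e1, e2, hg0])
  have D2 := hasDerivAt_of_periodic_of_eqOn (e := fun x => f2 (m x)) (e' := fun x =>
    I / h * (t * f1 (m x) - (conj (g (x0 + m x)) - conj z) * f2 (m x))) two_pi_pos
    (fun x => by simp only [hm x]) (fun x => by simp only [hm x])
    (fun y hy => by simp only [hm1 y hy]) (fun y hy => by simp only [hm1 y hy])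
    d2 e2 (by simp only [e1, e2, hg0])
  have he : IsEig h g z t (fun x => f1 (m (x - x0))) (fun x => f2 (m (x - x0))) := by
    refine ⟨fun x => ?_, fun x => ?_, fun x => ?_, fun x => ?_⟩
    · simp only [add_sub_right_comm, hm _]
    · simp only [add_sub_right_comm, hm _]
    · have := (D1 (x - x0)).comp_sub_const x x0
      simpa only [hmg, add_sub_cancel] using this
    · have := (D2 (x - x0)).comp_sub_const x x0
      simpa only [hmg, add_sub_cancel] using this
  obtain ⟨x, hx⟩ : ∃ x, f1 (m (x - x0)) ≠ 0 := by
    by_contra! hc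
    have hF : ∀ x, f2 (m (x - x0)) = 0 := by
      intro x
      have h1 := he.deriv_u x
      rw [funext hc] at h1
      have h2 := h1.unique (hasDerivAt_const x (0 : ℂ))
      simp only [hc, mul_zero, sub_zero] at h2
      exact (mul_eq_zero.1 h2).resolve_left (div_ne_zero I_ne_zero hh')
    have a1 := hc x0
    have a2 := hF x0
    rw [sub_self, hm1 0 ⟨le_rfl, two_pi_pos⟩] at a1 a2
    rcases h0 with h0 | h0
    · exact mul_ne_zero (cexp_ne_zero _) h0 a1
    · exact mul_ne_zero (cexp_ne_zero _)
        (mul_ne_zero (mul_ne_zero (neg_ne_zero.2 I_ne_zero) ht') h0) a2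
  have hpos := scalar_self_ne_zero he.continuous_u he.per_u hx
  set I0 := ∫ x in 0..(2 * π), ‖f1 (m (x - x0))‖^2
  refine ⟨_, _, he.const_mul ((√I0 : ℝ) : ℂ)⁻¹, ?_⟩
  rw [scalar_const_mul, scalar_self, map_inv₀, conj_ofReal, ← mul_inv,
    ← ofReal_mul, mul_self_sqrt hpos.le]
  exact inv_mul_cancel₀ (ofReal_ne_zero.2 hpos.ne')

theorem EE_sysOf_conj (hg' : Continuous fun x => conj (g x)) :
    (sysOf h hh (fun x => conj (g x)) hg' x0).EE (conj z).im = (§.EE z.im)⁻¹ := by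
  rw [Sys.EE, Sys.EE, ← Complex.exp_neg]
  congr 1
  change (h : ℂ)⁻¹ * (((∫ s in 0..(2 * π), (conj (g (x0 + s))).im : ℝ) : ℂ) -
    ((conj z).im : ℂ) * _) = -((h : ℂ)⁻¹ * (((∫ s in 0..(2 * π),
      (g (x0 + s)).im : ℝ) : ℂ) - (z.im : ℂ) * _))
  simp only [conj_im, integral_neg]
  push_cast
  change (h : ℂ)⁻¹ * (_ - -(z.im : ℂ) * ((2 * π : ℝ) : ℂ)) =
    -((h : ℂ)⁻¹ * (_ - (z.im : ℂ) * ((2 * π : ℝ) : ℂ)))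
  ring

theorem scalar_commutator (hh : 0 < h) (e : IsEig h g z t u F) {χ : ℝ → ℂ}
    (hχ : ContDiff ℝ ∞ χ) (hχp : Periodic χ (2 * π)) :
    scalar (commutator h g χ u) F =
      -∫ x in 0..(2 * π), χ x * (F x * conj (F x) - t * (u x * conj (u x))) := by
  have hh' : (h : ℂ) ≠ 0 := ofReal_ne_zero.2 hh.ne'
  have hχd : Differentiable ℝ χ := hχ.differentiable (by simp)
  have hχc : Continuous (deriv χ) := hχ.continuous_deriv (by simp)
  have hχ0 := hχ.continuous
  have huc := e.continuous_u
  have hFc := e.continuous_F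
  have huc' : Continuous fun x => conj (u x) := continuous_conj.comp huc
  have hFc' : Continuous fun x => conj (F x) := continuous_conj.comp hFc
  have hcomm : ∀ x, commutator h g χ u x = h / I * (deriv χ x * u x) := by
    intro x
    have h1 : deriv (fun y => χ y * u y) x = deriv χ x * u x + χ x * deriv u x :=
      ((hχd x).hasDerivAt.mul (e.deriv_u x).differentiableAt.hasDerivAt).deriv
    simp only [commutator, P, h1]
    ring
  have h1 : ∀ x, HasDerivAt (fun x => χ x * (u x * conj (F x)))
      (deriv χ x * (u x * conj (F x)) + χ x * (I / h *
        (F x * conj (F x) - t * (u x * conj (u x))))) x := fun x =>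
    (hχd x).hasDerivAt.mul (e.hasDerivAt_mul_conj x)
  have h2 := integral_eq_sub_of_hasDerivAt (a := 0) (b := 2 * π)
    (fun x _ => h1 x) (Continuous.intervalIntegrable (by fun_prop) _ _)
  have e1 := e.per_u 0
  have e2 := e.per_F 0
  have e3 := hχp 0
  rw [zero_add] at e1 e2 e3
  rw [e1, e2, e3, sub_self, integral_add (Continuous.intervalIntegrable (by fun_prop) _ _)
    (Continuous.intervalIntegrable (by fun_prop) _ _)] at h2
  have h3 : ∫ x in 0..(2 * π), χ x * (I / h * (F x * conj (F x) - t * (u x * conj (u x)))) = I / h *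
      ∫ x in 0..(2 * π), χ x * (F x * conj (F x) - t * (u x * conj (u x))) := by
    rw [← integral_const_mul]
    congr 1; funext x; ring
  rw [h3] at h2
  have h4 : scalar (commutator h g χ u) F =
      h / I * ∫ x in 0..(2 * π), deriv χ x * (u x * conj (F x)) := by
    rw [scalar, ← integral_const_mul]
    congr 1; funext x; rw [hcomm]; ring
  rw [h4, eq_neg_of_add_eq_zero_left h2]
  have hI := I_ne_zero
  field_simp

/-- A ground state formula: the modulus of the matrix element of the commutator is determined by
the monodromy. -/
theorem norm_scalar_commutator (hgs : ContDiff ℝ ∞ g) (hp : Periodic g (2 * π)) {l : ℝ} (hl : 0 < l)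
    (hroot : §.tr (l, z.im) = 2 * Complex.cos (gauge h g z x0 (2 * π)))
    (huniq : ∀ t : ℝ, 0 < t → t ≤ l → §.tr (t, z.im) =
      2 * Complex.cos (gauge h g z x0 (2 * π)) → t = l)
    (hn : ∃ x, §.nn (l, z.im) x ≠ 0)
    (hE : §.EE z.im ≠ 1)
    {χ : ℝ → ℂ} (hχ : ContDiff ℝ ∞ χ) (hχp : Periodic χ (2 * π))
    (v : §.X)
    (hv : ∀ x : Icc (0 : ℝ) (2 * π), v x = χ (x0 + x))
    {e0 f0 : ℝ → ℂ} (he : IsGroundState (Q h g z) e0) (hf : IsGroundState (Qtilde h g z) f0) :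
    ‖scalar (commutator h g χ e0) f0‖ = √l * ‖§.ww v (l, z.im)‖ := by
  have hg' : ContDiff ℝ ∞ fun x => conj (g x) := conjCLE.contDiff.comp hgs
  have hp' : Periodic (fun x => conj (g x)) (2 * π) := fun x => by simp only [hp x]
  obtain ⟨t, het, hmin⟩ := he
  obtain ⟨t', hft, hmin'⟩ := hf
  rw [Qtilde_eq] at hft hmin'
  have hl' : (l : ℂ) ≠ 0 := ofReal_ne_zero.2 hl.ne'
  obtain ⟨u1, F1, E1, hu1⟩ := exists_isEig hh hg x0 hp hl.ne' hroot
  -- the eigenvalues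
  have E := het.isEig hh hgs hp
  have E' := hft.isEig hh hg' hp'
  set F := Pz h g z e0
  set H := Pz h (fun x => conj (g x)) (conj z) f0
  have hE0 : 0 < (§.EE z.im).re := by rw [Sys.EE_eq_ofReal, ofReal_re]; exact exp_pos _
  have ht0 : 0 < t := (E.nonneg hh het.2.1).lt_of_ne'
    (E.eq_zero hh hg x0 hE (by rw [het.2.1]; exact one_ne_zero) hE0)
  have ht0' : 0 < t' := by
    refine (E'.nonneg hh hft.2.1).lt_of_ne'
      (E'.eq_zero hh hg'.continuous x0 ?_ (by rw [hft.2.1]; exact one_ne_zero) ?_)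
    · rw [EE_sysOf_conj hh hg]
      intro h1
      exact hE (inv_eq_one.1 h1)
    · rw [Sys.EE_eq_ofReal, ofReal_re]; exact exp_pos _
  have htl : t = l := huniq t ht0 (hmin l u1 (E1.isNormalizedEigenfunction hh hgs hu1))
    (E.tr_eq hh hg x0 ht0.ne' (by rw [het.2.1]; exact one_ne_zero))
  have htl' : t' = l := by
    refine huniq t' ht0' (hmin' l _ ((E1.swap.const_mul ((√l : ℝ) : ℂ)⁻¹).isNormalizedEigenfunction
      hh hg' ?_)) (E'.swap'.tr_eq hh hg x0 ht0'.ne' ?_)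
    · rw [scalar_const_mul, E1.scalar_F hh, hu1, mul_one, map_inv₀, conj_ofReal, ← mul_inv,
        ← ofReal_mul, mul_self_sqrt hl.le]
      exact inv_mul_cancel₀ hl'
    · rw [E'.scalar_F hh, hft.2.1, mul_one]
      exact ofReal_ne_zero.2 ht0'.ne'
  clear hmin hmin' E1 hu1
  subst htl htl'
  have hE1 : scalar e0 e0 ≠ 0 := by rw [het.2.1]; exact one_ne_zero
  -- proportionality
  have hfl := E.isFloquet hh hg x0 ht0.ne'
  have hfl' := E'.swap'.isFloquet hh hg x0 ht0.ne'
  have h0 : gaugeP hh hg x0 e0 z 0 ≠ 0 ∨ (t' : ℂ)⁻¹ * gaugeQ hh hg x0 F z 0 ≠ 0 := by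
    rw [gaugeP_zero, gaugeQ_zero]
    rcases E.ne_zero hh hg x0 ht0.ne' hE1 with h1 | h1
    · exact Or.inl h1
    · exact Or.inr (mul_ne_zero (inv_ne_zero hl') (mul_ne_zero I_ne_zero h1))
  have c1 : conj (t' : ℂ) = t' := conj_ofReal _
  have c2 : conj (z.im : ℂ) = z.im := conj_ofReal _
  have hmul := multiplier_mul_conj h g z x0
  obtain ⟨k, hk⟩ := hfl.proportional hfl' h0 c1 c2 hl' hmul hn
  have hfF : ∀ x, f0 x = (fun x => (k / t') * F x) x := by
    refine eq_of_periodic_of_eqOn (x0 := x0) two_pi_pos E'.per_u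
      (fun x => by simp only [E.per_F x]) fun x hx => ?_
    have h1 := (hk x hx).2
    simp only [gaugeQ] at h1
    have hexp := cexp_ne_zero ((h : ℂ)⁻¹ * §.phase z.im x + I * gauge h g z x0 x)
    have hI := I_ne_zero
    have h2 : (t' : ℂ) * f0 (x0 + x) = k * F (x0 + x) := by
      field_simp at h1
      exact h1
    field_simp
    linear_combination h2
  have hkn : ‖k‖ = √t' := by
    have h1 : scalar f0 f0 = (k / t') * conj (k / t') * scalar F F := by
      rw [← scalar_const_mul, ← funext hfF]
    rw [hft.2.1, E.scalar_F hh, het.2.1, mul_conj, normSq_eq_norm_sq, norm_div,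
      norm_real, norm_of_nonneg hl.le] at h1
    have h2 : (1 : ℝ) = (‖k‖ / t')^2 * t' := by
      rw [mul_one] at h1
      exact_mod_cast h1
    rw [eq_comm, sqrt_eq_iff_mul_self_eq hl.le (norm_nonneg _)]
    field_simp at h2
    nlinarith
  -- densities
  obtain ⟨k', hk'⟩ := hfl.density h0 c1 c2 hl' hmul hn
  have du : ∀ x ∈ Icc 0 (2 * π), e0 (x0 + x) * conj (e0 (x0 + x)) =
      k' * (t' * §.mm (t', z.im) (§.pt x)) := by
    intro x hx
    have h1 := (hk' (§.pt x)).1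
    rw [§.pt_val hx, §.al_pt _ hx] at h1
    exact (gaugeP_mul_conj hh hg x0 x).symm.trans h1
  have dF : ∀ x ∈ Icc 0 (2 * π), F (x0 + x) * conj (F (x0 + x)) =
      t'^2 * (k' * §.nn (t', z.im) (§.pt x)) := by
    intro x hx
    have h1 := (hk' (§.pt x)).2
    rw [§.pt_val hx, §.be_pt _ hx] at h1
    have h2 := gaugeQ_mul_conj (F := F) (z := z) hh hg x0 x
    rw [← h1, ← h2, map_mul, map_inv₀, c1]
    have h3 : (t' : ℂ)^2 * ((t' : ℂ)⁻¹ * (t' : ℂ)⁻¹) = 1 := by field_simp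
    linear_combination (-(§.bef z.im x * (gaugeQ hh hg x0 F z x *
      conj (gaugeQ hh hg x0 F z x)))) * h3
  have hmem : ∀ {x}, x ∈ uIcc 0 (2 * π) → x ∈ Icc 0 (2 * π) := fun {x} hx => by
    rwa [uIcc_of_le two_pi_pos.le] at hx
  have hhc : (h : ℂ) ≠ 0 := ofReal_ne_zero.2 hh.ne'
  have hintg : ∀ w : §.X, ∫ x in 0..(2 * π), w (§.pt x) = h * §.tot w := by
    intro w
    rw [Sys.tot_apply]
    change _ = h * ((h : ℂ)⁻¹ * _)
    rw [mul_inv_cancel_left₀ hhc]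
    rfl
  have Iu : (1 : ℂ) = k' * t' * (h * §.tot (§.mm (t', z.im))) := by
    rw [← het.2.1, scalar_eq_shift E.per_u E.per_u x0, ← hintg, ← integral_const_mul]
    refine integral_congr fun x hx => ?_
    simp only [du x (hmem hx)]; ring
  have IF : (t' : ℂ) = t'^2 * k' * (h * §.tot (§.nn (t', z.im))) := by
    have h1 := E.scalar_F hh
    rw [het.2.1, mul_one] at h1
    refine h1.symm.trans ?_
    rw [scalar_eq_shift E.per_F E.per_F x0, ← hintg, ← integral_const_mul]
    refine integral_congr fun x hx => ?_
    simp only [dF x (hmem hx)]; ring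
  have hvx : ∀ x ∈ Icc 0 (2 * π), v (§.pt x) = χ (x0 + x) := by
    intro x hx
    have := hv (§.pt x)
    rwa [§.pt_val hx] at this
  have Iχ : ∫ x in 0..(2 * π), χ x * (F x * conj (F x) - t' * (e0 x * conj (e0 x))) =
      t'^2 * k' * (h * §.tot (v * §.nn (t', z.im))) -
        t' * (k' * t' * (h * §.tot (v * §.mm (t', z.im)))) := by
    have hper : Periodic (fun x => χ x * (F x * conj (F x) - t' * (e0 x * conj (e0 x))))
      (2 * π) := fun x => by simp only [hχp x, E.per_F x, E.per_u x]
    have h1 := hper.intervalIntegral_add_eq 0 x0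
    rw [zero_add] at h1
    have h2 := integral_comp_add_left (a := 0) (b := 2 * π)
      (fun x => χ x * (F x * conj (F x) - t' * (e0 x * conj (e0 x)))) x0
    rw [add_zero] at h2
    rw [h1, ← h2, ← hintg, ← hintg, ← integral_const_mul, ← integral_const_mul, ← integral_const_mul,
      ← integral_sub]
    · refine integral_congr fun x hx => ?_
      simp only [du x (hmem hx), dF x (hmem hx), Sys.mul_apply, hvx x (hmem hx)]
      ring
    · exact ((§.continuous_ext _).const_mul _).intervalIntegrable _ _
    · exact (((§.continuous_ext _).const_mul _).const_mul _).intervalIntegrable _ _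
  have hS : scalar (commutator h g χ e0) f0 = conj (k / t') * scalar (commutator h g χ e0) F := by
    rw [funext hfF]
    simp only [scalar]
    rw [← integral_const_mul]
    congr 1; funext x
    simp only [map_mul]; ring
  have hmm0 : §.tot (§.mm (t', z.im)) ≠ 0 := by intro h1; rw [h1] at Iu; simp at Iu
  have hnn0 : §.tot (§.nn (t', z.im)) ≠ 0 := by intro h1; rw [h1] at IF; simp at IF; exact hl.ne' IF
  have hww : t'^2 * k' * (h * §.tot (v * §.nn (t', z.im))) -
        t' * (k' * t' * (h * §.tot (v * §.mm (t', z.im)))) = t' * §.ww v (t', z.im) := by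
    have e1 : t'^2 * k' * h = t' / §.tot (§.nn (t', z.im)) := by
      rw [eq_div_iff hnn0]; linear_combination -IF
    have e2 : k' * t' * h = 1 / §.tot (§.mm (t', z.im)) := by
      rw [eq_div_iff hmm0]; linear_combination -Iu
    rw [Sys.ww]
    linear_combination §.tot (v * §.nn (t', z.im)) * e1 - t' * §.tot (v * §.mm (t', z.im)) * e2
  rw [hS, scalar_commutator hh E hχ hχp, Iχ, hww, norm_mul, norm_neg, norm_mul, RCLike.norm_conj,
    norm_div, hkn, norm_real, norm_of_nonneg hl.le]
  field_simp

/-! ### Laplace's method -/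

theorem norm_exp_sub_one_sub_le (w : ℂ) : ‖cexp w - 1 - w‖ ≤ ‖w‖^2 * max 1 (exp w.re) := by
  set m := max 1 (exp w.re)
  have hm : ∀ t ∈ Icc (0 : ℝ) 1, ‖cexp (t * w)‖ ≤ m := by
    intro t ht
    rw [norm_exp, re_ofReal_mul]
    rcases le_total 0 w.re with h | h
    · exact (exp_le_exp.2 (mul_le_of_le_one_left h ht.2)).trans (le_max_right _ _)
    · refine le_trans ?_ (le_max_left _ _)
      rw [exp_le_one_iff]
      exact mul_nonpos_of_nonneg_of_nonpos ht.1 h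
  have d0 : ∀ t : ℝ, HasDerivAt (fun t : ℝ => (t : ℂ) * w) w t := fun t => by
    simpa using (ofRealCLM.hasDerivAt (x := t)).mul_const w
  have d1 : ∀ t : ℝ, HasDerivAt (fun t : ℝ => cexp (t * w)) (cexp (t * w) * w) t :=
    fun t => (d0 t).cexp
  have h1 : ∀ t ∈ Icc (0 : ℝ) 1, ‖cexp (t * w) - 1‖ ≤ ‖w‖ * m := by
    intro t ht
    have := norm_image_sub_le_of_norm_deriv_le_segment' (f := fun t : ℝ => cexp (t * w))
      (f' := fun t => cexp (t * w) * w) (C := ‖w‖ * m) (a := 0) (b := 1)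
      (fun x _ => (d1 x).hasDerivWithinAt) (fun x hx => by
        rw [norm_mul, mul_comm]
        exact mul_le_mul_of_nonneg_left (hm x ⟨hx.1, hx.2.le⟩) (norm_nonneg _)) t ht
    simp only [ofReal_zero, zero_mul, Complex.exp_zero, sub_zero] at this
    refine this.trans (mul_le_of_le_one_right ?_ ht.2)
    have : 0 ≤ m := zero_le_one.trans (le_max_left _ _)
    positivity
  have h2 := norm_image_sub_le_of_norm_deriv_le_segment_01' (f := fun t : ℝ => cexp (t * w) - t * w)
    (f' := fun t => cexp (t * w) * w - w) (C := ‖w‖^2 * m)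
    (fun x _ => ((d1 x).sub (d0 x)).hasDerivWithinAt) (fun x hx => by
      have : cexp (x * w) * w - w = w * (cexp (x * w) - 1) := by ring
      rw [this, norm_mul, pow_two, mul_assoc]
      exact mul_le_mul_of_nonneg_left (h1 x ⟨hx.1, hx.2.le⟩) (norm_nonneg _))
  simp only [ofReal_zero, zero_mul, Complex.exp_zero, sub_zero, ofReal_one, one_mul] at h2
  rwa [show cexp w - 1 - w = cexp w - w - 1 by ring]

theorem pow_mul_exp_neg_le {b s : ℝ} (hb : 0 < b) (hs : 0 ≤ s) (n : ℕ) :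
    s^n * exp (-(b * s)) ≤ n.factorial / b^n := by
  have h1 := pow_div_factorial_le_exp (b * s) (by positivity) n
  rw [exp_neg, ← div_eq_mul_inv, div_le_div_iff₀ (exp_pos _) (by positivity)]
  have h2 : (0 : ℝ) < n.factorial := by exact_mod_cast Nat.factorial_pos n
  rw [div_le_iff₀ h2, mul_pow] at h1
  linarith

/-- The hypotheses of Laplace's method for `e^{2W/h}` near a nondegenerate maximum of `W`, with
`h = θ² r³`. -/
structure IsPeak (b K c r θ κ q s e : ℝ) (W : ℝ → ℝ) : Prop where
  r_pos : 0 < r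
  r_le : r ≤ K
  θ_pos : 0 < θ
  θ_le : θ ≤ 1
  le_κ : 2 * b * r ≤ κ
  κ_le : κ ≤ K * r
  q_le : |q| ≤ K
  s_le : s ≤ -(c * r)
  le_e : c * r ≤ e
  u_le : ∀ u ∈ Icc s e, |u| ≤ K
  cont : ContinuousOn W (Icc s e)
  le : ∀ u ∈ Icc s e, W u ≤ -(b * r * u^2)
  taylor : ∀ u ∈ Icc s e, |W u + κ / 2 * u^2 - q * u^3| ≤ K * u^4

variable {b K c r θ κ q s e : ℝ} {W : ℝ → ℝ}

/-- The integrand of Laplace's method. -/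
def peakFun (r θ : ℝ) (W : ℝ → ℝ) (ζ : ℂ) (u : ℝ) : ℂ := cexp ((2 / (θ^2 * r^3) * W u : ℝ) + ζ * u)

theorem IsPeak.re_le (H : IsPeak b K c r θ κ q s e W) (hb : 0 < b) {ζ : ℂ}
    (hζ : ‖ζ‖ ≤ K / r) (u : ℝ) : (ζ * u).re ≤ K^2 / (4 * b) + b * (u / (θ * r))^2 := by
  have hr := H.r_pos
  have hθ := H.θ_pos
  have hK : 0 < K := hr.trans_le H.r_le
  have h1 : (ζ * u).re ≤ K * |u / (θ * r)| := by
    refine (re_le_norm _).trans ?_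
    rw [norm_mul, norm_real, norm_eq_abs, abs_div, abs_of_pos (mul_pos hθ hr)]
    calc ‖ζ‖ * |u| ≤ K / r * |u| := by gcongr
      _ = K * (θ * (|u| / (θ * r))) := by field_simp
      _ ≤ K * (1 * (|u| / (θ * r))) := by gcongr; exact H.θ_le
      _ = _ := by rw [one_mul]
  refine h1.trans ?_
  rw [← sq_abs (u / (θ * r))]
  set v := |u / (θ * r)|
  rw [div_add' _ _ _ (by positivity), le_div_iff₀ (by positivity)]
  nlinarith [sq_nonneg (K - 2 * b * v)]

theorem IsPeak.norm_peakFun_le (H : IsPeak b K c r θ κ q s e W) (hb : 0 < b) {ζ : ℂ}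
    (hζ : ‖ζ‖ ≤ K / r) {u : ℝ} (hu : u ∈ Icc s e) :
    ‖peakFun r θ W ζ u‖ ≤ exp (K^2 / (4 * b)) * exp (-(b * (u / (θ * r))^2)) := by
  have hr := H.r_pos
  have hθ := H.θ_pos
  rw [peakFun, norm_exp, add_re, ofReal_re, ← exp_add]
  apply exp_le_exp.2
  have h1 := H.re_le hb hζ u
  have h2 := H.le u hu
  have h3 : 2 / (θ^2 * r^3) * W u ≤ -(2 * b * (u / (θ * r))^2) := by
    calc _ ≤ 2 / (θ^2 * r^3) * -(b * r * u^2) := by gcongr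
      _ = _ := by field_simp
  linarith

set_option maxHeartbeats 1000000 in
/-- The approximation of the integrand by a Gaussian with an odd correction. -/
theorem IsPeak.norm_peakFun_sub_le (hb : 0 < b) (hc : 0 < c) (hK : 0 < K) :
    ∃ C : ℝ, 0 < C ∧ ∀ {r θ κ q s e : ℝ} {W : ℝ → ℝ}, IsPeak b K c r θ κ q s e W →
      ∀ {ζ : ℂ}, ‖ζ‖ ≤ K / r → ∀ u : ℝ,
      ‖(Icc s e).indicator (peakFun r θ W ζ) u - (exp (-(κ / (θ^2 * r^3) * u^2)) : ℂ) *
          (1 + (((2 * q / (θ^2 * r^3) : ℝ) : ℂ) * u^3 + ζ * u))‖ ≤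
        C * θ^2 * exp (-(b / 2 * (u / (θ * r))^2)) := by
  set C1 := exp (K^2 / (4 * b)) with hC1
  set C2 := (2 * (2 * K + 2 * K^2)^2 + 2 * K^2) with hC2
  set C3 := 1 / c^2 + K / c + 2 * K / c with hC3
  set A : ℕ → ℝ := fun n => n.factorial / (b / 2)^n with hA
  have hA0 : ∀ n, 0 ≤ A n := fun n => by positivity
  have hC₁1 : 1 ≤ C1 := one_le_exp (by positivity)
  refine ⟨C2 * C1 * (A 1 + A 3) + 2 * K^2 * A 2 + C3 * (A 1 + A 2), ?_, ?_⟩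
  · have : 0 < A 1 := by positivity
    have := hA0 2; have := hA0 3
    positivity
  intro r θ κ q s e W H ζ hζ u
  have hr := H.r_pos
  have hθ := H.θ_pos
  set v := |u| / (θ * r) with hv
  have hv0 : 0 ≤ v := by positivity
  have huv : |u| = θ * r * v := by rw [hv]; field_simp
  have hsq : (u / (θ * r))^2 = v^2 := by rw [hv, div_pow, div_pow, sq_abs]
  have hpow : ∀ n : ℕ, (v^2)^n * exp (-(b * v^2)) ≤ A n * exp (-(b / 2 * v^2)) := by
    intro n
    have h1 := pow_mul_exp_neg_le (b := b / 2) (s := v^2) (by positivity) (by positivity) n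
    have : exp (-(b * v^2)) = exp (-(b / 2 * v^2)) * exp (-(b / 2 * v^2)) := by
      rw [← exp_add]; congr 1; ring
    rw [this, ← mul_assoc]
    exact mul_le_mul_of_nonneg_right h1 (exp_pos _).le
  have hgauss : exp (-(κ / (θ^2 * r^3) * u^2)) ≤ exp (-(b * v^2)) := by
    apply exp_le_exp.2
    have : κ / (θ^2 * r^3) * u^2 = κ / r * v^2 := by rw [← sq_abs u, huv]; field_simp
    rw [this]
    have h2 : 2 * b ≤ κ / r := by rw [le_div_iff₀ hr]; exact H.le_κ
    nlinarith [sq_nonneg v]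
  have hζu : ‖ζ * u‖ ≤ K * (θ * v) := by
    rw [norm_mul, norm_real, norm_eq_abs, huv]
    calc _ ≤ K / r * (θ * r * v) := by gcongr
      _ = _ := by field_simp
  have hq3 : ‖((2 * q / (θ^2 * r^3) : ℝ) : ℂ) * u^3‖ ≤ 2 * K * (θ * v^3) := by
    rw [norm_mul, norm_pow, norm_real, norm_real, norm_eq_abs,
      norm_eq_abs, huv, abs_div, abs_mul, abs_two, abs_of_pos (by positivity : 0 < θ^2 * r^3)]
    calc 2 * |q| / (θ^2 * r^3) * (θ * r * v)^3 ≤ 2 * K / (θ^2 * r^3) * (θ * r * v)^3 := by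
          gcongr; exact H.q_le
      _ = _ := by field_simp
  rw [hsq]
  have e0 := exp_pos (-(b / 2 * v^2))
  have p1 := hpow 1
  have p2 := hpow 2
  have p3 := hpow 3
  have hgn : ‖(exp (-(κ / (θ^2 * r^3) * u^2)) : ℂ)‖ = exp (-(κ / (θ^2 * r^3) * u^2)) := by
    rw [norm_real, norm_of_nonneg (exp_pos _).le]
  by_cases hu : u ∈ Icc s e
  · rw [Set.indicator_of_mem hu]
    set g := exp (-(κ / (θ^2 * r^3) * u^2)) with hg
    set w : ℂ := ((2 / (θ^2 * r^3) * W u + κ / (θ^2 * r^3) * u^2 : ℝ) : ℂ) + ζ * u with hw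
    set w1 : ℂ := ((2 * q / (θ^2 * r^3) : ℝ) : ℂ) * u^3 + ζ * u with hw1
    have hf : peakFun r θ W ζ u = g * cexp w := by
      rw [peakFun, hg, ofReal_exp, ← cexp_add, hw]
      congr 1
      push_cast; ring
    have hsplit : peakFun r θ W ζ u - g * (1 + w1) =
        g * (cexp w - 1 - w) + g * (w - w1) := by rw [hf]; ring
    have hww : w - w1 = ((2 / (θ^2 * r^3) * (W u + κ / 2 * u^2 - q * u^3) : ℝ) : ℂ) := by
      rw [hw, hw1]; push_cast; ring
    have hT := H.taylor u hu
    have hu4 : u^4 = (θ * r * v)^4 := by rw [← huv]; exact ((even_two_mul 2).pow_abs u).symm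
    have hdiff : ‖w - w1‖ ≤ 2 * K^2 * θ^2 * v^4 := by
      rw [hww, norm_real, norm_eq_abs, abs_mul, abs_of_pos (by positivity : 0 < 2 / (θ^2 * r^3))]
      calc _ ≤ 2 / (θ^2 * r^3) * (K * u^4) := by gcongr
        _ = 2 * K * r * θ^2 * v^4 := by rw [hu4]; field_simp
        _ ≤ 2 * K * K * θ^2 * v^4 := by gcongr; exact H.r_le
        _ = _ := by ring
    have hdiff' : ‖w - w1‖ ≤ 2 * K^2 * (θ * v^3) := by
      rw [hww, norm_real, norm_eq_abs, abs_mul, abs_of_pos (by positivity : 0 < 2 / (θ^2 * r^3))]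
      calc _ ≤ 2 / (θ^2 * r^3) * (K * u^4) := by gcongr
        _ = 2 / (θ^2 * r^3) * (K * (|u| * |u|^3)) := by
          congr 2
          rw [← pow_succ']
          exact ((even_two_mul 2).pow_abs u).symm
        _ ≤ 2 / (θ^2 * r^3) * (K * (K * |u|^3)) := by gcongr; exact H.u_le u hu
        _ = _ := by rw [huv]; field_simp
    have hwn : ‖w‖^2 ≤ C2 * θ^2 * (v^2 + (v^2)^3) := by
      have h1 : ‖w‖ ≤ (2 * K + 2 * K^2) * (θ * v^3) + K * (θ * v) := by
        have : w = (w - w1) + w1 := by ring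
        rw [this]
        refine (norm_add_le _ _).trans ?_
        have := norm_add_le (((2 * q / (θ^2 * r^3) : ℝ) : ℂ) * u^3) (ζ * u)
        rw [← hw1] at this
        linarith
      calc ‖w‖^2 ≤ ((2 * K + 2 * K^2) * (θ * v^3) + K * (θ * v))^2 := by gcongr
        _ ≤ 2 * ((2 * K + 2 * K^2) * (θ * v^3))^2 + 2 * (K * (θ * v))^2 := by
          linarith [sq_nonneg ((2 * K + 2 * K^2) * (θ * v^3) - K * (θ * v)),
            add_sq ((2 * K + 2 * K^2) * (θ * v^3)) (K * (θ * v)),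
            sub_sq ((2 * K + 2 * K^2) * (θ * v^3)) (K * (θ * v))]
        _ ≤ 2 * ((2 * K + 2 * K^2) * (θ * v^3))^2 + 2 * (K * (θ * v))^2 +
            (2 * (2 * K + 2 * K^2)^2 * θ^2 * v^2 + 2 * K^2 * θ^2 * (v^2)^3) :=
          le_add_of_nonneg_right (by positivity)
        _ = _ := by rw [hC2]; ring
    have hmax : g * max 1 (exp w.re) ≤ C1 * exp (-(b * v^2)) := by
      rw [mul_max_of_nonneg _ _ (exp_pos _).le, mul_one]
      apply max_le
      · refine hgauss.trans ?_
        exact le_mul_of_one_le_left (exp_pos _).le hC₁1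
      · have h1 := H.norm_peakFun_le hb hζ hu
        rw [hf, norm_mul, hgn, norm_exp, hsq] at h1
        exact h1
    rw [hsplit]
    refine (norm_add_le _ _).trans ?_
    rw [norm_mul, norm_mul, hgn]
    have i1 : g * ‖cexp w - 1 - w‖ ≤ C2 * C1 * (A 1 + A 3) * θ^2 * exp (-(b / 2 * v^2)) := by
      calc _ ≤ g * (‖w‖^2 * max 1 (exp w.re)) :=
            mul_le_mul_of_nonneg_left (norm_exp_sub_one_sub_le w) (exp_pos _).le
        _ = ‖w‖^2 * (g * max 1 (exp w.re)) := by ring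
        _ ≤ (C2 * θ^2 * (v^2 + (v^2)^3)) * (C1 * exp (-(b * v^2))) := by gcongr
        _ = C2 * C1 * θ^2 * ((v^2)^1 * exp (-(b * v^2)) + (v^2)^3 * exp (-(b * v^2))) := by ring
        _ ≤ C2 * C1 * θ^2 * (A 1 * exp (-(b / 2 * v^2)) + A 3 * exp (-(b / 2 * v^2))) := by gcongr
        _ = _ := by ring
    have i2 : g * ‖w - w1‖ ≤ 2 * K^2 * A 2 * θ^2 * exp (-(b / 2 * v^2)) := by
      calc _ ≤ exp (-(b * v^2)) * (2 * K^2 * θ^2 * v^4) := by gcongr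
        _ = 2 * K^2 * θ^2 * ((v^2)^2 * exp (-(b * v^2))) := by ring
        _ ≤ 2 * K^2 * θ^2 * (A 2 * exp (-(b / 2 * v^2))) := by gcongr
        _ = _ := by ring
    have i3 : 0 ≤ C3 * (A 1 + A 2) * θ^2 * exp (-(b / 2 * v^2)) := by
      have := hA0 1; have := hA0 2
      positivity
    refine (add_le_add i1 i2).trans ((le_add_of_nonneg_right i3).trans_eq ?_)
    ring
  · rw [Set.indicator_of_notMem hu, zero_sub, norm_neg, norm_mul, hgn]
    have hcu : c * r ≤ |u| := by
      rw [mem_Icc, not_and_or, not_le, not_le] at hu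
      rcases hu with h | h
      · rw [le_abs]; right; linarith [H.s_le]
      · rw [le_abs]; left; linarith [H.le_e]
    have hθv : 1 ≤ θ * v / c := by
      rw [le_div_iff₀ hc, one_mul]
      rw [huv] at hcu
      exact le_of_mul_le_mul_left (by linarith : r * c ≤ r * (θ * v)) hr
    have h1 : ‖1 + (((2 * q / (θ^2 * r^3) : ℝ) : ℂ) * u^3 + ζ * u)‖ ≤
        C3 * θ^2 * (v^2 + (v^2)^2) := by
      calc _ ≤ 1 + (2 * K * (θ * v^3) + K * (θ * v)) := by
            refine (norm_add_le _ _).trans ?_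
            rw [norm_one]
            have := norm_add_le (((2 * q / (θ^2 * r^3) : ℝ) : ℂ) * u^3) (ζ * u)
            linarith
        _ ≤ (θ * v / c)^2 + (2 * K * (θ * v^3) * (θ * v / c) + K * (θ * v) * (θ * v / c)) := by
            have i1 : 1 ≤ (θ * v / c)^2 := one_le_pow₀ hθv
            have i2 : 2 * K * (θ * v^3) ≤ 2 * K * (θ * v^3) * (θ * v / c) :=
              le_mul_of_one_le_right (by positivity) hθv
            have i3 : K * (θ * v) ≤ K * (θ * v) * (θ * v / c) :=
              le_mul_of_one_le_right (by positivity) hθv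
            linarith
        _ = θ^2 * ((1 / c^2 + K / c) * v^2 + 2 * K / c * (v^2)^2) := by field_simp; ring
        _ ≤ θ^2 * (C3 * v^2 + C3 * (v^2)^2) := by
            have : 0 ≤ 1 / c^2 + K / c := by positivity
            have : 0 ≤ 2 * K / c := by positivity
            gcongr
            · rw [hC3]; linarith
            · rw [hC3]; linarith
        _ = _ := by ring
    have i3 : 0 ≤ (C2 * C1 * (A 1 + A 3) + 2 * K^2 * A 2) * θ^2 * exp (-(b / 2 * v^2)) := by
      have := hA0 1; have := hA0 2; have := hA0 3
      positivity
    calc _ ≤ exp (-(b * v^2)) * (C3 * θ^2 * (v^2 + (v^2)^2)) := by gcongr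
      _ = C3 * θ^2 * ((v^2)^1 * exp (-(b * v^2)) + (v^2)^2 * exp (-(b * v^2))) := by ring
      _ ≤ C3 * θ^2 * (A 1 * exp (-(b / 2 * v^2)) + A 2 * exp (-(b / 2 * v^2))) := by
        have : 0 ≤ C3 := by positivity
        gcongr
      _ ≤ C3 * θ^2 * (A 1 * exp (-(b / 2 * v^2)) +
          A 2 * exp (-(b / 2 * v^2))) + _ := le_add_of_nonneg_right i3
      _ = _ := by ring

theorem integrable_pow_mul_gaussian {β : ℝ} (hβ : 0 < β) (n : ℕ) :
    Integrable fun u : ℝ => u^n * exp (-(β * u^2)) := by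
  have := integrable_rpow_mul_exp_neg_mul_sq hβ (s := n)
    (lt_of_lt_of_le (by norm_num) (Nat.cast_nonneg n))
  simpa only [rpow_natCast, neg_mul] using this

theorem integral_gaussian_mul_odd {β : ℝ} (hβ : 0 < β) (q ζ : ℂ) :
    ∫ u : ℝ, (exp (-(β * u^2)) : ℂ) * (1 + (q * u^3 + ζ * u)) = (√(π / β) : ℂ) := by
  have i0 : Integrable fun u : ℝ => (exp (-(β * u^2)) : ℂ) := by
    simpa using (integrable_pow_mul_gaussian hβ 0).ofReal (𝕜 := ℂ)
  have i1 : Integrable fun u : ℝ => ((u^1 * exp (-(β * u^2)) : ℝ) : ℂ) :=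
    (integrable_pow_mul_gaussian hβ 1).ofReal
  have i3 : Integrable fun u : ℝ => ((u^3 * exp (-(β * u^2)) : ℝ) : ℂ) :=
    (integrable_pow_mul_gaussian hβ 3).ofReal
  have io : Integrable fun u : ℝ => (exp (-(β * u^2)) : ℂ) * (q * u^3 + ζ * u) := by
    refine ((i3.const_mul q).add (i1.const_mul ζ)).congr (Filter.Eventually.of_forall fun u => ?_)
    simp only [Pi.add_apply]
    push_cast; ring
  have hodd : ∫ u : ℝ, (exp (-(β * u^2)) : ℂ) * (q * u^3 + ζ * u) = 0 := by
    have h1 := MeasureTheory.integral_neg_eq_self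
      (fun u : ℝ => (exp (-(β * u^2)) : ℂ) * (q * u^3 + ζ * u)) volume
    have h2 : (fun u : ℝ => (exp (-(β * (-u)^2)) : ℂ) *
        (q * ((-u : ℝ) : ℂ)^3 + ζ * ((-u : ℝ) : ℂ))) = fun u : ℝ =>
        -((exp (-(β * u^2)) : ℂ) * (q * u^3 + ζ * u)) := by
      funext u
      rw [neg_sq]; push_cast; ring
    rw [h2, MeasureTheory.integral_neg] at h1
    have h3 := CharZero.eq_neg_self_iff.1 h1.symm
    exact h3
  have hsum : (fun u : ℝ => (exp (-(β * u^2)) : ℂ) * (1 + (q * u^3 + ζ * u))) =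
      fun u : ℝ => (exp (-(β * u^2)) : ℂ) + (exp (-(β * u^2)) : ℂ) * (q * u^3 + ζ * u) := by
    funext u; ring
  rw [hsum, MeasureTheory.integral_add i0 io, hodd, add_zero, integral_complex_ofReal]
  congr 1
  simpa only [neg_mul] using integral_gaussian β

theorem integral_gaussian_scaled {b w : ℝ} (hw : 0 < w) :
    ∫ u : ℝ, exp (-(b / 2 * (u / w)^2)) = √(2 * π / b) * w := by
  have h := integral_gaussian (b / 2 / w^2)
  have h1 : (fun u : ℝ => exp (-(b / 2 * (u / w)^2))) =
      fun u : ℝ => exp (-(b / 2 / w^2) * u^2) := by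
    funext u; congr 1; field_simp
  have h2 : π / (b / 2 / w^2) = 2 * π / b * w^2 := by
    by_cases hb : b = 0
    · simp [hb]
    · field_simp
  rw [h1, h, h2, sqrt_mul' _ (by positivity), sqrt_sq hw.le]

theorem integrable_gaussian_scaled {b w : ℝ} (hb : 0 < b) (hw : 0 < w) :
    Integrable fun u : ℝ => exp (-(b / 2 * (u / w)^2)) := by
  have h := integrable_exp_neg_mul_sq (b := b / 2 / w^2) (by positivity)
  refine h.congr (Filter.Eventually.of_forall fun u => ?_)
  simp only []
  congr 1; field_simp

variable {b K c : ℝ}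

/-- The leading term of Laplace's method. -/
def peakVal (r θ κ : ℝ) : ℝ := √(π * (θ^2 * r^3) / κ)

theorem IsPeak.peakVal_ge (hb : 0 < b) {r θ κ q s e : ℝ} {W : ℝ → ℝ}
    (H : IsPeak b K c r θ κ q s e W) : √(π / K) * (θ * r) ≤ peakVal r θ κ := by
  have hr := H.r_pos
  have hθ := H.θ_pos
  have hK : 0 < K := hr.trans_le H.r_le
  have hκ : 0 < κ := lt_of_lt_of_le (by positivity) H.le_κ
  rw [← sqrt_sq (mul_pos hθ hr).le, ← sqrt_mul' _ (by positivity), peakVal]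
  apply sqrt_le_sqrt
  rw [div_mul_eq_mul_div, div_le_div_iff₀ hK hκ]
  calc π * (θ * r)^2 * κ ≤ π * (θ * r)^2 * (K * r) := by gcongr; exact H.κ_le
    _ = _ := by ring

theorem IsPeak.peakVal_pos (hb : 0 < b) {r θ κ q s e : ℝ} {W : ℝ → ℝ}
    (H : IsPeak b K c r θ κ q s e W) : 0 < peakVal r θ κ := by
  have hr := H.r_pos
  have hθ := H.θ_pos
  have hK : 0 < K := hr.trans_le H.r_le
  exact lt_of_lt_of_le (by positivity) (H.peakVal_ge hb)

theorem IsPeak.laplace (hb : 0 < b) (hc : 0 < c) (hK : 0 < K) :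
    ∃ C : ℝ, 0 < C ∧ ∀ {r θ κ q s e : ℝ} {W : ℝ → ℝ}, IsPeak b K c r θ κ q s e W →
      ∀ {ζ : ℂ}, ‖ζ‖ ≤ K / r →
      ‖(∫ u in s..e, peakFun r θ W ζ u) - peakVal r θ κ‖ ≤ C * θ^2 * peakVal r θ κ := by
  obtain ⟨C, hC, hle⟩ := IsPeak.norm_peakFun_sub_le hb hc hK
  refine ⟨C * √(2 * π / b) / √(π / K), by positivity, ?_⟩
  intro r θ κ q s e W H ζ hζ
  have hr := H.r_pos
  have hθ := H.θ_pos
  have hκ : 0 < κ := lt_of_lt_of_le (by positivity) H.le_κ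
  have hse : s ≤ e := by nlinarith [H.s_le, H.le_e, mul_pos hc hr]
  set β := κ / (θ^2 * r^3) with hβ
  have hβ0 : 0 < β := by positivity
  have hG := integral_gaussian_mul_odd hβ0 ((2 * q / (θ^2 * r^3) : ℝ) : ℂ) ζ
  have hval : √(π / β) = peakVal r θ κ := by rw [peakVal, hβ]; congr 1; field_simp
  have hcont : ContinuousOn (peakFun r θ W ζ) (Icc s e) := by
    have h1 := H.cont
    unfold peakFun
    refine Complex.continuous_exp.comp_continuousOn (ContinuousOn.add ?_ (by fun_prop))
    exact Complex.continuous_ofReal.comp_continuousOn (continuousOn_const.mul h1)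
  have hintg : ∫ u in s..e, peakFun r θ W ζ u = ∫ u, (Icc s e).indicator (peakFun r θ W ζ) u := by
    rw [MeasureTheory.integral_indicator measurableSet_Icc, integral_of_le hse,
      MeasureTheory.integral_Icc_eq_integral_Ioc]
  have hi1 : Integrable ((Icc s e).indicator (peakFun r θ W ζ)) :=
    (MeasureTheory.integrable_indicator_iff measurableSet_Icc).2 hcont.integrableOn_Icc
  have hi2 : Integrable fun u : ℝ => (exp (-(β * u^2)) : ℂ) *
      (1 + (((2 * q / (θ^2 * r^3) : ℝ) : ℂ) * u^3 + ζ * u)) := by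
    by_contra hn
    rw [MeasureTheory.integral_undef hn] at hG
    have : 0 < √(π / β) := by positivity
    exact (ofReal_ne_zero.2 this.ne') hG.symm
  rw [hintg, ← hval, ← hG, ← MeasureTheory.integral_sub hi1 hi2]
  have hθr : 0 < θ * r := by positivity
  refine (MeasureTheory.norm_integral_le_of_norm_le
    ((integrable_gaussian_scaled hb hθr).const_mul (C * θ^2))
    (Filter.Eventually.of_forall (hle H hζ))).trans ?_
  rw [MeasureTheory.integral_const_mul, integral_gaussian_scaled hθr, hval]
  have h1 := H.peakVal_ge hb
  have h2 : 0 < √(π / K) := by positivity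
  calc C * θ^2 * (√(2 * π / b) * (θ * r))
      = C * √(2 * π / b) / √(π / K) * θ^2 * (√(π / K) * (θ * r)) := by field_simp
    _ ≤ _ := by gcongr

theorem IsPeak.laplace_tail (hb : 0 < b) (hc : 0 < c) (hK : 0 < K) :
    ∃ C : ℝ, 0 < C ∧ ∀ {r θ κ q s e : ℝ} {W : ℝ → ℝ}, IsPeak b K c r θ κ q s e W →
      ∀ {ζ : ℂ}, ‖ζ‖ ≤ K / r → ∀ {M : ℝ} {ψ : ℝ → ℂ}, 0 ≤ M → (∀ u ∈ Icc s e, ‖ψ u‖ ≤ M) →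
      (∀ u ∈ Icc s e, |u| ≤ c * r → ψ u = 0) →
      ‖∫ u in s..e, ψ u * peakFun r θ W ζ u‖ ≤ C * M * θ^2 * peakVal r θ κ := by
  set C1 := exp (K^2 / (4 * b)) with hC1
  set A := C1 * (1 / c^2) * ((1 : ℕ).factorial / (b / 2)^1) with hA
  have hA0 : 0 < A := by positivity
  refine ⟨A * √(2 * π / b) / √(π / K), by positivity, ?_⟩
  intro r θ κ q s e W H ζ hζ M ψ hM hψ hψ0
  have hr := H.r_pos
  have hθ := H.θ_pos
  have hθr : 0 < θ * r := by positivity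
  have hse : s ≤ e := by nlinarith [H.s_le, H.le_e, mul_pos hc hr]
  have hpt : ∀ u ∈ Ioc s e, ‖ψ u * peakFun r θ W ζ u‖ ≤
      M * (A * θ^2) * exp (-(b / 2 * (u / (θ * r))^2)) := by
    intro u hu
    have hu' : u ∈ Icc s e := ⟨hu.1.le, hu.2⟩
    by_cases hcu : |u| ≤ c * r
    · rw [hψ0 u hu' hcu, zero_mul, norm_zero]; positivity
    push Not at hcu
    set v := (u / (θ * r))^2 with hv
    have hv0 : 0 ≤ v := by positivity
    have h1 : 1 ≤ 1 / c^2 * θ^2 * v := by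
      rw [hv, ← sq_abs (u / _), abs_div, abs_of_pos hθr]
      have : 1 / c^2 * θ^2 * (|u| / (θ * r))^2 = (|u| / (c * r))^2 := by field_simp
      rw [this]
      exact one_le_pow₀ ((one_le_div (by positivity)).2 hcu.le)
    have h2 := H.norm_peakFun_le hb hζ hu'
    have h3 := pow_mul_exp_neg_le (b := b / 2) (s := v) (by positivity) hv0 1
    have h4 : exp (-(b * v)) = exp (-(b / 2 * v)) * exp (-(b / 2 * v)) := by
      rw [← exp_add]; congr 1; ring
    rw [norm_mul]
    calc ‖ψ u‖ * ‖peakFun r θ W ζ u‖ ≤ M * (C1 * exp (-(b * v))) :=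
          mul_le_mul (hψ u hu') h2 (norm_nonneg _) hM
      _ ≤ M * (C1 * exp (-(b * v))) * (1 / c^2 * θ^2 * v) :=
          le_mul_of_one_le_right (by positivity) h1
      _ = M * C1 * (1 / c^2) * θ^2 * (v^1 * exp (-(b / 2 * v))) *
          exp (-(b / 2 * v)) := by rw [h4]; ring
      _ ≤ M * C1 * (1 / c^2) * θ^2 * ((1 : ℕ).factorial / (b / 2)^1) *
          exp (-(b / 2 * v)) := by gcongr
      _ = _ := by rw [hA]; ring
  have hgi := (integrable_gaussian_scaled hb hθr).const_mul (M * (A * θ^2))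
  refine (norm_integral_le_of_norm_le hse (Filter.Eventually.of_forall hpt)
    hgi.intervalIntegrable).trans ?_
  have h5 : ∫ u in s..e, M * (A * θ^2) * exp (-(b / 2 * (u / (θ * r))^2)) ≤
      M * (A * θ^2) * (√(2 * π / b) * (θ * r)) := by
    rw [← integral_gaussian_scaled hθr, ← MeasureTheory.integral_const_mul, integral_of_le hse]
    exact MeasureTheory.setIntegral_le_integral hgi
      (Filter.Eventually.of_forall fun u => by positivity)
  refine h5.trans ?_
  have h1 := H.peakVal_ge hb
  have h2 : 0 < √(π / K) := by positivity
  calc _ = A * √(2 * π / b) / √(π / K) * M * θ^2 * (√(π / K) * (θ * r)) := by field_simp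
    _ ≤ _ := by gcongr

/-! ### A bound for iterated integrals -/

/-- The bound comes from the growth of the energy of a subsolution of the system. -/
theorem iterated_integral_le {V φ : ℝ → ℝ} (hV : Continuous V) (hφ : ∀ x, HasDerivAt φ (V x) x)
    {h τ : ℝ} (hh : 0 < h) (hτ : 0 < τ) {s e : ℝ} (hse : s ≤ e) :
    ∫ x in s..e, exp (-(2 / h * φ x)) * ∫ t in s..x, exp (2 / h * φ t) ≤
      h^2 / τ^2 * exp (h⁻¹ * ∫ x in s..e, (√(V x^2 + τ^2) - V x)) := by
  have hφc : Continuous φ := continuous_iff_continuousAt.2 fun x => (hφ x).continuousAt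
  set a : ℝ → ℝ := fun x => exp (2 / h * φ x) with ha
  set b : ℝ → ℝ := fun x => exp (-(2 / h * φ x)) with hb
  have hac : Continuous a := by fun_prop
  have hbc : Continuous b := by fun_prop
  have hab : ∀ x, a x * b x = 1 := fun x => by rw [ha, hb]; simp only []; rw [← exp_add]; simp
  have hda : ∀ x, HasDerivAt a (a x * (2 / h * V x)) x := fun x => ((hφ x).const_mul _).exp
  have hdb : ∀ x, HasDerivAt b (b x * (-(2 / h * V x))) x := fun x => ((hφ x).const_mul _).neg.exp
  set q : ℝ → ℝ := fun x => ∫ t in s..x, a t with hq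
  have hdq : ∀ x, HasDerivAt q (a x) x := fun x => (hac.integral_hasStrictDerivAt _ _).hasDerivAt
  have hqc : Continuous q := continuous_iff_continuousAt.2 fun x => (hdq x).continuousAt
  set R : ℝ → ℝ := fun x => √(V x^2 + τ^2) with hR
  have hRc : Continuous R := by fun_prop
  set w : ℝ → ℝ := fun x => ∫ t in s..x, b t * q t with hw
  have hdw : ∀ x, HasDerivAt w (b x * q x) x := fun x =>
    ((hbc.mul hqc).integral_hasStrictDerivAt _ _).hasDerivAt
  set I : ℝ → ℝ := fun x => ∫ t in s..x, R t with hI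
  have hdI : ∀ x, HasDerivAt I (R x) x := fun x => (hRc.integral_hasStrictDerivAt _ _).hasDerivAt
  set k := τ^2 / h^2 with hk
  have hk0 : 0 < k := by positivity
  set F : ℝ → ℝ := fun x => (a x * (1 + k * w x)^2 + k * (b x * q x^2)) *
    exp (-(2 / h * I x)) with hF
  have hdF : ∀ x, HasDerivAt F ((a x * (2 / h * V x) * (1 + k * w x)^2 +
      a x * (2 * (1 + k * w x) * (k * (b x * q x))) +
      k * (b x * (-(2 / h * V x)) * q x^2 + b x * (2 * q x * a x)) -
      2 / h * R x * (a x * (1 + k * w x)^2 + k * (b x * q x^2))) *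
      exp (-(2 / h * I x))) x := by
    intro x
    have d1 := (hda x).mul ((((hdw x).const_mul k).const_add 1).pow 2)
    have d2 := ((hdb x).mul ((hdq x).pow 2)).const_mul k
    have d3 := ((hdI x).const_mul (2 / h)).neg.exp
    refine ((d1.add d2).mul d3).congr_deriv ?_
    simp only [Pi.add_apply, Pi.mul_apply, Pi.neg_apply, Pi.pow_apply]
    push_cast
    ring
  have hw0 : ∀ x ∈ Icc s e, 0 ≤ w x := fun x hx =>
    integral_nonneg hx.1 fun t ht => mul_nonneg (exp_pos _).le
      (integral_nonneg ht.1 fun u _ => (exp_pos _).le)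
  have hq0 : ∀ x ∈ Icc s e, 0 ≤ q x := fun x hx => integral_nonneg hx.1 fun u _ => (exp_pos _).le
  have hanti : AntitoneOn F (Icc s e) := by
    apply antitoneOn_of_deriv_nonpos (convex_Icc _ _)
    · exact fun x _ => (hdF x).continuousAt.continuousWithinAt
    · exact fun x _ => (hdF x).differentiableAt.differentiableWithinAt
    · intro x hx
      rw [interior_Icc] at hx
      have hx' : x ∈ Icc s e := ⟨hx.1.le, hx.2.le⟩
      rw [(hdF x).deriv]
      apply mul_nonpos_of_nonpos_of_nonneg _ (exp_pos _).le
      set p := 1 + k * w x with hp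
      have hp1 : 1 ≤ p := by rw [hp]; have := mul_nonneg hk0.le (hw0 x hx'); linarith
      have hqx := hq0 x hx'
      have hax : 0 < a x := exp_pos _
      have hbx : 0 < b x := exp_pos _
      have hab' := hab x
      have i3 := Sys.quadratic_form_le (v := V x) (t := τ) (a := √(a x) * p)
        (b := τ / h * (√(b x) * q x))
      have e1 : (√(a x) * p)^2 = a x * p^2 := by rw [mul_pow, sq_sqrt hax.le]
      have e2 : (τ / h * (√(b x) * q x))^2 = k * (b x * q x^2) := by
        rw [mul_pow, mul_pow, sq_sqrt hbx.le, hk]; ring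
      have e3 : 2 * τ * (√(a x) * p * (τ / h * (√(b x) * q x))) = 2 * (k * h) * (p * q x) := by
        have : √(a x) * √(b x) = 1 := by rw [← sqrt_mul hax.le, hab', sqrt_one]
        calc _ = 2 * τ * (τ / h) * (√(a x) * √(b x)) * (p * q x) := by ring
          _ = _ := by rw [this, hk]; field_simp
      rw [e1, e2, e3] at i3
      have i4 : q x ≤ p * q x := le_mul_of_one_le_left hqx hp1
      have i5 := mul_le_mul_of_nonneg_left i3 (by positivity : (0 : ℝ) ≤ 2 / h)
      have e4 : a x * (2 * p * (k * (b x * q x))) = 2 * k * (p * q x) := by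
        linear_combination (2 * k * (p * q x)) * hab'
      have e5 : k * (b x * (-(2 / h * V x)) * q x^2 + b x * (2 * q x * a x)) =
          -(2 / h * V x * (k * (b x * q x^2))) + 2 * k * q x := by
        linear_combination (2 * k * q x) * hab'
      have e6 : 2 / h * (2 * (k * h) * (p * q x)) = 4 * k * (p * q x) := by field_simp; ring
      have i6 := mul_le_mul_of_nonneg_left i4 (by positivity : (0 : ℝ) ≤ 2 * k)
      rw [e4, e5]
      rw [mul_add, e6] at i5
      have hRx : R x = √(V x^2 + τ^2) := rfl
      rw [← hRx] at i5
      linarith [i5, i6]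
  have hFe := hanti ⟨le_rfl, hse⟩ ⟨hse, le_rfl⟩ hse
  have hFs : F s = a s := by simp [hF, hw, hq, hI]
  rw [hFs] at hFe
  have h1 : a e * (1 + k * w e)^2 ≤ a s * exp (2 / h * I e) := by
    have h2 : a e * (1 + k * w e)^2 * exp (-(2 / h * I e)) ≤ a s := by
      refine le_trans ?_ hFe
      simp only [hF]
      refine mul_le_mul_of_nonneg_right ?_ (exp_pos _).le
      have : 0 ≤ k * (b e * q e^2) := mul_nonneg hk0.le (mul_nonneg (exp_pos _).le (sq_nonneg _))
      linarith
    rw [exp_neg, ← div_eq_mul_inv, div_le_iff₀ (exp_pos _)] at h2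
    exact h2
  have hφI : φ e - φ s = ∫ x in s..e, V x :=
    (integral_eq_sub_of_hasDerivAt (fun x _ => hφ x) (hV.intervalIntegrable _ _)).symm
  have h2 : 1 + k * w e ≤ exp (h⁻¹ * ∫ x in s..e, (R x - V x)) := by
    have hwe : 0 ≤ 1 + k * w e := by have := mul_nonneg hk0.le (hw0 e ⟨hse, le_rfl⟩); linarith
    refine le_of_sq_le_sq ?_ (exp_pos _).le
    rw [integral_sub (hRc.intervalIntegrable _ _) (hV.intervalIntegrable _ _), ← hφI, ← exp_nat_mul]
    have h3 : (1 + k * w e)^2 = b e * (a e * (1 + k * w e)^2) := by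
      linear_combination -((1 + k * w e)^2) * hab e
    rw [h3]
    refine (mul_le_mul_of_nonneg_left h1 (exp_pos _).le).trans_eq ?_
    simp only [ha]
    rw [← exp_add, ← exp_add]
    congr 1
    simp only [hI]
    push_cast
    field_simp
    ring
  have h3 : w e ≤ k⁻¹ * exp (h⁻¹ * ∫ x in s..e, (R x - V x)) := by
    rw [inv_mul_eq_div, le_div_iff₀ hk0]
    nlinarith
  refine h3.trans_eq ?_
  rw [hk, inv_div]

/-! ### Wells -/

/-- Quantitative properties of a function `G - y` on `[0, L]` that is increasing on `[0, b]` with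
zero `xm` and decreasing on `[b, L]` with zero `xp`, where `r²` is the depth of the well. -/
structure IsWell (c K L b : ℝ) (G : ℝ → ℝ) (y r xm xp κm κp qm qp : ℝ) : Prop where
  L_le : L ≤ K
  r_pos : 0 < r
  r_le : r ≤ K
  xm_ge : c * r ≤ xm
  xm_le : xm ≤ K * r
  xm_le_b : xm + c ≤ b
  xm_le_b' : xm + c * r ≤ b
  xp_le : xp ≤ L - c * r
  le_xp : L - K * r ≤ xp
  b_le_xp : b + c ≤ xp
  b_le_xp' : b + c * r ≤ xp
  left : ∀ x ∈ Icc 0 b, c * r * (x - xm)^2 ≤ (G x - y) * (x - xm)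
  left' : ∀ x ∈ Icc 0 b, c * (x - xm)^2 ≤ |G x - y|
  right : ∀ x ∈ Icc b L, c * r * (x - xp)^2 ≤ (G x - y) * (xp - x)
  right' : ∀ x ∈ Icc b L, c * (x - xp)^2 ≤ |G x - y|
  taylor_left : ∀ x ∈ Icc 0 b,
    |G x - y - κm * (x - xm) - qm * (x - xm)^2| ≤ K * |x - xm|^3
  taylor_right : ∀ x ∈ Icc b L,
    |G x - y - κp * (xp - x) - qp * (xp - x)^2| ≤ K * |x - xp|^3
  κm_ge : c * r ≤ κm
  κm_le : κm ≤ K * r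
  κp_ge : c * r ≤ κp
  κp_le : κp ≤ K * r
  qm_le : |qm| ≤ K
  qp_le : |qp| ≤ K
  top : ∀ x ∈ Icc (b - c) (b + c), c ≤ G x - y

variable {c K L b : ℝ} {G : ℝ → ℝ} {y r xm xp κm κp qm qp : ℝ} {φ : ℝ → ℝ} {θ : ℝ}

local notation "𝖶" => IsWell c K L b G y r xm xp κm κp qm qp

theorem IsWell.reflect (H : 𝖶) :
    IsWell c K L (L - b) (fun x => G (L - x)) y r (L - xp) (L - xm) κp κm qp qm where
  L_le := H.L_le
  r_pos := H.r_pos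
  r_le := H.r_le
  xm_ge := by linarith [H.xp_le]
  xm_le := by linarith [H.le_xp]
  xm_le_b := by linarith [H.b_le_xp]
  xm_le_b' := by linarith [H.b_le_xp']
  xp_le := by linarith [H.xm_ge]
  le_xp := by linarith [H.xm_le]
  b_le_xp := by linarith [H.xm_le_b]
  b_le_xp' := by linarith [H.xm_le_b']
  left := fun x hx => by
    have := H.right (L - x) ⟨by linarith [hx.2], by linarith [hx.1]⟩
    convert! this using 1 <;> ring
  left' := fun x hx => by
    have := H.right' (L - x) ⟨by linarith [hx.2], by linarith [hx.1]⟩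
    convert! this using 1; ring
  right := fun x hx => by
    have := H.left (L - x) ⟨by linarith [hx.2], by linarith [hx.1]⟩
    convert! this using 1 <;> ring
  right' := fun x hx => by
    have := H.left' (L - x) ⟨by linarith [hx.2], by linarith [hx.1]⟩
    convert! this using 1; ring
  taylor_left := fun x hx => by
    have := H.taylor_right (L - x) ⟨by linarith [hx.2], by linarith [hx.1]⟩
    convert! this using 2
    · ring
    · rw [abs_sub_comm]; congr 2; ring
  taylor_right := fun x hx => by
    have := H.taylor_left (L - x) ⟨by linarith [hx.2], by linarith [hx.1]⟩
    convert! this using 2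
    · ring
    · rw [abs_sub_comm]; congr 2; ring
  κm_ge := H.κp_ge
  κm_le := H.κp_le
  κp_ge := H.κm_ge
  κp_le := H.κm_le
  qm_le := H.qp_le
  qp_le := H.qm_le
  top := fun x hx => H.top (L - x) ⟨by linarith [hx.2], by linarith [hx.1]⟩

theorem IsWell.K_pos (H : 𝖶) : 0 < K := H.r_pos.trans_le H.r_le

theorem IsWell.nonneg_left (H : 𝖶) (hc : 0 < c) {x : ℝ} (hx : x ∈ Icc xm b) : 0 ≤ G x - y := by
  have h0 : 0 ≤ xm := le_trans (mul_pos hc H.r_pos).le H.xm_ge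
  rcases hx.1.eq_or_lt with rfl | hlt
  · have := H.taylor_left xm ⟨h0, hx.2⟩
    simp only [sub_self, mul_zero, sub_zero, ne_eq, OfNat.ofNat_ne_zero, not_false_eq_true,
      zero_pow, abs_zero] at this
    exact (abs_eq_zero.1 (le_antisymm this (abs_nonneg _))).ge
  · have h1 := H.left x ⟨h0.trans hx.1, hx.2⟩
    have h2 : 0 ≤ c * r * (x - xm)^2 := mul_nonneg (mul_pos hc H.r_pos).le (sq_nonneg _)
    exact nonneg_of_mul_nonneg_left (h2.trans h1) (sub_pos.2 hlt)

theorem IsWell.nonpos_left (H : 𝖶) (hc : 0 < c) {x : ℝ} (hx : x ∈ Icc 0 xm) : G x - y ≤ 0 := by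
  rcases hx.2.eq_or_lt with rfl | hlt
  · have := H.taylor_left x ⟨hx.1, by linarith [H.xm_le_b]⟩
    simp only [sub_self, mul_zero, sub_zero, ne_eq, OfNat.ofNat_ne_zero, not_false_eq_true,
      zero_pow, abs_zero] at this
    exact (abs_eq_zero.1 (le_antisymm this (abs_nonneg _))).le
  · have h1 := H.left x ⟨hx.1, by linarith [H.xm_le_b]⟩
    have h2 : 0 ≤ c * r * (x - xm)^2 := mul_nonneg (mul_pos hc H.r_pos).le (sq_nonneg _)
    by_contra! hcon
    nlinarith

theorem nonneg_of_deriv_mul_nonneg {f f' : ℝ → ℝ} {s e : ℝ} (hs : s ≤ 0) (he : 0 ≤ e)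
    (hf : ∀ u, HasDerivAt f (f' u) u) (h0 : f 0 = 0) (h : ∀ u ∈ Icc s e, 0 ≤ f' u * u) {u : ℝ}
    (hu : u ∈ Icc s e) : 0 ≤ f u := by
  rw [← h0]
  rcases le_total 0 u with h1 | h1
  · refine monotoneOn_of_hasDerivWithinAt_nonneg (convex_Icc 0 e) (f' := f')
      (fun x _ => (hf x).continuousAt.continuousWithinAt) (fun x _ => (hf x).hasDerivWithinAt)
      (fun x hx => ?_) ⟨le_rfl, he⟩ ⟨h1, hu.2⟩ h1
    rw [interior_Icc] at hx
    exact nonneg_of_mul_nonneg_left (h x ⟨hs.trans hx.1.le, hx.2.le⟩) hx.1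
  · refine antitoneOn_of_hasDerivWithinAt_nonpos (convex_Icc s 0) (f' := f')
      (fun x _ => (hf x).continuousAt.continuousWithinAt) (fun x _ => (hf x).hasDerivWithinAt)
      (fun x hx => ?_) ⟨hu.1, h1⟩ ⟨hs, le_rfl⟩ h1
    rw [interior_Icc] at hx
    have := h x ⟨hx.1.le, hx.2.le.trans he⟩
    by_contra! hcon
    nlinarith [hx.2]

theorem IsWell.isPeak_left (H : 𝖶) (hc : 0 < c)
    (hφ : ∀ x, HasDerivAt φ (G x - y) x) {θ : ℝ} (hθ : 0 < θ) (hθ1 : θ ≤ 1) (hb : b ≤ L) :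
    IsPeak (c / 2) K c r θ κm (-qm / 3) (-xm) (b - xm) (fun u => φ xm - φ (xm + u)) := by
  have hr := H.r_pos
  have hK := H.K_pos
  have hcr : 0 < c * r := mul_pos hc hr
  have hxm : 0 ≤ xm := le_trans hcr.le H.xm_ge
  have hs : -xm ≤ 0 := by linarith
  have he : 0 ≤ b - xm := by linarith [H.xm_le_b]
  have hd : ∀ u, HasDerivAt (fun u => φ xm - φ (xm + u)) (-(G (xm + u) - y)) u := fun u => by
    simpa using ((hφ (xm + u)).comp_const_add xm u).const_sub (φ xm)
  have hmem : ∀ u ∈ Icc (-xm) (b - xm), xm + u ∈ Icc 0 b := fun u hu =>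
    ⟨by linarith [hu.1], by linarith [hu.2]⟩
  have hT : ∀ u ∈ Icc (-xm) (b - xm),
      |G (xm + u) - y - κm * u - qm * u^2| ≤ K * |u|^3 := fun u hu => by
    have := H.taylor_left _ (hmem u hu)
    simpa using this
  refine ⟨hr, H.r_le, hθ, hθ1, by linarith [H.κm_ge], H.κm_le, ?_, by linarith [H.xm_ge],
    by linarith [H.xm_le_b'], fun u hu => ?_, ?_, fun u hu => ?_, fun u hu => ?_⟩
  · rw [abs_div, abs_neg, abs_of_pos (by norm_num : (0 : ℝ) < 3)]
    have := H.qm_le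
    have := abs_nonneg qm
    linarith
  · rw [abs_le]
    constructor <;> linarith [hu.1, hu.2, H.L_le, H.xm_le_b]
  · exact fun u _ => (hd u).continuousAt.continuousWithinAt
  · have := nonneg_of_deriv_mul_nonneg (f := fun u => -(φ xm - φ (xm + u)) - c / 2 * r * u^2)
      (f' := fun u => (G (xm + u) - y) - c * r * u) hs he (fun u => by
        refine ((hd u).neg.sub (((hasDerivAt_id u).pow 2).const_mul (c / 2 * r))).congr_deriv ?_
        simp; ring) (by simp) (fun u hu => by
        have := H.left _ (hmem u hu)
        rw [add_sub_cancel_left] at this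
        nlinarith) hu
    linarith
  · have hu4 : ∀ u : ℝ, |u|^3 * |u| = u^4 := fun u => by
      rw [← pow_succ]; exact (even_two_mul 2).pow_abs u
    have key : ∀ σ : ℝ, |σ| = 1 → 0 ≤ K * u^4 / 4 +
        σ * (φ xm - φ (xm + u) + κm / 2 * u^2 - -qm / 3 * u^3) := by
      intro σ hσ
      refine nonneg_of_deriv_mul_nonneg (f := fun u => K * u^4 / 4 +
        σ * (φ xm - φ (xm + u) + κm / 2 * u^2 - -qm / 3 * u^3))
        (f' := fun u => K * u^3 - σ * (G (xm + u) - y - κm * u - qm * u^2)) hs he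
        (fun u => ?_) (by simp) (fun u hu => ?_) hu
      · refine ((((hasDerivAt_id u).pow 4).const_mul K).div_const 4 |>.add
          ((((hd u).add (((hasDerivAt_id u).pow 2).const_mul (κm / 2))).sub
          (((hasDerivAt_id u).pow 3).const_mul (-qm / 3))).const_mul σ)).congr_deriv ?_
        simp; ring
      · have h1 : |σ * (G (xm + u) - y - κm * u - qm * u^2) * u| ≤ K * u^4 := by
          rw [abs_mul, abs_mul, hσ, one_mul, ← hu4, ← mul_assoc]
          exact mul_le_mul_of_nonneg_right (hT u hu) (abs_nonneg u)
        have h2 := (abs_le.1 h1).2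
        have : K * u^3 * u = K * u^4 := by ring
        nlinarith
    have k1 := key 1 (by simp)
    have k2 := key (-1) (by simp)
    have : 0 ≤ K * u^4 := by positivity
    rw [abs_le]
    constructor <;> linarith

theorem IsWell.b_nonneg (H : 𝖶) (hc : 0 < c) : 0 ≤ b := by
  linarith [mul_pos hc H.r_pos, H.xm_ge, H.xm_le_b]

theorem IsWell.b_le (H : 𝖶) (hc : 0 < c) : b ≤ L := by
  linarith [mul_pos hc H.r_pos, H.xp_le, H.b_le_xp]

theorem hasDerivAt_reflect (hφ : ∀ x, HasDerivAt φ (G x - y) x) (L x : ℝ) :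
    HasDerivAt (fun x => φ L - φ (L - x)) (G (L - x) - y) x := by
  simpa using ((hφ (L - x)).comp_const_sub L x).const_sub (φ L)

/-- The lower bound for the depth of the barrier, at the left end. -/
theorem IsWell.barrier_left (H : 𝖶) (hc : 0 < c)
    (hφ : ∀ x, HasDerivAt φ (G x - y) x) : c^3 / 2 * r^3 ≤ φ 0 - φ xm := by
  have hr := H.r_pos
  have h1 := (H.isPeak_left hc hφ one_pos le_rfl (H.b_le hc)).le (-xm)
    ⟨le_rfl, by linarith [H.b_nonneg hc]⟩
  simp only [add_neg_cancel] at h1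
  have h2 : (c * r)^2 ≤ (-xm)^2 := by
    rw [neg_sq]; exact pow_le_pow_left₀ (mul_pos hc hr).le H.xm_ge 2
  have h3 : c / 2 * r * (c * r)^2 ≤ c / 2 * r * (-xm)^2 :=
    mul_le_mul_of_nonneg_left h2 (by positivity)
  have h4 : c / 2 * r * (c * r)^2 = c^3 / 2 * r^3 := by ring
  linarith

theorem IsWell.barrier_right (H : 𝖶) (hc : 0 < c)
    (hφ : ∀ x, HasDerivAt φ (G x - y) x) : c^3 / 2 * r^3 ≤ φ xp - φ L := by
  have := H.reflect.barrier_left hc (hasDerivAt_reflect hφ L)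
  simpa using this

theorem IsWell.monotoneOn_left (H : 𝖶) (hc : 0 < c)
    (hφ : ∀ x, HasDerivAt φ (G x - y) x) : MonotoneOn φ (Icc xm b) :=
  monotoneOn_of_hasDerivWithinAt_nonneg (convex_Icc _ _)
    (fun x _ => (hφ x).continuousAt.continuousWithinAt) (fun x _ => (hφ x).hasDerivWithinAt)
    fun x hx => H.nonneg_left hc (interior_subset hx)

theorem IsWell.antitoneOn_left (H : 𝖶) (hc : 0 < c)
    (hφ : ∀ x, HasDerivAt φ (G x - y) x) : AntitoneOn φ (Icc 0 xm) :=
  antitoneOn_of_hasDerivWithinAt_nonpos (convex_Icc _ _)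
    (fun x _ => (hφ x).continuousAt.continuousWithinAt) (fun x _ => (hφ x).hasDerivWithinAt)
    fun x hx => H.nonpos_left hc (interior_subset hx)

/-- Near the top, the phase grows at least linearly. -/
theorem IsWell.top_left (H : 𝖶) (hc : 0 < c)
    (hφ : ∀ x, HasDerivAt φ (G x - y) x) {x : ℝ} (hx : x ∈ Icc (b - c) b) :
    c * (b - x) ≤ φ b - φ x := by
  have hm : MonotoneOn (fun x => φ x - c * x) (Icc (b - c) b) := by
    have hd : ∀ x, HasDerivAt (fun x => φ x - c * x) (G x - y - c) x := fun x => by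
      simpa using! (hφ x).sub ((hasDerivAt_id x).const_mul c)
    refine monotoneOn_of_hasDerivWithinAt_nonneg (convex_Icc _ _)
      (fun x _ => (hd x).continuousAt.continuousWithinAt) (fun x _ => (hd x).hasDerivWithinAt)
      fun x hx => ?_
    have hx' := interior_subset hx
    have := H.top x ⟨hx'.1, by linarith [hx'.2]⟩
    linarith
  have := hm hx ⟨by linarith, le_rfl⟩ hx.2
  simp only at this
  linarith

theorem IsWell.hill_left (H : 𝖶) (hc : 0 < c)
    (hφ : ∀ x, HasDerivAt φ (G x - y) x) : c^2 ≤ φ b - φ xm := by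
  have h1 := H.top_left hc hφ (x := b - c) ⟨le_rfl, by linarith⟩
  have h2 := H.monotoneOn_left hc hφ ⟨le_rfl, by linarith [H.xm_le_b]⟩
    (⟨by linarith [H.xm_le_b], by linarith⟩ : b - c ∈ Icc xm b) (by linarith [H.xm_le_b])
  nlinarith

theorem IsWell.hill_right (H : 𝖶) (hc : 0 < c)
    (hφ : ∀ x, HasDerivAt φ (G x - y) x) : c^2 ≤ φ xp - φ b := by
  have := H.reflect.hill_left hc (hasDerivAt_reflect hφ L)
  simpa using this

/-- The exponential of the phase over the left half. -/
theorem IsWell.integral_exp_le (H : 𝖶) (hc : 0 < c)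
    (hφ : ∀ x, HasDerivAt φ (G x - y) x) {h : ℝ} (hh : 0 < h) :
    ∫ x in 0..b, exp (2 / h * φ x) ≤
      K * exp (2 / h * φ 0) + (1 / (2 * c) + K / (2 * c^2)) * h * exp (2 / h * φ b) := by
  have hφc : Continuous φ := continuous_iff_continuousAt.2 fun x => (hφ x).continuousAt
  have hE : Continuous fun x => exp (2 / h * φ x) := by fun_prop
  have hK := H.K_pos
  have hcr := mul_pos hc H.r_pos
  have hbc : 0 ≤ b - c := by linarith [H.xm_ge, H.xm_le_b]
  have hh2 : 0 < 2 / h := by positivity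
  rw [← integral_add_adjacent_intervals (hE.intervalIntegrable 0 (b - c))
    (hE.intervalIntegrable (b - c) b)]
  have i1 : ∫ x in 0..(b - c), exp (2 / h * φ x) ≤
      K * (exp (2 / h * φ 0) + h / (2 * c^2) * exp (2 / h * φ b)) := by
    have hbd : ∀ x ∈ Icc 0 (b - c), exp (2 / h * φ x) ≤
        exp (2 / h * φ 0) + h / (2 * c^2) * exp (2 / h * φ b) := by
      intro x hx
      rcases le_total x xm with h1 | h1
      · have := H.antitoneOn_left hc hφ ⟨le_rfl, hx.1.trans h1⟩ ⟨hx.1, h1⟩ hx.1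
        have h2 : exp (2 / h * φ x) ≤ exp (2 / h * φ 0) :=
          exp_le_exp.2 (mul_le_mul_of_nonneg_left this hh2.le)
        have : 0 ≤ h / (2 * c^2) * exp (2 / h * φ b) := by positivity
        linarith
      · have h2 := H.monotoneOn_left hc hφ ⟨h1, by linarith [hx.2]⟩
          (⟨by linarith [H.xm_le_b], by linarith⟩ : b - c ∈ Icc xm b) hx.2
        have h3 := H.top_left hc hφ (x := b - c) ⟨le_rfl, by linarith⟩
        have h4 : φ x ≤ φ b - c^2 := by nlinarith
        have h5 : exp (2 / h * φ x) ≤ exp (-(2 * c^2 / h)) * exp (2 / h * φ b) := by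
          rw [← exp_add]
          apply exp_le_exp.2
          have := mul_le_mul_of_nonneg_left h4 hh2.le
          refine this.trans_eq ?_
          field_simp; ring
        have h6 : exp (-(2 * c^2 / h)) ≤ h / (2 * c^2) := by
          rw [exp_neg, ← inv_div (2 * c^2) h]
          exact inv_anti₀ (by positivity) (by linarith [add_one_le_exp (2 * c^2 / h)])
        have h7 := mul_le_mul_of_nonneg_right h6 (exp_pos (2 / h * φ b)).le
        have := exp_pos (2 / h * φ 0)
        linarith
    have := integral_mono_on (μ := volume) hbc (hE.intervalIntegrable _ _)
      (continuous_const.intervalIntegrable _ _) hbd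
    rw [integral_const, sub_zero, smul_eq_mul] at this
    refine this.trans (mul_le_mul_of_nonneg_right ?_ (by positivity))
    linarith [H.b_le hc, H.L_le]
  have i2 : ∫ x in (b - c)..b, exp (2 / h * φ x) ≤ h / (2 * c) * exp (2 / h * φ b) := by
    have hbd : ∀ x ∈ Icc (b - c) b, exp (2 / h * φ x) ≤
        exp (2 / h * φ b) * exp (2 * c / h * (x - b)) := by
      intro x hx
      rw [← exp_add]
      apply exp_le_exp.2
      have h1 := H.top_left hc hφ hx
      have h2 : φ x ≤ φ b + c * (x - b) := by linarith
      refine (mul_le_mul_of_nonneg_left h2 hh2.le).trans_eq ?_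
      field_simp
    have hk : (2 * c / h) ≠ 0 := by positivity
    have hd : ∀ x ∈ uIcc (b - c) b, HasDerivAt
        (fun x => exp (2 / h * φ b) * (h / (2 * c) * exp (2 * c / h * (x - b))))
        (exp (2 / h * φ b) * exp (2 * c / h * (x - b))) x := by
      intro x _
      have := ((((hasDerivAt_id x).sub_const b).const_mul (2 * c / h)).exp.const_mul
        (h / (2 * c))).const_mul (exp (2 / h * φ b))
      refine this.congr_deriv ?_
      simp only [id]
      field_simp
    have hci : Continuous fun x => exp (2 / h * φ b) * exp (2 * c / h * (x - b)) := by fun_prop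
    refine (integral_mono_on (by linarith) (hE.intervalIntegrable _ _)
      (hci.intervalIntegrable _ _) hbd).trans ?_
    rw [integral_eq_sub_of_hasDerivAt hd (hci.intervalIntegrable _ _)]
    simp only [sub_self, mul_zero, exp_zero, mul_one]
    have : 0 ≤ exp (2 / h * φ b) * (h / (2 * c) * exp (2 * c / h * (b - c - b))) := by positivity
    linarith
  refine (add_le_add i1 i2).trans_eq ?_
  field_simp
  ring

/-! ### Estimates for the iterated integrals -/

theorem sqrt_sub_abs_le {v t : ℝ} (ht : 0 < t) : √(v^2 + t^2) - |v| ≤ t^2 / (t + |v|) := by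
  have h1 : t ≤ √(v^2 + t^2) := le_sqrt_of_sq_le (by nlinarith [sq_nonneg v])
  have h2 : √(v^2 + t^2)^2 = v^2 + t^2 := sq_sqrt (by positivity)
  have h3 : |v| ≤ √(v^2 + t^2) := abs_le_sqrt (by nlinarith [sq_nonneg t])
  have h4 := sq_abs v
  have h5 := abs_nonneg v
  rw [le_div_iff₀ (by positivity)]
  nlinarith

theorem integral_sqrt_sub_abs_le {V : ℝ → ℝ} (hV : Continuous V) {c t s e x0 : ℝ} (hc : 0 < c)
    (ht : 0 < t) (hse : s ≤ e) (hle : ∀ x ∈ Icc s e, c * (x - x0)^2 ≤ |V x|) :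
    ∫ x in s..e, (√(V x^2 + t^2) - |V x|) ≤ π * t * √(t / c) := by
  set k := √(c / t) with hk
  have hk0 : 0 < k := sqrt_pos.2 (by positivity)
  have hk2 : k^2 = c / t := sq_sqrt (by positivity)
  have hd : ∀ x ∈ uIcc s e, HasDerivAt (fun x => t / k * arctan (k * (x - x0)))
      (t / (1 + (k * (x - x0))^2)) x := by
    intro x _
    have := ((((hasDerivAt_id x).sub_const x0).const_mul k).arctan).const_mul (t / k)
    refine this.congr_deriv ?_
    simp only [id]
    field_simp
  have hci : Continuous fun x => t / (1 + (k * (x - x0))^2) :=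
    continuous_const.div (by fun_prop) fun x => by positivity
  have h1 : ∫ x in s..e, (√(V x^2 + t^2) - |V x|) ≤ ∫ x in s..e, t / (1 + (k * (x - x0))^2) := by
    refine integral_mono_on hse (Continuous.intervalIntegrable (by fun_prop) _ _)
      (hci.intervalIntegrable _ _) fun x hx => (sqrt_sub_abs_le ht).trans ?_
    rw [div_le_div_iff₀ (by positivity) (by positivity), mul_pow, hk2]
    have h2 := hle x hx
    have h3 : t * (t + |V x|) ≥ t * (t + c * (x - x0)^2) := by gcongr
    have h4 : t^2 * (1 + c / t * (x - x0)^2) = t * (t + c * (x - x0)^2) := by field_simp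
    linarith
  refine h1.trans ?_
  rw [integral_eq_sub_of_hasDerivAt hd (hci.intervalIntegrable _ _), ← mul_sub]
  have h5 := (arctan_lt_pi_div_two (k * (e - x0))).le
  have h6 := (neg_pi_div_two_lt_arctan (k * (s - x0))).le
  have h7 : t / k = t * √(t / c) := by rw [hk, div_eq_mul_inv, ← sqrt_inv, inv_div]
  rw [h7]
  have : 0 ≤ t * √(t / c) := by positivity
  nlinarith

theorem iterated_integral_le_exp {V φ : ℝ → ℝ} (hV : Continuous V)
    (hφ : ∀ x, HasDerivAt φ (V x) x) {h τ R : ℝ} (hh : 0 < h) (hτ : 0 < τ) {s e : ℝ} (hse : s ≤ e)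
    (hR : h⁻¹ * ∫ x in s..e, (√(V x^2 + τ^2) - |V x|) ≤ R) :
    (∫ x in s..e, exp (-(2 / h * φ x)) * ∫ t in s..x, exp (2 / h * φ t) ≤
      h^2 / τ^2 * (exp R * exp (h⁻¹ * ((∫ x in s..e, |V x|) - (φ e - φ s))))) ∧
    (∫ x in s..e, exp (-(2 / h * φ x)) * ∫ t in x..e, exp (2 / h * φ t) ≤
      h^2 / τ^2 * (exp R * exp (h⁻¹ * ((∫ x in s..e, |V x|) + (φ e - φ s))))) := by
  have hφc : Continuous φ := continuous_iff_continuousAt.2 fun x => (hφ x).continuousAt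
  have hi : ∀ f : ℝ → ℝ, Continuous f → IntervalIntegrable f volume s e := fun f hf =>
    hf.intervalIntegrable _ _
  have hVi : ∫ x in s..e, V x = φ e - φ s :=
    integral_eq_sub_of_hasDerivAt (fun x _ => hφ x) (hi V hV)
  constructor
  · refine (iterated_integral_le hV hφ hh hτ hse).trans ?_
    rw [← exp_add]
    gcongr
    have : ∫ x in s..e, (√(V x^2 + τ^2) - V x) =
        (∫ x in s..e, (√(V x^2 + τ^2) - |V x|)) + ((∫ x in s..e, |V x|) - ∫ x in s..e, V x) := by
      rw [← integral_sub (hi _ (by fun_prop)) (hi _ hV),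
        ← integral_add (hi _ (by fun_prop)) (hi _ (by fun_prop))]
      congr 1; funext x; ring
    rw [this, hVi, mul_add]
    linarith
  · have hV' : Continuous fun x => -V (s + e - x) := by fun_prop
    have hφ' : ∀ x, HasDerivAt (fun x => φ (s + e - x)) (-V (s + e - x)) x := fun x =>
      (hφ (s + e - x)).comp_const_sub (s + e) x
    have key := iterated_integral_le hV' hφ' hh hτ hse
    have e1 : ∫ x in s..e, exp (-(2 / h * φ (s + e - x))) *
        (∫ t in s..x, exp (2 / h * φ (s + e - t))) =
        ∫ x in s..e, exp (-(2 / h * φ x)) * ∫ t in x..e, exp (2 / h * φ t) := by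
      have := integral_comp_sub_left (a := s) (b := e)
        (fun x => exp (-(2 / h * φ x)) * ∫ t in x..e, exp (2 / h * φ t)) (s + e)
      simp only [add_sub_cancel_left, add_sub_cancel_right] at this
      rw [← this]
      congr 1; funext x; congr 1
      have := integral_comp_sub_left (a := s) (b := x) (fun t => exp (2 / h * φ t)) (s + e)
      simpa using this
    have e2 : ∫ x in s..e, (√((-V (s + e - x))^2 + τ^2) - -V (s + e - x)) =
        ∫ x in s..e, (√(V x^2 + τ^2) + V x) := by
      have := integral_comp_sub_left (a := s) (b := e) (fun x => √(V x^2 + τ^2) + V x) (s + e)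
      simp only [add_sub_cancel_left, add_sub_cancel_right] at this
      rw [← this]
      simp only [neg_sq, sub_neg_eq_add]
    rw [e1, e2] at key
    refine key.trans ?_
    rw [← exp_add]
    gcongr
    have : ∫ x in s..e, (√(V x^2 + τ^2) + V x) =
        (∫ x in s..e, (√(V x^2 + τ^2) - |V x|)) + ((∫ x in s..e, |V x|) + ∫ x in s..e, V x) := by
      rw [← integral_add (hi _ (by fun_prop)) (hi _ hV),
        ← integral_add (hi _ (by fun_prop)) (hi _ (by fun_prop))]
      congr 1; funext x; ring
    rw [this, hVi, mul_add]
    linarith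

theorem IsWell.integral_abs_left (H : 𝖶) (hc : 0 < c)
    (hG : Continuous G) (hφ : ∀ x, HasDerivAt φ (G x - y) x) :
    ∫ x in 0..b, |G x - y| = (φ 0 - φ xm) + (φ b - φ xm) := by
  have hi : ∀ f : ℝ → ℝ, Continuous f → ∀ s e, IntervalIntegrable f volume s e :=
    fun f hf s e => hf.intervalIntegrable _ _
  have h0 : 0 ≤ xm := le_trans (mul_pos hc H.r_pos).le H.xm_ge
  have hb : xm ≤ b := by linarith [H.xm_le_b]
  rw [← integral_add_adjacent_intervals (hi _ (by fun_prop) 0 xm) (hi _ (by fun_prop) xm b)]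
  have e1 : ∫ x in 0..xm, |G x - y| = ∫ x in 0..xm, -(G x - y) :=
    integral_congr fun x hx => by
      rw [uIcc_of_le h0] at hx; exact abs_of_nonpos (H.nonpos_left hc hx)
  have e2 : ∫ x in xm..b, |G x - y| = ∫ x in xm..b, (G x - y) :=
    integral_congr fun x hx => by
      rw [uIcc_of_le hb] at hx; exact abs_of_nonneg (H.nonneg_left hc hx)
  rw [e1, e2, integral_neg,
    integral_eq_sub_of_hasDerivAt (fun x _ => hφ x) (hi _ (by fun_prop) _ _),
    integral_eq_sub_of_hasDerivAt (fun x _ => hφ x) (hi _ (by fun_prop) _ _)]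
  ring

theorem IsWell.integral_abs_right (H : 𝖶) (hc : 0 < c)
    (hG : Continuous G) (hφ : ∀ x, HasDerivAt φ (G x - y) x) :
    ∫ x in b..L, |G x - y| = (φ xp - φ L) + (φ xp - φ b) := by
  have := H.reflect.integral_abs_left hc (by fun_prop) (hasDerivAt_reflect hφ L)
  have e := integral_comp_sub_left (a := 0) (b := L - b) (fun x => |G x - y|) L
  simp only [sub_sub_cancel, sub_zero] at e this
  rw [← e, this]
  ring

theorem IsWell.rate_left (H : 𝖶) (hc : 0 < c)
    (hG : Continuous G) {θ : ℝ} (hθ : 0 < θ) (hθ1 : θ ≤ 1) :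
    (θ^2 * r^3)⁻¹ * ∫ x in 0..b, (√((G x - y)^2 + (θ^2 * r^2)^2) - |G x - y|) ≤ π / √c := by
  have hr := H.r_pos
  have h1 := integral_sqrt_sub_abs_le (V := fun x => G x - y) (by fun_prop) hc
    (by positivity : 0 < θ^2 * r^2) (H.b_nonneg hc) H.left'
  rw [inv_mul_le_iff₀ (by positivity)]
  refine h1.trans ?_
  rw [sqrt_div (by positivity), ← mul_pow, sqrt_sq (by positivity)]
  calc π * (θ * r)^2 * (θ * r / √c) = (θ^2 * r^3 * (π / √c)) * θ := by ring
    _ ≤ (θ^2 * r^3 * (π / √c)) * 1 := by gcongr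
    _ = _ := mul_one _

theorem IsWell.rate_right (H : 𝖶) (hc : 0 < c)
    (hG : Continuous G) {θ : ℝ} (hθ : 0 < θ) (hθ1 : θ ≤ 1) :
    (θ^2 * r^3)⁻¹ * ∫ x in b..L, (√((G x - y)^2 + (θ^2 * r^2)^2) - |G x - y|) ≤ π / √c := by
  have := H.reflect.rate_left hc (by fun_prop) hθ hθ1
  have e := integral_comp_sub_left (a := 0) (b := L - b)
    (fun x => √((G x - y)^2 + (θ^2 * r^2)^2) - |G x - y|) L
  simp only [sub_sub_cancel, sub_zero] at e
  rwa [e] at this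

/-! ### Laplace's method at the turning points -/

/-- The exponential of the phase with a linear term. -/
def wexp (r θ : ℝ) (φ : ℝ → ℝ) (ζ : ℂ) (x : ℝ) : ℂ := cexp ((-(2 / (θ^2 * r^3) * φ x) : ℝ) + ζ * x)

theorem IsWell.laplace_left (hc : 0 < c) (hK : 0 < K) :
    ∃ C : ℝ, 0 < C ∧ ∀ {L b : ℝ} {G : ℝ → ℝ} {y r xm xp κm κp qm qp : ℝ} {φ : ℝ → ℝ} {θ : ℝ},
      IsWell c K L b G y r xm xp κm κp qm qp → (∀ x, HasDerivAt φ (G x - y) x) → 0 < θ → θ ≤ 1 →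
      ∀ {ζ : ℂ}, ‖ζ‖ ≤ K / r →
      ‖(∫ x in 0..b, wexp r θ φ ζ x) - wexp r θ φ ζ xm * peakVal r θ κm‖ ≤
        C * θ^2 * (‖wexp r θ φ ζ xm‖ * peakVal r θ κm) ∧
      ∀ {M : ℝ} {ψ : ℝ → ℂ}, 0 ≤ M → (∀ x ∈ Icc 0 b, ‖ψ x‖ ≤ M) →
        (∀ x ∈ Icc 0 b, |x - xm| ≤ c * r → ψ x = 0) →
        ‖∫ x in 0..b, ψ x * wexp r θ φ ζ x‖ ≤ C * M * θ^2 * (‖wexp r θ φ ζ xm‖ *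
          peakVal r θ κm) := by
  obtain ⟨C1, hC1, h1⟩ := IsPeak.laplace (b := c / 2) (c := c) (K := K) (by positivity) hc hK
  obtain ⟨C2, hC2, h2⟩ := IsPeak.laplace_tail (b := c / 2) (c := c) (K := K) (by positivity) hc hK
  refine ⟨max C1 C2, by positivity, ?_⟩
  intro L b G y r xm xp κm κp qm qp φ θ H hφ hθ hθ1 ζ hζ
  have hp := H.isPeak_left hc hφ hθ hθ1 (H.b_le hc)
  have hpv := hp.peakVal_pos (by positivity)
  have hφe : ∀ x : ℝ, wexp r θ φ ζ x = wexp r θ φ ζ xm *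
        peakFun r θ (fun u => φ xm - φ (xm + u)) ζ (x - xm) := by
    intro x
    rw [peakFun, wexp, wexp, ← cexp_add, add_sub_cancel]
    congr 1
    push_cast
    ring
  have hsub : ∀ f : ℝ → ℂ, ∫ x in 0..b, f (x - xm) = ∫ u in (-xm)..(b - xm), f u := fun f => by
    rw [integral_comp_sub_right, zero_sub]
  constructor
  · have e1 : (∫ x in 0..b, wexp r θ φ ζ x) = wexp r θ φ ζ xm *
        ∫ u in (-xm)..(b - xm), peakFun r θ (fun u => φ xm - φ (xm + u)) ζ u := by
      rw [← hsub, ← integral_const_mul]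
      exact integral_congr fun x _ => hφe x
    rw [e1, ← mul_sub, norm_mul]
    calc _ ≤ ‖wexp r θ φ ζ xm‖ *
          (C1 * θ^2 * peakVal r θ κm) := by gcongr; exact h1 hp hζ
      _ ≤ ‖wexp r θ φ ζ xm‖ * (max C1 C2 * θ^2 * peakVal r θ κm) := by gcongr; exact le_max_left _ _
      _ = _ := by ring
  · intro M ψ hM hψ hψ0
    have e1 : (∫ x in 0..b, ψ x * wexp r θ φ ζ x) = wexp r θ φ ζ xm *
        ∫ u in (-xm)..(b - xm), ψ (xm + u) * peakFun r θ (fun u => φ xm - φ (xm + u)) ζ u := by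
      rw [← hsub, ← integral_const_mul]
      refine integral_congr fun x _ => ?_
      simp only [add_sub_cancel]
      rw [hφe x]
      ring
    have hmem : ∀ u ∈ Icc (-xm) (b - xm), xm + u ∈ Icc 0 b := fun u hu =>
      ⟨by linarith [hu.1], by linarith [hu.2]⟩
    rw [e1, norm_mul]
    calc _ ≤ ‖wexp r θ φ ζ xm‖ *
          (C2 * M * θ^2 * peakVal r θ κm) := by
          gcongr
          exact h2 hp hζ hM (fun u hu => hψ _ (hmem u hu)) fun u hu hu' =>
            hψ0 _ (hmem u hu) (by rwa [add_sub_cancel_left])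
      _ ≤ ‖wexp r θ φ ζ xm‖ *
          (max C1 C2 * M * θ^2 * peakVal r θ κm) := by gcongr; exact le_max_right _ _
      _ = _ := by ring

theorem IsWell.laplace_right (hc : 0 < c) (hK : 0 < K) :
    ∃ C : ℝ, 0 < C ∧ ∀ {L b : ℝ} {G : ℝ → ℝ} {y r xm xp κm κp qm qp : ℝ} {φ : ℝ → ℝ} {θ : ℝ},
      IsWell c K L b G y r xm xp κm κp qm qp → (∀ x, HasDerivAt φ (G x - y) x) → 0 < θ → θ ≤ 1 →
      ∀ {ζ : ℂ}, ‖ζ‖ ≤ K / r →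
      ‖(∫ x in b..L, cexp ((2 / (θ^2 * r^3) * φ x : ℝ) - ζ * x)) -
        cexp ((2 / (θ^2 * r^3) * φ xp : ℝ) - ζ * xp) * peakVal r θ κp‖ ≤
        C * θ^2 * (‖cexp ((2 / (θ^2 * r^3) * φ xp : ℝ) - ζ * xp)‖ * peakVal r θ κp) := by
  obtain ⟨C, hC, h1⟩ := IsWell.laplace_left hc hK
  refine ⟨C, hC, ?_⟩
  intro L b G y r xm xp κm κp qm qp φ θ H hφ hθ hθ1 ζ hζ
  obtain ⟨h2, -⟩ := h1 H.reflect (hasDerivAt_reflect hφ L) hθ hθ1 hζ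
  simp only [wexp] at h2
  set k : ℂ := cexp ((2 / (θ^2 * r^3) * φ L : ℝ) - ζ * L) with hk
  have he : ∀ x : ℝ, cexp ((2 / (θ^2 * r^3) * φ (L - x) : ℝ) - ζ * (L - x : ℝ)) =
      k * cexp ((-(2 / (θ^2 * r^3) * (φ L - φ (L - x))) : ℝ) + ζ * x) := by
    intro x
    rw [hk, ← cexp_add]
    congr 1
    push_cast
    ring
  have e1 : (∫ x in b..L, cexp ((2 / (θ^2 * r^3) * φ x : ℝ) - ζ * x)) = k * ∫ x in 0..(L - b),
        cexp ((-(2 / (θ^2 * r^3) * (φ L - φ (L - x))) : ℝ) + ζ * x) := by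
    have := integral_comp_sub_left (a := 0) (b := L - b)
      (fun x : ℝ => cexp ((2 / (θ^2 * r^3) * φ x : ℝ) - ζ * x)) L
    rw [sub_sub_cancel, sub_zero] at this
    rw [← this, ← integral_const_mul]
    simp only [he]
  have e2 := he (L - xp)
  rw [sub_sub_cancel] at e2 h2
  rw [e1, e2, mul_assoc, ← mul_sub, norm_mul, norm_mul]
  rw [mul_assoc ‖k‖, mul_left_comm]
  exact mul_le_mul_of_nonneg_left h2 (norm_nonneg _)

theorem exp_neg_le_div_sq {x : ℝ} (hx : 0 < x) : exp (-x) ≤ 2 / x^2 := by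
  have h := quadratic_le_exp_of_nonneg hx.le
  rw [exp_neg, ← inv_div]
  have h1 : 0 < x^2 / 2 := by positivity
  exact inv_anti₀ h1 (by linarith)

theorem IsWell.isPeak_left_le_one (H : 𝖶) (hc : 0 < c)
    (hφ : ∀ x, HasDerivAt φ (G x - y) x) (hθ : 0 < θ) (hθ1 : θ ≤ 1) :
    √(π / K) * (θ * r) ≤ peakVal r θ κm :=
  (H.isPeak_left hc hφ hθ hθ1 (H.b_le hc)).peakVal_ge (by positivity)

/-- Lower bounds for the two main integrals. -/
theorem IsWell.main_integrals (hc : 0 < c) (hK : 0 < K) :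
    ∃ C : ℝ, 0 < C ∧ ∃ θ0 : ℝ, 0 < θ0 ∧ θ0 ≤ 1 ∧
      ∀ {L b : ℝ} {G : ℝ → ℝ} {y r xm xp κm κp qm qp : ℝ} {φ : ℝ → ℝ} {θ : ℝ},
      IsWell c K L b G y r xm xp κm κp qm qp → (∀ x, HasDerivAt φ (G x - y) x) → 0 < θ → θ ≤ θ0 →
      θ * r * exp (-(2 / (θ^2 * r^3) * φ xm)) ≤
        C * ∫ x in 0..b, exp (-(2 / (θ^2 * r^3) * φ x)) := by
  obtain ⟨C1, hC1, h1⟩ := IsWell.laplace_left hc hK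
  refine ⟨2 / √(π / K), by positivity, min 1 (√(1 / (2 * C1))), by positivity,
    min_le_left _ _, ?_⟩
  intro L b G y r xm xp κm κp qm qp φ θ H hφ hθ hθ0
  set k := 2 / (θ^2 * r^3)
  have hr := H.r_pos
  have hθ1 := hθ0.trans (min_le_left _ _)
  have hθ2 : C1 * θ^2 ≤ 1 / 2 := by
    have : θ^2 ≤ 1 / (2 * C1) := by
      rw [← sq_sqrt (by positivity : 0 ≤ 1 / (2 * C1))]
      exact pow_le_pow_left₀ hθ.le (hθ0.trans (min_le_right _ _)) 2
    calc C1 * θ^2 ≤ C1 * (1 / (2 * C1)) := by gcongr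
      _ = 1 / 2 := by field_simp
  obtain ⟨h2, -⟩ := h1 H hφ hθ hθ1 (ζ := 0) (by rw [norm_zero]; positivity)
  have hpv := H.isPeak_left_le_one hc hφ hθ hθ1
  have hpv0 : 0 < peakVal r θ κm := lt_of_lt_of_le (by positivity) hpv
  simp only [wexp, zero_mul, add_zero, ← ofReal_exp] at h2
  have e1 : ∫ x in 0..b, ((exp (-(k * φ x)) : ℝ) : ℂ) = ((∫ x in 0..b, exp (-(k * φ x)) : ℝ) : ℂ) :=
    intervalIntegral.integral_ofReal
  rw [e1, ← ofReal_mul, ← ofReal_sub, norm_real, norm_real,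
    norm_of_nonneg (exp_pos _).le, norm_eq_abs] at h2
  set B := ∫ x in 0..b, exp (-(k * φ x))
  set e := exp (-(k * φ xm))
  have he : 0 < e := exp_pos _
  have h3 := (abs_le.1 h2).1
  have h4 : C1 * θ^2 * (e * peakVal r θ κm) ≤ 1 / 2 * (e * peakVal r θ κm) := by gcongr
  have h5 : e * peakVal r θ κm ≤ 2 * B := by linarith
  have h6 : e * (√(π / K) * (θ * r)) ≤ 2 * B := (mul_le_mul_of_nonneg_left hpv he.le).trans h5
  have hs : 0 < √(π / K) := by positivity
  rw [div_mul_eq_mul_div, le_div_iff₀ hs]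
  linarith

theorem IsWell.main_integrals_mul (hc : 0 < c) (hK : 0 < K) :
    ∃ C : ℝ, 0 < C ∧ ∃ θ0 : ℝ, 0 < θ0 ∧ θ0 ≤ 1 ∧
      ∀ {L b : ℝ} {G : ℝ → ℝ} {y r xm xp κm κp qm qp : ℝ} {φ : ℝ → ℝ} {θ : ℝ},
      IsWell c K L b G y r xm xp κm κp qm qp → (∀ x, HasDerivAt φ (G x - y) x) → 0 < θ → θ ≤ θ0 →
      (θ * r)^2 * exp (2 / (θ^2 * r^3) * (φ xp - φ xm)) ≤
        C * ((∫ x in b..L, exp (2 / (θ^2 * r^3) * φ x)) *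
          ∫ x in 0..b, exp (-(2 / (θ^2 * r^3) * φ x))) := by
  obtain ⟨C, hC, θ0, hθ₀, hθ₀1, h1⟩ := IsWell.main_integrals hc hK
  refine ⟨C * C, by positivity, θ0, hθ₀, hθ₀1, ?_⟩
  intro L b G y r xm xp κm κp qm qp φ θ H hφ hθ hθ0
  set k := 2 / (θ^2 * r^3)
  have hr := H.r_pos
  have h2 := h1 H hφ hθ hθ0
  have h3 := h1 H.reflect (hasDerivAt_reflect hφ L) hθ hθ0
  have e1 : ∫ x in 0..(L - b), exp (-(k * (φ L - φ (L - x)))) =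
      exp (-(k * φ L)) * ∫ x in b..L, exp (k * φ x) := by
    have := integral_comp_sub_left (a := 0) (b := L - b) (fun x : ℝ => exp (k * φ x)) L
    rw [sub_sub_cancel, sub_zero] at this
    rw [← this, ← integral_const_mul]
    simp only [← exp_add]
    congr 1; funext x; congr 1; ring
  have e2 : exp (-(k * (φ L - φ (L - (L - xp))))) = exp (-(k * φ L)) * exp (k * φ xp) := by
    rw [← exp_add, sub_sub_cancel]; congr 1; ring
  rw [e1, e2] at h3
  have he := exp_pos (-(k * φ L))
  have h4 : θ * r * exp (k * φ xp) ≤ C * ∫ x in b..L, exp (k * φ x) := by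
    refine le_of_mul_le_mul_left ?_ he
    linarith
  have h5 := mul_le_mul h4 h2 (by positivity) (le_trans (by positivity) h4)
  refine Eq.trans_le ?_ (h5.trans_eq (by ring))
  rw [show k * (φ xp - φ xm) = k * φ xp + -(k * φ xm) by ring, exp_add]
  ring

theorem IsWell.integral_exp_right_le (H : 𝖶) (hc : 0 < c)
    (hφ : ∀ x, HasDerivAt φ (G x - y) x) {h : ℝ} (hh : 0 < h) :
    ∫ x in b..L, exp (-(2 / h * φ x)) ≤ K * exp (-(2 / h * φ L)) +
      (1 / (2 * c) + K / (2 * c^2)) * h * exp (-(2 / h * φ b)) := by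
  have h1 := H.reflect.integral_exp_le hc (hasDerivAt_reflect hφ L) hh
  have e0 : ∀ x, exp (2 / h * (φ L - φ (L - x))) =
      exp (2 / h * φ L) * exp (-(2 / h * φ (L - x))) := fun x => by
    rw [← exp_add]; congr 1; ring
  have e1 := integral_comp_sub_left (a := 0) (b := L - b) (fun x : ℝ => exp (-(2 / h * φ x))) L
  rw [sub_sub_cancel, sub_zero] at e1
  simp only [e0, sub_zero, sub_sub_cancel] at h1
  rw [integral_const_mul, e1] at h1
  refine le_of_mul_le_mul_left ?_ (exp_pos (2 / h * φ L))
  refine h1.trans_eq ?_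
  have e2 : ∀ x, exp (2 / h * (φ L - φ x)) = exp (2 / h * φ L) * exp (-(2 / h * φ x)) := fun x => by
    rw [← exp_add]; congr 1; ring
  rw [e2, e2]
  ring

/-- All the remainders in the expansion of the densities and of the trace. -/
theorem IsWell.remainders (hc : 0 < c) (hK : 0 < K) : ∃ C : ℝ, 0 < C ∧
      ∀ {L b : ℝ} {G : ℝ → ℝ} {y r xm xp κm κp qm qp : ℝ} {φ : ℝ → ℝ} {θ h : ℝ},
      IsWell c K L b G y r xm xp κm κp qm qp → Continuous G → (∀ x, HasDerivAt φ (G x - y) x) →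
      φ 0 = 0 → 0 < θ → θ ≤ 1 → h = θ^2 * r^3 →
      (∀ X, X = (θ * r)^2 * exp (2 / h * (φ xp - φ xm)) →
      exp (2 / h * φ L) * (∫ x in 0..L, exp (-(2 / h * φ x)) *
        ∫ t in 0..x, exp (2 / h * φ t)) ≤ C * θ^2 * X ∧
      (∫ x in 0..b, exp (-(2 / h * φ x)) * ∫ t in x..b, exp (2 / h * φ t)) +
        (∫ x in b..L, exp (-(2 / h * φ x)) * ∫ t in x..L, exp (2 / h * φ t)) ≤ C * θ^2 * X ∧
      exp (h⁻¹ * ((∫ x in 0..L, √((G x - y)^2 + (θ^2 * r^2)^2)) + φ L)) * (θ * r)^2 ≤ C * X ∧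
      exp (2 / h * φ L) * (θ * r)^2 ≤ C * θ^8 * X) := by
  set R := π / √c with hR
  set D := 1 / (2 * c) + K / (2 * c^2) with hD
  have hD0 : 0 < D := by positivity
  set C1 := 2 * exp R / c^6 with hC1
  set E := K^2 * (1 / (2 * c^4)) + 2 * (K * D * (1 / (2 * c^2))) + D^2 with hE
  set C3 := exp R * K^6 / (2 * c^4) with hC3
  refine ⟨2 * C1 + E * K^4 + 2 * C3 + exp (2 * R) + 4 / c^12, by positivity, ?_⟩
  intro L b G y r xm xp κm κp qm qp φ θ h H hG hφ h0 hθ hθ1 hh X hX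
  have hr := H.r_pos
  have hrK := H.r_le
  have hhp : 0 < h := by rw [hh]; positivity
  have hb0 := H.b_nonneg hc
  have hbL := H.b_le hc
  have hφc : Continuous φ := continuous_iff_continuousAt.2 fun x => (hφ x).continuousAt
  have hi : ∀ f : ℝ → ℝ, Continuous f → ∀ s e, IntervalIntegrable f volume s e :=
    fun f hf s e => hf.intervalIntegrable _ _
  have hal := H.integral_abs_left hc hG hφ
  have har := H.integral_abs_right hc hG hφ
  have hrl := H.rate_left hc hG hθ hθ1
  have hrr := H.rate_right hc hG hθ hθ1
  rw [← hh] at hrl hrr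
  have hVc : Continuous fun x => G x - y := by fun_prop
  obtain ⟨T1, T4⟩ := iterated_integral_le_exp hVc hφ hhp (by positivity : 0 < θ^2 * r^2) hb0 hrl
  obtain ⟨T2, T5⟩ := iterated_integral_le_exp hVc hφ hhp (by positivity : 0 < θ^2 * r^2) hbL hrr
  have hht : h^2 / (θ^2 * r^2)^2 = r^2 := by rw [hh]; field_simp
  have I1 := H.integral_exp_le hc hφ hhp
  have I2 := H.integral_exp_right_le hc hφ hhp
  have h2h : 0 < 2 / h := by positivity
  have hk : h⁻¹ = 2 / h / 2 := by field_simp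
  -- barriers and hills
  have bl := H.barrier_left hc hφ
  have br := H.barrier_right hc hφ
  have hl := H.hill_left hc hφ
  have hr' := H.hill_right hc hφ
  rw [h0] at bl
  have anti : ∀ {s d : ℝ}, s ≤ d → exp (-(2 / h * d)) ≤ exp (-(2 / h * s)) := fun hd =>
    exp_le_exp.2 (neg_le_neg (mul_le_mul_of_nonneg_left hd h2h.le))
  have ebar : ∀ d : ℝ, c^3 / 2 * r^3 ≤ d → exp (-(2 / h * d)) ≤ 2 * θ^4 / c^6 := fun d hd => by
    refine ((anti hd).trans (exp_neg_le_div_sq (by positivity))).trans_eq ?_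
    rw [hh]; field_simp
  have ehill : ∀ d : ℝ, c^2 ≤ d → exp (-(2 / h * d)) ≤ h^2 / (2 * c^4) := fun d hd => by
    refine ((anti hd).trans (exp_neg_le_div_sq (by positivity))).trans_eq ?_
    field_simp
  have ehill1 : ∀ d : ℝ, c^2 ≤ d → exp (-(2 / h * d)) ≤ h / (2 * c^2) := fun d hd => by
    have h60 : 0 < 2 / h * c^2 := by positivity
    refine (anti hd).trans ?_
    rw [exp_neg, show h / (2 * c^2) = (2 / h * c^2)⁻¹ by field_simp]
    exact inv_anti₀ h60 (by linarith [add_one_le_exp (2 / h * c^2)])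
  rw [← hD] at I1 I2
  have hE0 : 0 ≤ E := by positivity
  clear_value D E
  generalize 2 / h = k at *
  have hα : Continuous fun x => exp (k * φ x) := by fun_prop
  have hβ : Continuous fun x => exp (-(k * φ x)) := by fun_prop
  have hprim : ∀ s : ℝ, Continuous fun x => ∫ t in s..x, exp (k * φ t) := fun s =>
    continuous_primitive (fun a b => hi _ hα a b) s
  have c1 : h⁻¹ * ((∫ x in 0..b, |G x - y|) - (φ b - φ 0)) = -(k * φ xm) := by
    rw [hal, h0, hk]; ring
  have c2 : h⁻¹ * ((∫ x in b..L, |G x - y|) - (φ L - φ b)) = k * (φ xp - φ L) := by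
    rw [har, hk]; ring
  have c4 : h⁻¹ * ((∫ x in 0..b, |G x - y|) + (φ b - φ 0)) = k * (φ b - φ xm) := by
    rw [hal, h0, hk]; ring
  have c5 : h⁻¹ * ((∫ x in b..L, |G x - y|) + (φ L - φ b)) = k * (φ xp - φ b) := by
    rw [har, hk]; ring
  rw [hht, c1] at T1
  rw [hht, c2] at T2
  rw [hht, c4] at T4
  rw [hht, c5] at T5
  set e := exp (k * (φ xp - φ xm)) with he
  have hepos : 0 < e := exp_pos _
  have hXpos : 0 < X := by rw [hX]; positivity
  have hfac : ∀ a d : ℝ, a = (φ xp - φ xm) - d → exp (k * a) = e * exp (-(k * d)) :=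
    fun a d had => by rw [he, ← exp_add, had]; congr 1; ring
  have hθ4 : θ^4 * r^2 * e = θ^2 * X := by rw [hX]; ring
  refine ⟨?_, ?_, ?_, ?_⟩
  · -- splitting of the first remainder
    have hab := integral_add_adjacent_intervals (hi _ (hβ.mul (hprim 0)) 0 b)
      (hi _ (hβ.mul (hprim 0)) b L)
    have hsp : ∫ x in b..L, exp (-(k * φ x)) * ∫ t in 0..x, exp (k * φ t) =
        (∫ x in b..L, exp (-(k * φ x))) * (∫ t in 0..b, exp (k * φ t)) +
        ∫ x in b..L, exp (-(k * φ x)) * ∫ t in b..x, exp (k * φ t) := by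
      have := integral_add (hi _ (hβ.mul (continuous_const (y :=
        ∫ t in 0..b, exp (k * φ t)))) b L) (hi _ (hβ.mul (hprim b)) b L)
      simp only [Pi.mul_apply] at this
      rw [← integral_mul_const, ← this]
      refine integral_congr fun x _ => ?_
      rw [← integral_add_adjacent_intervals (hi _ hα 0 b) (hi _ hα b x)]
      ring
    simp only [Pi.mul_apply] at hab
    rw [← hab, hsp]
    rw [h0, mul_zero, exp_zero, mul_one] at I1
    have hbar : ∀ a d : ℝ, c^3 / 2 * r^3 ≤ d → φ L + a = (φ xp - φ xm) - d →
        exp (k * φ L) * (r^2 * (exp R * exp (k * a))) ≤ C1 * (θ^2 * X) := fun a d hd had => by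
      calc _ = r^2 * exp R * (exp (k * (φ L + a))) := by rw [mul_add, exp_add]; ring
        _ ≤ r^2 * exp R * (e * (2 * θ^4 / c^6)) := by rw [hfac _ d had]; gcongr; exact ebar d hd
        _ = _ := by rw [hC1, ← hθ4]; ring
    have k1 := hbar (-φ xm) _ br (by ring)
    have k2 := hbar (φ xp - φ L) _ bl (by ring)
    rw [mul_neg] at k1
    have k3 : exp (k * φ L) * ((K * exp (-(k * φ L)) + D * h * exp (-(k * φ b))) *
        (K + D * h * exp (k * φ b))) ≤ E * K^4 * (θ^2 * X) := by
      have e0 : ∀ x, exp (k * x) * exp (-(k * x)) = 1 := fun x => by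
        rw [← exp_add, add_neg_cancel, exp_zero]
      have hbar : 0 ≤ c^3 / 2 * r^3 := by positivity
      have a1 : 1 ≤ e * (h^2 / (2 * c^4)) := by
        have := hfac 0 (φ xp - φ xm) (by ring)
        rw [mul_zero, exp_zero] at this
        rw [this]
        gcongr
        exact ehill _ (by linarith [sq_nonneg c])
      have a2 : exp (k * φ b) ≤ e * (h / (2 * c^2)) := by
        rw [hfac (φ b) ((φ xp - φ b) + (0 - φ xm)) (by ring)]
        gcongr
        exact ehill1 _ (by linarith)
      have a3 : exp (k * φ L) * exp (-(k * φ b)) ≤ e * (h / (2 * c^2)) := by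
        rw [← exp_add, ← sub_eq_add_neg, ← mul_sub,
          hfac (φ L - φ b) ((φ xp - φ L) + (φ b - φ xm)) (by ring)]
        gcongr
        exact ehill1 _ (by linarith)
      have a4 : exp (k * φ L) ≤ e := by
        apply exp_le_exp.2
        gcongr
        linarith
      calc _ = K^2 * 1 + K * D * h * exp (k * φ b) +
            K * D * h * (exp (k * φ L) * exp (-(k * φ b))) + D^2 * h^2 * exp (k * φ L) := by
            linear_combination (K^2 + K * D * h * exp (k * φ b)) * e0 (φ L) +
              D^2 * h^2 * exp (k * φ L) * e0 (φ b)
        _ ≤ K^2 * (e * (h^2 / (2 * c^4))) + K * D * h * (e * (h / (2 * c^2))) +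
            K * D * h * (e * (h / (2 * c^2))) + D^2 * h^2 * e := by gcongr
        _ = E * r^4 * (θ^4 * r^2 * e) := by rw [hE, hh]; ring
        _ ≤ _ := by rw [hθ4]; gcongr
    have I0 : 0 ≤ ∫ t in 0..b, exp (k * φ t) := integral_nonneg hb0 fun x _ => (exp_pos _).le
    have hL := (exp_pos (k * φ L)).le
    have s1 := mul_le_mul_of_nonneg_left T1 hL
    have s2 := mul_le_mul_of_nonneg_left T2 hL
    have s3 := mul_le_mul_of_nonneg_left (mul_le_mul I2 I1 I0 (by positivity)) hL
    have : 0 ≤ (2 * C3 + exp (2 * R) + 4 / c^12) * (θ^2 * X) := by positivity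
    rw [mul_add, mul_add]
    linarith
  · have hhill : ∀ a d : ℝ, c^2 ≤ d → a = (φ xp - φ xm) - d →
        r^2 * (exp R * exp (k * a)) ≤ C3 * (θ^2 * X) := fun a d hd had => by
      rw [hfac a d had]
      calc _ ≤ r^2 * (exp R * (e * (h^2 / (2 * c^4)))) := by gcongr; exact ehill d hd
        _ = r^6 * (exp R / (2 * c^4) * (θ^4 * r^2 * e)) := by rw [hh]; ring
        _ ≤ K^6 * (exp R / (2 * c^4) * (θ^4 * r^2 * e)) := by gcongr
        _ = _ := by rw [hC3, ← hθ4]; ring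
    have k4 := hhill (φ b - φ xm) _ hr' (by ring)
    have k5 := hhill (φ xp - φ b) _ hl (by ring)
    have : 0 ≤ (2 * C1 + E * K^4 + exp (2 * R) + 4 / c^12) * (θ^2 * X) := by positivity
    linarith
  · rw [integral_sub (hi _ (by fun_prop) _ _) (hi _ (by fun_prop) _ _)] at hrl hrr
    rw [← integral_add_adjacent_intervals (b := b) (hi _ (by fun_prop) _ _)
      (hi _ (by fun_prop) _ _)]
    have h2 := exp_le_exp.2 (show h⁻¹ * (((∫ x in 0..b, √((G x - y)^2 + (θ^2 * r^2)^2)) +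
        ∫ x in b..L, √((G x - y)^2 + (θ^2 * r^2)^2)) + φ L) ≤
        2 * R + k * (φ xp - φ xm) by
      rw [hal, h0] at hrl
      rw [har] at hrr
      have : h⁻¹ * ((0 - φ xm + (φ b - φ xm)) + (φ xp - φ L + (φ xp - φ b)) + φ L) =
        k * (φ xp - φ xm) := by rw [hk]; ring
      linarith)
    rw [exp_add, ← he] at h2
    have h3 : 0 ≤ (2 * C1 + E * K^4 + 2 * C3 + 4 / c^12) * X := by positivity
    calc _ ≤ exp (2 * R) * e * (θ * r)^2 := by gcongr
      _ = exp (2 * R) * X := by rw [hX]; ring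
      _ ≤ _ := by linarith
  · rw [hfac (φ L) ((φ xp - φ L) + (0 - φ xm)) (by ring), mul_add, neg_add, exp_add]
    have h3 : 0 ≤ (2 * C1 + E * K^4 + 2 * C3 + exp (2 * R)) * (θ^8 * X) := by positivity
    have h4 := ebar _ br
    have h5 := ebar _ bl
    calc _ ≤ e * (2 * θ^4 / c^6 * (2 * θ^4 / c^6)) * (θ * r)^2 := by gcongr
      _ = 4 / c^12 * (θ^8 * X) := by rw [hX]; field_simp; ring
      _ ≤ _ := by linarith

namespace Sys

variable (D : Sys)

/-! ### Comparison with a positive system -/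

/-- `(P, Q)` solves the real positive system that majorizes the parameter `(l, y)`, `|l| ≤ Λ`. -/
def IsPosSol (y : ℂ) (Λ : ℝ) (P Q : ℝ → ℝ) : Prop :=
  ∀ x ∈ Icc 0 D.L, HasDerivWithinAt P (D.h⁻¹ * (Λ * ‖D.bef y x‖ * Q x)) (Icc 0 D.L) x ∧
    HasDerivWithinAt Q (D.h⁻¹ * (‖D.alf y x‖ * P x)) (Icc 0 D.L) x

variable {D}

theorem IsSol.norm_le {p : ℂ × ℂ} {Λ : ℝ} (hΛ : ‖p.1‖ ≤ Λ) {P Q : ℝ → ℂ} (hs : D.IsSol p P Q)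
    {Pr Qr : ℝ → ℝ} (hr : D.IsPosSol p.2 Λ Pr Qr) {s : ℝ} (hs0 : s ∈ Icc 0 D.L)
    (hP : ‖P s‖ ≤ Pr s) (hQ : ‖Q s‖ ≤ Qr s) {x : ℝ} (hx : x ∈ Icc s D.L) :
    ‖P x‖ ≤ Pr x ∧ ‖Q x‖ ≤ Qr x := by
  have hh := D.hh
  have hΛ0 : 0 ≤ Λ := (norm_nonneg _).trans hΛ
  have hsub : Icc s D.L ⊆ Icc 0 D.L := Icc_subset_Icc hs0.1 le_rfl
  have hca := (D.continuous_alf p.2).norm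
  have hcb := (D.continuous_bef p.2).norm
  -- the excess over the majorant
  set ex : (ℝ → ℂ) → (ℝ → ℝ) → ℝ → ℝ := fun f F x => max (‖f (D.pt x)‖ - F (D.pt x)) 0 with hex
  have hex0 : ∀ {f F x}, 0 ≤ ex f F x := le_max_right _ _
  have hexc : ∀ {f F} {f' : ℝ → ℂ} {F' : ℝ → ℝ}, (∀ x ∈ Icc 0 D.L, HasDerivWithinAt f (f' x) (Icc 0 D.L) x) →
      (∀ x ∈ Icc 0 D.L, HasDerivWithinAt F (F' x) (Icc 0 D.L) x) → Continuous (ex f F) := fun h H => by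
    have hc := continuous_subtype_val.comp D.continuous_pt
    exact ((ContinuousOn.comp_continuous (fun x hx => (h x hx).continuousWithinAt) hc
      fun x => (D.pt x).2).norm.sub (ContinuousOn.comp_continuous
        (fun x hx => (H x hx).continuousWithinAt) hc fun x => (D.pt x).2)).max continuous_const
  have hle : ∀ f F, ∀ x ∈ Icc 0 D.L, ‖f x‖ ≤ F x + ex f F x := fun f F x hx => by
    simp only [hex, D.pt_val hx]; linarith [le_max_left (‖f x‖ - F x) 0]
  set u := ex P Pr
  set w := ex Q Qr
  have hc : Continuous fun x => u x + w x := (hexc (fun x hx => (hs x hx).1)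
    fun x hx => (hr x hx).1).add (hexc (fun x hx => (hs x hx).2) fun x hx => (hr x hx).2)
  obtain ⟨C, hC⟩ := isCompact_Icc.exists_bound_of_continuousOn (s := Icc 0 D.L) (f := fun x =>
    D.h⁻¹ * (Λ * ‖D.bef p.2 x‖) + D.h⁻¹ * ‖D.alf p.2 x‖) (by fun_prop)
  replace hC := fun x hx => (le_norm_self _).trans (hC x hx)
  have hC0 : 0 ≤ C := le_trans (by positivity) (hC s hs0)
  set Z : ℝ → ℝ := fun x => ∫ t in s..x, (u t + w t) with hZ
  have hZd : ∀ x, HasDerivAt Z (u x + w x) x := fun x => (hc.integral_hasStrictDerivAt _ _).hasDerivAt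
  have hZs : Z s = 0 := integral_same
  have hZ0 : ∀ x ∈ Icc s D.L, 0 ≤ Z x := fun x hx =>
    integral_nonneg hx.1 fun t _ => add_nonneg hex0 hex0
  have main : ∀ {f f' : ℝ → ℂ} {F F' : ℝ → ℝ},
      (∀ x ∈ Icc 0 D.L, HasDerivWithinAt f (f' x) (Icc 0 D.L) x) →
      (∀ x ∈ Icc 0 D.L, HasDerivWithinAt F (F' x) (Icc 0 D.L) x) → ‖f s‖ ≤ F s →
      (∀ x ∈ Icc 0 D.L, ‖f' x‖ ≤ F' x + C * (u x + w x)) →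
      ∀ x ∈ Icc s D.L, ‖f x‖ ≤ F x + C * Z x := fun {f f' F F'} h H h0 hb => by
    have hm : ∀ {x}, x ∈ Ico s D.L → Icc 0 D.L ∈ nhdsWithin x (Ici x) := fun hx =>
      Filter.mem_of_superset (Icc_mem_nhdsGE hx.2) (Icc_subset_Icc (hs0.1.trans hx.1) le_rfl)
    exact image_norm_le_of_norm_deriv_right_le_deriv_boundary'
      (fun x hx => (h x (hsub hx)).continuousWithinAt.mono hsub)
      (fun x hx => (h x (hsub ⟨hx.1, hx.2.le⟩)).mono_of_mem_nhdsWithin (hm hx))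
      (B := fun x => F x + C * Z x) (by rw [hZs]; linarith)
      (fun x hx => ((H x (hsub hx)).continuousWithinAt.mono hsub).add
        ((hZd x).continuousAt.continuousWithinAt.const_mul C))
      (fun x hx => ((H x (hsub ⟨hx.1, hx.2.le⟩)).mono_of_mem_nhdsWithin (hm hx)).add
        ((hZd x).const_mul C).hasDerivWithinAt) fun x hx => hb x (hsub ⟨hx.1, hx.2.le⟩)
  have mP := main (fun x hx => (hs x hx).1) (fun x hx => (hr x hx).1) hP fun x hx => by
    rw [norm_mul, norm_mul, norm_mul, norm_inv, norm_real, norm_of_nonneg hh.le]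
    calc _ ≤ D.h⁻¹ * (Λ * ‖D.bef p.2 x‖ * (Qr x + w x)) := by gcongr; exact hle Q Qr x hx
      _ = D.h⁻¹ * (Λ * ‖D.bef p.2 x‖ * Qr x) + D.h⁻¹ * (Λ * ‖D.bef p.2 x‖) * w x := by ring
      _ ≤ _ := by
        gcongr
        · exact (le_add_of_nonneg_right (by positivity)).trans (hC x hx)
        · exact le_add_of_nonneg_left hex0
  have mQ := main (fun x hx => (hs x hx).2) (fun x hx => (hr x hx).2) hQ fun x hx => by
    rw [norm_neg, norm_mul, norm_mul, norm_inv, norm_real, norm_of_nonneg hh.le]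
    calc _ ≤ D.h⁻¹ * (‖D.alf p.2 x‖ * (Pr x + u x)) := by gcongr; exact hle P Pr x hx
      _ = D.h⁻¹ * (‖D.alf p.2 x‖ * Pr x) + D.h⁻¹ * ‖D.alf p.2 x‖ * u x := by ring
      _ ≤ _ := by
        gcongr
        · exact (le_add_of_nonneg_left (by positivity)).trans (hC x hx)
        · exact le_add_of_nonneg_right hex0
  have hZle : Z x ≤ 0 := by
    have := norm_le_gronwallBound_of_norm_deriv_right_le (K := 2 * C) (ε := 0)
      (fun x _ => (hZd x).continuousAt.continuousWithinAt) (fun x _ => (hZd x).hasDerivWithinAt)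
      (by rw [hZs, norm_zero]) (fun t ht => ?_) x hx
    · rw [gronwallBound_ε0_δ0] at this
      exact (le_norm_self _).trans this
    · have ht' : t ∈ Icc s D.L := ⟨ht.1, ht.2.le⟩
      have h0 := mul_nonneg hC0 (hZ0 t ht')
      have e : ∀ {f F}, ‖f t‖ ≤ F t + C * Z t → ex f F t ≤ C * Z t := fun h => by
        simp only [hex, D.pt_val (hsub ht')]; exact max_le (by linarith) h0
      rw [norm_of_nonneg (add_nonneg hex0 hex0), norm_of_nonneg (hZ0 t ht')]
      linarith [e (mP t ht'), e (mQ t ht')]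
  have h2 : C * Z x ≤ 0 := mul_nonpos_of_nonneg_of_nonpos hC0 hZle
  exact ⟨by linarith [mP x hx], by linarith [mQ x hx]⟩

variable (D)

/-- The real negative parameter that majorizes `(l, y)`, `|l| ≤ Λ`. -/
def maj (_D : Sys) (Λ : ℝ) (y : ℂ) : ℂ × ℂ := (-(Λ : ℂ), (y.re : ℂ))

theorem phase_ofReal (y x : ℝ) : D.phase y x = ((D.phase y x).re : ℝ) := by simp [phase]

theorem phase_re_re (y : ℂ) (x : ℝ) : (D.phase (y.re : ℂ) x).re = (D.phase y x).re := by
  simp [phase]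

theorem alf_re (y : ℂ) (x : ℝ) : D.alf (y.re : ℂ) x = ((‖D.alf y x‖ : ℝ) : ℂ) := by
  rw [norm_alf, alf, D.phase_ofReal, phase_re_re]; push_cast; rfl

theorem bef_re (y : ℂ) (x : ℝ) : D.bef (y.re : ℂ) x = ((‖D.bef y x‖ : ℝ) : ℂ) := by
  rw [norm_bef, bef, D.phase_ofReal, phase_re_re]; push_cast; rfl

theorem norm_EE (y : ℂ) : ‖D.EE y‖ = exp (D.h⁻¹ * (D.phase y D.L).re) := by
  rw [EE, norm_exp, ← ofReal_inv, re_ofReal_mul]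

theorem EE_re (y : ℂ) : D.EE (y.re : ℂ) = ((‖D.EE y‖ : ℝ) : ℂ) := by
  rw [norm_EE, EE, D.phase_ofReal, phase_re_re]; push_cast; rfl

variable {D}

theorem IsSol.isPosSol {Λ : ℝ} {y : ℂ} {P Q : ℝ → ℂ} (hs : D.IsSol (D.maj Λ y) P Q) :
    D.IsPosSol y Λ (fun x => (P x).re) (fun x => -(Q x).re) := by
  intro x hx
  obtain ⟨h1, h2⟩ := hs x hx
  have a := reCLM.hasFDerivAt.comp_hasDerivWithinAt x h1
  have b := (reCLM.hasFDerivAt.comp_hasDerivWithinAt x h2).neg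
  constructor
  · refine a.congr_deriv ?_
    simp only [maj, bef_re, reCLM_apply, ← ofReal_inv, ← ofReal_neg, ← ofReal_mul, re_ofReal_mul]
    ring
  · refine b.congr_deriv ?_
    simp only [maj, alf_re, reCLM_apply, ← ofReal_inv, neg_re, re_ofReal_mul]
    ring

variable (D) in
/-- The solution with the initial value `(1, 0)` at `x`. -/
theorem isSol_at (p : ℂ × ℂ) (x : Icc 0 D.L) :
    D.IsSol p (fun s => D.p1 p (D.pt s) * D.q2 p x - p.1 * D.r p (D.pt s) * D.q1 p x)
      (fun s => D.q1 p (D.pt s) * D.q2 p x - D.q2 p (D.pt s) * D.q1 p x) := by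
  have := (D.isSol_fst p).lin (D.isSol_snd p) (D.q2 p x) (-D.q1 p x)
  simpa only [mul_neg, ← sub_eq_add_neg] using this

theorem IsPosSol.neg_neg {y : ℂ} {Λ : ℝ} {P Q : ℝ → ℝ} (h : D.IsPosSol y Λ P Q) :
    D.IsPosSol y Λ (fun x => -P x) (fun x => -Q x) := fun x hx =>
  ⟨(h x hx).1.neg.congr_deriv (by ring), (h x hx).2.neg.congr_deriv (by ring)⟩

variable (D) in
/-- The upper transfer coefficient from a point to the end of the interval. -/
def tt1 (p : ℂ × ℂ) : D.X := D.atL (D.p1 p) • D.q2 p - (p.1 * D.atL (D.r p)) • D.q1 p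

variable (D) in
/-- The lower transfer coefficient from a point to the end of the interval. -/
def tt2 (p : ℂ × ℂ) : D.X := D.atL (D.q1 p) • D.q2 p - D.atL (D.q2 p) • D.q1 p

variable (D) in
/-- The polarized density. -/
def mix (p p' : ℂ × ℂ) : D.X :=
  D.be p.2 * (D.EE p.2 • (D.q1 p' * D.tt1 p) + (D.EE p.2)⁻¹ • (D.q2 p' * D.tt2 p))

theorem nn_eq_mix (p : ℂ × ℂ) (x : Icc 0 D.L) : D.nn p x = -D.mix p p x := by
  simp only [nn_apply, mix, tt1, tt2, mul_apply, add_apply, sub_apply, smul_apply]; ring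

variable {p p' : ℂ × ℂ} {Λ Λ' : ℝ}

theorem norm_fundamental_le (hΛ : ‖p.1‖ ≤ Λ) (x : Icc 0 D.L) :
    ‖D.q1 p x‖ ≤ -(D.q1 (D.maj Λ p.2) x).re ∧ ‖D.q2 p x‖ ≤ (D.q2 (D.maj Λ p.2) x).re := by
  have h1 := (D.isSol_fst p).norm_le hΛ (D.isSol_fst (D.maj Λ p.2)).isPosSol D.mem_zero
    (by simp) (by simp) x.2
  have h2 := (D.isSol_snd p).norm_le hΛ (D.isSol_snd (D.maj Λ p.2)).isPosSol.neg_neg D.mem_zero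
    (by simp) (by simp [q2, prim_pt_zero]) x.2
  simp only [D.pt_coe, _root_.neg_neg] at h1 h2
  exact ⟨h1.2, h2.2⟩

theorem norm_transfer_le (hΛ : ‖p.1‖ ≤ Λ) (x : Icc 0 D.L) :
    ‖D.tt1 p x‖ ≤ (D.tt1 (D.maj Λ p.2) x).re ∧ ‖D.tt2 p x‖ ≤ -(D.tt2 (D.maj Λ p.2) x).re := by
  have hd := D.det_eq_one p x.2
  have hd' := D.det_eq_one (D.maj Λ p.2) x.2
  exact (D.isSol_at p x).norm_le hΛ (D.isSol_at (D.maj Λ p.2) x).isPosSol x.2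
    (by rw [D.pt_coe] at hd hd' ⊢; rw [hd, hd']; simp)
    (by simp only [D.pt_coe]; rw [mul_comm, sub_self, mul_comm (D.q1 _ x), sub_self]; simp)
    (x := D.L) ⟨x.2.2, le_rfl⟩

theorem norm_mix_le (hΛ : ‖p.1‖ ≤ Λ) (hΛ' : ‖p'.1‖ ≤ Λ') (h0 : 0 < Λ') (he : p'.2 = p.2)
    (x : Icc 0 D.L) : ‖D.mix p p' x‖ ≤ -(D.mix (D.maj Λ p.2) (D.maj Λ' p.2) x).re := by
  obtain ⟨a1, a2⟩ := norm_fundamental_le (D := D) hΛ' x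
  obtain ⟨b1, b2⟩ := norm_transfer_le (D := D) hΛ x
  rw [he] at a1 a2
  obtain ⟨-, c2, -, c4⟩ := D.conj_fundamental (p := D.maj Λ' p.2) (by simp [maj]) (by simp [maj])
    (by simp [maj, h0.ne']) x
  rw [conj_eq_iff_re] at c2 c4
  have hbe : D.be (D.maj Λ p.2).2 x = ((‖D.be p.2 x‖ : ℝ) : ℂ) := by
    rw [be_apply, be_apply]; exact D.bef_re _ _
  have hEE : D.EE (D.maj Λ p.2).2 = ((‖D.EE p.2‖ : ℝ) : ℂ) := D.EE_re _
  simp only [mix, mul_apply, add_apply, smul_apply]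
  rw [hbe, hEE, ← c2, ← c4, ← ofReal_inv, re_ofReal_mul, add_re, re_ofReal_mul, re_ofReal_mul,
    re_ofReal_mul, re_ofReal_mul, norm_mul, ← mul_neg]
  refine mul_le_mul_of_nonneg_left ((norm_add_le _ _).trans ?_) (norm_nonneg _)
  rw [norm_mul, norm_mul, norm_mul, norm_mul, norm_inv, show ∀ a b c d e f : ℝ,
    -(a * (b * c) + d * (e * f)) = a * (-b * c) + d * (e * -f) from fun _ _ _ _ _ _ => by ring]
  gcongr
  · exact (norm_nonneg _).trans a1
  · exact (norm_nonneg _).trans a2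

/-- The density is bounded by its value at the majorizing parameter. -/
theorem norm_nn_le_re (hΛ : ‖p.1‖ ≤ Λ) (hΛ0 : 0 < Λ) (x : Icc 0 D.L) :
    ‖D.nn p x‖ ≤ (D.nn (D.maj Λ p.2) x).re := by
  rw [nn_eq_mix, nn_eq_mix, norm_neg, neg_re]
  exact norm_mix_le hΛ hΛ hΛ0 rfl x

/-- Finite variation of the trace of the monodromy. -/
theorem tr_sub_tr (l l' y : ℂ) : D.tr (l', y) - D.tr (l, y) =
    (l' - l) * ((D.h : ℂ)⁻¹ * ∫ x in 0..D.L, D.mix (l, y) (l', y) (D.pt x)) := by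
  have key : ∀ {P Q : ℝ → ℂ}, D.IsSol (l', y) P Q → ∀ x ∈ Icc 0 D.L,
      HasDerivWithinAt (fun x => P x * D.q2 (l, y) (D.pt x) - l * D.r (l, y) (D.pt x) * Q x)
        ((l' - l) * ((D.h : ℂ)⁻¹ * (D.be y (D.pt x) * Q x * D.q2 (l, y) (D.pt x))))
        (Icc 0 D.L) x ∧
      HasDerivWithinAt (fun x => D.p1 (l, y) (D.pt x) * Q x - P x * D.q1 (l, y) (D.pt x))
        (-((l' - l) * ((D.h : ℂ)⁻¹ * (D.be y (D.pt x) * Q x * D.q1 (l, y) (D.pt x)))))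
        (Icc 0 D.L) x := by
    intro P Q hs x hx
    obtain ⟨s1, s2⟩ := hs x hx
    obtain ⟨f1, f2⟩ := D.isSol_fst (l, y) x hx
    obtain ⟨g1, g2⟩ := D.isSol_snd (l, y) x hx
    rw [D.be_pt y hx]
    exact ⟨((s1.mul g2).sub (g1.mul s2)).congr_deriv (by ring),
      ((f1.mul s2).sub (s1.mul f2)).congr_deriv (by ring)⟩
  have hF := fun x hx =>
    let k := key (D.isSol_fst (l', y)) x hx
    let k' := key (D.isSol_snd (l', y)) x hx
    ((((k.1.const_mul (D.atL (D.p1 (l, y)))).add (k.2.const_mul (l * D.atL (D.r (l, y))))).const_mul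
      (D.EE y)).add (((k'.1.const_mul (D.atL (D.q1 (l, y)))).add
      (k'.2.const_mul (D.atL (D.q2 (l, y))))).mul_const (D.EE y)⁻¹)).congr_deriv (g' := (l' - l) *
        ((D.h : ℂ)⁻¹ * D.mix (l, y) (l', y) (D.pt x))) (by
      simp only [mix, tt1, tt2, mul_apply, add_apply, sub_apply, smul_apply]; ring)
  have hFI := integral_eq_sub_of_hasDerivAt_of_le D.hL.le (fun x hx => (hF x hx).continuousWithinAt)
    (fun x hx => (hF x ⟨hx.1.le, hx.2.le⟩).hasDerivAt (Icc_mem_nhds hx.1 hx.2))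
    ((continuous_const.mul (continuous_const.mul (D.continuous_ext _))).intervalIntegrable _ _)
  rw [integral_const_mul, integral_const_mul] at hFI
  rw [hFI]
  have hdet := D.det_eq_one (l, y) D.mem_L
  simp only at hdet
  simp only [Pi.add_apply, p1_pt_zero, q1_pt_zero, r_pt_zero, q2_pt_zero, tr, atL]
  linear_combination -(D.EE y * D.p1 (l', y) (D.pt D.L) +
    D.q2 (l', y) (D.pt D.L) * (D.EE y)⁻¹) * hdet

/-- The mass of the density, estimated by the growth of solutions. -/
theorem integral_nn_maj_le (hΛ0 : 0 < Λ) (y : ℂ) :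
    D.h⁻¹ * ∫ x in 0..D.L, (D.nn (D.maj Λ y) (D.pt x)).re ≤ 2 * D.growth (D.maj (2 * Λ) y) / Λ := by
  have hh := D.hh
  set m := D.maj Λ y with hm
  set m' := D.maj (2 * Λ) y with hm'
  have hmm : ∀ Λ', D.maj Λ' m.2 = D.maj Λ' y := fun Λ' => by simp [m, maj]
  have hn : ‖m.1‖ ≤ Λ := by simp [m, maj, abs_of_pos hΛ0]
  have hle : ∫ x in 0..D.L, (D.nn m (D.pt x)).re ≤ ∫ x in 0..D.L, -(D.mix m m' (D.pt x)).re := by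
    refine integral_mono_on D.hL.le ((continuous_re.comp (D.continuous_ext _)).intervalIntegrable _ _)
      ((continuous_re.comp (D.continuous_ext _)).neg.intervalIntegrable _ _) fun x hx => ?_
    have := norm_mix_le (p' := m) hn (hn.trans (by linarith : Λ ≤ 2 * Λ)) (by linarith) rfl (D.pt x)
    rw [hmm, hmm] at this
    rw [nn_eq_mix, neg_re]
    exact ((neg_le_abs _).trans (abs_re_le_norm _)).trans this
  have htr0 : 0 ≤ (D.tr m).re := by
    have b1 := (norm_transfer_le (D := D) hn (D.pt 0)).1
    have a2 := (norm_fundamental_le (D := D) hn (D.pt D.L)).2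
    simp only [hmm, ← hm, tt1, sub_apply, smul_apply, q2_pt_zero, q1_pt_zero, mul_zero, sub_zero,
      mul_one] at b1 a2
    have h1 := (norm_nonneg _).trans b1
    have h2 := (norm_nonneg _).trans a2
    have hEE : D.EE m.2 = ((‖D.EE y‖ : ℝ) : ℂ) := D.EE_re _
    rw [tr, hEE, ← ofReal_inv, add_re, re_ofReal_mul, re_mul_ofReal]
    positivity
  have hgr := (re_le_norm _).trans (D.norm_tr_le (p := m') (by simp [m', maj, hΛ0.ne']))
  have hT := congrArg Complex.re (D.tr_sub_tr m.1 m'.1 (y.re : ℂ))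
  rw [show m'.1 - m.1 = ((-Λ : ℝ) : ℂ) by simp [m, m', maj]; ring, re_ofReal_mul, ← ofReal_inv,
    re_ofReal_mul, sub_re] at hT
  have hintg : (∫ x in 0..D.L, D.mix m m' (D.pt x)).re = ∫ x in 0..D.L, (D.mix m m' (D.pt x)).re :=
    (reCLM.intervalIntegral_comp_comm ((D.continuous_ext _).intervalIntegrable _ _)).symm
  change (D.tr m').re - (D.tr m).re = -Λ * (D.h⁻¹ * (∫ x in 0..D.L, D.mix m m' (D.pt x)).re) at hT
  rw [integral_neg] at hle
  rw [hintg] at hT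
  rw [le_div_iff₀ hΛ0]
  have h1 := mul_le_mul_of_nonneg_left hle (mul_nonneg hΛ0.le (inv_pos.2 hh).le)
  linarith only [h1, hT, hgr, htr0]

/-- The variation of the density with respect to `λ`. -/
theorem integral_norm_nn_sub_le (hΛ0 : 0 < Λ) {l : ℂ} (hl : ‖l‖ ≤ Λ / 2) (y : ℂ) :
    D.h⁻¹ * ∫ x in 0..D.L, ‖D.nn (l, y) (D.pt x) - D.nn (0, y) (D.pt x)‖ ≤
      8 * D.growth (D.maj (2 * Λ) y) * ‖l‖ / Λ^2 := by
  have hh := D.hh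
  have hpt : ∀ x, ‖D.nn (l, y) x - D.nn (0, y) x‖ ≤ (4 * ‖l‖ / Λ) * (D.nn (D.maj Λ y) x).re := by
    intro x
    have hM0 : ‖D.nn (0, y) x‖ ≤ (D.nn (D.maj Λ y) x).re :=
      norm_nn_le_re (p := (0, y)) (by simpa using hΛ0.le) hΛ0 x
    have hd : Differentiable ℂ fun l : ℂ => D.nn (l, y) x := by
      have := (D.ev x).contDiff.comp (D.contDiff_nn_mm.1.comp
        (contDiff_id.prodMk (contDiff_const (c := y)) : ContDiff ℂ ω fun l : ℂ => (l, y)))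
      exact this.differentiable (by simp)
    have hM : ∀ l' : ℂ, ‖l'‖ ≤ Λ → ‖D.nn (l', y) x‖ ≤ (D.nn (D.maj Λ y) x).re := fun l' h =>
      norm_nn_le_re (p := (l', y)) h hΛ0 x
    have := Complex.dist_le_div_mul_dist_of_mapsTo_ball (f := fun l : ℂ => D.nn (l, y) x)
      (c := (0 : ℂ)) (R₁ := Λ) (R₂ := 2 * (D.nn (D.maj Λ y) x).re)  (z := l) hd.differentiableOn ?_ ?_
    · rw [dist_eq_norm, dist_zero_right] at this
      refine this.trans ?_
      have h0 := (norm_nonneg _).trans hM0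
      calc _ = (2 * ‖l‖ / Λ) * (D.nn (D.maj Λ y) x).re := by ring
        _ ≤ _ := by gcongr; norm_num
    · intro l' hl'
      rw [mem_ball_zero_iff] at hl'
      rw [mem_closedBall, dist_eq_norm]
      exact (norm_sub_le _ _).trans (by linarith [hM l' hl'.le])
    · rw [mem_ball_zero_iff]; linarith
  have h1 : ∫ x in 0..D.L, ‖D.nn (l, y) (D.pt x) - D.nn (0, y) (D.pt x)‖ ≤
      ∫ x in 0..D.L, (4 * ‖l‖ / Λ) * (D.nn (D.maj Λ y) (D.pt x)).re :=
    integral_mono_on D.hL.le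
      (((D.continuous_ext _).sub (D.continuous_ext _)).norm.intervalIntegrable _ _)
      ((continuous_const.mul (continuous_re.comp (D.continuous_ext _))).intervalIntegrable _ _)
      fun x _ => hpt _
  rw [integral_const_mul] at h1
  calc _ ≤ D.h⁻¹ * ((4 * ‖l‖ / Λ) * ∫ x in 0..D.L, (D.nn (D.maj Λ y) (D.pt x)).re) := by gcongr
    _ = (4 * ‖l‖ / Λ) * (D.h⁻¹ * ∫ x in 0..D.L, (D.nn (D.maj Λ y) (D.pt x)).re) := by ring
    _ ≤ (4 * ‖l‖ / Λ) * (2 * D.growth (D.maj (2 * Λ) y) / Λ) := by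
        gcongr; exact integral_nn_maj_le hΛ0 y
    _ = _ := by ring

end Sys

namespace Sys

variable (D : Sys)

/-! ### Reflection -/

/-- The system on `[0, L]` obtained by reflecting the interval. -/
def refl : Sys where
  L := D.L
  h := D.h
  G := ⟨fun x => D.G (D.L - x), by fun_prop⟩
  hL := D.hL
  hh := D.hh

theorem phase_refl (y : ℂ) (x : ℝ) : D.refl.phase y x = D.phase y D.L - D.phase y (D.L - x) := by
  have h1 : ∫ s in 0..x, D.G (D.L - s) = (∫ s in 0..D.L, D.G s) - ∫ s in 0..(D.L - x), D.G s := by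
    rw [integral_comp_sub_left (fun s => D.G s) D.L, sub_zero, integral_interval_sub_left] <;>
    exact D.G.continuous.intervalIntegrable _ _
  change ((∫ s in 0..x, D.G (D.L - s) : ℝ) : ℂ) - y * x = _
  rw [h1, phase, phase]
  push_cast
  ring

theorem EE_refl (y : ℂ) : D.refl.EE y = D.EE y := by
  rw [EE, EE, phase_refl]
  change cexp ((D.h : ℂ)⁻¹ * (D.phase y D.L - D.phase y (D.L - D.L))) = _
  rw [sub_self, phase_zero, sub_zero]

theorem alf_refl (y : ℂ) (x : ℝ) : D.refl.alf y x = D.EE y^2 * D.bef y (D.L - x) := by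
  rw [EE_sq, alf, alf, bef, ← cexp_add, phase_refl]
  congr 1
  change (2 / D.h : ℂ) * _ = _
  ring

theorem bef_refl (y : ℂ) (x : ℝ) : D.refl.bef y x = (D.EE y^2)⁻¹ * D.alf y (D.L - x) := by
  rw [EE_sq, alf, alf, bef, ← Complex.exp_neg, ← cexp_add, phase_refl]
  congr 1
  change -((2 / D.h : ℂ) * _) = _
  ring

variable {D}

theorem IsSol.refl {p : ℂ × ℂ} {P Q : ℝ → ℂ} (hs : D.IsSol p P Q) :
    D.refl.IsSol p (fun x => p.1 * (D.EE p.2)⁻¹ * Q (D.L - x)) (fun x => D.EE p.2 * P (D.L - x)) := by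
  intro x hx
  have hE := D.EE_ne_zero p.2
  have hx' : D.L - x ∈ Icc 0 D.L := ⟨sub_nonneg.2 hx.2, sub_le_self _ hx.1⟩
  obtain ⟨h1, h2⟩ := hs _ hx'
  have hd : HasDerivWithinAt (fun x => D.L - x) (-1) (Icc 0 D.L) x := by
    simpa using ((hasDerivAt_id x).const_sub D.L).hasDerivWithinAt
  have hm : MapsTo (fun x => D.L - x) (Icc 0 D.L) (Icc 0 D.L) := fun x hx =>
    ⟨sub_nonneg.2 hx.2, sub_le_self _ hx.1⟩
  constructor
  · refine ((h2.scomp x hd hm).const_mul (p.1 * (D.EE p.2)⁻¹)).congr_deriv ?_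
    rw [bef_refl]
    change _ = (D.h : ℂ)⁻¹ * _
    simp only [neg_smul, one_smul]
    field_simp
  · refine ((h1.scomp x hd hm).const_mul (D.EE p.2)).congr_deriv ?_
    rw [alf_refl]
    change _ = -((D.h : ℂ)⁻¹ * _)
    simp only [neg_smul, one_smul]
    field_simp

variable (D)

/-- The monodromy of the reflected system. -/
theorem monodromy_refl {p : ℂ × ℂ} (hp : p.1 ≠ 0) :
    D.refl.M11 p = D.M11 p ∧ D.refl.M12 p = -(p.1 * D.M21 p) ∧
      p.1 * D.refl.M21 p = -D.M12 p ∧ D.refl.M22 p = D.M22 p := by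
  have hE := D.EE_ne_zero p.2
  have hdet := D.det_monodromy p
  have a1 := (D.isSol_fst p).refl.eq_fst D.refl.mem_L
  have a2 := (D.isSol_fst p).refl.eq_snd D.refl.mem_L
  have b1 := (D.isSol_snd p).refl.eq_fst D.refl.mem_L
  have b2 := (D.isSol_snd p).refl.eq_snd D.refl.mem_L
  have hL : D.L - D.refl.L = 0 := sub_self _
  have hq20 : D.q2 p (D.pt 0) = 1 := by simp [q2, prim_pt_zero]
  simp only [hL, sub_zero, q1_pt_zero, r_pt_zero, p1_pt_zero, hq20, mul_zero, mul_one]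
    at a1 a2 b1 b2
  simp only [M11, M12, M21, M22, atL, EE_refl] at hdet ⊢
  set E := D.EE p.2
  set A := D.p1 p (D.pt D.L)
  set B := D.q1 p (D.pt D.L)
  set C := D.r p (D.pt D.L)
  set F := D.q2 p (D.pt D.L)
  set A' := D.refl.p1 p (D.refl.pt D.refl.L)
  set B' := D.refl.q1 p (D.refl.pt D.refl.L)
  set C' := D.refl.r p (D.refl.pt D.refl.L)
  set F' := D.refl.q2 p (D.refl.pt D.refl.L)
  have hEI : E * E⁻¹ = 1 := mul_inv_cancel₀ hE
  set I := E⁻¹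
  refine ⟨?_, ?_, ?_, ?_⟩
  · apply mul_left_cancel₀ hp
    linear_combination -(E^2 * A) * b1 + E^2 * p.1 * C * a1 + p.1 * E * A * hEI
      - A' * p.1 * E * hdet
  · linear_combination E * I * (B * b1 - F * a1) - p.1 * I * B * hEI - p.1 * C' * E * hdet
  · linear_combination E * I * (p.1 * C * a2 - A * b2) - p.1 * C * E * hEI - B' * p.1 * I * hdet
  · linear_combination -I^2 * (F * a2 - B * b2) + F * I * hEI - F' * I * hdet

theorem mm_eq_nn_refl_of_ne {p : ℂ × ℂ} (hp : p.1 ≠ 0) {x : ℝ} (hx : x ∈ Icc 0 D.L) :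
    D.mm p (D.pt x) = D.refl.nn p (D.refl.pt (D.L - x)) := by
  have hE := D.EE_ne_zero p.2
  have hdet := D.det_monodromy p
  have hx' : D.L - x ∈ Icc 0 D.refl.L := ⟨sub_nonneg.2 hx.2, sub_le_self _ hx.1⟩
  obtain ⟨m1, m2, m3, m4⟩ := D.monodromy_refl hp
  have a2 := (D.isSol_fst p).refl.eq_snd hx'
  have b2 := (D.isSol_snd p).refl.eq_snd hx'
  simp only [sub_sub_cancel, sub_zero] at a2 b2
  have hbe : D.refl.be p.2 (D.refl.pt (D.L - x)) = (D.EE p.2^2)⁻¹ * D.al p.2 (D.pt x) := by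
    rw [D.refl.be_pt _ hx', bef_refl, sub_sub_cancel, D.al_pt _ hx]
  apply mul_left_cancel₀ hp
  have hs : D.refl.q2 p (D.refl.pt (D.L - x)) =
      D.EE p.2 * (D.M22 p * D.p1 p (D.pt x) - D.M21 p * (p.1 * D.r p (D.pt x))) := by
    simp only [M11, M12, M21, M22] at hdet ⊢
    simp only [atL] at hdet ⊢
    linear_combination (D.q1 p (D.pt D.L) * (D.EE p.2)⁻¹) * b2 -
      (D.q2 p (D.pt D.L) * (D.EE p.2)⁻¹) * a2 - D.refl.q2 p (D.refl.pt (D.L - x)) * hdet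
  have hq : p.1 * D.refl.q1 p (D.refl.pt (D.L - x)) =
      D.EE p.2 * (D.M11 p * (p.1 * D.r p (D.pt x)) - D.M12 p * D.p1 p (D.pt x)) := by
    simp only [M11, M12, M21, M22] at hdet ⊢
    simp only [atL] at hdet ⊢
    linear_combination (D.EE p.2 * (p.1 * D.r p (D.pt D.L))) * a2 -
      (D.EE p.2 * D.p1 p (D.pt D.L)) * b2 - p.1 * D.refl.q1 p (D.refl.pt (D.L - x)) * hdet
  rw [lam_mul_mm_eq, nn_eq, m1, m2, m4, hbe]
  have e1 : p.1 * -((D.EE p.2^2)⁻¹ * D.al p.2 (D.pt x) *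
      (D.M11 p * D.refl.q1 p (D.refl.pt (D.L - x)) * D.refl.q2 p (D.refl.pt (D.L - x)) -
        -(p.1 * D.M21 p) * D.refl.q1 p (D.refl.pt (D.L - x))^2 +
        D.refl.M21 p * D.refl.q2 p (D.refl.pt (D.L - x))^2 -
        D.M22 p * D.refl.q1 p (D.refl.pt (D.L - x)) * D.refl.q2 p (D.refl.pt (D.L - x)))) =
      -((D.EE p.2^2)⁻¹ * D.al p.2 (D.pt x) * ((D.M11 p - D.M22 p) *
        (p.1 * D.refl.q1 p (D.refl.pt (D.L - x))) * D.refl.q2 p (D.refl.pt (D.L - x)) +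
        D.M21 p * (p.1 * D.refl.q1 p (D.refl.pt (D.L - x)))^2 -
        D.M12 p * D.refl.q2 p (D.refl.pt (D.L - x))^2)) := by
    linear_combination (-((D.EE p.2^2)⁻¹ * D.al p.2 (D.pt x) *
      D.refl.q2 p (D.refl.pt (D.L - x))^2)) * m3
  rw [e1, hs, hq]
  field_simp
  linear_combination (-(D.al p.2 (D.pt x)) * (D.M12 p * D.p1 p (D.pt x)^2
      + (D.M22 p - D.M11 p) * D.p1 p (D.pt x) * (p.1 * D.r p (D.pt x))
      - D.M21 p * (p.1 * D.r p (D.pt x))^2)) * hdet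

/-- The second density is the first one of the reflected system. -/
theorem mm_eq_nn_refl (p : ℂ × ℂ) {x : ℝ} (hx : x ∈ Icc 0 D.L) :
    D.mm p (D.pt x) = D.refl.nn p (D.refl.pt (D.L - x)) := by
  obtain ⟨l, y⟩ := p
  have h1 : Continuous fun l : ℂ => D.mm (l, y) (D.pt x) :=
    (D.ev _).continuous.comp (D.contDiff_nn_mm.2.continuous.comp (by fun_prop))
  have h2 : Continuous fun l : ℂ => D.refl.nn (l, y) (D.refl.pt (D.L - x)) :=
    (D.refl.ev _).continuous.comp (D.refl.contDiff_nn_mm.1.continuous.comp (by fun_prop))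
  exact congrFun (h1.ext_on (dense_compl_singleton (0 : ℂ)) h2 fun l hl =>
    D.mm_eq_nn_refl_of_ne (p := (l, y)) hl hx) l

theorem integral_mul_mm (p : ℂ × ℂ) (v : ℝ → ℂ) : ∫ x in 0..D.L, v x * D.mm p (D.pt x) =
      ∫ x in 0..D.L, v (D.L - x) * D.refl.nn p (D.refl.pt x) := by
  have h1 := integral_comp_sub_left (a := 0) (b := D.L) (fun x => v x * D.mm p (D.pt x)) D.L
  simp only [sub_zero, sub_self] at h1
  rw [← h1]
  refine integral_congr fun x hx => ?_
  rw [uIcc_of_le D.hL.le] at hx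
  simp only
  rw [D.mm_eq_nn_refl p ⟨sub_nonneg.2 hx.2, sub_le_self _ hx.1⟩, sub_sub_cancel]

theorem tr_refl {p : ℂ × ℂ} (hp : p.1 ≠ 0) : D.refl.tr p = D.tr p := by
  obtain ⟨m1, -, -, m4⟩ := D.monodromy_refl hp
  rw [tr_eq, tr_eq, m1, m4]

theorem jj_refl (y : ℂ) : D.refl.jj y = D.jj y := by
  have h1 : (fun l : ℂ => D.refl.tr (l, y)) = fun l => D.tr (l, y) :=
    Continuous.ext_on (dense_compl_singleton (0 : ℂ))
      (D.refl.contDiff_tr.continuous.comp (by fun_prop)) (D.contDiff_tr.continuous.comp (by fun_prop))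
      fun l hl => D.tr_refl (p := (l, y)) hl
  have h2 := D.refl.hasDerivAt_tr_zero y
  rw [h1] at h2
  exact neg_injective (h2.unique (D.hasDerivAt_tr_zero y))

end Sys

namespace Sys

variable (D : Sys)

/-! ### The densities at `λ = 0` -/

theorem tot_mul (ψ : ℝ → ℂ) (v w : D.X) (hv : ∀ x ∈ Icc 0 D.L, v (D.pt x) = ψ x) :
    D.tot (v * w) = (D.h : ℂ)⁻¹ * ∫ x in 0..D.L, ψ x * w (D.pt x) := by
  rw [tot_apply]
  congr 1
  refine integral_congr fun x hx => ?_
  rw [uIcc_of_le D.hL.le] at hx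
  simp only [mul_apply]
  rw [hv x hx]

theorem prim_pt (v : D.X) {f : ℝ → ℂ} (hf : ∀ x ∈ Icc 0 D.L, v (D.pt x) = f x) {x : ℝ}
    (hx : x ∈ Icc 0 D.L) : D.prim v (D.pt x) = (D.h : ℂ)⁻¹ * ∫ s in 0..x, f s := by
  rw [prim_apply, D.pt_val hx]
  congr 1
  refine integral_congr fun s hs => ?_
  rw [uIcc_of_le hx.1] at hs
  exact hf s ⟨hs.1, hs.2.trans hx.2⟩

theorem intervalIntegrable_of_continuous (f : ℝ → ℂ) (hf : Continuous f) (s e : ℝ) :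
    IntervalIntegrable f volume s e := hf.intervalIntegrable _ _

theorem integral_eq_sub {E : Type*} [NormedAddCommGroup E] [NormedSpace ℝ E] {f : ℝ → E}
    (hf : Continuous f) (x e : ℝ) : ∫ s in x..e, f s = (∫ s in 0..e, f s) - ∫ s in 0..x, f s :=
  (integral_interval_sub_left (hf.intervalIntegrable _ _) (hf.intervalIntegrable _ _)).symm

theorem continuous_integral_left {E : Type*} [NormedAddCommGroup E] [NormedSpace ℝ E]
    {f : ℝ → E} (hf : Continuous f) (e : ℝ) : Continuous fun x => ∫ s in x..e, f s :=
  (continuous_const.sub (continuous_primitive (fun _ _ => hf.intervalIntegrable _ _) 0)).congr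
    fun x => (integral_eq_sub hf x e).symm

theorem integral_nn_zero (y : ℂ) {ψ : ℝ → ℂ} (hψ : Continuous ψ) :
    (D.h : ℂ)⁻¹ * ∫ x in 0..D.L, ψ x * D.nn (0, y) (D.pt x) =
    (D.h : ℂ)⁻¹^2 * (D.EE y * (∫ x in 0..D.L, ψ x * (D.bef y x * ∫ s in 0..x, D.alf y s))
      + (D.EE y)⁻¹ * ∫ x in 0..D.L, ψ x * (D.bef y x * ∫ s in x..D.L, D.alf y s)) := by
  have ha := D.continuous_alf y
  have hb := D.continuous_bef y
  have hi := intervalIntegrable_of_continuous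
  have hp := continuous_primitive (hi _ ha) 0
  have e1 : ∀ x ∈ uIcc 0 D.L, ψ x * D.nn (0, y) (D.pt x) = (D.h : ℂ)⁻¹ *
      (D.EE y * (ψ x * (D.bef y x * ∫ s in 0..x, D.alf y s)) +
      (D.EE y)⁻¹ * (ψ x * (D.bef y x * ∫ s in x..D.L, D.alf y s))) := by
    intro x hx
    rw [uIcc_of_le D.hL.le] at hx
    rw [nn_zero, D.be_pt y hx, atL, D.prim_pt _ (fun x hx => D.al_pt y hx) hx,
      D.prim_pt _ (fun x hx => D.al_pt y hx) D.mem_L, integral_eq_sub ha x]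
    ring
  have hp' := continuous_integral_left ha D.L
  rw [integral_congr e1, integral_const_mul, integral_add (hi _ (by fun_prop) _ _)
      (hi _ (by fun_prop) _ _), integral_const_mul,
    integral_const_mul]
  ring

theorem integral_triangle {f g : ℝ → ℂ} (hf : Continuous f) (hg : Continuous g) (L : ℝ) :
    ∫ x in 0..L, f x * ∫ s in 0..x, g s = ∫ x in 0..L, g x * ∫ s in x..L, f s := by
  have hi := intervalIntegrable_of_continuous
  have hcf := continuous_primitive (hi f hf) 0
  have hcg := continuous_primitive (hi g hg) 0
  have hcL := continuous_integral_left hf L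
  have := integral_eq_sub_of_hasDerivAt (a := 0) (b := L)
    (fun x _ => (hg.integral_hasStrictDerivAt 0 x).hasDerivAt.mul
      ((hf.integral_hasStrictDerivAt 0 x).hasDerivAt.const_sub (∫ s in 0..L, f s)))
    (hi _ (by fun_prop) _ _)
  simp only [Pi.mul_apply, integral_same, sub_self, mul_zero, zero_mul] at this
  rw [← sub_eq_zero, ← neg_eq_zero, neg_sub, ← integral_sub (hi _ (by fun_prop) _ _)
    (hi _ (by fun_prop) _ _), ← this]
  refine integral_congr fun x _ => ?_
  rw [integral_eq_sub hf x]
  ring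

theorem jj_eq (y : ℂ) : D.jj y = (D.h : ℂ)⁻¹ * ∫ x in 0..D.L, D.nn (0, y) (D.pt x) := by
  have ha := D.continuous_alf y
  have hb := D.continuous_bef y
  have h1 := D.integral_nn_zero y (ψ := fun _ => 1) continuous_const
  simp only [one_mul] at h1
  rw [h1, jj, ← integral_triangle ha hb]
  have key : ∀ {u v : D.X} {f g : ℝ → ℂ}, (∀ x ∈ Icc 0 D.L, u (D.pt x) = f x) →
      (∀ x ∈ Icc 0 D.L, v (D.pt x) = g x) → D.atL (D.prim (u * D.prim v)) =
      (D.h : ℂ)⁻¹^2 * ∫ x in 0..D.L, f x * ∫ s in 0..x, g s := by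
    intro u v f g hu hv
    rw [atL, D.prim_pt (u * D.prim v) (f := fun x => (D.h : ℂ)⁻¹ * (f x * ∫ s in 0..x, g s))
      (fun x hx => by rw [mul_apply, hu x hx, D.prim_pt v hv hx]; ring) D.mem_L,
      integral_const_mul]
    ring
  rw [key (fun x hx => D.be_pt y hx) (fun x hx => D.al_pt y hx),
    key (fun x hx => D.al_pt y hx) (fun x hx => D.be_pt y hx)]
  ring

theorem norm_integral_mul_le {ψ f g : ℝ → ℂ} {F : ℝ → ℝ} {M s e : ℝ} (hse : s ≤ e) (hM : 0 ≤ M)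
    (hψ : ∀ x ∈ Icc s e, ‖ψ x‖ ≤ M) (hf : Continuous f) (hF : Continuous F)
    (hgF : ∀ x ∈ Icc s e, ‖g x‖ ≤ F x) :
    ‖∫ x in s..e, ψ x * (f x * g x)‖ ≤ M * ∫ x in s..e, ‖f x‖ * F x := by
  rw [← integral_const_mul]
  refine norm_integral_le_of_norm_le hse ?_ (Continuous.intervalIntegrable (by fun_prop) _ _)
  refine Filter.Eventually.of_forall fun x hx => ?_
  have hx' : x ∈ Icc s e := ⟨hx.1.le, hx.2⟩
  rw [norm_mul, norm_mul]
  have := hψ x hx'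
  have := hgF x hx'
  gcongr

/-- Splitting of the first density at `λ = 0` into the main part and a remainder. -/
theorem norm_integral_nn_zero_sub_le (y : ℂ) {ψ : ℝ → ℂ} (hψ : Continuous ψ) {M b : ℝ} (hM : 0 ≤ M)
    (hψM : ∀ x ∈ Icc 0 D.L, ‖ψ x‖ ≤ M) (hb : b ∈ Icc 0 D.L) :
    ‖(D.h : ℂ)^2 * ((D.h : ℂ)⁻¹ * ∫ x in 0..D.L, ψ x * D.nn (0, y) (D.pt x)) -
      (D.EE y)⁻¹ * ((∫ x in b..D.L, D.alf y x) * ∫ x in 0..b, ψ x * D.bef y x)‖ ≤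
    M * (‖D.EE y‖ * (∫ x in 0..D.L, ‖D.bef y x‖ * ∫ s in 0..x, ‖D.alf y s‖) +
      ‖D.EE y‖⁻¹ * ((∫ x in 0..b, ‖D.bef y x‖ * ∫ s in x..b, ‖D.alf y s‖) +
        ∫ x in b..D.L, ‖D.bef y x‖ * ∫ s in x..D.L, ‖D.alf y s‖)) := by
  have hh : (D.h : ℂ) ≠ 0 := ofReal_ne_zero.2 D.hh.ne'
  have ha := D.continuous_alf y
  have hbe := D.continuous_bef y
  have hi := intervalIntegrable_of_continuous
  have hp := continuous_primitive (hi _ ha) 0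
  have hpr : Continuous fun x => ∫ s in 0..x, ‖D.alf y s‖ :=
    continuous_primitive (fun _ _ => ha.norm.intervalIntegrable _ _) 0
  have hp1 := continuous_integral_left ha b
  have hp2 := continuous_integral_left ha D.L
  have hper := continuous_integral_left ha.norm
  have e1 : ∫ x in 0..D.L, ψ x * (D.bef y x * ∫ s in x..D.L, D.alf y s) =
      (∫ x in b..D.L, D.alf y x) * (∫ x in 0..b, ψ x * D.bef y x) +
      (∫ x in 0..b, ψ x * (D.bef y x * ∫ s in x..b, D.alf y s)) +
      ∫ x in b..D.L, ψ x * (D.bef y x * ∫ s in x..D.L, D.alf y s) := by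
    rw [← integral_add_adjacent_intervals (hi _ (by fun_prop) 0 b) (hi _ (by fun_prop) b D.L)]
    congr 1
    rw [← integral_const_mul, ← integral_add (hi _ (by fun_prop) _ _) (hi _ (by fun_prop) _ _)]
    refine integral_congr fun x _ => ?_
    rw [← integral_add_adjacent_intervals (hi _ ha x b) (hi _ ha b D.L)]
    ring
  rw [D.integral_nn_zero y hψ, ← mul_assoc, ← mul_pow, mul_inv_cancel₀ hh, one_pow, one_mul, e1,
    mul_add, mul_add]
  have nle : ∀ s e : ℝ, s ≤ e → ‖∫ t in s..e, D.alf y t‖ ≤ ∫ t in s..e, ‖D.alf y t‖ := fun s e h =>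
    norm_integral_le_integral_norm h
  have n1 := norm_integral_mul_le D.hL.le hM hψM hbe hpr (fun x hx => nle 0 x hx.1)
  have n2 := norm_integral_mul_le hb.1 hM (fun x hx => hψM x ⟨hx.1, hx.2.trans hb.2⟩) hbe (hper b)
    (fun x hx => nle x b hx.2)
  have n3 := norm_integral_mul_le hb.2 hM (fun x hx => hψM x ⟨hb.1.trans hx.1, hx.2⟩) hbe (hper D.L)
    (fun x hx => nle x D.L hx.2)
  set I1 := ∫ x in 0..D.L, ψ x * (D.bef y x * ∫ s in 0..x, D.alf y s)
  set I2 := ∫ x in 0..b, ψ x * (D.bef y x * ∫ s in x..b, D.alf y s)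
  set I3 := ∫ x in b..D.L, ψ x * (D.bef y x * ∫ s in x..D.L, D.alf y s)
  set AB := (∫ x in b..D.L, D.alf y x) * (∫ x in 0..b, ψ x * D.bef y x)
  have e2 : D.EE y * I1 + ((D.EE y)⁻¹ * AB + (D.EE y)⁻¹ * I2 + (D.EE y)⁻¹ * I3) - (D.EE y)⁻¹ * AB =
      D.EE y * I1 + (D.EE y)⁻¹ * (I2 + I3) := by ring
  rw [e2]
  refine (norm_add_le _ _).trans ?_
  rw [norm_mul, norm_mul, norm_inv, mul_add]
  have n4 := (norm_add_le I2 I3).trans (add_le_add n2 n3)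
  have k1 := mul_le_mul_of_nonneg_left n1 (norm_nonneg (D.EE y))
  have k2 := mul_le_mul_of_nonneg_left n4 (inv_nonneg.2 (norm_nonneg (D.EE y)))
  refine (add_le_add k1 k2).trans_eq ?_
  ring

/-- The leading term of `jj`. -/
def lead (y0 : ℝ) (y : ℂ) (xm xp pm pp : ℝ) : ℂ :=
  (D.EE y)⁻¹ * ((D.h : ℂ)⁻¹^2 *
    (cexp ((2 / D.h * (D.phase y0 xp).re : ℝ) - 2 / D.h * (y - y0) * xp) * pp *
    (cexp ((-(2 / D.h * (D.phase y0 xm).re) : ℝ) + 2 / D.h * (y - y0) * xm) * pm)))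

theorem alf_center (y0 : ℝ) (y : ℂ) (x : ℝ) : D.alf y x =
    cexp ((2 / D.h * (D.phase y0 x).re : ℝ) - 2 / D.h * (y - y0) * x) := by
  rw [alf, ofReal_mul, ← D.phase_ofReal y0, phase, phase]
  congr 1
  push_cast
  ring

theorem bef_center (y0 : ℝ) (y : ℂ) (x : ℝ) : D.bef y x =
    cexp ((-(2 / D.h * (D.phase y0 x).re) : ℝ) + 2 / D.h * (y - y0) * x) := by
  rw [bef, ofReal_neg, ofReal_mul, ← D.phase_ofReal y0, phase, phase]
  congr 1
  push_cast
  ring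

end Sys

namespace Sys

/-! ### Uniform expansions near the real axis -/

/-- The complex parameter `y` is close to the real `y0`, and both `y0` and `Re y` see a well. -/
structure IsCenter (D : Sys) (c K b y0 r θ xm xp κm κp : ℝ) (y : ℂ) : Prop where
  well : ∃ qm qp, IsWell c K D.L b D.G y0 r xm xp κm κp qm qp
  θ_pos : 0 < θ
  h_eq : D.h = θ^2 * r^3
  close : ‖y - y0‖ ≤ K / 2 * (D.h / r)
  well' : ∃ r' xm' xp' κm' κp' qm qp,
    IsWell c K D.L b D.G y.re r' xm' xp' κm' κp' qm qp ∧ r ≤ 2 * r' ∧ r' ≤ 2 * r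

variable {D : Sys} {c K b y0 r θ xm xp κm κp : ℝ} {y : ℂ}

theorem IsCenter.refl (H : D.IsCenter c K b y0 r θ xm xp κm κp y) :
    D.refl.IsCenter c K (D.L - b) y0 r θ (D.L - xp) (D.L - xm) κp κm y where
  well := let ⟨qm, qp, h⟩ := H.well; ⟨qp, qm, h.reflect⟩
  θ_pos := H.θ_pos
  h_eq := H.h_eq
  close := H.close
  well' := let ⟨r', xm', xp', κm', κp', qm, qp, h, h1, h2⟩ := H.well'
    ⟨r', D.L - xp', D.L - xm', κp', κm', qp, qm, h.reflect, h1, h2⟩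

theorem growth_mono {p q : ℂ × ℂ} (h2 : p.2.re = q.2.re) (h1 : ‖p.1‖ ≤ ‖q.1‖) :
    D.growth p ≤ D.growth q := by
  have := D.hh
  refine exp_le_exp.2 (mul_le_mul_of_nonneg_left ?_ (by positivity))
  refine integral_mono_on D.hL.le ((D.continuous_rate p).intervalIntegrable _ _)
    ((D.continuous_rate q).intervalIntegrable _ _) fun x _ => ?_
  rw [rate, rate, h2]
  gcongr

set_option maxHeartbeats 1000000 in
theorem IsCenter.bounds (hc : 0 < c) (hK : 0 < K) : ∃ C : ℝ, 0 < C ∧ ∃ θ0 : ℝ, 0 < θ0 ∧ θ0 ≤ 1 ∧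
    ∀ {D : Sys} {b y0 r θ xm xp κm κp : ℝ} {y : ℂ}, D.IsCenter c K b y0 r θ xm xp κm κp y →
      θ ≤ θ0 → ∀ ℓ, ℓ = D.lead y0 y xm xp (peakVal r θ κm) (peakVal r θ κp) →
      0 < ‖ℓ‖ ∧ ‖D.jj y - ℓ‖ ≤ C * θ^2 * ‖ℓ‖ ∧
      (∀ {ψ : ℝ → ℂ} {M : ℝ}, Continuous ψ → 0 ≤ M → (∀ x ∈ Icc 0 D.L, ‖ψ x‖ ≤ M) →
        (∀ x ∈ Icc 0 b, |x - xm| ≤ c * r → ψ x = 0) →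
        ‖(D.h : ℂ)⁻¹ * ∫ x in 0..D.L, ψ x * D.nn (0, y) (D.pt x)‖ ≤ C * M * θ^2 * ‖ℓ‖) ∧
      (∀ p : ℂ × ℂ, p.2.re = y.re → ‖p.1‖ ≤ (D.h / (2 * r))^2 → D.growth p ≤ C * (D.h * r) * ‖ℓ‖) ∧
      ‖D.EE y‖ ≤ C * θ^8 * (D.h * r) * ‖ℓ‖ := by
  obtain ⟨C1, hC₁, hl⟩ := IsWell.laplace_left hc hK
  obtain ⟨C2, hC₂, hr⟩ := IsWell.laplace_right hc hK
  obtain ⟨C3, hC3, θ1, hθ₁, hθ₁1, hm⟩ := IsWell.main_integrals_mul hc hK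
  obtain ⟨C4, hC4, hrem⟩ := IsWell.remainders hc hK
  set C0 := C1 + C2 with hC0
  have hC₀p : 0 < C0 := add_pos hC₁ hC₂
  refine ⟨4 * C0 + C4 * C3 * 10^6, by positivity, min (θ1 / 3) (√(1 / C0)), by positivity,
    (min_le_left _ _).trans (by linarith), ?_⟩
  intro D b y0 r θ xm xp κm κp y H hθ0 ℓ hℓ
  obtain ⟨qm, qp, W⟩ := H.well
  obtain ⟨r', xm', xp', κm', κp', qm', qp', W', hrr, hrr'⟩ := H.well'
  have hh := D.hh
  have hr0 := W.r_pos
  have hr0' := W'.r_pos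
  have hθ := H.θ_pos
  have hθt : θ ≤ θ1 / 3 := hθ0.trans (min_le_left _ _)
  have hθ1 : θ ≤ 1 := by linarith
  have hCθ : C0 * θ^2 ≤ 1 := by
    have : θ^2 ≤ 1 / C0 := by
      rw [← sq_sqrt (by positivity : 0 ≤ 1 / C0)]
      exact pow_le_pow_left₀ hθ.le (hθ0.trans (min_le_right _ _)) 2
    calc C0 * θ^2 ≤ C0 * (1 / C0) := by gcongr
      _ = 1 := mul_one_div_cancel (by positivity)
  have hC1 : C1 * θ^2 ≤ C0 * θ^2 := by gcongr; linarith
  have hC2 : C2 * θ^2 ≤ C0 * θ^2 := by gcongr; linarith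
  have hEpos : 0 < ‖D.EE y‖ := norm_pos_iff.2 (D.EE_ne_zero y)
  -- Laplace's method at the center
  have hζ : ∀ w : ℂ, ‖w - y0‖ ≤ K / 2 * (D.h / r) → ‖(2 / D.h : ℂ) * (w - y0)‖ ≤ K / r := by
    intro w hw
    rw [norm_mul, norm_div, norm_real, norm_of_nonneg hh.le, Complex.norm_ofNat]
    calc 2 / D.h * ‖w - y0‖ ≤ 2 / D.h * (K / 2 * (D.h / r)) := by gcongr
      _ = K / r := by field_simp
  have hφ₀ : ∀ x, HasDerivAt (fun x => (D.phase y0 x).re) (D.G x - y0) x := fun x => by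
    simpa using D.hasDerivAt_phase_re y0 x
  have hpm := (W.isPeak_left hc hφ₀ hθ hθ1 (W.b_le hc)).peakVal_pos (by positivity)
  have hpp := (W.reflect.isPeak_left hc (hasDerivAt_reflect hφ₀ D.L) hθ hθ1
    (W.reflect.b_le hc)).peakVal_pos (by positivity)
  set pm := peakVal r θ κm
  set pp := peakVal r θ κp
  set ea : ℂ → ℂ := fun w => cexp ((2 / D.h * (D.phase y0 xp).re : ℝ) - 2 / D.h * (w - y0) * xp)
    with hea
  set eb : ℂ → ℂ := fun w =>
    cexp ((-(2 / D.h * (D.phase y0 xm).re) : ℝ) + 2 / D.h * (w - y0) * xm) with heb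
  have hA : ∀ w : ℂ, ‖w - y0‖ ≤ K / 2 * (D.h / r) →
      ‖(∫ x in b..D.L, D.alf w x) - ea w * pp‖ ≤ C0 * θ^2 * (‖ea w‖ * pp) := by
    intro w hw
    have := hr W hφ₀ hθ hθ1 (hζ w hw)
    rw [← H.h_eq] at this
    simp only [D.alf_center y0 w]
    exact this.trans (by gcongr)
  have hB : ∀ w : ℂ, ‖w - y0‖ ≤ K / 2 * (D.h / r) →
      ‖(∫ x in 0..b, D.bef w x) - eb w * pm‖ ≤ C0 * θ^2 * (‖eb w‖ * pm) := by
    intro w hw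
    have := (hl W hφ₀ hθ hθ1 (hζ w hw)).1
    simp only [wexp] at this
    rw [← H.h_eq] at this
    simp only [D.bef_center y0 w]
    exact this.trans (by gcongr)
  have hclose' : ‖(y.re : ℂ) - y0‖ ≤ K / 2 * (D.h / r) := by
    refine le_trans ?_ H.close
    rw [← ofReal_sub, norm_real]
    simpa using abs_re_le_norm (y - y0)
  have hre : ∀ x : ℝ, (2 / D.h * ((y.re : ℂ) - y0) * x).re = (2 / D.h * (y - y0) * x).re := by
    intro x
    rw [show (2 / D.h * ((y.re : ℂ) - y0) * x) = ((2 / D.h * x : ℝ) : ℂ) * ((y.re : ℂ) - y0) by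
        push_cast; ring, show (2 / D.h * (y - y0) * x) = ((2 / D.h * x : ℝ) : ℂ) * (y - y0) by
        push_cast; ring, re_ofReal_mul, re_ofReal_mul]
    simp
  have hna : ‖ea (y.re : ℂ)‖ = ‖ea y‖ := by simp only [hea, norm_exp, sub_re, hre]
  have hnb : ‖eb (y.re : ℂ)‖ = ‖eb y‖ := by simp only [heb, norm_exp, add_re, hre]
  set A' := ∫ x in b..D.L, ‖D.alf y x‖ with hA'
  set B' := ∫ x in 0..b, ‖D.bef y x‖ with hB'
  have hbL := W.b_le hc
  have hb0 := W.b_nonneg hc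
  have upper : ∀ {z w : ℂ} {t : ℝ}, 0 ≤ t → ‖z - w * t‖ ≤ C0 * θ^2 * (‖w‖ * t) →
      ‖z‖ ≤ 2 * (‖w‖ * t) := by
    intro z w t ht h
    have h1 := norm_le_norm_add_norm_sub (w * t) z
    have h2 : ‖w * (t : ℂ)‖ = ‖w‖ * t := by rw [norm_mul, norm_real, norm_of_nonneg ht]
    have h3 : C0 * θ^2 * (‖w‖ * t) ≤ 1 * (‖w‖ * t) := by gcongr
    linarith [norm_sub_rev z (w * t)]
  have hA'le : A' ≤ 2 * (‖ea y‖ * pp) := by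
    have h1 := upper hpp.le (hA _ hclose')
    simp only [D.alf_re] at h1
    rw [intervalIntegral.integral_ofReal, norm_real, hna] at h1
    exact (le_abs_self _).trans h1
  have hB'le : B' ≤ 2 * (‖eb y‖ * pm) := by
    have h1 := upper hpm.le (hB _ hclose')
    simp only [D.bef_re] at h1
    rw [intervalIntegral.integral_ofReal, norm_real, hnb] at h1
    exact (le_abs_self _).trans h1
  have hA0 : 0 ≤ A' := integral_nonneg hbL fun _ _ => norm_nonneg _
  have hB0 : 0 ≤ B' := integral_nonneg hb0 fun _ _ => norm_nonneg _
  have hP : ‖ℓ‖ = ‖D.EE y‖⁻¹ * (D.h⁻¹^2 * (‖ea y‖ * pp * (‖eb y‖ * pm))) := by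
    rw [hℓ, lead]
    simp only [norm_mul, norm_inv, norm_pow, norm_real, norm_of_nonneg hh.le,
      norm_of_nonneg hpp.le, norm_of_nonneg hpm.le]
    rfl
  have hea0 : 0 < ‖ea y‖ := norm_pos_iff.2 (cexp_ne_zero _)
  have heb0 : 0 < ‖eb y‖ := norm_pos_iff.2 (cexp_ne_zero _)
  have hPpos : 0 < ‖ℓ‖ := by rw [hP]; positivity
  have hPab : ‖ea y‖ * pp * (‖eb y‖ * pm) = D.h^2 * ‖D.EE y‖ * ‖ℓ‖ := by rw [hP]; field_simp
  -- the well at the real part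
  set θ' := √(D.h / r'^3) with hθ'
  have hθ'pos : 0 < θ' := by positivity
  have hθ'2 : θ'^2 = D.h / r'^3 := sq_sqrt (by positivity)
  have hh' : D.h = θ'^2 * r'^3 := by rw [hθ'2]; field_simp
  have hθ3 : θ' ≤ 3 * θ := by
    refine le_of_sq_le_sq ?_ (by positivity)
    rw [hθ'2, div_le_iff₀ (by positivity), H.h_eq]
    have : r^3 ≤ (2 * r')^3 := by gcongr
    calc θ^2 * r^3 ≤ θ^2 * (2 * r')^3 := by gcongr
      _ ≤ _ := by linarith only [mul_pos (pow_pos hθ 2) (pow_pos hr0' 3)]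
  have hθ'1 : θ' ≤ 1 := by linarith
  set φ : ℝ → ℝ := fun x => (D.phase y x).re with hφdef
  have hφ : ∀ x, HasDerivAt φ (D.G x - y.re) x := D.hasDerivAt_phase_re y
  have hφ0 : φ 0 = 0 := by simp [hφdef, phase_zero]
  have hX := hm W' hφ hθ'pos (by linarith)
  obtain ⟨R1, R2, R3, R4⟩ := hrem W' D.G.continuous hφ hφ0 hθ'pos hθ'1 hh' _ rfl
  rw [← hh'] at hX
  have hE2 : exp (2 / D.h * φ D.L) = ‖D.EE y‖^2 := by
    rw [norm_EE, ← exp_nat_mul]; congr 1; push_cast; ring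
  simp only [hφdef, ← norm_alf, ← norm_bef] at hX R1 R2
  rw [hE2] at R4
  rw [show ‖D.alf y D.L‖ = ‖D.EE y‖^2 by rw [norm_alf]; exact hE2] at R1
  set X := (θ' * r')^2 * exp (2 / D.h * ((D.phase y xp').re - (D.phase y xm').re)) with hXdef
  have hXle : X ≤ C3 * (4 * (D.h^2 * ‖D.EE y‖ * ‖ℓ‖)) := by
    refine hX.trans ?_
    have := mul_le_mul hA'le hB'le hB0 (by positivity)
    rw [← hPab]
    refine mul_le_mul_of_nonneg_left (this.trans_eq (by ring)) hC3.le
  have hX0 : 0 < X := by positivity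
  have hτ' : (θ' * r')^2 = D.h / r' := by rw [mul_pow, hθ'2]; field_simp
  have hθsq : θ'^2 ≤ 9 * θ^2 := by rw [show 9 * θ^2 = (3 * θ)^2 by ring]; gcongr
  -- the remainder
  have hR : ∀ {ψ : ℝ → ℂ} {M : ℝ}, Continuous ψ → 0 ≤ M → (∀ x ∈ Icc 0 D.L, ‖ψ x‖ ≤ M) →
      ‖(D.h : ℂ)^2 * ((D.h : ℂ)⁻¹ * ∫ x in 0..D.L, ψ x * D.nn (0, y) (D.pt x)) -
      (D.EE y)⁻¹ * ((∫ x in b..D.L, D.alf y x) * ∫ x in 0..b, ψ x * D.bef y x)‖ ≤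
      M * (72 * C4 * C3 * θ^2 * (D.h^2 * ‖ℓ‖)) := by
    intro ψ M hψ hM hψM
    refine (D.norm_integral_nn_zero_sub_le y hψ hM hψM ⟨hb0, hbL⟩).trans
      (mul_le_mul_of_nonneg_left ?_ hM)
    set I1 := ∫ x in 0..D.L, ‖D.bef y x‖ * ∫ s in 0..x, ‖D.alf y s‖
    set I2 := (∫ x in 0..b, ‖D.bef y x‖ * ∫ s in x..b, ‖D.alf y s‖) +
        ∫ x in b..D.L, ‖D.bef y x‖ * ∫ s in x..D.L, ‖D.alf y s‖
    calc ‖D.EE y‖ * I1 + ‖D.EE y‖⁻¹ * I2 = ‖D.EE y‖⁻¹ * (‖D.EE y‖^2 * I1 + I2) := by field_simp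
      _ ≤ ‖D.EE y‖⁻¹ * (C4 * θ'^2 * X + C4 * θ'^2 * X) := by gcongr
      _ ≤ ‖D.EE y‖⁻¹ * (C4 * (9 * θ^2) * (C3 * (4 * (D.h^2 * ‖D.EE y‖ * ‖ℓ‖))) +
          C4 * (9 * θ^2) * (C3 * (4 * (D.h^2 * ‖D.EE y‖ * ‖ℓ‖)))) := by gcongr
      _ = _ := by field_simp; ring
  have hdiv : ∀ {w : ℂ} {t : ℝ}, ‖(D.h : ℂ)^2 * w‖ ≤ D.h^2 * t → ‖w‖ ≤ t := by
    intro w t h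
    rw [norm_mul, norm_pow, norm_real, norm_of_nonneg hh.le] at h
    exact le_of_mul_le_mul_left h (by positivity)
  have hAn := upper hpp.le (hA y H.close)
  have hBn := upper hpm.le (hB y H.close)
  have hbig : 0 ≤ C4 * C3 * θ^2 * (D.h^2 * ‖ℓ‖) := by positivity
  refine ⟨hPpos, ?_, ?_, ?_, ?_⟩
  · apply hdiv
    have h1 := hR (ψ := fun _ => 1) (M := 1) continuous_const zero_le_one (fun _ _ => by simp)
    simp only [one_mul] at h1
    rw [← D.jj_eq] at h1
    have h2 : ‖(D.EE y)⁻¹ * ((∫ x in b..D.L, D.alf y x) * ∫ x in 0..b, D.bef y x) -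
        (D.h : ℂ)^2 * ℓ‖ ≤ 3 * C0 * θ^2 * (D.h^2 * ‖ℓ‖) := by
      have hne : (D.h : ℂ) ≠ 0 := ofReal_ne_zero.2 hh.ne'
      have e1 : (D.h : ℂ)^2 * ℓ = (D.EE y)⁻¹ * (ea y * pp * (eb y * pm)) := by
        rw [hℓ, lead]; simp only [hea, heb]; field_simp
      rw [e1, ← mul_sub, norm_mul, norm_inv]
      set A := ∫ x in b..D.L, D.alf y x
      set B := ∫ x in 0..b, D.bef y x
      have e2 : A * B - ea y * pp * (eb y * pm) =
        (A - ea y * pp) * B + ea y * pp * (B - eb y * pm) := by ring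
      have n1 : ‖ea y * (pp : ℂ)‖ = ‖ea y‖ * pp := by
        rw [norm_mul, norm_real, norm_of_nonneg hpp.le]
      rw [e2]
      calc _ ≤ ‖D.EE y‖⁻¹ * (‖A - ea y * pp‖ * ‖B‖ + ‖ea y * pp‖ * ‖B - eb y * pm‖) := by
            gcongr
            exact (norm_add_le _ _).trans (by rw [norm_mul, norm_mul (ea y * pp)])
        _ ≤ ‖D.EE y‖⁻¹ * (C0 * θ^2 * (‖ea y‖ * pp) * (2 * (‖eb y‖ * pm)) +
            ‖ea y‖ * pp * (C0 * θ^2 * (‖eb y‖ * pm))) := by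
            rw [n1]
            have := hA y H.close
            have := hB y H.close
            gcongr
        _ = 3 * C0 * θ^2 * (‖D.EE y‖⁻¹ * (‖ea y‖ * pp * (‖eb y‖ * pm))) := by ring
        _ = _ := by rw [hPab]; field_simp
    have h3 := norm_add_le_of_le h1 h2
    rw [sub_add_sub_cancel, ← mul_sub] at h3
    refine h3.trans ?_
    have : 0 ≤ C0 * θ^2 * (D.h^2 * ‖ℓ‖) := by positivity
    linarith only [this, hbig]
  · intro ψ M hψ hM hψM hψ0
    apply hdiv
    have h1 := hR hψ hM hψM
    have h2 := (hl W hφ₀ hθ hθ1 (hζ y H.close)).2 hM (fun x hx => hψM x ⟨hx.1, hx.2.trans hbL⟩) hψ0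
    simp only [wexp] at h2
    rw [← H.h_eq] at h2
    have h2' : ‖∫ x in 0..b, ψ x * D.bef y x‖ ≤ C1 * M * θ^2 * (‖eb y‖ * pm) := by
      simp only [D.bef_center y0 y]
      exact h2
    have h3 : ‖(D.EE y)⁻¹ * ((∫ x in b..D.L, D.alf y x) * ∫ x in 0..b, ψ x * D.bef y x)‖ ≤
        2 * C0 * M * θ^2 * (D.h^2 * ‖ℓ‖) := by
      rw [norm_mul, norm_mul, norm_inv]
      calc _ ≤ ‖D.EE y‖⁻¹ * (2 * (‖ea y‖ * pp) * (C1 * M * θ^2 * (‖eb y‖ * pm))) := by gcongr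
        _ = 2 * (C1 * θ^2) * M * (‖D.EE y‖⁻¹ * (‖ea y‖ * pp * (‖eb y‖ * pm))) := by ring
        _ ≤ 2 * (C0 * θ^2) * M * (‖D.EE y‖⁻¹ * (‖ea y‖ * pp * (‖eb y‖ * pm))) := by gcongr
        _ = _ := by rw [hPab]; field_simp
    have h4 := norm_add_le_of_le h1 h3
    rw [sub_add_cancel] at h4
    refine h4.trans ?_
    have : 0 ≤ M * (C0 * θ^2 * (D.h^2 * ‖ℓ‖)) := by positivity
    linarith only [this, mul_nonneg hM hbig]
  · intro p hp2 hp1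
    have h1 : D.growth p ≤ D.growth ((((D.h / r')^2 : ℝ) : ℂ), y) := by
      refine growth_mono hp2 (hp1.trans ?_)
      rw [norm_real, norm_of_nonneg (by positivity)]
      gcongr
    refine h1.trans ?_
    have e1 : D.growth ((((D.h / r')^2 : ℝ) : ℂ), y) =
        exp (D.h⁻¹ * ∫ x in 0..D.L, √((D.G x - y.re)^2 + (θ'^2 * r'^2)^2)) := by
      rw [growth]
      simp only [rate]
      rw [norm_real, norm_of_nonneg (by positivity), ← mul_pow θ' r', hτ']
    rw [mul_add, exp_add, ← e1, hτ'] at R3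
    have e2 : exp (D.h⁻¹ * φ D.L) = ‖D.EE y‖ := by rw [norm_EE]
    rw [e2] at R3
    set g := D.growth ((((D.h / r')^2 : ℝ) : ℂ), y)
    have h2 : g * (‖D.EE y‖ * (D.h / r')) ≤
        (8 * C4 * C3 * (D.h * r) * ‖ℓ‖) * (‖D.EE y‖ * (D.h / r')) := by
      calc _ ≤ C4 * X := by rw [← mul_assoc]; exact R3
        _ ≤ C4 * (C3 * (4 * (D.h^2 * ‖D.EE y‖ * ‖ℓ‖))) := by gcongr
        _ = 4 * C4 * C3 * (D.h * r') * ‖ℓ‖ * (‖D.EE y‖ * (D.h / r')) := by field_simp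
        _ ≤ 4 * C4 * C3 * (D.h * (2 * r)) * ‖ℓ‖ * (‖D.EE y‖ * (D.h / r')) := by gcongr
        _ = _ := by ring
    refine (le_of_mul_le_mul_right h2 (by positivity)).trans ?_
    gcongr
    linarith only [mul_pos hC4 hC3, hC₀p]
  · rw [hτ'] at R4
    have hθ8 : θ'^8 ≤ 3^8 * θ^8 := by rw [← mul_pow]; gcongr
    have h2 : ‖D.EE y‖ * (‖D.EE y‖ * (D.h / r')) ≤
        (8 * 3^8 * C4 * C3 * θ^8 * (D.h * r) * ‖ℓ‖) * (‖D.EE y‖ * (D.h / r')) := by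
      calc _ = ‖D.EE y‖^2 * (D.h / r') := by ring
        _ ≤ C4 * θ'^8 * X := R4
        _ ≤ C4 * (3^8 * θ^8) * (C3 * (4 * (D.h^2 * ‖D.EE y‖ * ‖ℓ‖))) := by gcongr
        _ = 4 * 3^8 * C4 * C3 * θ^8 * (D.h * r') * ‖ℓ‖ * (‖D.EE y‖ * (D.h / r')) := by field_simp
        _ ≤ 4 * 3^8 * C4 * C3 * θ^8 * (D.h * (2 * r)) * ‖ℓ‖ * (‖D.EE y‖ * (D.h / r')) := by gcongr
        _ = _ := by ring
    refine (le_of_mul_le_mul_right h2 (by positivity)).trans ?_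
    gcongr
    linarith only [mul_pos hC4 hC3, hC₀p]

end Sys

namespace Sys

variable {D : Sys} {c K b y0 r θ xm xp κm κp : ℝ} {y : ℂ}

theorem IsCenter.integral_nn (hc : 0 < c) (hK : 0 < K) : ∃ C : ℝ, 0 < C ∧ ∃ θ0 : ℝ, 0 < θ0 ∧ θ0 ≤ 1 ∧
    ∀ {D : Sys} {b y0 r θ xm xp κm κp : ℝ} {y : ℂ}, D.IsCenter c K b y0 r θ xm xp κm κp y →
      θ ≤ θ0 → (∀ ℓ, ℓ = D.lead y0 y xm xp (peakVal r θ κm) (peakVal r θ κp) → 0 < ‖ℓ‖ ∧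
        ‖D.jj y - ℓ‖ ≤ C * θ^2 * ‖ℓ‖) ∧ 0 < ‖D.jj y‖ ∧
      (∀ p : ℂ × ℂ, p.2.re = y.re → ‖p.1‖ ≤ (D.h / (2 * r))^2 →
        D.growth p ≤ C * (D.h * r) * ‖D.jj y‖) ∧
      ‖D.EE y‖ ≤ C * θ^8 * (D.h * r) * ‖D.jj y‖ ∧
      ∀ l : ℂ, ‖l‖ ≤ 4 * ‖D.EE y‖ / ‖D.jj y‖ → ‖l‖ * (16 * r^2) ≤ D.h^2 ∧
        ‖(D.h : ℂ)⁻¹ * (∫ x in 0..D.L, D.nn (l, y) (D.pt x)) - D.jj y‖ ≤ C * θ^2 * ‖D.jj y‖ ∧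
        ∀ {ψ : ℝ → ℂ} {M : ℝ}, Continuous ψ → 0 ≤ M → (∀ x ∈ Icc 0 D.L, ‖ψ x‖ ≤ M) →
          (∀ x ∈ Icc 0 b, |x - xm| ≤ c * r → ψ x = 0) →
          ‖(D.h : ℂ)⁻¹ * ∫ x in 0..D.L, ψ x * D.nn (l, y) (D.pt x)‖ ≤ C * M * θ^2 * ‖D.jj y‖ := by
  obtain ⟨C, hC, θ0, hθ₀, hθ₀1, H⟩ := IsCenter.bounds hc hK
  refine ⟨2 * C + 10^6 * C^2, by positivity, min θ0 (min (1 / (2 * C)) (1 / (128 * C))),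
    by positivity, (min_le_left _ _).trans hθ₀1, ?_⟩
  intro D b y0 r θ xm xp κm κp y hcen hθ0
  obtain ⟨h1, h2, h3, h4, h5⟩ := H hcen (hθ0.trans (min_le_left _ _)) _ rfl
  set ℓ := D.lead y0 y xm xp (peakVal r θ κm) (peakVal r θ κp)
  have hh := D.hh
  have hθ := hcen.θ_pos
  have hr : 0 < r := let ⟨_, _, W⟩ := hcen.well; W.r_pos
  have hθC : θ ≤ 1 / (2 * C) := hθ0.trans ((min_le_right _ _).trans (min_le_left _ _))
  have hθC' : θ ≤ 1 / (128 * C) := hθ0.trans ((min_le_right _ _).trans (min_le_right _ _))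
  have hθ1 : θ ≤ 1 := hθ0.trans ((min_le_left _ _).trans hθ₀1)
  rw [le_div_iff₀ (by positivity)] at hθC hθC'
  have hp : ∀ m n, n ≤ m → θ^m ≤ θ^n := fun m n h => pow_le_pow_of_le_one hθ.le hθ1 h
  have hj : ‖ℓ‖ ≤ 2 * ‖D.jj y‖ := by
    have e : C * θ^2 * ‖ℓ‖ ≤ 1 / 2 * ‖ℓ‖ := by
      gcongr
      nlinarith [hp 2 1 (by norm_num)]
    have := norm_le_norm_add_norm_sub (D.jj y) ℓ
    linarith only [this, e, h2]
  have hj0 : 0 < ‖D.jj y‖ := by linarith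
  set J := ‖D.jj y‖
  have hE : ‖D.EE y‖ ≤ 2 * C * θ^8 * (D.h * r) * J := by
    calc _ ≤ C * θ^8 * (D.h * r) * ‖ℓ‖ := h5
      _ ≤ C * θ^8 * (D.h * r) * (2 * J) := by gcongr
      _ = _ := by ring
  have hg : ∀ p : ℂ × ℂ, p.2.re = y.re → ‖p.1‖ ≤ (D.h / (2 * r))^2 →
      D.growth p ≤ 2 * C * (D.h * r) * J := fun p hp1 hp2 => by
    calc _ ≤ C * (D.h * r) * ‖ℓ‖ := h4 p hp1 hp2
      _ ≤ C * (D.h * r) * (2 * J) := by gcongr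
      _ = _ := by ring
  have hCC : 2 * C ≤ 2 * C + 10^6 * C^2 := by linarith only [sq_nonneg C]
  refine ⟨fun ℓ' hℓ' => hℓ' ▸ ⟨h1, h2.trans (by gcongr; linarith only [sq_nonneg C, hC])⟩, hj0,
    fun p hp1 hp2 => (hg p hp1 hp2).trans (by gcongr), hE.trans (by gcongr), fun l hl => ?_⟩
  have hl8 : ‖l‖ ≤ 8 * C * θ^8 * (D.h * r) := by
    refine hl.trans ((div_le_iff₀ hj0).2 ?_)
    linarith only [hE]
  have hl1 : ‖l‖ * (16 * r^2) ≤ D.h^2 := by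
    have e : 128 * C * θ^8 ≤ θ^2 := by
      calc 128 * C * θ^8 = (θ * (128 * C)) * θ^7 := by ring
        _ ≤ 1 * θ^2 := mul_le_mul hθC' (hp 7 2 (by norm_num)) (by positivity) zero_le_one
        _ = _ := one_mul _
    calc ‖l‖ * (16 * r^2) ≤ 8 * C * θ^8 * (D.h * r) * (16 * r^2) := by gcongr
      _ = (128 * C * θ^8) * (D.h * r^3) := by ring
      _ ≤ θ^2 * (D.h * r^3) := by gcongr
      _ = _ := by rw [hcen.h_eq]; ring
  set Λ := (D.h / (2 * r))^2 / 2 with hΛ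
  have hΛ0 : 0 < Λ := by positivity
  have hpert := D.integral_norm_nn_sub_le hΛ0 (l := l) (by
    rw [hΛ, div_div, div_pow, div_div, le_div_iff₀ (by positivity)]
    linarith only [hl1]) y
  have hgr : D.growth (D.maj (2 * Λ) y) ≤ 2 * C * (D.h * r) * J := hg _ (by simp [maj]) (by
    simp only [maj, norm_neg, norm_real]
    rw [norm_of_nonneg (by positivity)]
    linarith only [hΛ])
  have hpert2 : D.h⁻¹ * ∫ x in 0..D.L, ‖D.nn (l, y) (D.pt x) - D.nn (0, y) (D.pt x)‖ ≤
      8192 * C^2 * θ^2 * J := by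
    refine hpert.trans ?_
    calc 8 * D.growth (D.maj (2 * Λ) y) * ‖l‖ / Λ^2
        ≤ 8 * (2 * C * (D.h * r) * J) * (8 * C * θ^8 * (D.h * r)) / Λ^2 := by gcongr
      _ = 8192 * C^2 * (θ^8 * r^6 / D.h^2) * J := by rw [hΛ]; field_simp; ring
      _ = 8192 * C^2 * θ^4 * J := by rw [hcen.h_eq]; field_simp
      _ ≤ _ := by gcongr 8192 * C^2 * ?_ * J; exact hp 4 2 (by norm_num)
  have hci : ∀ l, Continuous fun x => D.nn (l, y) (D.pt x) := fun l => D.continuous_ext _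
  have hpert3 : ∀ {ψ : ℝ → ℂ} {M : ℝ}, Continuous ψ → 0 ≤ M → (∀ x ∈ Icc 0 D.L, ‖ψ x‖ ≤ M) →
      ‖(D.h : ℂ)⁻¹ * (∫ x in 0..D.L, ψ x * D.nn (l, y) (D.pt x)) -
        (D.h : ℂ)⁻¹ * ∫ x in 0..D.L, ψ x * D.nn (0, y) (D.pt x)‖ ≤
      M * (8192 * C^2 * θ^2 * J) := by
    intro ψ M hψ hM hψM
    have hi : ∀ l, IntervalIntegrable (fun x => ψ x * D.nn (l, y) (D.pt x)) volume 0 D.L :=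
      fun l => (hψ.mul (hci l)).intervalIntegrable _ _
    rw [← mul_sub, ← integral_sub (hi l) (hi 0), norm_mul, norm_inv, norm_real,
      norm_of_nonneg hh.le]
    refine le_trans ?_ (mul_le_mul_of_nonneg_left hpert2 hM)
    rw [mul_left_comm, ← integral_const_mul M]
    refine mul_le_mul_of_nonneg_left ?_ (by positivity)
    refine norm_integral_le_of_norm_le D.hL.le (Filter.Eventually.of_forall fun x hx => ?_)
      ((continuous_const.mul ((hci l).sub (hci 0)).norm).intervalIntegrable _ _)
    rw [← mul_sub, norm_mul]
    exact mul_le_mul_of_nonneg_right (hψM x ⟨hx.1.le, hx.2⟩) (norm_nonneg _)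
  have hθJ : 0 ≤ C^2 * θ^2 * J := by positivity
  refine ⟨hl1, ?_, fun {ψ M} hψ hM hψM hψ0 => ?_⟩
  · have := hpert3 (ψ := fun _ => 1) (M := 1) continuous_const zero_le_one fun _ _ => by simp
    simp only [one_mul] at this
    rw [← D.jj_eq] at this
    have e : 0 ≤ C * θ^2 * J := by positivity
    linarith only [this, hθJ, e]
  · have e1 := hpert3 hψ hM hψM
    have e2 := h3 hψ hM hψM hψ0
    have e3 : C * M * θ^2 * ‖ℓ‖ ≤ C * M * θ^2 * (2 * J) := by gcongr
    have e4 := norm_le_norm_add_norm_sub ((D.h : ℂ)⁻¹ * ∫ x in 0..D.L, ψ x * D.nn (0, y) (D.pt x))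
      ((D.h : ℂ)⁻¹ * ∫ x in 0..D.L, ψ x * D.nn (l, y) (D.pt x))
    rw [norm_sub_rev] at e4
    linarith only [e1, e2, e3, e4, mul_nonneg hM hθJ,
      norm_sub_rev ((D.h : ℂ)⁻¹ * ∫ x in 0..D.L, ψ x * D.nn (0, y) (D.pt x))
      ((D.h : ℂ)⁻¹ * ∫ x in 0..D.L, ψ x * D.nn (l, y) (D.pt x))]

/-- For `l` of the order of the small eigenvalue: the expansion of the trace and of `ww`. -/
theorem IsCenter.expansions (hc : 0 < c) (hK : 0 < K) : ∃ C : ℝ, 0 < C ∧ ∃ θ0 : ℝ, 0 < θ0 ∧ θ0 ≤ 1 ∧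
    ∀ {D : Sys} {b y0 r θ xm xp κm κp : ℝ} {y : ℂ}, D.IsCenter c K b y0 r θ xm xp κm κp y →
      θ ≤ θ0 → 1 ≤ ‖D.EE y‖ → ∀ ℓ, ℓ = D.lead y0 y xm xp (peakVal r θ κm) (peakVal r θ κp) →
      0 < ‖ℓ‖ ∧ 0 < ‖D.jj y‖ ∧ ‖D.jj y - ℓ‖ ≤ C * θ^2 * ‖ℓ‖ ∧
      ∀ l : ℂ, ‖l‖ ≤ 4 * ‖D.EE y‖ / ‖D.jj y‖ →
        ‖D.tr (l, y) - (D.EE y + (D.EE y)⁻¹ - l * D.jj y)‖ ≤ C * θ^2 * ‖D.EE y‖ ∧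
        D.tot (D.nn (l, y)) ≠ 0 ∧ D.tot (D.mm (l, y)) ≠ 0 ∧
        ∀ {v : D.X} {χ : ℝ → ℂ} {M : ℝ}, Continuous χ → (∀ x ∈ Icc 0 D.L, v (D.pt x) = χ x) →
          0 ≤ M → (∀ x, ‖χ x‖ ≤ M) → (∀ x, |x - xm| ≤ c * r → χ x = 1) →
          (∀ x, |x - xp| ≤ c * r → χ x = 0) → ‖D.ww v (l, y) - 1‖ ≤ C * (1 + M) * θ^2 := by
  obtain ⟨C, hC, θ0, hθ₀, hθ₀1, H⟩ := IsCenter.integral_nn hc hK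
  refine ⟨C + 4 * C + 16 * 10^6 * (C + 1)^2, by positivity, min θ0 (1 / (2 * C)), by positivity,
    (min_le_left _ _).trans hθ₀1, ?_⟩
  intro D b y0 r θ xm xp κm κp y hcen hθ0 hE1 ℓ hℓ
  obtain ⟨h0, hJ, hg, hE, hl⟩ := H hcen (hθ0.trans (min_le_left _ _))
  obtain ⟨-, -, -, -, hl'⟩ := H hcen.refl (hθ0.trans (min_le_left _ _))
  simp only [jj_refl, EE_refl] at hl'
  obtain ⟨hℓ0, hjℓ⟩ := h0 ℓ hℓ
  have hh := D.hh
  have hθ := hcen.θ_pos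
  have hr : 0 < r := let ⟨_, _, W⟩ := hcen.well; W.r_pos
  have hθC : θ ≤ 1 / (2 * C) := hθ0.trans (min_le_right _ _)
  have hθ1 : θ ≤ 1 := hθ0.trans ((min_le_left _ _).trans hθ₀1)
  rw [le_div_iff₀ (by positivity)] at hθC
  have hp : ∀ m n, n ≤ m → θ^m ≤ θ^n := fun m n h => pow_le_pow_of_le_one hθ.le hθ1 h
  have hC2 : C * θ^2 ≤ 1 / 2 := by nlinarith [hp 2 1 (by norm_num)]
  refine ⟨hℓ0, hJ, hjℓ.trans (by gcongr; nlinarith), fun l hle => ?_⟩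
  obtain ⟨a1, a2, a3⟩ := hl l hle
  obtain ⟨-, b2, b3⟩ := hl' l hle
  set J := ‖D.jj y‖
  have lower : ∀ {t : ℂ}, ‖t - D.jj y‖ ≤ C * θ^2 * J → J ≤ 2 * ‖t‖ := by
    intro t ht
    have h1 := norm_le_norm_add_norm_sub t (D.jj y)
    have : C * θ^2 * J ≤ 1 / 2 * J := by gcongr
    linarith only [h1, ht, this]
  have htn : D.tot (D.nn (l, y)) = (D.h : ℂ)⁻¹ * ∫ x in 0..D.L, D.nn (l, y) (D.pt x) :=
    D.tot_apply _
  have htm : D.tot (D.mm (l, y)) = (D.h : ℂ)⁻¹ * ∫ x in 0..D.L, D.refl.nn (l, y) (D.refl.pt x) := by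
    rw [tot_apply]
    have := D.integral_mul_mm (l, y) fun _ => 1
    simp only [one_mul] at this
    rw [this]
  have c2 := lower (htn ▸ a2)
  have c3 := lower (htm ▸ b2)
  refine ⟨?_, norm_pos_iff.1 (by linarith), norm_pos_iff.1 (by linarith), ?_⟩
  · set R := (D.h / (2 * r))^2 with hR
    have hR0 : 0 < R := by positivity
    set f : ℂ → ℂ := fun l => D.tr (l, y) + l * D.jj y with hf
    have hf0 : f 0 = D.EE y + (D.EE y)⁻¹ := by simp [hf, tr_zero]
    have hd : HasDerivAt f 0 0 := by
      have : HasDerivAt f _ 0 :=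
        (D.hasDerivAt_tr_zero y).add ((hasDerivAt_id (0 : ℂ)).mul_const (D.jj y))
      simpa using this
    have hRb : ∀ l ∈ ball (0 : ℂ) R, f l ∈ closedBall (f 0) (8 * (C + 1) * (D.h * r) * J) := by
      intro l hl
      rw [mem_ball_zero_iff] at hl
      rw [mem_closedBall_iff_norm]
      rcases eq_or_ne l 0 with rfl | hl0
      · simp only [sub_self, norm_zero]; positivity
      have e1 := D.norm_tr_le (p := (l, y)) hl0
      have e2 := hg (l, y) rfl hl.le
      have e3 : ‖f 0‖ ≤ 2 * (C * θ^8 * (D.h * r) * J) := by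
        rw [hf0]
        have : ‖(D.EE y)⁻¹‖ ≤ 1 := by rw [norm_inv]; exact inv_le_one_of_one_le₀ hE1
        linarith [norm_add_le (D.EE y) (D.EE y)⁻¹]
      have e4 : C * θ^8 * (D.h * r) * J ≤ C * 1 * (D.h * r) * J := by
        gcongr; exact pow_le_one₀ hθ.le hθ1
      have e5 : ‖l * D.jj y‖ ≤ D.h * r * J := by
        rw [norm_mul]
        refine mul_le_mul_of_nonneg_right (hl.le.trans ?_) hJ.le
        calc R = θ^2 / 4 * (D.h * r) := by rw [hR, div_pow, sq D.h]; nth_rw 2 [hcen.h_eq]; field_simp; norm_num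
          _ ≤ 1 * (D.h * r) := by gcongr; linarith [hp 2 0 (by norm_num)]
          _ = _ := one_mul _
      have e6 : ‖f l - f 0‖ ≤ ‖D.tr (l, y)‖ + ‖l * D.jj y‖ + ‖f 0‖ :=
        (norm_sub_le _ _).trans (add_le_add_left (norm_add_le _ _) _)
      have e7 : 0 ≤ D.h * r * J := by positivity
      have e8 : 0 ≤ C * (D.h * r) * J := by positivity
      linarith only [e1, e2, e3, e4, e5, e6, e7, e8]
    have hlR : ‖l‖ < R := by
      rw [hR, div_pow, lt_div_iff₀ (by positivity)]
      have : 0 < D.h^2 := by positivity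
      linarith only [a1, this, mul_nonneg (norm_nonneg l) (sq_nonneg r)]
    have key := Complex.dist_le_mul_div_pow_of_mapsTo_ball_of_isLittleO (f := f) (c := 0) (n := 1)
      (z := l) (R₁ := R) (fun l _ => DifferentiableAt.differentiableWithinAt (by
        have := (D.contDiff_tr.differentiable (by simp)).comp
          (differentiable_id.prodMk (differentiable_const y) : Differentiable ℂ fun l : ℂ => (l, y))
        exact (this.add (differentiable_id.mul_const _)) l)) hRb (by
        have := hd.isLittleO
        simp only [sub_zero, smul_zero] at this
        simpa using this.norm_right) (mem_ball_zero_iff.2 hlR)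
    rw [dist_eq_norm, dist_zero_right, hf0] at key
    rw [show D.tr (l, y) - (D.EE y + (D.EE y)⁻¹ - l * D.jj y) = f l - (D.EE y + (D.EE y)⁻¹) by
      simp only [hf]; ring]
    refine key.trans ?_
    have hll : ‖l‖ * J ≤ 4 * ‖D.EE y‖ := (le_div_iff₀ hJ).1 hle
    have hl8 : ‖l‖ ≤ 4 * (C * θ^8 * (D.h * r)) := by
      refine hle.trans ((div_le_iff₀ hJ).2 ?_)
      linarith only [hE]
    calc 8 * (C + 1) * (D.h * r) * J * (‖l‖ / R)^(1 + 1)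
        = 8 * (C + 1) * (D.h * r) * (‖l‖ * J) * ‖l‖ / R^2 := by
          rw [one_add_one_eq_two, div_pow]; ring
      _ ≤ 8 * (C + 1) * (D.h * r) * (4 * ‖D.EE y‖) * (4 * (C * θ^8 * (D.h * r))) / R^2 := by gcongr
      _ = 2048 * (C + 1) * C * (θ^8 * r^6 / D.h^2) * ‖D.EE y‖ := by rw [hR]; field_simp; ring
      _ = 2048 * (C + 1) * C * θ^4 * ‖D.EE y‖ := by rw [hcen.h_eq]; field_simp
      _ ≤ _ := by
          gcongr ?_ * ?_ * ‖D.EE y‖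
          · nlinarith
          · exact hp 4 2 (by norm_num)
  · intro v χ M hχ hv hM hχM h1 h0
    have hn0 : D.tot (D.nn (l, y)) ≠ 0 := norm_pos_iff.1 (by linarith)
    have hm0 : D.tot (D.mm (l, y)) ≠ 0 := norm_pos_iff.1 (by linarith)
    have d1 : ‖D.tot (v * D.nn (l, y)) - D.tot (D.nn (l, y))‖ ≤ C * (1 + M) * θ^2 * J := by
      have := a3 (ψ := fun x => χ x - 1) (M := 1 + M) (hχ.sub continuous_const) (by linarith)
        (fun x _ => (norm_sub_le _ _).trans (by rw [norm_one]; linarith [hχM x]))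
        (fun x _ hx => by rw [h1 x hx, sub_self])
      have i1 : IntervalIntegrable (fun x => D.nn (l, y) (D.pt x)) volume 0 D.L :=
        (D.continuous_ext _).intervalIntegrable _ _
      have i2 : IntervalIntegrable (fun x => χ x * D.nn (l, y) (D.pt x)) volume 0 D.L :=
        (hχ.mul (D.continuous_ext _)).intervalIntegrable _ _
      rw [D.tot_mul χ v _ hv, htn, ← mul_sub, ← integral_sub i2 i1]
      simpa only [sub_mul, one_mul] using this
    have d2 : ‖D.tot (v * D.mm (l, y))‖ ≤ C * M * θ^2 * J := by
      rw [D.tot_mul χ v _ hv, D.integral_mul_mm]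
      exact b3 (ψ := fun x => χ (D.L - x)) (hχ.comp (by fun_prop)) hM (fun x _ => hχM _)
        (fun x _ hx => h0 _ (by rw [← abs_neg]; convert hx using 2; ring))
    have q1 : ‖D.tot (v * D.nn (l, y)) / D.tot (D.nn (l, y)) - 1‖ ≤ 2 * C * (1 + M) * θ^2 := by
      rw [div_sub_one hn0, norm_div, div_le_iff₀ (norm_pos_iff.2 hn0)]
      refine d1.trans ?_
      calc C * (1 + M) * θ^2 * J ≤ C * (1 + M) * θ^2 * (2 * ‖D.tot (D.nn (l, y))‖) := by gcongr
        _ = _ := by ring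
    have q2 : ‖D.tot (v * D.mm (l, y)) / D.tot (D.mm (l, y))‖ ≤ 2 * C * M * θ^2 := by
      rw [norm_div, div_le_iff₀ (norm_pos_iff.2 hm0)]
      refine d2.trans ?_
      calc C * M * θ^2 * J ≤ C * M * θ^2 * (2 * ‖D.tot (D.mm (l, y))‖) := by gcongr
        _ = _ := by ring
    rw [ww, sub_right_comm]
    have e1 : 0 ≤ C * θ^2 * (1 + M) := by positivity
    have e2 : 0 ≤ (C + 1)^2 * θ^2 * (1 + M) := by positivity
    have e3 : 0 ≤ C * θ^2 := by positivity
    linarith only [norm_sub_le (D.tot (v * D.nn (l, y)) / D.tot (D.nn (l, y)) - 1)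
      (D.tot (v * D.mm (l, y)) / D.tot (D.mm (l, y))), q1, q2, e1, e2, e3]

end Sys

/-! ### Roots of holomorphic functions close to `1 - μ` -/

theorem norm_deriv_add_one_le {f : ℂ → ℂ} {η : ℝ} (hd : DifferentiableOn ℂ f (ball 0 4))
    (hf : ∀ μ ∈ ball (0 : ℂ) 4, ‖f μ - (1 - μ)‖ ≤ η) {μ : ℂ} (hμ : ‖μ‖ ≤ 3) :
    DifferentiableAt ℂ f μ ∧ ‖deriv f μ + 1‖ ≤ 2 * η := by
  have hsub : closedBall μ (1 / 2) ⊆ ball 0 4 := fun w hw => by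
    rw [mem_closedBall_iff_norm] at hw
    rw [mem_ball_zero_iff]
    linarith [norm_le_norm_add_norm_sub' w μ]
  have hda : ∀ w ∈ closedBall μ (1 / 2), DifferentiableAt ℂ f w := fun w hw =>
    hd.differentiableAt (isOpen_ball.mem_nhds (hsub hw))
  have hμd := hda μ (Metric.mem_closedBall_self (by norm_num))
  have h := Complex.norm_deriv_le_of_forall_mem_sphere_norm_le (f := fun w => f w - (1 - w))
    (c := μ) (R := 1 / 2) (C := η) (by norm_num)
    (DifferentiableOn.diffContOnCl (by
      rw [closure_ball _ (by norm_num)]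
      exact fun w hw => ((hda w hw).sub ((differentiableAt_const _).sub
        differentiableAt_id)).differentiableWithinAt))
    fun w hw => hf w (hsub (Metric.sphere_subset_closedBall hw))
  have e : deriv (fun w => f w - (1 - w)) μ = deriv f μ + 1 := by
    have : HasDerivAt (fun w => f w - (1 - w)) _ μ :=
      hμd.hasDerivAt.sub ((hasDerivAt_id μ).const_sub 1)
    simpa using this.deriv
  rw [e] at h
  exact ⟨hμd, h.trans (by linarith)⟩

theorem exists_root {f : ℂ → ℂ} {η : ℝ} (hη : η ≤ 1 / 8) (hd : DifferentiableOn ℂ f (ball 0 4))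
    (hf : ∀ μ ∈ ball (0 : ℂ) 4, ‖f μ - (1 - μ)‖ ≤ η) {S : Set ℂ} (hS : IsClosed S)
    (h1 : (1 : ℂ) ∈ S) (hfS : ∀ μ ∈ S, f μ + μ ∈ S) :
    ∃ μ ∈ S, ‖μ - 1‖ ≤ η ∧ f μ = 0 ∧ ∀ ν, ‖ν‖ ≤ 3 → f ν = 0 → ν = μ := by
  set Ψ : ℂ → ℂ := fun μ => f μ + μ
  have hη0 : 0 ≤ η := (norm_nonneg _).trans (hf 0 (by simp))
  have hlip : ∀ μ ∈ closedBall (0 : ℂ) 3, ∀ ν ∈ closedBall (0 : ℂ) 3,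
      ‖Ψ μ - Ψ ν‖ ≤ 1 / 4 * ‖μ - ν‖ := by
    intro μ hμ ν hν
    refine (convex_closedBall (0 : ℂ) 3).norm_image_sub_le_of_norm_hasDerivWithin_le
      (f' := fun w => deriv f w + 1) (fun w hw => ?_) (fun w hw => ?_) hν hμ
    · rw [mem_closedBall_zero_iff] at hw
      exact ((norm_deriv_add_one_le hd hf hw).1.hasDerivAt.add (hasDerivAt_id w)).hasDerivWithinAt
    · rw [mem_closedBall_zero_iff] at hw
      exact (norm_deriv_add_one_le hd hf hw).2.trans (by linarith)
  have hΨ : ∀ μ ∈ ball (0 : ℂ) 4, ‖Ψ μ - 1‖ ≤ η := fun μ hμ => by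
    have := hf μ hμ
    rwa [show Ψ μ - 1 = f μ - (1 - μ) by simp only [Ψ]; ring]
  have hsub : ∀ μ ∈ closedBall (1 : ℂ) 1, μ ∈ closedBall (0 : ℂ) 3 ∧
      μ ∈ ball (0 : ℂ) 4 := fun μ hμ => by
    rw [mem_closedBall_iff_norm] at hμ
    rw [mem_ball_zero_iff, mem_closedBall_zero_iff]
    have := norm_le_norm_add_norm_sub' μ 1
    rw [norm_one] at this
    constructor <;> linarith
  have hmaps : MapsTo Ψ (closedBall 1 1 ∩ S) (closedBall 1 1 ∩ S) := fun μ hμ =>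
    ⟨mem_closedBall_iff_norm.2 ((hΨ μ (hsub μ hμ.1).2).trans (by linarith)), hfS μ hμ.2⟩
  have hcon : ContractingWith (1 / 4) (hmaps.restrict Ψ _ _) := by
    refine ⟨by norm_num, LipschitzWith.of_dist_le_mul fun x y => ?_⟩
    have := hlip _ (hsub _ x.2.1).1 _ (hsub _ y.2.1).1
    simpa [Subtype.dist_eq, dist_eq_norm] using this
  obtain ⟨μ, hμ, hfix, -⟩ := hcon.exists_fixedPoint' (x := 1)
    ((Metric.isClosed_closedBall.inter hS).isComplete) hmaps ⟨by simp, h1⟩ (edist_ne_top _ _)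
  have hfix' : Ψ μ = μ := hfix
  have h0 : f μ = 0 := by simpa [Ψ] using hfix'
  refine ⟨μ, hμ.2, ?_, h0, fun ν hν hν0 => ?_⟩
  · have := hΨ μ (hsub μ hμ.1).2
    rwa [hfix'] at this
  · have := hlip ν (mem_closedBall_zero_iff.2 hν) μ (hsub μ hμ.1).1
    rw [hfix', show Ψ ν = ν by simp [Ψ, hν0]] at this
    exact sub_eq_zero.1 (norm_le_zero_iff.1 (by linarith))

theorem exists_root_analytic {f : (ℂ × ℂ) × ℂ → ℂ} {η : ℝ} (hη : η ≤ 1 / 8) {U : Set (ℂ × ℂ)}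
    (hf : ∀ p ∈ U, ∀ μ ∈ ball (0 : ℂ) 4, ContDiffAt ℂ ω f (p, μ))
    (hb : ∀ p ∈ U, ∀ μ ∈ ball (0 : ℂ) 4, ‖f (p, μ) - (1 - μ)‖ ≤ η) (hU : IsOpen U) :
    ∃ m : ℂ × ℂ → ℂ, ContDiffOn ℂ ω m U ∧ ∀ p ∈ U, ‖m p - 1‖ ≤ η ∧ f (p, m p) = 0 ∧
      ∀ ν, ‖ν‖ ≤ 3 → f (p, ν) = 0 → ν = m p := by
  have hdi : ∀ p ∈ U, DifferentiableOn ℂ (fun μ => f (p, μ)) (ball 0 4) := fun p hp μ hμ =>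
    (((hf p hp μ hμ).differentiableAt (by simp)).comp μ
      ((differentiableAt_const p).prodMk differentiableAt_id)).differentiableWithinAt
  have hex : ∀ p, ∃ μ, p ∈ U → ‖μ - 1‖ ≤ η ∧ f (p, μ) = 0 ∧
      ∀ ν, ‖ν‖ ≤ 3 → f (p, ν) = 0 → ν = μ := fun p => by
    by_cases hp : p ∈ U
    · obtain ⟨μ, -, h⟩ := exists_root hη (hdi p hp) (hb p hp) isClosed_univ (mem_univ _)
        fun _ _ => mem_univ _
      exact ⟨μ, fun _ => h⟩
    · exact ⟨0, fun h => absurd h hp⟩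
  choose m hm using hex
  refine ⟨m, fun p hp => ContDiffAt.contDiffWithinAt ?_, hm⟩
  obtain ⟨h1, h2, h3⟩ := hm p hp
  have hlt : ‖m p‖ < 3 := by
    have := norm_le_norm_add_norm_sub' (m p) 1
    rw [norm_one] at this
    linarith
  have hcd := hf p hp (m p) (mem_ball_zero_iff.2 (by linarith))
  obtain ⟨hd1, hd2⟩ := norm_deriv_add_one_le (hdi p hp) (hb p hp) hlt.le
  have hd0 : deriv (fun μ => f (p, μ)) (m p) ≠ 0 := fun h => by
    rw [h, zero_add, norm_one] at hd2
    linarith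
  have hfd : fderiv ℂ f (p, m p) ∘L .inr ℂ (ℂ × ℂ) ℂ =
      ContinuousLinearMap.toSpanSingleton ℂ (deriv (fun μ => f (p, μ)) (m p)) := by
    have e := ((hcd.differentiableAt (by simp)).hasFDerivAt).comp_hasDerivAt (m p)
      ((hasDerivAt_const (m p) p).prodMk (hasDerivAt_id (m p)))
    ext
    simpa using (show HasDerivAt (fun μ => f (p, μ)) _ _ from e).deriv.symm
  have hinv : (fderiv ℂ f (p, m p) ∘L .inr ℂ (ℂ × ℂ) ℂ).IsInvertible := by
    rw [hfd]
    exact ⟨ContinuousLinearEquiv.unitsEquivAut ℂ (Units.mk0 _ hd0), by ext; simp⟩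
  have hψ := hcd.contDiffAt_implicitFunction (by simp) hinv
  refine hψ.congr_of_eventuallyEq ?_
  have hc : ContinuousAt (hcd.implicitFunction (by simp) hinv) p := hψ.continuousAt
  have h0 := hcd.implicitFunction_apply_self (by simp) hinv
  filter_upwards [hcd.eventually_apply_implicitFunction (by simp) hinv, hU.mem_nhds hp,
    hc.norm.eventually_lt_const (by simp only [ContinuousAt] at *; rw [h0]; exact hlt)] with q a1 a2 a3
  rw [h2] at a1
  exact ((hm q a2).2.2 _ a3.le a1).symm

namespace Sys

variable {D : Sys} {c K b y0 r θ xm xp κm κp : ℝ} {y : ℂ}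

theorem tr_im_eq_zero (l y : ℝ) : (D.tr (l, y)).im = 0 := by
  rcases eq_or_ne l 0 with rfl | hl
  · have := D.EE_re y
    rw [ofReal_re] at this
    rw [ofReal_zero, tr_zero, this, ← ofReal_inv, ← Complex.ofReal_add, ofReal_im]
  · exact Complex.conj_eq_iff_im.1 (D.conj_tr (by simp) (by simp) (by simpa using hl))

theorem jj_im_eq_zero (y : ℝ) : (D.jj y).im = 0 := by
  have h1 : HasDerivAt (fun l : ℝ => D.tr (l, y)) (-D.jj y) 0 :=
    (show HasDerivAt (fun l : ℂ => D.tr (l, y)) (-D.jj y) ((0 : ℝ) : ℂ) from by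
      simpa using D.hasDerivAt_tr_zero y).comp_ofReal
  have h2 : HasDerivAt (fun l : ℝ => (D.tr (l, y)).im) (-D.jj y).im 0 := by
    have := (imCLM.hasFDerivAt (x := D.tr (((0 : ℝ) : ℂ), (y : ℂ)))).comp_hasDerivAt (0 : ℝ) h1
    exact this
  simp only [tr_im_eq_zero] at h2
  simpa using h2.unique (hasDerivAt_const _ _)

theorem lead_ofReal (y : ℝ) {pm pp : ℝ} (hm : 0 ≤ pm) (hp : 0 ≤ pp) :
    ∃ t : ℝ, 0 ≤ t ∧ D.lead y0 y xm xp pm pp = t := by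
  have := D.hh
  refine ⟨‖D.EE y‖⁻¹ * (D.h⁻¹^2 *
    (exp (2 / D.h * (D.phase y0 xp).re - 2 / D.h * (y - y0) * xp) * pp *
    (exp (-(2 / D.h * (D.phase y0 xm).re) + 2 / D.h * (y - y0) * xm) * pm))), by positivity, ?_⟩
  have hE := D.EE_re y
  rw [ofReal_re] at hE
  rw [lead, hE]
  push_cast
  simp

theorem norm_cos_le (w : ℂ) : ‖Complex.cos w‖ ≤ exp |w.im| := by
  rw [Complex.cos, norm_div, Complex.norm_ofNat]
  have h1 := norm_add_le (cexp (w * I)) (cexp (-w * I))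
  rw [norm_exp, norm_exp] at h1
  have h2 : (w * I).re = -w.im := by simp
  have h3 : (-w * I).re = w.im := by simp
  rw [h2, h3] at h1
  have h4 := exp_le_exp.2 (neg_le_abs w.im)
  have h5 := exp_le_exp.2 (le_abs_self w.im)
  linarith

theorem norm_mul_sub_one_le {a b : ℂ} {s t : ℝ} (ha : ‖a - 1‖ ≤ s) (hb : ‖b - 1‖ ≤ t) :
    ‖a * b - 1‖ ≤ s + t + s * t := by
  rw [show a * b - 1 = (a - 1) + (b - 1) + (a - 1) * (b - 1) by ring]
  refine norm_add₃_le.trans ?_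
  rw [norm_mul]
  gcongr
  exact (norm_nonneg _).trans ha

theorem norm_div_sub_one_le {a b : ℂ} {s : ℝ} (ha : a ≠ 0) (h : ‖b - a‖ ≤ s * ‖a‖) (hs : s ≤ 1 / 2) :
    ‖a / b - 1‖ ≤ 2 * s := by
  have hb : ‖a‖ ≤ 2 * ‖b‖ := by
    have h1 := norm_le_norm_add_norm_sub b a
    nlinarith [norm_nonneg a]
  have ha' := norm_pos_iff.2 ha
  have hb0 : b ≠ 0 := norm_pos_iff.1 (by linarith)
  have hs0 : 0 ≤ s := nonneg_of_mul_nonneg_left ((norm_nonneg _).trans h) ha'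
  rw [div_sub_one hb0, norm_div, div_le_iff₀ (norm_pos_iff.2 hb0), norm_sub_rev]
  nlinarith

theorem contDiff_jj : ContDiff ℂ ω D.jj := by
  have h1 : ContDiff ℂ ω fun y : ℂ => fderiv ℂ D.tr ((0 : ℂ), y) ((1 : ℂ), (0 : ℂ)) :=
    ((D.contDiff_tr.fderiv_right (m := ω) (by simp)).comp
      (contDiff_const.prodMk contDiff_id)).clm_apply contDiff_const
  refine (funext fun y => ?_ : D.jj = fun y => _) ▸ h1.neg
  have h2 := ((D.contDiff_tr.differentiable (by simp)) ((0 : ℂ), y)).hasFDerivAt.comp_hasDerivAt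
    (0 : ℂ) ((hasDerivAt_id (0 : ℂ)).prodMk (hasDerivAt_const (0 : ℂ) y))
  have h3 := h2.unique (D.hasDerivAt_tr_zero y)
  rw [h3, neg_neg]

theorem contDiff_lead {pm pp : ℝ} : ContDiff ℂ ω fun y => D.lead y0 y xm xp pm pp := by
  have h1 : ContDiff ℂ ω fun y : ℂ => (D.EE y)⁻¹ := D.contDiff_EE.inv D.EE_ne_zero
  refine h1.mul (contDiff_const.mul (.mul (.mul (Complex.contDiff_exp.comp ?_) contDiff_const)
    (.mul (Complex.contDiff_exp.comp ?_) contDiff_const))) <;> fun_prop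

theorem contDiffAt_ww (v : D.X) {p : ℂ × ℂ} (h1 : D.tot (D.nn p) ≠ 0) (h2 : D.tot (D.mm p) ≠ 0) :
    ContDiffAt ℂ ω (D.ww v) p := by
  have t : ∀ {f : ℂ × ℂ → D.X}, ContDiff ℂ ω f → ContDiffAt ℂ ω (fun p => D.tot (f p)) p :=
    fun hf => (D.tot.contDiff.comp hf).contDiffAt
  exact ((t (contDiff_const.mul D.contDiff_nn_mm.1)).div (t D.contDiff_nn_mm.1) h1).sub
    ((t (contDiff_const.mul D.contDiff_nn_mm.2)).div (t D.contDiff_nn_mm.2) h2)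

/-- The rate of the commutator, holomorphically continued from the real axis. -/
theorem exists_holomorphic_rate (hc : 0 < c) (hK : 0 < K) {s τ M : ℝ} (hs : 0 < s) (hτ : 0 < τ)
    (hM : 0 ≤ M) : ∃ C : ℝ, 0 < C ∧ ∃ θ0 : ℝ, 0 < θ0 ∧
    ∀ {D : Sys} {b y0 r θ xm xp κm κp : ℝ}, θ ≤ θ0 →
      (∀ y : ℂ, ‖y - y0‖ < s * (D.h / r) → D.IsCenter c K b y0 r θ xm xp κm κp y ∧
        exp (τ / D.h) ≤ ‖D.EE y‖) →
      ∀ (x0 ω0 : ℝ) {v : D.X} {χ : ℝ → ℂ}, Continuous χ →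
        (∀ x ∈ Icc 0 D.L, v (D.pt x) = χ x) → (∀ x, ‖χ x‖ ≤ M) →
        (∀ x, |x - xm| ≤ c * r → χ x = 1) → (∀ x, |x - xp| ≤ c * r → χ x = 0) →
      ∃ F : ℂ × ℂ → ℂ, ContDiffOn ℂ ω F (ball (x0, y0) (s * (D.h / r))) ∧
        (∀ p ∈ ball ((x0 : ℂ), (y0 : ℂ)) (s * (D.h / r)), ‖F p - 1‖ ≤ C * θ^2 ∧ ‖F p - 1‖ ≤ 1 / 2) ∧
        ∀ x y : ℝ, ((x : ℂ), (y : ℂ)) ∈ ball ((x0 : ℂ), (y0 : ℂ)) (s * (D.h / r)) →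
          ∃ l : ℝ, 0 < l ∧ D.tr (l, y) = 2 * Complex.cos (ω0 - D.L / D.h * x : ℝ) ∧
            (∀ t : ℝ, 0 < t → t ≤ l → D.tr (t, y) = 2 * Complex.cos (ω0 - D.L / D.h * x : ℝ) → t = l) ∧
            (∃ x, D.nn (l, y) x ≠ 0) ∧ D.EE y ≠ 1 ∧
            √l * ‖D.ww v (l, y)‖ = √(‖D.EE y / D.lead y0 y xm xp (peakVal r θ κm) (peakVal r θ κp)‖ *
              ‖F (x, y)‖) := by
  obtain ⟨C1, hC1, θ1, hθ₁, hθ₁1, H⟩ := IsCenter.expansions hc hK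
  set C2 := (C1 + 6 * K^3 / τ) * (1 + M)  with hC2
  have hC₂0 : 0 < C2 := by positivity
  have hKs : 0 < τ / (2 * K^3 * s + 1) := by positivity
  refine ⟨16 * C2, by positivity, min θ1 (min (1 / (32 * C2 + 1)) (min (τ / (2 * K^3 * s + 1)) 1)),
    by positivity, ?_⟩
  intro D b y0 r θ xm xp κm κp hθ0 hcen x0 ω0 v χ hχ hv hχM hχ1 hχ0
  have hh := D.hh
  set ρ := s * (D.h / r) with hρ
  set U : Set (ℂ × ℂ) := ball ((x0 : ℂ), (y0 : ℂ)) ρ with hU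
  rcases le_or_gt ρ 0 with hρ0 | hρ0
  · have hemp : ∀ p, p ∉ U := by simp [hU, Metric.ball_eq_empty.2 hρ0]
    exact ⟨0, contDiffOn_const, fun p hp => absurd hp (hemp p), fun x y hp => absurd hp (hemp _)⟩
  obtain ⟨hcen0, -⟩ := hcen y0 (by simpa using hρ0)
  have hθ := hcen0.θ_pos
  obtain ⟨_, _, W⟩ := hcen0.well
  have hr := W.r_pos
  have hrK := W.r_le
  have hθ1 : θ ≤ 1 :=
    hθ0.trans ((min_le_right _ _).trans ((min_le_right _ _).trans (min_le_right _ _)))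
  have hθ2 : θ ≤ 1 / (32 * C2 + 1) := hθ0.trans ((min_le_right _ _).trans (min_le_left _ _))
  have hθ3 : θ ≤ τ / (2 * K^3 * s + 1) :=
    hθ0.trans ((min_le_right _ _).trans ((min_le_right _ _).trans (min_le_left _ _)))
  rw [le_div_iff₀ (by positivity)] at hθ2 hθ3
  have hθsq : θ^2 ≤ θ := by nlinarith
  set η := C2 * θ^2 with hη
  have hη0 : 0 ≤ η := by positivity
  have hη1 : η ≤ 1 / 32 := by
    have := mul_le_mul_of_nonneg_left hθsq hC₂0.le
    linarith only [this, hθ2, hη, hθ]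
  have hC12 : C1 * θ^2 ≤ η ∧ C1 * (1 + M) * θ^2 ≤ η := by
    have h0 : 0 ≤ 6 * K^3 / τ * θ^2 := by positivity
    have h1 : 0 ≤ 6 * K^3 / τ * θ^2 * M := by positivity
    have h2 : 0 ≤ C1 * θ^2 * M := by positivity
    constructor <;> linarith only [h0, h1, h2, hη, hC2, hη.trans (congrArg (· * θ^2) hC2)]
  have hex : 3 * exp (-(τ / (2 * D.h))) ≤ 6 * K^3 / τ * θ^2 := by
    have h1 := add_one_le_exp (τ / (2 * D.h))
    have h2 : D.h ≤ K^3 * θ^2 := by rw [hcen0.h_eq, mul_comm]; gcongr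
    rw [exp_neg, ← one_div, mul_one_div, div_le_iff₀ (exp_pos _)]
    calc (3 : ℝ) = 6 * D.h / τ * (τ / (2 * D.h)) := by field_simp; norm_num
      _ ≤ 6 * (K^3 * θ^2) / τ * exp (τ / (2 * D.h)) := by gcongr; linarith
      _ = _ := by ring
  have hsplit : ∀ {p : ℂ × ℂ}, p ∈ U → |p.1.im| < ρ ∧ ‖p.2 - y0‖ < ρ := fun {p} hp => by
    rw [hU, ← ball_prod_same, Set.mem_prod, mem_ball_iff_norm, mem_ball_iff_norm] at hp
    have := abs_im_le_norm (p.1 - x0)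
    rw [sub_im, ofReal_im, sub_zero] at this
    exact ⟨this.trans_lt hp.1, hp.2⟩
  set ℓ : ℂ → ℂ := fun y => D.lead y0 y xm xp (peakVal r θ κm) (peakVal r θ κp) with hℓ
  have hEne := D.EE_ne_zero
  have hEbig : ∀ {y : ℂ}, ‖y - y0‖ < ρ → 1 < ‖D.EE y‖ ∧ 1 ≤ ‖D.EE y‖ := fun hy => by
    have h1 : 1 < exp (τ / D.h) := one_lt_exp_iff.2 (by positivity)
    exact ⟨h1.trans_le (hcen _ hy).2, (h1.trans_le (hcen _ hy).2).le⟩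
  have hexp : ∀ {y : ℂ}, ‖y - y0‖ < ρ → _ := fun {y} hy =>
    H (hcen y hy).1 (hθ0.trans (min_le_left _ _)) (hEbig hy).2 (ℓ y) rfl
  have hjne : ∀ {y : ℂ}, ‖y - y0‖ < ρ → D.jj y ≠ 0 := fun hy => norm_pos_iff.1 (hexp hy).2.1
  -- the equation for the small eigenvalue
  set om : ℂ → ℂ := fun x => ω0 - D.L / D.h * x with hom
  set lam : (ℂ × ℂ) × ℂ → ℂ := fun q => q.2 * (D.EE q.1.2 / D.jj q.1.2) with hlam
  set f : (ℂ × ℂ) × ℂ → ℂ := fun q =>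
    (D.tr (lam q, q.1.2) - 2 * Complex.cos (om q.1.1)) / D.EE q.1.2 with hf
  have hlamle : ∀ {p : ℂ × ℂ}, p ∈ U → ∀ {μ : ℂ}, ‖μ‖ ≤ 4 →
      ‖lam (p, μ)‖ ≤ 4 * ‖D.EE p.2‖ / ‖D.jj p.2‖ := fun {p} hp {μ} hμ => by
    simp only [hlam, norm_mul, norm_div]
    rw [mul_div_assoc]
    gcongr
  have hcos : ∀ {p : ℂ × ℂ}, p ∈ U →
      ‖2 * Complex.cos (om p.1)‖ ≤ 2 * exp (-(τ / (2 * D.h))) * ‖D.EE p.2‖ := fun {p} hp => by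
    obtain ⟨hp1, hp2⟩ := hsplit hp
    have h1 : (om p.1).im = -(D.L / D.h * p.1.im) := by
      simp only [hom]
      rw [← Complex.ofReal_div, sub_im, Complex.im_ofReal_mul, ofReal_im, zero_sub]
    have h2 : |(om p.1).im| ≤ τ / (2 * D.h) := by
      rw [h1, abs_neg, abs_mul, abs_of_nonneg (div_nonneg D.hL.le hh.le)]
      calc D.L / D.h * |p.1.im| ≤ K / D.h * ρ := by gcongr; exact W.L_le
        _ = K * s / r := by rw [hρ]; field_simp
        _ ≤ τ / (2 * D.h) := by
          rw [div_le_div_iff₀ hr (by positivity), hcen0.h_eq]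
          have h3 : 2 * K^3 * s * θ^2 ≤ τ := by
            calc 2 * K^3 * s * θ^2 ≤ 2 * K^3 * s * θ := by gcongr
              _ ≤ τ := by linarith only [hθ3, hθ]
          calc K * s * (2 * (θ^2 * r^3)) = 2 * (K * r^2) * s * θ^2 * r := by ring
            _ ≤ 2 * (K * K^2) * s * θ^2 * r := by gcongr
            _ = 2 * K^3 * s * θ^2 * r := by ring
            _ ≤ τ * r := by gcongr
    have h4 : exp (τ / (2 * D.h)) ≤ exp (-(τ / (2 * D.h))) * ‖D.EE p.2‖ := by
      refine Eq.trans_le ?_ (mul_le_mul_of_nonneg_left (hcen _ hp2).2 (exp_pos _).le)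
      rw [← exp_add]; congr 1; field_simp; ring
    rw [norm_mul, Complex.norm_ofNat, mul_assoc]
    exact mul_le_mul_of_nonneg_left ((norm_cos_le _).trans ((exp_le_exp.2 h2).trans h4)) two_pos.le
  have hfb : ∀ p ∈ U, ∀ μ ∈ ball (0 : ℂ) 4, ‖f (p, μ) - (1 - μ)‖ ≤ η := by
    intro p hp μ hμ
    obtain ⟨hp1, hp2⟩ := hsplit hp
    have hE1 := (hEbig hp2).2
    have hE0 : 0 < ‖D.EE p.2‖ := by linarith
    obtain ⟨-, -, -, ht⟩ := hexp hp2
    obtain ⟨ht, -⟩ := ht (lam (p, μ)) (hlamle hp (mem_ball_zero_iff.1 hμ).le)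
    have hlj : lam (p, μ) * D.jj p.2 = μ * D.EE p.2 := by
      have : D.jj p.2 ≠ 0 := hjne hp2
      simp only [hlam]; field_simp
    have e : f (p, μ) - (1 - μ) = (D.tr (lam (p, μ), p.2) - (D.EE p.2 + (D.EE p.2)⁻¹ -
        lam (p, μ) * D.jj p.2) + (D.EE p.2)⁻¹ - 2 * Complex.cos (om p.1)) / D.EE p.2 := by
      have := hEne p.2
      rw [hlj]; simp only [hf]; field_simp; ring
    rw [e, norm_div, div_le_iff₀ hE0]
    have hinv : ‖(D.EE p.2)⁻¹‖ ≤ exp (-(τ / (2 * D.h))) * ‖D.EE p.2‖ := by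
      rw [norm_inv]
      refine (inv_le_one_of_one_le₀ hE1).trans ?_
      rw [exp_neg, inv_mul_eq_div, one_le_div (exp_pos _)]
      refine (exp_le_exp.2 ?_).trans (hcen _ hp2).2
      gcongr; linarith
    have h3 := norm_sub_le_of_le (norm_add_le_of_le ht hinv) (hcos hp)
    refine h3.trans ?_
    have : (C1 * θ^2 + 3 * exp (-(τ / (2 * D.h)))) * ‖D.EE p.2‖ ≤ η * ‖D.EE p.2‖ := by
      have h1 : 0 ≤ (C1 + 6 * K^3 / τ) * M * θ^2 := by positivity
      gcongr
      rw [hη, hC2]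
      linarith only [hex, h1]
    linarith only [this]
  have hfan : ∀ p ∈ U, ∀ μ ∈ ball (0 : ℂ) 4, ContDiffAt ℂ ω lam (p, μ) ∧
      ContDiffAt ℂ ω f (p, μ) := by
    intro p hp μ _
    have c1 : ContDiffAt ℂ ω (fun q : (ℂ × ℂ) × ℂ => q.1.2) (p, μ) := by fun_prop
    have c2 : ContDiffAt ℂ ω (fun q : (ℂ × ℂ) × ℂ => D.EE q.1.2) (p, μ) :=
      D.contDiff_EE.contDiffAt.comp (p, μ) c1
    have c3 : ContDiffAt ℂ ω (fun q : (ℂ × ℂ) × ℂ => D.jj q.1.2) (p, μ) :=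
      D.contDiff_jj.contDiffAt.comp (p, μ) c1
    have c4 : ContDiffAt ℂ ω lam (p, μ) := contDiffAt_snd.mul (c2.div c3 (hjne (hsplit hp).2))
    have c5 : ContDiffAt ℂ ω (fun q : (ℂ × ℂ) × ℂ => Complex.cos (om q.1.1)) (p, μ) :=
      Complex.contDiff_cos.contDiffAt.comp (p, μ) (by simp only [hom]; fun_prop)
    exact ⟨c4, ((D.contDiff_tr.contDiffAt.comp (p, μ) (c4.prodMk c1)).sub
      (contDiffAt_const.mul c5)).div c2 (hEne _)⟩
  obtain ⟨m, hman, hm⟩ := exists_root_analytic (hη1.trans (by norm_num))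
    (fun p hp μ hμ => (hfan p hp μ hμ).2) hfb isOpen_ball
  have hmle : ∀ p ∈ U, ‖m p‖ ≤ 2 := fun p hp => by
    have := norm_le_norm_add_norm_sub' (m p) 1
    rw [norm_one] at this
    linarith [(hm p hp).1]
  have hww : ∀ p ∈ U, D.tot (D.nn (lam (p, m p), p.2)) ≠ 0 ∧ D.tot (D.mm (lam (p, m p), p.2)) ≠ 0 ∧
      ‖D.ww v (lam (p, m p), p.2) - 1‖ ≤ η := fun p hp => by
    obtain ⟨-, h1, h2, h3⟩ := (hexp (hsplit hp).2).2.2.2 (lam (p, m p))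
      (hlamle hp ((hmle p hp).trans (by norm_num)))
    exact ⟨h1, h2, (h3 hχ hv hM hχM hχ1 hχ0).trans hC12.2⟩
  have hℓj : ∀ p ∈ U, ‖ℓ p.2 / D.jj p.2 - 1‖ ≤ 2 * η := fun p hp => by
    obtain ⟨h1, h2, h3, -⟩ := hexp (hsplit hp).2
    exact norm_div_sub_one_le (norm_pos_iff.1 h1) (h3.trans (by gcongr; exact hC12.1)) (by linarith)
  have hmℓ : ∀ p ∈ U, ‖m p * (ℓ p.2 / D.jj p.2) - 1‖ ≤ 4 * η := fun p hp =>
    (norm_mul_sub_one_le (hm p hp).1 (hℓj p hp)).trans (by nlinarith)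
  refine ⟨fun p => m p * (ℓ p.2 / D.jj p.2) * (D.ww v (lam (p, m p), p.2) * D.ww v (lam (p, m p), p.2)),
    fun p hp => ContDiffAt.contDiffWithinAt ?_, fun p hp => ?_, fun x y hp => ?_⟩
  · have c1 : ContDiffAt ℂ ω m p := hman.contDiffAt (isOpen_ball.mem_nhds hp)
    have c2 : ContDiffAt ℂ ω (fun p : ℂ × ℂ => ℓ p.2 / D.jj p.2) p :=
      (D.contDiff_lead.contDiffAt.comp p contDiffAt_snd).div
        (D.contDiff_jj.contDiffAt.comp p contDiffAt_snd) (hjne (hsplit hp).2)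
    have c3 : ContDiffAt ℂ ω (fun p => lam (p, m p)) p :=
      ContDiffAt.comp (g := lam) (f := fun p => (p, m p)) p
        (hfan p hp (m p) (mem_ball_zero_iff.2 (by linarith [hmle p hp]))).1 (contDiffAt_id.prodMk c1)
    have c4 : ContDiffAt ℂ ω (fun p => D.ww v (lam (p, m p), p.2)) p :=
      ContDiffAt.comp (g := D.ww v) (f := fun p : ℂ × ℂ => (lam (p, m p), p.2)) p
        (contDiffAt_ww v (hww p hp).1 (hww p hp).2.1) (c3.prodMk contDiffAt_snd)
    exact (c1.mul c2).mul (c4.mul c4)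
  · have h1 := norm_mul_sub_one_le (hmℓ p hp) (norm_mul_sub_one_le (hww p hp).2.2 (hww p hp).2.2)
    have h2 : 4 * η + (η + η + η * η) + 4 * η * (η + η + η * η) ≤ 16 * η := by nlinarith
    exact ⟨(h1.trans h2).trans (by linarith only [hη]), (h1.trans h2).trans (by linarith only [hη1])⟩
  · obtain ⟨hp1, hp2⟩ := hsplit hp
    obtain ⟨hm1, hm2, hm3⟩ := hm _ hp
    set p : ℂ × ℂ := ((x : ℂ), (y : ℂ)) with hpdef
    have hEr : D.EE y = ((‖D.EE y‖ : ℝ) : ℂ) := by simpa using D.EE_re (y : ℂ)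
    have hE0 : 0 < ‖D.EE y‖ := norm_pos_iff.2 (hEne _)
    have hjr : D.jj y = ((D.jj y).re : ℂ) := Complex.ext (by simp) (by simp [jj_im_eq_zero])
    have hj0 : (D.jj y).re ≠ 0 := fun h => hjne hp2 (by rw [hjr, h, ofReal_zero])
    have hor : om x = ((ω0 - D.L / D.h * x : ℝ) : ℂ) := by simp [hom]
    obtain ⟨μ, hμS, hμ1, hμ0, -⟩ := exists_root (f := fun μ => f (p, μ)) (hη1.trans (by norm_num))
      (fun μ hμ => (((hfan p hp μ hμ).2.differentiableAt (by simp)).comp μ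
        ((differentiableAt_const p).prodMk differentiableAt_id)).differentiableWithinAt)
      (hfb p hp) (S := {μ | μ.im = 0}) (isClosed_eq continuous_im continuous_const) (by simp)
      (fun μ hμ => by
        have hμr : μ = (μ.re : ℂ) := Complex.ext (by simp) (by simpa using hμ)
        have e : lam (p, μ) = ((μ.re * (‖D.EE y‖ / (D.jj y).re) : ℝ) : ℂ) := by
          push_cast
          rw [← hμr, ← hEr, ← hjr]
        have e2 : (f (p, μ)).im = 0 := by
          simp only [hf, hpdef]
          rw [← hpdef, e, hor, hEr, Complex.div_ofReal_im, sub_im, tr_im_eq_zero,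
            ← Complex.ofReal_cos, ← Complex.ofReal_ofNat, ← ofReal_mul, ofReal_im,
            sub_zero, zero_div]
        rw [Set.mem_setOf_eq, Complex.add_im, e2, zero_add]
        exact hμ)
    have hμm : μ = m p := hm3 μ (by
      have := norm_le_norm_add_norm_sub' μ 1
      rw [norm_one] at this
      linarith) hμ0
    have hmr : m p = ((m p).re : ℂ) := Complex.ext (by simp) (by rw [← hμm]; simpa using hμS)
    set l : ℝ := (m p).re * (‖D.EE y‖ / (D.jj y).re) with hl
    have hlc : (l : ℂ) = lam (p, m p) := by
      rw [hl]; push_cast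
      rw [← hmr, ← hEr, ← hjr]
    have hpk : ∀ κ, 0 ≤ peakVal r θ κ := fun κ => sqrt_nonneg _
    obtain ⟨t, ht0, ht⟩ := D.lead_ofReal (y0 := y0) (xm := xm) (xp := xp) y (hpk κm) (hpk κp)
    change ℓ y = t at ht
    have hlE : ((l * t / ‖D.EE y‖ : ℝ) : ℂ) = m p * (ℓ y / D.jj y) := by
      push_cast
      rw [hlc, ht, ← hEr]
      have := hEne y
      simp only [hlam, hpdef]; field_simp
    have hlE' : 0 < l * t / ‖D.EE y‖ := by
      have h1 := hmℓ p hp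
      change ‖m p * (ℓ y / D.jj y) - 1‖ ≤ _ at h1
      rw [← hlE, ← ofReal_one, ← ofReal_sub, norm_real, norm_eq_abs, abs_le] at h1
      linarith
    have hl0 : 0 < l := by
      by_contra hneg
      have := div_nonpos_of_nonpos_of_nonneg (mul_nonpos_of_nonpos_of_nonneg (not_lt.1 hneg) ht0) hE0.le
      linarith
    have hroot : ∀ q : ℂ, f (p, q) = 0 ↔
        D.tr (lam (p, q), y) = 2 * Complex.cos (ω0 - D.L / D.h * x : ℝ) := fun q => by
      rw [← hor]; simp only [hf, hpdef]
      rw [div_eq_zero_iff, or_iff_left (hEne _), sub_eq_zero]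
    refine ⟨l, hl0, by rw [hlc]; exact (hroot _).1 hm2, fun q hq hql hqr => ?_, ?_, ?_, ?_⟩
    · have hqν : (q : ℂ) = lam (p, q * (D.jj y / D.EE y)) := by
        have := hEne y
        have : D.jj y ≠ 0 := hjne hp2
        simp only [hlam, hpdef]; field_simp
      have h1 : ‖(q : ℂ) * (D.jj y / D.EE y)‖ ≤ 3 := by
        have h2 : (l : ℂ) * (D.jj y / D.EE y) = m p := by
          have := hEne y
          have : D.jj y ≠ 0 := hjne hp2
          rw [hlc]; simp only [hlam, hpdef]; field_simp
        have h3 := hmle p hp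
        rw [← h2, norm_mul, norm_real, norm_of_nonneg hl0.le] at h3
        rw [norm_mul, norm_real, norm_of_nonneg hq.le]
        exact (mul_le_mul_of_nonneg_right hql (norm_nonneg _)).trans (h3.trans (by norm_num))
      have h2 := hm3 _ h1 ((hroot _).2 (by rw [← hqν]; exact hqr))
      rw [h2, ← hlc] at hqν
      exact_mod_cast hqν
    · by_contra hcon
      push Not at hcon
      have : D.nn (lam (p, m p), y) = 0 := by ext x; rw [← hlc]; exact hcon x
      exact (hww p hp).1 (by rw [this, map_zero])
    · intro h
      have := (hEbig hp2).1
      rw [h, norm_one] at this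
      exact lt_irrefl _ this
    · have hww0 := norm_nonneg (D.ww v (l, y))
      rw [← sqrt_sq hww0, ← sqrt_mul hl0.le]
      congr 1
      change _ = ‖D.EE y / ℓ y‖ * ‖m p * (ℓ y / D.jj y) *
        (D.ww v (lam (p, m p), y) * D.ww v (lam (p, m p), y))‖
      have hℓ0 : ℓ y ≠ 0 := norm_pos_iff.1 (hexp hp2).1
      have hnl : l = ‖D.EE y / ℓ y * (m p * (ℓ y / D.jj y))‖ := by
        have : D.EE y / ℓ y * (m p * (ℓ y / D.jj y)) = l := by
          have : D.jj y ≠ 0 := hjne hp2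
          rw [hlc]; simp only [hlam, hpdef]; field_simp
        rw [this, norm_real, norm_of_nonneg hl0.le]
      rw [← hlc, ← norm_mul, ← mul_assoc, norm_mul, ← hnl, norm_mul, sq]

end Sys

/-! ### Wells from a profile with nondegenerate minimum -/

/-- `G` increases from a nondegenerate minimum at `0` up to `b`. -/
structure Hill (G : ℝ → ℝ) (b : ℝ) : Prop where
  smooth : ContDiff ℝ ∞ G
  b_pos : 0 < b
  deriv_pos : ∀ x ∈ Ioo 0 b, 0 < deriv G x
  deriv_zero : deriv G 0 = 0
  convex : 0 < deriv (deriv G) 0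

/-- One half of a well. -/
structure IsHalfWell (c K b : ℝ) (G : ℝ → ℝ) (y r x : ℝ) : Prop where
  r_pos : 0 < r
  r_le : r ≤ K
  x_ge : c * r ≤ x
  x_le : x ≤ K * r
  x_le_b : x + c ≤ b
  x_le_b' : x + c * r ≤ b
  left : ∀ t ∈ Icc 0 b, c * r * (t - x)^2 ≤ (G t - y) * (t - x)
  left' : ∀ t ∈ Icc 0 b, c * (t - x)^2 ≤ |G t - y|
  taylor : ∀ t ∈ Icc 0 b,
    |G t - y - deriv G x * (t - x) - deriv (deriv G) x / 2 * (t - x)^2| ≤ K * |t - x|^3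
  κ_ge : c * r ≤ deriv G x
  κ_le : deriv G x ≤ K * r
  q_le : |deriv (deriv G) x / 2| ≤ K
  top : ∀ t ∈ Icc (b - c) b, c ≤ G t - y

theorem IsHalfWell.isWell {c K L b : ℝ} {G : ℝ → ℝ} {y r xm x : ℝ} (hL : L ≤ K)
    (h1 : IsHalfWell c K b G y r xm) (h2 : IsHalfWell c K (L - b) (fun x => G (L - x)) y r x) :
    IsWell c K L b G y r xm (L - x) (deriv G xm) (deriv (fun x => G (L - x)) x)
      (deriv (deriv G) xm / 2) (deriv (deriv fun x => G (L - x)) x / 2) := by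
  have hm : ∀ {t}, t ∈ Icc b L → L - t ∈ Icc 0 (L - b) := fun {t} ht =>
    ⟨by linarith [ht.2], by linarith [ht.1]⟩
  have e : ∀ t, t - (L - x) = -(L - t - x) := fun t => by ring
  have e' : ∀ t, L - x - t = L - t - x := fun t => by ring
  obtain ⟨a1, a2, a3, a4, a5, a6, a7, a8, a9, a10, a11, a12, a13⟩ := h1
  obtain ⟨-, -, b3, b4, b5, b6, b7, b8, b9, b10, b11, b12, b13⟩ := h2
  refine ⟨hL, a1, a2, a3, a4, a5, a6, by linarith, by linarith, by linarith, by linarith, a7, a8,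
    fun t ht => ?_, fun t ht => ?_, a9, fun t ht => ?_, a10, a11, b10, b11, a12, b12, fun t ht => ?_⟩
  · have := b7 _ (hm ht)
    simp only [sub_sub_cancel] at this
    rwa [e, neg_sq, e']
  · have := b8 _ (hm ht)
    simp only [sub_sub_cancel] at this
    rwa [e, neg_sq]
  · have := b9 _ (hm ht)
    simp only [sub_sub_cancel] at this
    rwa [e t, abs_neg, e' t]
  · rcases le_total t b with htb | htb
    · exact a13 t ⟨ht.1, htb⟩
    · have := b13 (L - t) ⟨by linarith [ht.2], by linarith⟩
      rwa [sub_sub_cancel] at this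

theorem abs_le_of_abs_deriv_le {F F' : ℝ → ℝ} {x b K : ℝ} (n : ℕ) (hK : 0 ≤ K)
    (hx : x ∈ Icc 0 b) (hF : ∀ t, HasDerivAt F (F' t) t) (h0 : F x = 0)
    (h : ∀ t ∈ Icc 0 b, |F' t| ≤ K * |t - x|^n) {t : ℝ} (ht : t ∈ Icc 0 b) :
    |F t| ≤ K * |t - x|^(n + 1) := by
  have := (convex_uIcc x t).norm_image_sub_le_of_norm_hasDerivWithin_le (f := F) (f' := F')
    (C := K * |t - x|^n) (fun s _ => (hF s).hasDerivWithinAt) (fun s hs => by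
      refine (h s (Set.uIcc_subset_Icc hx ht hs)).trans ?_
      gcongr K * ?_^n
      exact Set.abs_sub_left_of_mem_uIcc hs) Set.left_mem_uIcc Set.right_mem_uIcc
  rw [h0, sub_zero, norm_eq_abs, norm_eq_abs] at this
  rwa [pow_succ, ← mul_assoc]

namespace Hill

variable {G : ℝ → ℝ} {b : ℝ}

theorem hasDerivAt (H : Hill G b) (x : ℝ) : HasDerivAt G (deriv G x) x ∧
    HasDerivAt (deriv G) (deriv (deriv G) x) x ∧
    HasDerivAt (deriv (deriv G)) (deriv (deriv (deriv G)) x) x ∧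
    Continuous (deriv (deriv (deriv G))) := by
  have h1 : ContDiff ℝ ∞ (deriv G) := (contDiff_infty_iff_deriv.1 H.smooth).2
  have h2 : ContDiff ℝ ∞ (deriv (deriv G)) := (contDiff_infty_iff_deriv.1 h1).2
  have d : ∀ {f : ℝ → ℝ}, ContDiff ℝ ∞ f → HasDerivAt f (deriv f x) x := fun hf =>
    (hf.differentiable (by simp) x).hasDerivAt
  exact ⟨d H.smooth, d h1, d h2, ((contDiff_infty_iff_deriv.1 h2).2).continuous⟩

theorem strictMonoOn (H : Hill G b) : StrictMonoOn G (Icc 0 b) :=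
  strictMonoOn_of_deriv_pos (convex_Icc 0 b) H.smooth.continuous.continuousOn
    (by rw [interior_Icc]; exact H.deriv_pos)

theorem exists_inverse (H : Hill G b) : ∃ X : ℝ → ℝ, ∀ y ∈ Ioo (G 0) (G b),
    X y ∈ Ioo 0 b ∧ G (X y) = y ∧ ContDiffAt ℝ ∞ X y ∧ HasDerivAt X (deriv G (X y))⁻¹ y := by
  have hex : ∀ y, ∃ x, y ∈ Ioo (G 0) (G b) → x ∈ Ioo 0 b ∧ G x = y := fun y => by
    by_cases hy : y ∈ Ioo (G 0) (G b)
    · obtain ⟨x, hx, h⟩ := intermediate_value_Ioo H.b_pos.le H.smooth.continuous.continuousOn hy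
      exact ⟨x, fun _ => ⟨hx, h⟩⟩
    · exact ⟨0, fun h => absurd h hy⟩
  choose X hX using hex
  refine ⟨X, fun y hy => ?_⟩
  obtain ⟨hx, hG⟩ := hX y hy
  have hne := (H.deriv_pos _ hx).ne'
  have hf : HasFDerivAt G (ContinuousLinearEquiv.unitsEquivAut ℝ (Units.mk0 _ hne) : ℝ →L[ℝ] ℝ)
      (X y) := (H.hasDerivAt (X y)).1.hasFDerivAt.congr_fderiv (by ext; simp)
  have hs := H.smooth.contDiffAt (x := X y)
  have hloc := hs.to_localInverse hf (by simp)
  rw [hG] at hloc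
  have h0 : hs.localInverse hf (by simp) y = X y := by
    have := hs.localInverse_apply_image hf (by simp)
    rwa [hG] at this
  have hev : ∀ᶠ w in nhds y, G (hs.localInverse hf (by simp) w) = w := by
    have := (hs.hasStrictFDerivAt' hf (by simp)).eventually_right_inverse
    rwa [hG] at this
  have hcd : ContDiffAt ℝ ∞ X y := hloc.congr_of_eventuallyEq <| by
    filter_upwards [hev, isOpen_Ioo.mem_nhds hy, hloc.continuousAt.eventually_mem
      (isOpen_Ioo.mem_nhds (h0.symm ▸ hx))] with w h1 h2 h3
    exact H.strictMonoOn.injOn (Ioo_subset_Icc_self (hX w h2).1) (Ioo_subset_Icc_self h3)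
      ((hX w h2).2.trans h1.symm)
  refine ⟨hx, hG, hcd, ?_⟩
  have h1 := (hcd.differentiableAt (by simp)).hasDerivAt
  have h2 := ((H.hasDerivAt (X y)).1.comp y h1).congr_of_eventuallyEq
    (f₁ := id) (by filter_upwards [isOpen_Ioo.mem_nhds hy] with w hw using (hX w hw).2.symm)
  rwa [eq_inv_of_mul_eq_one_right (h2.unique (hasDerivAt_id y))] at h1

theorem exists_isHalfWell (H : Hill G b) {Y : ℝ} (hY : Y < G b) : ∃ c0 : ℝ, 0 < c0 ∧ ∃ K0 : ℝ,
    ∀ c, 0 < c → c ≤ c0 → ∀ K, K0 ≤ K → ∀ y ∈ Ioc (G 0) Y, ∀ x ∈ Ioo 0 b, G x = y →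
      IsHalfWell c K b G y (√(y - G 0)) x := by
  obtain ⟨b1, hb1, hb0, hbb⟩ : ∃ b1, Y < G b1 ∧ 0 < b1 ∧ b1 < b := by
    have h1 : ∀ᶠ t in nhdsWithin b (Set.Iio b), Y < G t :=
      (H.smooth.continuous.tendsto b).mono_left nhdsWithin_le_nhds |>.eventually_const_lt hY
    obtain ⟨t, h, h'⟩ := (h1.and (Ioo_mem_nhdsLT H.b_pos)).exists
    exact ⟨t, h, h'⟩
  have hd := H.hasDerivAt
  have hψ : ContinuousOn (dslope (deriv G) 0) (Icc 0 b1) :=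
    ((continuousOn_dslope Filter.univ_mem).2 ⟨(Continuous.continuousOn
      (continuous_iff_continuousAt.2 fun x => (hd x).2.1.continuousAt)),
      (hd 0).2.1.differentiableAt⟩).mono (Set.subset_univ _)
  have hψeq : ∀ t, deriv G t = dslope (deriv G) 0 t * t := fun t => by
    have := sub_smul_dslope (deriv G) 0 t
    rw [H.deriv_zero, sub_zero, sub_zero, smul_eq_mul, mul_comm] at this
    exact this.symm
  obtain ⟨t0, ht0, hmin⟩ := isCompact_Icc.exists_isMinOn ⟨0, ⟨le_rfl, hb0.le⟩⟩ hψ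
  set c1 := dslope (deriv G) 0 t0 with hc₁def
  have hc1 : 0 < c1 := by
    rcases eq_or_lt_of_le ht0.1 with h | h
    · rw [hc₁def, ← h, dslope_same]; exact H.convex
    · have h1 := H.deriv_pos t0 ⟨h, ht0.2.trans_lt hbb⟩
      rw [hψeq] at h1
      exact pos_of_mul_pos_left h1 h.le
  obtain ⟨K2, hK2⟩ := isCompact_Icc.exists_bound_of_continuousOn hψ
  obtain ⟨K1, hK₁⟩ := isCompact_Icc.exists_bound_of_continuousOn (s := Icc 0 b)
    (Continuous.continuousOn (continuous_iff_continuousAt.2 fun x => (hd x).2.1.continuousAt))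
  obtain ⟨K4, hK₄⟩ := isCompact_Icc.exists_bound_of_continuousOn (s := Icc 0 b)
    (Continuous.continuousOn (continuous_iff_continuousAt.2 fun x => (hd x).2.2.1.continuousAt))
  obtain ⟨K3, hK₃⟩ := isCompact_Icc.exists_bound_of_continuousOn (s := Icc 0 b)
    (hd 0).2.2.2.continuousOn
  have hlow : ∀ t ∈ Icc 0 b1, c1 * t ≤ deriv G t := fun t ht => by
    rw [hψeq]; exact mul_le_mul_of_nonneg_right (hmin ht) ht.1
  have hup : ∀ t ∈ Icc 0 b1, deriv G t ≤ K2 * t := fun t ht => by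
    rw [hψeq]; exact mul_le_mul_of_nonneg_right ((le_abs_self _).trans (hK2 t ht)) ht.1
  have hmono : MonotoneOn (fun t => G t - c1 / 2 * t^2) (Icc 0 b1) := by
    refine monotoneOn_of_hasDerivWithinAt_nonneg (f' := fun t => deriv G t - c1 * t)
      (convex_Icc _ _) (by have := H.smooth.continuous; fun_prop) (fun t _ => ?_) fun t ht => ?_
    · exact (((hd t).1.sub (((hasDerivAt_id t).pow 2).const_mul (c1 / 2))).congr_deriv
        (by simp; ring)).hasDerivWithinAt
    · rw [interior_Icc] at ht; linarith [hlow t (Ioo_subset_Icc_self ht)]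
  have hanti : MonotoneOn (fun t => K2 / 2 * t^2 - G t) (Icc 0 b1) := by
    refine monotoneOn_of_hasDerivWithinAt_nonneg (f' := fun t => K2 * t - deriv G t)
      (convex_Icc _ _) (by have := H.smooth.continuous; fun_prop) (fun t _ => ?_) fun t ht => ?_
    · exact (((((hasDerivAt_id t).pow 2).const_mul (K2 / 2)).sub (hd t).1).congr_deriv
        (by simp; ring)).hasDerivWithinAt
    · rw [interior_Icc] at ht; linarith [hup t (Ioo_subset_Icc_self ht)]
  have hbmem : b1 ∈ Icc 0 b := ⟨hb0.le, hbb.le⟩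
  set δ := G b1 - Y with hδ
  have hδ0 : 0 < δ := sub_pos.2 hb1
  have hK1 : 0 < K1 + 1 := by linarith [(norm_nonneg _).trans (hK₁ b1 hbmem)]
  have hK20 : 0 < K2 := by
    have h1 := hlow b1 ⟨hb0.le, le_rfl⟩
    have h2 := hup b1 ⟨hb0.le, le_rfl⟩
    exact pos_of_mul_pos_left ((mul_pos hc1 hb0).trans_le (h1.trans h2)) hb0.le
  set α := √(c1 / 2) with hα
  set β := √(K2 / 2) with hβ
  have hα0 : 0 < α := by positivity
  have hβ0 : 0 < β := by positivity
  have hα2 : α^2 = c1 / 2 := sq_sqrt (by positivity)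
  have hβ2 : β^2 = K2 / 2 := sq_sqrt (by positivity)
  have hb := H.b_pos
  set γ := δ / (K1 + 1) with hγ
  have hbb' : 0 < b - b1 := sub_pos.2 hbb
  refine ⟨min (1 / β) (min γ (min (b - b1) (min (γ / (β * b)) (min (c1 / 2 / β)
    (min (δ / (β * b * b)) (min (c1 / 2) (min (δ / b^2) δ))))))), by positivity,
    β * b + 1 / α + K2 / α + K4 + K3, fun c hc hcc K hK y hy x hx hxy => ?_⟩
  simp only [le_min_iff] at hcc
  obtain ⟨m1, m2, m3, m4, m5, m6, m7, m8, m9⟩ := hcc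
  rw [le_div_iff₀ (by positivity)] at m1 m4 m5 m6 m8
  have hK3 : 0 ≤ K3 := (norm_nonneg _).trans (hK₃ b1 hbmem)
  have hK4 : 0 ≤ K4 := (norm_nonneg _).trans (hK₄ b1 hbmem)
  have p1 : 0 < β * b := by positivity
  have p2 : 0 < 1 / α := by positivity
  have p3 : 0 < K2 / α := by positivity
  set r := √(y - G 0) with hr
  have hr0 : 0 < r := sqrt_pos.2 (sub_pos.2 hy.1)
  have hr2 : r^2 = y - G 0 := sq_sqrt (sub_pos.2 hy.1).le
  have hxb : x ≤ b1 := by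
    by_contra! h
    have := H.strictMonoOn hbmem ⟨hx.1.le, hx.2.le⟩ h
    linarith [hy.2]
  have hx1 : x ∈ Icc 0 b1 := ⟨hx.1.le, hxb⟩
  have hx' : x ∈ Icc 0 b := ⟨hx.1.le, hx.2.le⟩
  have h0 : (0 : ℝ) ∈ Icc 0 b1 := ⟨le_rfl, hb0.le⟩
  have q1 := hmono h0 hx1 hx1.1
  have q2 := hanti h0 hx1 hx1.1
  simp only [hxy] at q1 q2
  have hαx : α * x ≤ r := le_of_sq_le_sq (by rw [mul_pow, hα2, hr2]; linarith) hr0.le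
  have hrβ : r ≤ β * x := le_of_sq_le_sq (by rw [mul_pow, hβ2, hr2]; linarith) (mul_nonneg hβ0.le hx.1.le)
  have hrb : r ≤ β * b := hrβ.trans (mul_le_mul_of_nonneg_left hx.2.le hβ0.le)
  have hxα : x ≤ 1 / α * r := by rw [one_div, inv_mul_eq_div, le_div_iff₀ hα0]; linarith
  have hcβ : ∀ {w u}, c * β ≤ w → x ≤ u → c * r ≤ w * u := fun {w u} h hu => by
    calc c * r ≤ c * (β * x) := by gcongr
      _ = c * β * x := by ring
      _ ≤ w * u := mul_le_mul h hu hx.1.le ((mul_pos hc hβ0).le.trans h)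
  have hcr : c * r ≤ x := by simpa using hcβ m1 le_rfl
  have hγx : x + γ ≤ b1 := by
    have := (convex_Icc (0 : ℝ) b).norm_image_sub_le_of_norm_hasDerivWithin_le
      (fun s _ => (hd s).1.hasDerivWithinAt) hK₁ hx' hbmem
    rw [norm_eq_abs, norm_eq_abs, hxy, abs_of_nonneg (sub_nonneg.2 hxb)] at this
    have h1 : δ ≤ (K1 + 1) * (b1 - x) := by linarith [le_abs_self (G b1 - y), hy.2]
    have : γ ≤ b1 - x := by rw [hγ, div_le_iff₀ hK1]; linarith
    linarith
  have hbig : ∀ t ∈ Icc b1 b, δ ≤ G t - y := fun t ht => by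
    have := H.strictMonoOn.monotoneOn hbmem ⟨hb0.le.trans ht.1, ht.2⟩ ht.1
    linarith [hy.2]
  have hκ : c * r ≤ c1 / 2 * x := hcβ m5 le_rfl
  have hcb : c * r ≤ γ := (mul_le_mul_of_nonneg_left hrb hc.le).trans m4
  have hP : ∀ t ∈ Icc 0 b1, 0 ≤ (G t - y - c1 / 2 * (t^2 - x^2)) * (t - x) := fun t ht => by
    rcases le_total x t with h | h
    · have := hmono hx1 ht h
      exact mul_nonneg (by simp only [hxy] at this; linarith) (sub_nonneg.2 h)
    · have := hmono ht hx1 h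
      exact mul_nonneg_of_nonpos_of_nonpos (by simp only [hxy] at this; linarith) (sub_nonpos.2 h)
  have hsplit : ∀ t ∈ Icc 0 b, t ∈ Icc 0 b1 ∨ t ∈ Icc b1 b := fun t ht =>
    (le_total t b1).imp (fun h => ⟨ht.1, h⟩) fun h => ⟨h, ht.2⟩
  refine ⟨hr0, by linarith, hcr, hxα.trans (by gcongr; linarith), by linarith, by linarith,
    fun t ht => ?_, fun t ht => ?_, fun t ht => ?_, (hκ.trans (by
    linarith [mul_pos hc1 hx.1])).trans (hlow x hx1), (hup x hx1).trans ?_, ?_, fun t ht => m9.trans (hbig t ⟨by linarith [ht.1], ht.2⟩)⟩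
  · rcases hsplit t ht with ht' | ht'
    · linarith [hP t ht', mul_nonneg (sub_nonneg.2 hκ) (sq_nonneg (t - x)),
        mul_nonneg (mul_nonneg hc1.le ht.1) (sq_nonneg (t - x))]
    · have h1 := hbig t ht'
      have h2 : 0 ≤ t - x := by linarith [ht'.1]
      have h3 : c * r * (t - x) ≤ δ := by
        calc c * r * (t - x) ≤ c * (β * b) * b := by gcongr; linarith [ht.2, hx.1]
          _ ≤ δ := by linarith
      linarith [mul_nonneg (sub_nonneg.2 h3) h2, mul_nonneg (sub_nonneg.2 h1) h2]
  · rcases hsplit t ht with ht' | ht'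
    · rcases le_total x t with h | h
      · have := hmono hx1 ht' h
        simp only [hxy] at this
        refine le_trans ?_ (le_abs_self _)
        linarith [mul_nonneg (sub_nonneg.2 m7) (sq_nonneg (t - x)),
          mul_nonneg (mul_nonneg hc1.le (sub_nonneg.2 h)) hx.1.le]
      · have := hmono ht' hx1 h
        simp only [hxy] at this
        refine le_trans ?_ (neg_le_abs _)
        linarith [mul_nonneg (sub_nonneg.2 m7) (sq_nonneg (t - x)),
          mul_nonneg (mul_nonneg hc1.le (sub_nonneg.2 h)) ht.1]
    · refine le_trans ?_ ((hbig t ht').trans (le_abs_self _))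
      have h2 : 0 ≤ t - x := by linarith [ht'.1]
      calc c * (t - x)^2 ≤ c * b^2 := by gcongr; linarith [ht.2, hx.1]
        _ ≤ δ := m8
  · have e1 : ∀ t ∈ Icc 0 b, |deriv (deriv G) t - deriv (deriv G) x| ≤ K3 * |t - x|^1 :=
      fun t ht => abs_le_of_abs_deriv_le 0 hK3 hx' (fun t => (hd t).2.2.1.sub_const _) (sub_self _)
        (fun s hs => by simpa using hK₃ s hs) ht
    have e2 : ∀ t ∈ Icc 0 b, |deriv G t - deriv G x - deriv (deriv G) x * (t - x)| ≤
        K3 * |t - x|^2 := fun t ht => abs_le_of_abs_deriv_le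
        (F := fun t => deriv G t - deriv G x - deriv (deriv G) x * (t - x)) 1 hK3 hx' (fun t =>
          (((hd t).2.1.sub_const _).sub (((hasDerivAt_id t).sub_const x).const_mul _)).congr_deriv
          (by simp)) (by simp) e1 ht
    have e3 := abs_le_of_abs_deriv_le (F := fun t => G t - y - deriv G x * (t - x) -
        deriv (deriv G) x / 2 * (t - x)^2) 2 hK3 hx' (fun t =>
        ((((hd t).1.sub_const y).sub (((hasDerivAt_id t).sub_const x).const_mul _)).sub
          ((((hasDerivAt_id t).sub_const x).pow 2).const_mul _)).congr_deriv
          (show _ = deriv G t - deriv G x - deriv (deriv G) x * (t - x) by simp; ring))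
        (by simp [hxy]) e2 ht
    exact e3.trans (by gcongr; linarith)
  · calc K2 * x ≤ K2 * (1 / α * r) := by gcongr
      _ = K2 / α * r := by ring
      _ ≤ K * r := by gcongr; linarith
  · have := hK₄ x hx'
    rw [norm_eq_abs] at this
    rw [abs_div, abs_two]
    linarith [abs_nonneg (deriv (deriv G) x)]

end Hill

namespace Hill

/-- `X` is the inverse of the profile on the slope. -/
def IsInverse (G : ℝ → ℝ) (b : ℝ) (X : ℝ → ℝ) : Prop := ∀ y ∈ Ioo (G 0) (G b),
    X y ∈ Ioo 0 b ∧ G (X y) = y ∧ ContDiffAt ℝ ∞ X y ∧ HasDerivAt X (deriv G (X y))⁻¹ y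

variable {G X : ℝ → ℝ} {b : ℝ}

theorem contDiff_deriv (H : Hill G b) : ContDiff ℝ ∞ (deriv G) ∧ ContDiff ℝ ∞ (deriv (deriv G)) :=
  have h := (contDiff_infty_iff_deriv.1 H.smooth).2
  ⟨h, (contDiff_infty_iff_deriv.1 h).2⟩

theorem contDiffAt_comp_inverse (H : Hill G b) (hX : IsInverse G b X) {B : ℝ → ℝ}
    (hB : ContDiff ℝ ∞ B) (p : ℕ) {y : ℝ} (hy : y ∈ Ioo (G 0) (G b)) :
    ContDiffAt ℝ ∞ (fun y => B (X y) * (deriv G (X y))⁻¹^p) y := by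
  obtain ⟨h1, -, h3, -⟩ := hX y hy
  exact (hB.contDiffAt.comp y h3).mul
    (((H.contDiff_deriv.1.contDiffAt.comp y h3).inv (H.deriv_pos _ h1).ne').pow p)

theorem iteratedDeriv_comp_inverse (H : Hill G b) (hX : IsInverse G b X) {B : ℝ → ℝ}
    (hB : ContDiff ℝ ∞ B) (p n : ℕ) : ∃ B' : ℝ → ℝ, ContDiff ℝ ∞ B' ∧
    ∀ y ∈ Ioo (G 0) (G b), iteratedDeriv n (fun y => B (X y) * (deriv G (X y))⁻¹^p) y =
      B' (X y) * (deriv G (X y))⁻¹^(p + 2 * n) := by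
  induction n with
  | zero => exact ⟨B, hB, fun y _ => by simp⟩
  | succ n ih =>
    obtain ⟨A, hA, h⟩ := ih
    obtain ⟨c1, c2⟩ := H.contDiff_deriv
    refine ⟨fun x => deriv A x * deriv G x - (p + 2 * n : ℕ) * A x * deriv (deriv G) x,
      ((contDiff_infty_iff_deriv.1 hA).2.mul c1).sub ((contDiff_const.mul hA).mul c2),
      fun y hy => ?_⟩
    obtain ⟨x1, -, -, x4⟩ := hX y hy
    have hne := (H.deriv_pos _ x1).ne'
    rw [iteratedDeriv_succ, Filter.EventuallyEq.deriv_eq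
      (Filter.eventually_of_mem (isOpen_Ioo.mem_nhds hy) h)]
    have d1 := ((hA.differentiable (by simp) (X y)).hasDerivAt).comp y x4
    have d2 := ((H.hasDerivAt (X y)).2.1.comp y x4).inv hne
    refine (d1.mul (d2.pow (p + 2 * n))).deriv.trans ?_
    simp only [Function.comp, Pi.inv_apply, Pi.pow_apply]
    rw [show p + 2 * (n + 1) = p + 2 * n + 2 by ring]
    generalize p + 2 * n = q
    rcases q with _ | q
    · simp; field_simp
    · simp only [Nat.add_sub_cancel, inv_pow]
      field_simp
      ring

theorem norm_iteratedDeriv_comp_inverse_le (H : Hill G b) (hX : IsInverse G b X) {B : ℝ → ℝ}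
    (hB : ContDiff ℝ ∞ B) (p n : ℕ) {Y : ℝ} (hY : Y < G b) : ∃ C, 0 ≤ C ∧ ∀ y ∈ Ioc (G 0) Y,
      |iteratedDeriv n (fun y => B (X y) * (deriv G (X y))⁻¹^p) y| ≤
        C * (√(y - G 0))⁻¹^(p + 2 * n) := by
  obtain ⟨B', hB', h⟩ := H.iteratedDeriv_comp_inverse hX hB p n
  obtain ⟨c, hc, K, hw⟩ := H.exists_isHalfWell hY
  obtain ⟨M, hM⟩ := isCompact_Icc.exists_bound_of_continuousOn (s := Icc 0 b)
    hB'.continuous.continuousOn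
  have hM0 : 0 ≤ M := (norm_nonneg _).trans (hM 0 ⟨le_rfl, H.b_pos.le⟩)
  refine ⟨M * c⁻¹^(p + 2 * n), by positivity, fun y hy => ?_⟩
  have hy' : y ∈ Ioo (G 0) (G b) := ⟨hy.1, hy.2.trans_lt hY⟩
  obtain ⟨x1, x2, -⟩ := hX y hy'
  have W := hw c hc le_rfl K le_rfl y hy _ x1 x2
  have hr := W.r_pos
  rw [h y hy', abs_mul, abs_pow, abs_inv, abs_of_pos (H.deriv_pos _ x1), mul_assoc, ← mul_pow,
    ← mul_inv]
  exact mul_le_mul (hM _ (Ioo_subset_Icc_self x1)) (pow_le_pow_left₀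
    (inv_pos.2 (H.deriv_pos _ x1)).le (inv_anti₀ (by positivity) W.κ_ge) _)
    (pow_nonneg (inv_pos.2 (H.deriv_pos _ x1)).le _) hM0

/-- The derivative of the logarithm of the reference rate, relative to its linearization. -/
def slope (G X : ℝ → ℝ) (h y0 y : ℝ) : ℝ :=
  h⁻¹ * (X y - X y0) - 1 / 4 * (deriv (deriv G) (X y) * (deriv G (X y))⁻¹^2)

theorem contDiffAt_slope (H : Hill G b) (hX : IsInverse G b X) (h y0 : ℝ) {y : ℝ}
    (hy : y ∈ Ioo (G 0) (G b)) : ContDiffAt ℝ ∞ (slope G X h y0) y :=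
  (contDiffAt_const.mul ((hX y hy).2.2.1.sub contDiffAt_const)).sub
    (contDiffAt_const.mul (H.contDiffAt_comp_inverse hX H.contDiff_deriv.2 2 hy))

theorem norm_iteratedDeriv_slope_le (H : Hill G b) (hX : IsInverse G b X) (n : ℕ) {Y : ℝ}
    (hY : Y < G b) : ∃ C, 0 ≤ C ∧ ∀ h, 0 < h → ∀ y ∈ Ioc (G 0) Y, ∀ r, r = √(y - G 0) →
      h ≤ r^3 → |iteratedDeriv n (slope G X h y) y| ≤ C * (h / r^3) / (h / r)^(n + 1) := by
  obtain ⟨C1, hC1, h1⟩ := H.norm_iteratedDeriv_comp_inverse_le hX H.contDiff_deriv.2 2 n hY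
  obtain ⟨C2, hC2, h2⟩ := H.norm_iteratedDeriv_comp_inverse_le hX (contDiff_const (c := 1)) 1 (n - 1) hY
  refine ⟨C1 + C2, by positivity, fun h hh y hy r hr hhr => ?_⟩
  have hy' : y ∈ Ioo (G 0) (G b) := ⟨hy.1, hy.2.trans_lt hY⟩
  have hr0 : 0 < r := hr ▸ sqrt_pos.2 (sub_pos.2 hy.1)
  specialize h1 y hy
  specialize h2 y hy
  rw [← hr] at h1 h2
  set ε := h / r^3 with hε
  have hε0 : 0 < ε := by positivity
  have hε1 : ε ≤ 1 := (div_le_one (by positivity)).2 hhr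
  have hh' : h = ε * r^3 := by rw [hε]; field_simp
  have hρ : h / r = ε * r^2 := by rw [hh']; field_simp
  have hpow : ∀ {t : ℝ} (k : ℕ), t * ε^k = r⁻¹^(2 + 2 * n) → t * ε^k ≤ t := fun {t} k ht =>
    mul_le_of_le_one_right (nonneg_of_mul_nonneg_left (ht ▸ by positivity) (pow_pos hε0 k))
      (pow_le_one₀ hε0.le hε1)
  have e1 : r⁻¹^(2 + 2 * n) ≤ ε / (h / r)^(n + 1) := by
    have : ε / (h / r)^(n + 1) * ε^n = r⁻¹^(2 + 2 * n) := by rw [hρ, inv_pow]; field_simp; ring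
    exact this ▸ hpow n this
  have e2 : n ≠ 0 → h⁻¹ * r⁻¹^(1 + 2 * (n - 1)) ≤ ε / (h / r)^(n + 1) := fun hn => by
    obtain ⟨k, rfl⟩ := Nat.exists_eq_succ_of_ne_zero hn
    have : ε / (h / r)^(k + 1 + 1) * ε^k = h⁻¹ * r⁻¹^(1 + 2 * k) := by
      rw [hρ, hh', inv_pow]; field_simp; ring
    rw [Nat.succ_eq_add_one, Nat.add_sub_cancel, ← this]
    exact mul_le_of_le_one_right (by positivity) (pow_le_one₀ hε0.le hε1)
  have c1 : ContDiffAt ℝ n _ y :=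
    (H.contDiffAt_comp_inverse hX H.contDiff_deriv.2 2 hy').of_le (by exact_mod_cast le_top)
  have c2 : ContDiffAt ℝ n X y := (hX y hy').2.2.1.of_le (by exact_mod_cast le_top)
  have s1 : iteratedDeriv n (slope G X h y) y = h⁻¹ * iteratedDeriv n (fun t => X t - X y) y -
      1 / 4 * iteratedDeriv n (fun y => deriv (deriv G) (X y) * (deriv G (X y))⁻¹^2) y := by
    unfold slope
    rw [iteratedDeriv_fun_sub (contDiffAt_const.mul (c2.sub contDiffAt_const))
      (contDiffAt_const.mul c1), iteratedDeriv_const_mul_field,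
      iteratedDeriv_const_mul_field]
  have s2 : |h⁻¹ * iteratedDeriv n (fun t => X t - X y) y| ≤ C2 * (ε / (h / r)^(n + 1)) := by
    rcases Nat.eq_zero_or_pos n with hn | hn
    · simp only [hn, iteratedDeriv_zero, sub_self, mul_zero, abs_zero]; positivity
    · have s3 : iteratedDeriv n (fun t => X t - X y) y =
          iteratedDeriv (n - 1) (fun t => 1 * (deriv G (X t))⁻¹^1) y := by
        conv_lhs => rw [← Nat.sub_add_cancel hn]
        rw [iteratedDeriv_succ']
        refine Filter.EventuallyEq.iteratedDeriv_eq _ ?_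
        filter_upwards [isOpen_Ioo.mem_nhds hy'] with t ht
        rw [one_mul, pow_one]
        exact ((hX t ht).2.2.2.sub_const _).deriv
      rw [s3, abs_mul, abs_of_pos (inv_pos.2 hh)]
      calc _ ≤ h⁻¹ * (C2 * r⁻¹^(1 + 2 * (n - 1))) := by gcongr
        _ = C2 * (h⁻¹ * r⁻¹^(1 + 2 * (n - 1))) := by ring
        _ ≤ _ := by gcongr; exact e2 hn.ne'
  rw [s1]
  refine (abs_sub _ _).trans ?_
  rw [abs_mul (1 / 4)]
  have : C1 * r⁻¹^(2 + 2 * n) ≤ C1 * (ε / (h / r)^(n + 1)) := by gcongr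
  rw [abs_of_pos (by norm_num : (0 : ℝ) < 1 / 4), mul_div_assoc]
  nlinarith [abs_nonneg (iteratedDeriv n (fun y => deriv (deriv G) (X y) * (deriv G (X y))⁻¹^2) y)]

/-- The action of the tunnelling path, for turning points given by `X` and, after reflection,
`X'`. -/
def actionOf (G X X' : ℝ → ℝ) (L y : ℝ) : ℝ := ((∫ t in 0..L - X' y, G t) - y * (L - X' y)) -
  ((∫ t in 0..X y, G t) - y * X y) - ((∫ t in 0..L, G t) - y * L)

/-- The logarithms of the slopes at the turning points. -/
def logSlope (G X X' : ℝ → ℝ) (L y : ℝ) : ℝ :=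
  log (deriv G (X y)) + log (deriv (fun x => G (L - x)) (X' y))

/-- The logarithm of the reference rate at `y`, subtracted from its linearization at `y0`. -/
def refDefect (G X X' : ℝ → ℝ) (L h y0 y : ℝ) : ℝ :=
  (-h⁻¹ * (actionOf G X X' L y0 + (X' y0 + X y0) * (y - y0)) + 1 / 4 * logSlope G X X' L y0) -
    (-h⁻¹ * actionOf G X X' L y + 1 / 4 * logSlope G X X' L y)

theorem hasDerivAt_refDefect {X' : ℝ → ℝ} {L : ℝ} (H : Hill G b)
    (H' : Hill (fun x => G (L - x)) (L - b)) (hL : G L = G 0) (hX : IsInverse G b X)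
    (hX' : IsInverse (fun x => G (L - x)) (L - b) X') (h y0 : ℝ) {y : ℝ}
    (hy : y ∈ Ioo (G 0) (G b)) : HasDerivAt (refDefect G X X' L h y0)
      (slope G X h y0 y + slope (fun x => G (L - x)) X' h y0 y) y := by
  have hy' : y ∈ Ioo (G (L - 0)) (G (L - (L - b))) := by rwa [sub_zero, sub_sub_cancel, hL]
  obtain ⟨a1, a2, -, a4⟩ := hX y hy
  obtain ⟨b1, b2, -, b4⟩ := hX' y hy'
  have hΓ : ∀ x, HasDerivAt (fun x => ∫ t in 0..x, G t) (G x) x := fun x =>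
    (H.smooth.continuous.integral_hasStrictDerivAt _ _).hasDerivAt
  have hS : HasDerivAt (actionOf G X X' L) (X' y + X y) y := by
    have d1 := ((hΓ (L - X' y)).comp y (b4.const_sub L)).sub ((hasDerivAt_id y).mul (b4.const_sub L))
    have d2 := ((hΓ (X y)).comp y a4).sub ((hasDerivAt_id y).mul a4)
    have d3 := ((hasDerivAt_id y).mul_const L).const_sub (∫ t in 0..L, G t)
    refine ((d1.sub d2).sub d3).congr_deriv ?_
    simp only [a2, b2, id]
    ring
  have hlog : ∀ {F Z : ℝ → ℝ} {z : ℝ}, Hill F z → Z y ∈ Ioo 0 z →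
      HasDerivAt Z (deriv F (Z y))⁻¹ y → HasDerivAt (fun y => log (deriv F (Z y)))
        (deriv (deriv F) (Z y) * (deriv F (Z y))⁻¹^2) y := fun hF hz hd => by
    have hne := (hF.deriv_pos _ hz).ne'
    refine (((hF.hasDerivAt _).2.1.comp y hd).log hne).congr_deriv ?_
    simp only [Function.comp]
    field_simp
  have d4 := (((((hasDerivAt_id y).sub_const y0).const_mul (X' y0 + X y0)).const_add
    (actionOf G X X' L y0)).const_mul (-h⁻¹)).add_const (1 / 4 * logSlope G X X' L y0)
  have d5 := (hS.const_mul (-h⁻¹)).add (((hlog H a1 a4).add (hlog H' b1 b4)).const_mul (1 / 4))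
  refine (d4.sub d5).congr_deriv ?_
  simp only [slope]
  ring

theorem refDefect_bounds {X' : ℝ → ℝ} {L Y : ℝ} (H : Hill G b)
    (H' : Hill (fun x => G (L - x)) (L - b)) (hL : G L = G 0) (hX : IsInverse G b X)
    (hX' : IsInverse (fun x => G (L - x)) (L - b) X') (hY : Y < G b) (n : ℕ) : ∃ C, 0 ≤ C ∧ ∀ h,
      0 < h → ∀ y ∈ Ioc (G 0) Y, ∀ r, r = √(y - G 0) → h ≤ r^3 →
      ContDiffAt ℝ ∞ (refDefect G X X' L h y) y ∧
      |iteratedDeriv n (refDefect G X X' L h y) y| ≤ C * (h / r^3) / (h / r)^n := by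
  have hr0 : G (L - 0) = G 0 := by rw [sub_zero, hL]
  have hrb : G (L - (L - b)) = G b := by rw [sub_sub_cancel]
  obtain ⟨C1, hC1, h1⟩ := H.norm_iteratedDeriv_slope_le hX (n - 1) hY
  obtain ⟨C2, hC2, h2⟩ := H'.norm_iteratedDeriv_slope_le hX' (n - 1) (hrb.symm ▸ hY)
  simp only [hr0] at h2
  refine ⟨C1 + C2, by positivity, fun h hh y hy r hr hhr => ?_⟩
  have hy' : y ∈ Ioo (G 0) (G b) := ⟨hy.1, hy.2.trans_lt hY⟩
  have hd := fun t ht => H.hasDerivAt_refDefect H' hL hX hX' h y (y := t) ht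
  have hev : deriv (refDefect G X X' L h y) =ᶠ[nhds y]
      fun t => slope G X h y t + slope (fun x => G (L - x)) X' h y t := by
    filter_upwards [isOpen_Ioo.mem_nhds hy'] with t ht using (hd t ht).deriv
  have c1 : ∀ t ∈ Ioo (G 0) (G b), ContDiffAt ℝ ∞ (slope G X h y) t := fun t ht =>
    H.contDiffAt_slope hX h y ht
  have c2 : ∀ t ∈ Ioo (G 0) (G b), ContDiffAt ℝ ∞ (slope (fun x => G (L - x)) X' h y) t :=
    fun t ht => H'.contDiffAt_slope hX' h y (by simpa only [hr0, hrb] using ht)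
  refine ⟨?_, ?_⟩
  · refine ContDiffOn.contDiffAt ((contDiffOn_infty_iff_deriv_of_isOpen isOpen_Ioo).2
      ⟨fun t ht => (hd t ht).differentiableAt.differentiableWithinAt, ?_⟩) (isOpen_Ioo.mem_nhds hy')
    exact ContDiffOn.congr (fun t ht => ((c1 t ht).add (c2 t ht)).contDiffWithinAt)
      fun t ht => (hd t ht).deriv
  · rcases Nat.eq_zero_or_pos n with rfl | hn
    · simp only [iteratedDeriv_zero, refDefect, sub_self, mul_zero, add_zero, abs_zero]
      have : 0 < r := hr ▸ sqrt_pos.2 (sub_pos.2 hy.1)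
      positivity
    · conv_lhs => rw [← Nat.sub_add_cancel hn]
      have hle : ∀ k : ℕ, (k : WithTop ℕ∞) ≤ ∞ := fun k => by exact_mod_cast le_top
      rw [iteratedDeriv_succ', hev.iteratedDeriv_eq,
        iteratedDeriv_fun_add ((c1 y hy').of_le (hle _)) ((c2 y hy').of_le (hle _))]
      have e1 := h1 h hh y hy r hr hhr
      have e2 := h2 h hh y hy r hr hhr
      rw [Nat.sub_add_cancel hn] at e1 e2
      refine (abs_add_le _ _).trans ((add_le_add e1 e2).trans_eq ?_)
      ring

end Hill

/-! ### The rate near a point of the upper half of the picture -/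

theorem norm_iteratedFDeriv_comp_clm_le {E F V : Type} [NormedAddCommGroup E] [NormedSpace ℝ E]
    [NormedAddCommGroup F] [NormedSpace ℝ F] [NormedAddCommGroup V] [NormedSpace ℝ V]
    (ι : E →L[ℝ] F) (hι : ‖ι‖ ≤ 1) {f : F → V} {n : ℕ} {z : E} {U : Set F} (hU : IsOpen U)
    (hf : ContDiffOn ℝ n f U) (hz : ι z ∈ U) :
    ‖iteratedFDeriv ℝ n (fun w => f (ι w)) z‖ ≤ ‖iteratedFDeriv ℝ n f (ι z)‖ := by
  have hU' : IsOpen (ι ⁻¹' U) := hU.preimage ι.continuous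
  have h := ι.iteratedFDerivWithin_comp_right hf hU.uniqueDiffOn hU'.uniqueDiffOn hz le_rfl
  rw [iteratedFDerivWithin_of_isOpen n hU' hz, iteratedFDerivWithin_of_isOpen n hU hz] at h
  change ‖iteratedFDeriv ℝ n (f ∘ ι) z‖ ≤ _
  rw [h]
  refine (ContinuousMultilinearMap.norm_compContinuousLinearMap_le _ _).trans ?_
  exact mul_le_of_le_one_right (norm_nonneg _) (Finset.prod_le_one (fun _ _ => norm_nonneg _)
    fun _ _ => hι)

/-- `z ↦ (Re z, Im z)`, as a map into `ℂ × ℂ`. -/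
def reIm : ℂ →L[ℝ] ℂ × ℂ := (ofRealCLM ∘L reCLM).prod (ofRealCLM ∘L imCLM)

theorem norm_reIm_le : ‖reIm‖ ≤ 1 := ContinuousLinearMap.opNorm_le_bound _ zero_le_one fun z => by
  rw [one_mul]
  refine max_le ?_ ?_
  · exact (norm_real _).trans_le (abs_re_le_norm z)
  · exact (norm_real _).trans_le (abs_im_le_norm z)

theorem norm_iteratedFDeriv_half_log_le {F : ℂ × ℂ → ℂ} {z : ℂ} {R η : ℝ} (hR : 0 < R)
    (hF : ContDiffOn ℂ ω F (ball (reIm z) R))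
    (hη : ∀ p ∈ ball (reIm z) R, ‖F p - 1‖ ≤ η ∧ ‖F p - 1‖ ≤ 1 / 2) :
    ContDiffAt ℝ ∞ (fun w => 1 / 2 * log ‖F (reIm w)‖) z ∧ ∀ n : ℕ,
      ‖iteratedFDeriv ℝ n (fun w => 1 / 2 * log ‖F (reIm w)‖) z‖ ≤ 4^n * 2^(n^2) * η / R^n := by
  set U := ball (reIm z) R
  have hzU : reIm z ∈ U := mem_ball_self hR
  set f : ℂ × ℂ → ℂ := fun p => 1 / 2 * Complex.log (F p) with hf
  have hfc : ContDiffOn ℂ ω f U := fun p hp => by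
    refine contDiffWithinAt_const.mul ((Complex.contDiffAt_log ?_).comp_contDiffWithinAt p (hF p hp))
    have := (abs_re_le_norm (F p - 1)).trans (hη p hp).2
    rw [sub_re, Complex.one_re, abs_le] at this
    exact Or.inl (by linarith [this.1])
  have hfb : ∀ p ∈ U, ‖f p‖ ≤ η := fun p hp => by
    have := Complex.norm_log_one_add_half_le_self (hη p hp).2
    rw [add_sub_cancel] at this
    simp only [hf]
    rw [norm_mul, norm_div, norm_one, Complex.norm_ofNat]
    linarith [(hη p hp).1, norm_nonneg (F p - 1)]
  set l : ℂ →L[ℝ] ℝ := reCLM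
  have hl : (fun w => 1 / 2 * log ‖F (reIm w)‖) = fun w => (l ∘ f) (reIm w) := by
    funext w
    simp only [l, hf, Function.comp, reCLM_apply]
    rw [show (1 / 2 : ℂ) = ((1 / 2 : ℝ) : ℂ) by push_cast; rfl, re_ofReal_mul, Complex.log_re]
  have hUo : IsOpen U := isOpen_ball
  have hlf : ContDiffOn ℝ ω (l ∘ f) U := l.contDiff.comp_contDiffOn (hfc.restrict_scalars ℝ)
  rw [hl]
  refine ⟨((hlf.contDiffAt (hUo.mem_nhds hzU)).comp z reIm.contDiff.contDiffAt).of_le le_top,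
    fun n => ?_⟩
  have hfn : ContDiffAt ℂ n f (reIm z) := (hfc.contDiffAt (hUo.mem_nhds hzU)).of_le le_top
  refine (norm_iteratedFDeriv_comp_clm_le reIm norm_reIm_le hUo (hlf.of_le le_top) hzU).trans ?_
  refine (l.norm_iteratedFDeriv_comp_left (hfn.restrict_scalars ℝ) le_rfl).trans ?_
  rw [← hfn.restrictScalars_iteratedFDeriv, Function.comp_apply,
    ContinuousMultilinearMap.norm_restrictScalars]
  exact (mul_le_of_le_one_left (norm_nonneg _) Complex.reCLM_norm.le).trans
    (norm_iteratedFDeriv_le_of_bounded_on_ball n hR hfc hfb)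

/-! ### The profile of a potential -/

theorem Hill.of_ne_zero {G : ℝ → ℝ} {b : ℝ} (hG : ContDiff ℝ ∞ G) (hb : 0 < b)
    (hne : ∀ x ∈ Ioo 0 b, deriv G x ≠ 0) (hlt : G 0 < G b) (h0 : deriv G 0 = 0)
    (h2 : deriv (deriv G) 0 ≠ 0) : Hill G b := by
  have hc : ContDiff ℝ ∞ (deriv G) := (contDiff_infty_iff_deriv.1 hG).2
  have hpos : ∀ x ∈ Ioo 0 b, 0 < deriv G x := by
    obtain ⟨ξ, hξ, he⟩ := exists_deriv_eq_slope G hb hG.continuous.continuousOn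
      (hG.differentiable (by simp)).differentiableOn
    have hξ0 : 0 < deriv G ξ := by rw [he]; exact div_pos (sub_pos.2 hlt) (by linarith)
    intro x hx
    by_contra! hneg
    obtain ⟨t, ht, ht0⟩ := intermediate_value_uIcc (a := x) (b := ξ) hc.continuous.continuousOn
      (Set.mem_uIcc.2 (Or.inl ⟨hneg, hξ0.le⟩))
    exact hne t (Set.ordConnected_Ioo.uIcc_subset hx hξ ht) ht0
  refine ⟨hG, hb, hpos, h0, lt_of_le_of_ne ?_ h2.symm⟩
  have ht := (((hc.differentiable (by simp)) 0).hasDerivAt.tendsto_slope).mono_left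
    (nhdsWithin_mono 0 fun t ht => ne_of_gt ht : nhdsWithin (0 : ℝ) (Set.Ioi 0) ≤ _)
  refine ge_of_tendsto ht ?_
  filter_upwards [Ioo_mem_nhdsGT hb] with t ht
  rw [slope_def_field, h0, sub_zero, sub_zero]
  exact (div_pos (hpos t ht) ht.1).le

/-- The imaginary part of the potential, with the minimum moved to `0`. -/
def profile (g : ℝ → ℂ) (a x : ℝ) : ℝ := (g (a + x)).im

theorem profile_zero {g : ℝ → ℂ} {a : ℝ} : profile g a 0 = (g a).im := by simp [profile]

theorem profile_sub {g : ℝ → ℂ} {a b : ℝ} : profile g a (b - a) = (g b).im := by simp [profile]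

namespace IsPotential

variable {g : ℝ → ℂ} {a b : ℝ}

theorem smooth_im (hg : IsPotential g a b) : ContDiff ℝ ∞ fun y => (g y).im :=
  imCLM.contDiff.comp hg.smooth

theorem periodic_im (hg : IsPotential g a b) : Periodic (fun y => (g y).im) (2 * π) :=
  fun y => congrArg im (hg.periodic y)

theorem periodic_deriv (hg : IsPotential g a b) :
    Periodic (deriv fun y => (g y).im) (2 * π) := fun x => by
  rw [← deriv_comp_add_const]
  exact congrArg (deriv · x) (funext hg.periodic_im)

theorem deriv_profile (g : ℝ → ℂ) (a x : ℝ) :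
    deriv (profile g a) x = deriv (fun y => (g y).im) (a + x) :=
  deriv_comp_const_add (f := fun y => (g y).im) a x

theorem profile_reflect (hg : IsPotential g a b) :
    (fun x => profile g a (2 * π - x)) = fun x => (g (a - x)).im := funext fun x => by
  rw [profile, ← hg.periodic (a - x)]; congr 2; ring

theorem deriv_reflect (hg : IsPotential g a b) (x : ℝ) :
    deriv (fun x => profile g a (2 * π - x)) x = -deriv (fun y => (g y).im) (a - x) := by
  rw [hg.profile_reflect]; exact deriv_comp_const_sub (f := fun y => (g y).im) a x

theorem hill (hg : IsPotential g a b) : Hill (profile g a) (b - a) := by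
  have hd : deriv (profile g a) = fun x => deriv (fun y => (g y).im) (a + x) :=
    funext (deriv_profile g a)
  have := hg.b_lt
  refine Hill.of_ne_zero (hg.smooth_im.comp (contDiff_const.add contDiff_id)) (sub_pos.2 hg.a_lt_b)
    (fun x hx h => ?_) ?_ ?_ ?_
  · rw [hd] at h
    rcases (hg.crit_iff (a + x) ⟨by linarith [hx.1], by linarith [hx.2]⟩).1 h with h | h <;>
      linarith [hx.1, hx.2]
  · simpa [profile] using hg.im_lt
  · rw [hd]
    simp only []
    rw [add_zero, (hg.crit_iff a ⟨le_rfl, by linarith [pi_pos]⟩).2 (Or.inl rfl)]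
  · rw [hd, deriv_comp_const_add, add_zero]; exact hg.nondeg_a

theorem hill_reflect (hg : IsPotential g a b) :
    Hill (fun x => profile g a (2 * π - x)) (2 * π - (b - a)) := by
  have hd := funext hg.deriv_reflect
  have hb := hg.b_lt
  have hab := hg.a_lt_b
  refine Hill.of_ne_zero (by
    rw [hg.profile_reflect]
    exact hg.smooth_im.comp (contDiff_const.sub contDiff_id)) (by linarith)
    (fun x hx h => ?_) ?_ ?_ ?_
  · rw [hd, neg_eq_zero, ← hg.periodic_deriv] at h
    rcases (hg.crit_iff _ ⟨by linarith [hx.2], by linarith [hx.1]⟩).1 h with h | h <;>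
      linarith [hx.1, hx.2]
  · have e := hg.periodic_im a
    simp only at e
    simpa [profile, e] using hg.im_lt
  · rw [hd]
    simp only []
    rw [sub_zero, (hg.crit_iff a ⟨le_rfl, by linarith [pi_pos]⟩).2 (Or.inl rfl), neg_zero]
  · rw [hd, deriv.fun_neg, deriv_comp_const_sub, neg_neg, sub_zero]; exact hg.nondeg_a

theorem profile_two_pi (hg : IsPotential g a b) : profile g a (2 * π) = profile g a 0 := by
  simpa [profile] using hg.periodic_im a

theorem integral_profile (hg : IsPotential g a b) :
    ∫ x in 0..2 * π, profile g a x = 2 * π * meanIm g := by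
  have := hg.periodic_im.intervalIntegral_add_eq a 0
  rw [zero_add] at this
  simp only [profile]
  rw [integral_comp_add_left (fun x => (g x).im), add_zero, this, meanIm,
    mul_inv_cancel_left₀ two_pi_pos.ne']

theorem profile_le (hg : IsPotential g a b) {x : ℝ} (hx : x ∈ Icc 0 (2 * π)) :
    profile g a x ≤ (g b).im := by
  have hb := hg.b_lt
  have hab := hg.a_lt_b
  rcases le_total x (b - a) with h | h
  · exact (hg.hill.strictMonoOn.monotoneOn ⟨hx.1, h⟩ ⟨by linarith, le_rfl⟩ h).trans_eq profile_sub
  · have := hg.hill_reflect.strictMonoOn.monotoneOn (a := 2 * π - x) (b := 2 * π - (b - a))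
      ⟨by linarith [hx.2], by linarith⟩ ⟨by linarith, le_rfl⟩ (by linarith)
    simp only [sub_sub_cancel] at this
    exact this.trans_eq profile_sub

theorem meanIm_le (hg : IsPotential g a b) : meanIm g ≤ (g b).im := by
  have h := integral_mono_on (μ := volume) two_pi_pos.le
    (hg.hill.smooth.continuous.intervalIntegrable _ _)
    (continuous_const.intervalIntegrable _ _) fun x hx => hg.profile_le hx
  rw [hg.integral_profile, integral_const, sub_zero, smul_eq_mul] at h
  exact le_of_mul_le_mul_left h two_pi_pos

end IsPotential

/-! ### Rates -/

/-- `t` is the modulus of the matrix element of the commutator, expressed by the monodromy. -/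
def IsRate (h : ℝ) (hh : 0 < h) (g : ℝ → ℂ) (hg : Continuous g) (x0 : ℝ) (χ : ℝ → ℂ) (z : ℂ)
    (t : ℝ) : Prop :=
  ∃ l : ℝ, 0 < l ∧ (sysOf h hh g hg x0).tr (l, z.im) = 2 * Complex.cos (gauge h g z x0 (2 * π)) ∧
    (∀ q : ℝ, 0 < q → q ≤ l → (sysOf h hh g hg x0).tr (q, z.im) =
      2 * Complex.cos (gauge h g z x0 (2 * π)) → q = l) ∧
    (∃ x, (sysOf h hh g hg x0).nn (l, z.im) x ≠ 0) ∧ (sysOf h hh g hg x0).EE z.im ≠ 1 ∧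
    ∀ v : (sysOf h hh g hg x0).X, (∀ x : Icc (0 : ℝ) (2 * π), v x = χ (x0 + x)) →
      t = √l * ‖(sysOf h hh g hg x0).ww v (l, z.im)‖

theorem exists_cutoff (h : ℝ) (hh : 0 < h) (g : ℝ → ℂ) (hg : Continuous g) (x0 : ℝ) {χ : ℝ → ℂ}
    (hχ : Continuous χ) : ∃ v : (sysOf h hh g hg x0).X,
      ∀ x : Icc (0 : ℝ) (2 * π), v x = χ (x0 + x) :=
  ⟨BoundedContinuousFunction.mkOfCompact ⟨fun x : Icc (0 : ℝ) (2 * π) => χ (x0 + x),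
    by fun_prop⟩, fun _ => rfl⟩

theorem IsRate.unique {h : ℝ} {hh : 0 < h} {g : ℝ → ℂ} {hg : Continuous g} {x0 : ℝ} {χ : ℝ → ℂ}
    (hχ : Continuous χ) {z : ℂ} {t t' : ℝ} (H : IsRate h hh g hg x0 χ z t)
    (H' : IsRate h hh g hg x0 χ z t') : t = t' := by
  obtain ⟨v, hv⟩ := exists_cutoff h hh g hg x0 hχ
  obtain ⟨l, h1, h2, h3, -, -, h6⟩ := H
  obtain ⟨l', h1', h2', h3', -, -, h6'⟩ := H'
  have : l = l' := by
    rcases le_total l l' with hl | hl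
    · exact h3' l h1 hl h2
    · exact (h3 l' h1' hl h2').symm
  rw [h6 v hv, h6' v hv, this]

/-! ### The rate near a spectral parameter -/

theorem Sys.sqrt_norm_EE_div_lead (D : Sys) {r θ κm κp : ℝ} (hκm : 0 < κm) (hκp : 0 < κp)
    (hh : D.h = θ^2 * r^3) (y0 y xm xp : ℝ) :
    √‖D.EE y / D.lead y0 y xm xp (peakVal r θ κm) (peakVal r θ κp)‖ = √(D.h / π) *
      exp (D.h⁻¹ * ((D.phase y D.L).re - (D.phase y0 xp).re + (D.phase y0 xm).re +
        (y - y0) * (xp - xm)) + 1 / 4 * (log κm + log κp)) := by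
  have h0 := D.hh
  have hpp : peakVal r θ κm * peakVal r θ κp = π * D.h * (exp (1 / 2 * (log κm + log κp)))⁻¹ := by
    rw [peakVal, peakVal, ← hh, ← sqrt_mul' _ (by positivity), ← log_mul hκm.ne' hκp.ne',
      ← exp_neg, show π * D.h / κm * (π * D.h / κp) = (π * D.h)^2 * (κm * κp)⁻¹ by
        field_simp, sqrt_mul (by positivity), sqrt_sq (by positivity), sqrt_eq_rpow,
      rpow_def_of_pos (by positivity), log_inv]
    ring_nf
  rw [← sqrt_sq (exp_pos _).le, ← sqrt_mul (by positivity), ← exp_nat_mul]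
  congr 1
  rw [lead, norm_div]
  simp only [norm_mul, norm_inv, norm_pow, norm_exp, norm_real, norm_eq_abs,
    abs_of_pos h0, D.norm_EE]
  have e1 : ((2 / D.h * (D.phase y0 xp).re : ℝ) - 2 / (D.h : ℂ) * (y - y0) * xp).re =
      2 / D.h * (D.phase y0 xp).re - 2 / D.h * (y - y0) * xp := by
    rw [← ofReal_re (2 / D.h * (D.phase y0 xp).re - 2 / D.h * (y - y0) * xp)]
    push_cast; rfl
  have e2 : ((-(2 / D.h * (D.phase y0 xm).re) : ℝ) + 2 / (D.h : ℂ) * (y - y0) * xm).re =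
      -(2 / D.h * (D.phase y0 xm).re) + 2 / D.h * (y - y0) * xm := by
    rw [← ofReal_re (-(2 / D.h * (D.phase y0 xm).re) + 2 / D.h * (y - y0) * xm)]
    push_cast; rfl
  rw [e1, e2, abs_of_nonneg (by unfold peakVal; positivity),
    abs_of_nonneg (by unfold peakVal; positivity)]
  set P := (D.phase y D.L).re
  set A := (D.phase y0 xp).re
  set B := (D.phase y0 xm).re
  set l := log κm + log κp
  have h3 : ∀ u v p q : ℝ, u * p * (v * q) = u * v * (q * p) := fun _ _ _ _ => by ring
  rw [h3, hpp, ← exp_add]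
  set U := 2 / D.h * A - 2 / D.h * (y - y0) * xp + (-(2 / D.h * B) + 2 / D.h * (y - y0) * xm) with hU
  rw [show (2 : ℕ) * (D.h⁻¹ * (P - A + B + (y - y0) * (xp - xm)) + 1 / 4 * l) =
    D.h⁻¹ * P + D.h⁻¹ * P - U + 1 / 2 * l by rw [hU]; push_cast; ring, exp_add _ (1 / 2 * l),
    exp_sub, exp_add (D.h⁻¹ * P)]
  field_simp

/-- The reference rate. -/
def refRate (G X X' : ℝ → ℝ) (L h y : ℝ) : ℝ :=
  √(h / π) * exp (-h⁻¹ * Hill.actionOf G X X' L y + 1 / 4 * Hill.logSlope G X X' L y)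

namespace IsPotential

variable {g : ℝ → ℂ} {a b : ℝ} {X X' : ℝ → ℝ}

theorem isCenter (hg : IsPotential g a b) {C : ℝ} (hC : 0 < C)
    (hX : Hill.IsInverse (profile g a) (b - a) X)
    (hX' : Hill.IsInverse (fun x => profile g a (2 * π - x)) (2 * π - (b - a)) X') :
    ∃ c0 : ℝ, 0 < c0 ∧ ∃ K : ℝ, 0 < K ∧ ∃ ε0 : ℝ, 0 < ε0 ∧ ε0 ≤ 1 ∧ ∀ c, 0 < c → c ≤ c0 →
    ∀ (h : ℝ) (hh : 0 < h) (y0 r : ℝ), (g a).im < y0 → y0 ≤ meanIm g - 1 / C →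
      r = √(y0 - (g a).im) → h ≤ ε0 * r^3 → ∀ y : ℂ, ‖y - y0‖ < 1 * (h / r) →
      (sysOf h hh g hg.smooth.continuous a).IsCenter c K (b - a) y0 r √(h / r^3) (X y0)
        (2 * π - X' y0) (deriv (profile g a) (X y0))
        (deriv (fun x => profile g a (2 * π - x)) (X' y0)) y ∧
      exp (π / C / h) ≤ ‖(sysOf h hh g hg.smooth.continuous a).EE y‖ := by
  have hm := hg.meanIm_le
  have hC' : 1 / C = 1 / (2 * C) + 1 / (2 * C) := by field_simp; norm_num
  have hC2 : 0 < 1 / (2 * C) := by positivity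
  obtain ⟨c1, hc1, K1, w1⟩ := hg.hill.exists_isHalfWell (Y := meanIm g - 1 / (2 * C))
    (by rw [profile_sub]; linarith)
  obtain ⟨c2, hc2, K2, w2⟩ := hg.hill_reflect.exists_isHalfWell (Y := meanIm g - 1 / (2 * C))
    (by rw [sub_sub_cancel, profile_sub]; linarith)
  set K := |K1| + |K2| + 2 * π + 2 with hK
  have hpi := pi_pos
  have hK1 : K1 ≤ K := by linarith [le_abs_self K1, abs_nonneg K2]
  have hK2 : K2 ≤ K := by linarith [le_abs_self K2, abs_nonneg K1]
  have hK3 : 2 * π ≤ K := by linarith [abs_nonneg K2, abs_nonneg K1]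
  have hK4 : 2 ≤ K := by linarith [abs_nonneg K2, abs_nonneg K1]
  set δ := |meanIm g - (g a).im| + 1
  have hδ : 0 < δ := by positivity
  refine ⟨min c1 c2, lt_min hc1 hc2, K, by linarith, min (3 / 4) (1 / (2 * C) / δ), by positivity,
    (min_le_left _ _).trans (by norm_num), fun c hc hcc h hh y0 r hy1 hy2 hr hhr y hy => ?_⟩
  have hr0 : 0 < r := hr ▸ sqrt_pos.2 (sub_pos.2 hy1)
  have hr2 : r^2 = y0 - (g a).im := by rw [hr, sq_sqrt (sub_pos.2 hy1).le]
  have hb1 : h / r ≤ min (3 / 4) (1 / (2 * C) / δ) * r^2 := by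
    rw [div_le_iff₀ hr0]; refine hhr.trans_eq (by ring)
  have hb2 : h / r ≤ 3 / 4 * r^2 :=
    hb1.trans (mul_le_mul_of_nonneg_right (min_le_left _ _) (sq_nonneg r))
  have hb3 : h / r ≤ 1 / (2 * C) := by
    refine hb1.trans ((mul_le_mul (min_le_right _ _) ?_ (sq_nonneg r) (by positivity)).trans_eq
      (div_mul_cancel₀ _ hδ.ne'))
    linarith [le_abs_self (meanIm g - (g a).im), one_div_pos.2 hC]
  have hre : |y.re - y0| < h / r := by
    have := (abs_re_le_norm (y - y0)).trans_lt hy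
    rwa [sub_re, ofReal_re, one_mul] at this
  obtain ⟨hre1, hre2⟩ := abs_lt.1 hre
  have hcc1 := hcc.trans (min_le_left _ _)
  have hcc2 := hcc.trans (min_le_right _ _)
  have hw : ∀ t, (g a).im < t → t ≤ meanIm g - 1 / (2 * C) → ∃ qm qp, IsWell c K (2 * π) (b - a)
      (profile g a) t √(t - (g a).im) (X t) (2 * π - X' t) (deriv (profile g a) (X t))
      (deriv (fun x => profile g a (2 * π - x)) (X' t)) qm qp := fun t ht1 ht2 => by
    have e1 : profile g a (2 * π - 0) = (g a).im := by rw [sub_zero, hg.profile_two_pi, profile_zero]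
    have t1 : t ∈ Ioc (profile g a 0) (meanIm g - 1 / (2 * C)) := ⟨by rwa [profile_zero], ht2⟩
    have t2 : t ∈ Ioc (profile g a (2 * π - 0)) (meanIm g - 1 / (2 * C)) := ⟨by rwa [e1], ht2⟩
    obtain ⟨a1, a2, -⟩ := hX t ⟨t1.1, by rw [profile_sub]; linarith⟩
    obtain ⟨b1, b2, -⟩ := hX' t ⟨t2.1, by simp only [sub_sub_cancel, profile_sub]; linarith⟩
    have W1 := w1 c hc hcc1 K hK1 t t1 _ a1 a2
    have W2 := w2 c hc hcc2 K hK2 t t2 _ b1 b2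
    rw [profile_zero] at W1
    simp only [e1] at W2
    exact ⟨_, _, W1.isWell hK3 W2⟩
  refine ⟨⟨by rw [hr]; exact hw y0 hy1 (by linarith), sqrt_pos.2 (by positivity), ?_, ?_, ?_⟩, ?_⟩
  · rw [sq_sqrt (by positivity)]; exact (div_mul_cancel₀ h (by positivity)).symm
  · refine hy.le.trans (mul_le_mul_of_nonneg_right (by linarith) ?_)
    exact (div_pos hh hr0).le
  · obtain ⟨qm, qp, W⟩ := hw y.re (by nlinarith only [hre1, hb2, hr2, hr0]) (by linarith)
    have hs := W.r_pos
    have hs2 : √(y.re - (g a).im)^2 = y.re - (g a).im := sq_sqrt (sqrt_pos.1 W.r_pos).le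
    refine ⟨_, _, _, _, _, qm, qp, W, abs_le_of_sq_le_sq' ?_ (by positivity) |>.2,
      abs_le_of_sq_le_sq' ?_ (by positivity) |>.2⟩
    · rw [mul_pow, hs2]; linarith
    · rw [mul_pow, hs2]; linarith
  · rw [Sys.norm_EE]
    refine exp_le_exp.2 ?_
    have : ((sysOf h hh g hg.smooth.continuous a).phase y (2 * π)).re =
        2 * π * (meanIm g - y.re) := by
      rw [Sys.phase]
      change ((((∫ s in 0..2 * π, profile g a s : ℝ) : ℂ)) - _).re = _
      rw [hg.integral_profile, sub_re, re_mul_ofReal, ofReal_re]; ring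
    change _ ≤ h⁻¹ * ((sysOf h hh g hg.smooth.continuous a).phase y (2 * π)).re
    rw [this, div_eq_inv_mul]
    refine mul_le_mul_of_nonneg_left ?_ (inv_pos.2 hh).le
    have e : π / C = 2 * π * (1 / (2 * C)) := by field_simp
    rw [e]
    exact mul_le_mul_of_nonneg_left (by linarith) two_pi_pos.le

end IsPotential

namespace IsPotential

variable {g : ℝ → ℂ} {a b : ℝ} {X X' : ℝ → ℝ}

theorem refDefect_im (hg : IsPotential g a b) {C : ℝ} (hC : 0 < C)
    (hX : Hill.IsInverse (profile g a) (b - a) X)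
    (hX' : Hill.IsInverse (fun x => profile g a (2 * π - x)) (2 * π - (b - a)) X') (n : ℕ) :
    ∃ B : ℝ, 0 ≤ B ∧ ∀ h, 0 < h → ∀ (z : ℂ) (r : ℝ), (g a).im < z.im → z.im ≤ meanIm g - 1 / C →
      r = √(z.im - (g a).im) → h ≤ r^3 →
      ContDiffAt ℝ ∞ (fun w : ℂ => Hill.refDefect (profile g a) X X' (2 * π) h z.im w.im) z ∧
      ‖iteratedFDeriv ℝ n (fun w : ℂ => Hill.refDefect (profile g a) X X' (2 * π) h z.im w.im) z‖ ≤
        B * (h / r^3) / (h / r)^n := by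
  obtain ⟨B, hB, H⟩ := hg.hill.refDefect_bounds hg.hill_reflect hg.profile_two_pi hX hX'
    (Y := meanIm g - 1 / C) (by rw [profile_sub]; linarith [hg.meanIm_le, one_div_pos.2 hC]) n
  refine ⟨B, hB, fun h hh z r h1 h2 hr hhr => ?_⟩
  obtain ⟨c1, c2⟩ := H h hh z.im ⟨by rwa [profile_zero], h2⟩ r (by rwa [profile_zero]) hhr
  refine ⟨c1.comp z imCLM.contDiff.contDiffAt, ?_⟩
  have hev := (c1.of_le (show (n : WithTop ℕ∞) ≤ ∞ by exact_mod_cast le_top)).eventually (by simp)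
  obtain ⟨U, hU, hUo, hzU⟩ := mem_nhds_iff.1 hev
  refine (norm_iteratedFDeriv_comp_clm_le imCLM Complex.imCLM_norm.le hUo
    (fun t ht => ContDiffAt.contDiffWithinAt (show ContDiffAt ℝ n
      (Hill.refDefect (profile g a) X X' (2 * π) h z.im) t from hU ht)) hzU).trans ?_
  rw [norm_iteratedFDeriv_eq_norm_iteratedDeriv]
  exact c2

theorem exists_local_rate (hg : IsPotential g a b) {C c M : ℝ} (hC : 0 < C) (hc : 0 < c)
    (hM : 0 ≤ M) (hX : Hill.IsInverse (profile g a) (b - a) X)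
    (hX' : Hill.IsInverse (fun x => profile g a (2 * π - x)) (2 * π - (b - a)) X') :
    ∃ ε0 : ℝ, 0 < ε0 ∧ ε0 ≤ 1 ∧ ∃ B : ℕ → ℝ, (∀ n, 0 ≤ B n) ∧ ∀ (h : ℝ) (hh : 0 < h) {χ : ℝ → ℂ},
      Continuous χ → (∀ x, ‖χ x‖ ≤ M) → ∀ (z0 : ℂ) (r : ℝ), (g a).im < z0.im →
      z0.im ≤ meanIm g - 1 / C → r = √(z0.im - (g a).im) → h ≤ ε0 * r^3 →
      (∀ x, |x - (a + X z0.im)| ≤ c * r → χ x = 1) →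
      (∀ x, |x - (a + (2 * π - X' z0.im))| ≤ c * r → χ x = 0) →
      ∃ u : ℂ → ℝ, ContDiffAt ℝ ∞ u z0 ∧
        (∀ n : ℕ, ‖iteratedFDeriv ℝ n u z0‖ ≤ B n * (h / r^3) / (h / r)^n) ∧
        ∀ᶠ z in nhds z0, IsRate h hh g hg.smooth.continuous a χ z
          (refRate (profile g a) X X' (2 * π) h z.im * exp (u z)) := by
  obtain ⟨c0, hc0, K, hK, ε1, hε1, hε₁1, Hc⟩ := hg.isCenter hC hX hX'
  obtain ⟨C1, hC1, θ0, hθ0, HF⟩ := Sys.exists_holomorphic_rate (lt_min hc hc0) hK one_pos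
    (div_pos pi_pos hC) hM
  choose B hB0 HB using hg.refDefect_im hC hX hX'
  refine ⟨min ε1 (θ0^2), by positivity, (min_le_left _ _).trans hε₁1,
    fun n => 4^n * 2^(n^2) * C1 + B n, fun n => add_nonneg (by positivity) (hB0 n),
    fun h hh χ hχ hχM z0 r h1 h2 hr hhr hχ1 hχ0 => ?_⟩
  have hr0 : 0 < r := hr ▸ sqrt_pos.2 (sub_pos.2 h1)
  have hr3 : 0 < r^3 := by positivity
  have hhr1 : h ≤ ε1 * r^3 := hhr.trans (by gcongr; exact min_le_left _ _)
  have hhr2 : h ≤ θ0^2 * r^3 := hhr.trans (by gcongr; exact min_le_right _ _)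
  have hhr3 : h ≤ r^3 := hhr1.trans (mul_le_of_le_one_left hr3.le hε₁1)
  set D := sysOf h hh g hg.smooth.continuous a with hD
  have hcen := Hc _ (lt_min hc hc0) (min_le_right _ _) h hh z0.im r h1 h2 hr hhr1
  obtain ⟨v, hv⟩ := exists_cutoff h hh g hg.smooth.continuous a hχ
  have hcr : min c c0 * r ≤ c * r := by gcongr; exact min_le_left _ _
  obtain ⟨F, hF, hF1, HF⟩ := HF (D := D) (θ := √(h / r^3)) (sqrt_le_iff.2 ⟨hθ0.le, (div_le_iff₀ hr3).2 hhr2⟩)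
    hcen z0.re (∫ s in 0..2 * π, h⁻¹ * (g (a + s)).re) (v := v)
    (χ := fun x => χ (a + x)) (by fun_prop) (fun x hx => (hv _).trans (by rw [D.pt_val hx]))
    (fun x => hχM _) (fun x hx => hχ1 _ (by rw [add_sub_add_left_eq_sub]; exact hx.trans hcr))
    (fun x hx => hχ0 _ (by rw [add_sub_add_left_eq_sub]; exact hx.trans hcr))
  have hR : 0 < 1 * (D.h / r) := by rw [one_mul]; exact div_pos hh hr0
  rw [sq_sqrt (by positivity)] at hF1
  obtain ⟨f1, f2⟩ := norm_iteratedFDeriv_half_log_le (z := z0) hR hF hF1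
  have hnn : ∀ n : ℕ, (n : WithTop ℕ∞) ≤ ∞ := fun n => by exact_mod_cast le_top
  refine ⟨(fun w => 1 / 2 * log ‖F (reIm w)‖) +
    fun w => Hill.refDefect (profile g a) X X' (2 * π) h z0.im w.im,
    f1.add (HB 0 h hh z0 r h1 h2 hr hhr3).1, fun n => ?_, ?_⟩
  · obtain ⟨b1, b2⟩ := HB n h hh z0 r h1 h2 hr hhr3
    rw [iteratedFDeriv_add_apply (f1.of_le (hnn n)) (b1.of_le (hnn n))]
    refine (norm_add_le_of_le (f2 n) b2).trans_eq ?_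
    rw [one_mul]
    change 4^n * 2^n^2 * (C1 * (h / r^3)) / (h / r)^n + _ = _
    ring
  · obtain ⟨_, _, W⟩ := (hcen z0.im (by rw [sub_self, norm_zero]; exact hR)).1.well
    filter_upwards [reIm.continuous.continuousAt.preimage_mem_nhds
      (Metric.ball_mem_nhds (reIm z0) hR)] with z hz
    obtain ⟨l, l1, l2, l3, l4, l5, l6⟩ := HF z.re z.im hz
    have hom : (∫ s in 0..2 * π, h⁻¹ * (g (a + s)).re) - D.L / D.h * z.re =
        gauge h g z a (2 * π) := by
      have hi : Continuous fun s => h⁻¹ * (g (a + s)).re := by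
        have := hg.smooth.continuous
        fun_prop
      have e : (fun s => h⁻¹ * ((g (a + s)).re - z.re)) = fun s => h⁻¹ * (g (a + s)).re - h⁻¹ * z.re :=
        funext fun s => mul_sub _ _ _
      rw [gauge, e, integral_sub (hi.intervalIntegrable _ _)
        (continuous_const.intervalIntegrable _ _), integral_const]
      change _ - 2 * π / h * z.re = _
      simp only [sub_zero, smul_eq_mul]; ring
    rw [hom] at l2 l3
    refine ⟨l, l1, l2, l3, l4, l5, fun v' hv' => ?_⟩
    obtain rfl : v' = v := BoundedContinuousFunction.ext fun x => (hv' x).trans (hv x).symm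
    have hcr0 : 0 < min c c0 * r := mul_pos (lt_min hc hc0) hr0
    have hκm := hcr0.trans_le W.κm_ge
    have hκp := hcr0.trans_le W.κp_ge
    have hF0 : 0 < ‖F (reIm z)‖ := norm_pos_iff.2 fun h0 => by
      have := (hF1 _ hz).2
      rw [h0, zero_sub, norm_neg, norm_one] at this
      norm_num at this
    refine Eq.symm (l6.trans ?_)
    rw [sqrt_mul (norm_nonneg _), D.sqrt_norm_EE_div_lead hκm hκp (by
      rw [sq_sqrt (by positivity)]; exact (div_mul_cancel₀ h hr3.ne').symm),
      show F (z.re, z.im) = F (reIm z) from rfl, sqrt_eq_rpow, sqrt_eq_rpow,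
      rpow_def_of_pos hF0, refRate, sqrt_eq_rpow, mul_assoc, mul_assoc, ← exp_add,
      ← exp_add]
    change (h / π)^(1 / 2 : ℝ) * _ = _
    congr 2
    have ep : ∀ y x : ℝ, (D.phase y x).re = (∫ t in 0..x, profile g a t) - y * x := fun y x => by
      rw [Sys.phase, ← ofReal_mul, ← ofReal_sub, ofReal_re]; rfl
    rw [ep, ep, ep]
    change h⁻¹ * (((∫ t in 0..2 * π, profile g a t) - z.im * (2 * π)) - _ + _ + _) + _ + _ = _
    simp only [Pi.add_apply, Hill.refDefect, Hill.actionOf, Hill.logSlope]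
    ring

end IsPotential

/-! ### Turning points, the action and the distance to the boundary -/

theorem conj_poisson (g : ℝ → ℂ) (hg : Differentiable ℝ g) (x ξ : ℝ) :
    poisson (symbol g) (fun x ξ => conj (symbol g x ξ)) x ξ =
      -(2 * I) * deriv (fun y => (g y).im) x ∧
    poisson (fun x ξ => conj (symbol g x ξ)) (symbol g) x ξ =
      2 * I * deriv (fun y => (g y).im) x := by
  have h1 : deriv (fun η : ℝ => symbol g x η) ξ = 1 := by
    simp only [symbol]
    exact (ofRealCLM.hasDerivAt.add_const (g x)).deriv
  have h2 : deriv (fun y => symbol g y ξ) x = deriv g x := by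
    simp only [symbol]; exact deriv_const_add _
  have h3 : deriv (fun η : ℝ => conj (symbol g x η)) ξ = 1 := by
    have := deriv.star (f := fun η : ℝ => symbol g x η) (x := ξ)
    rw [h1, star_one] at this; exact this
  have h4 : deriv (fun y => conj (symbol g y ξ)) x = conj (deriv g x) := by
    have := deriv.star (f := fun y => symbol g y ξ) (x := x)
    rw [h2] at this; exact this
  have h5 : deriv (fun y => (g y).im) x = (deriv g x).im :=
    (imCLM.hasFDerivAt.comp_hasDerivAt x (hg x).hasDerivAt).deriv
  simp only [poisson, h1, h2, h3, h4, h5]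
  constructor <;> apply Complex.ext <;> simp <;> ring

theorem bracketProd_eq {g : ℝ → ℂ} (hg : Differentiable ℝ g) (z : ℂ) (xp xm : ℝ) :
    bracketProd g z xp xm = -deriv (fun y => (g y).im) xp * deriv (fun y => (g y).im) xm := by
  rw [bracketProd, (conj_poisson g hg _ _).1, (conj_poisson g hg _ _).2]
  simp

theorem action_eq {g : ℝ → ℂ} (hg : Continuous g) (z : ℂ) (xp xm : ℝ) : action g z xp xm =
    min (∫ y in xp..xm, (z.im - (g y).im)) (∫ y in xp..(xm - 2 * π), (z.im - (g y).im)) := by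
  have : ∀ s t : ℝ, (∫ y in s..t, (z - g y)).im = ∫ y in s..t, (z.im - (g y).im) := fun s t =>
    (imCLM.intervalIntegral_comp_comm ((continuous_const.sub hg).intervalIntegrable s t)).symm
  rw [action, this, this]

namespace IsPotential

variable {g : ℝ → ℂ} {a b : ℝ} {X X' : ℝ → ℝ}

theorem exists_shift (x : ℝ) (a : ℝ) : ∃ k : ℤ, ∃ s ∈ Ico 0 (2 * π), x = a + s + k * (2 * π) := by
  obtain ⟨k, hk, -⟩ := existsUnique_add_zsmul_mem_Ico two_pi_pos (x - a) 0
  refine ⟨-k, _, by simpa using hk, ?_⟩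
  push_cast
  ring

theorem im_mem_Icc (hg : IsPotential g a b) (x : ℝ) : (g x).im ∈ Icc (g a).im (g b).im := by
  obtain ⟨k, s, hs, rfl⟩ := exists_shift x a
  rw [hg.periodic.int_mul k (a + s)]
  have hb := hg.b_lt
  have hab := hg.a_lt_b
  refine ⟨?_, hg.profile_le (Set.Ico_subset_Icc_self hs)⟩
  rw [← profile_zero]
  rcases le_total s (b - a) with h | h
  · exact hg.hill.strictMonoOn.monotoneOn ⟨le_rfl, by linarith⟩ ⟨hs.1, h⟩ hs.1
  · have := hg.hill_reflect.strictMonoOn.monotoneOn (a := 0) (b := 2 * π - s)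
      ⟨le_rfl, by linarith⟩ ⟨by linarith [hs.2], by linarith⟩ (by linarith [hs.2])
    simp only [sub_sub_cancel, sub_zero, hg.profile_two_pi] at this
    exact this

theorem sigma_eq (hg : IsPotential g a b) : sigma g = im ⁻¹' Icc (g a).im (g b).im := by
  have : (Set.range fun q : ℝ × ℝ => symbol g q.1 q.2) = im ⁻¹' Icc (g a).im (g b).im := by
    ext w
    constructor
    · rintro ⟨q, rfl⟩
      simpa [symbol] using hg.im_mem_Icc q.1
    · intro hw
      obtain ⟨x, -, hx⟩ := intermediate_value_Icc hg.a_lt_b.le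
        hg.smooth_im.continuous.continuousOn hw
      refine ⟨(x, w.re - (g x).re), Complex.ext ?_ ?_⟩
      · simp [symbol]
      · simpa [symbol] using hx
  rw [sigma, this]
  exact (isClosed_Icc.preimage continuous_im).closure_eq

theorem bdist_eq (hg : IsPotential g a b) {z : ℂ} (hz : z ∈ sigma g) :
    bdist g z = min (z.im - (g a).im) ((g b).im - z.im) := by
  rw [hg.sigma_eq] at hz
  rw [bdist, hg.sigma_eq, Complex.frontier_preimage_im, frontier_Icc hg.im_lt.le]
  have hd : ∀ t : ℝ, t ∈ ({(g a).im, (g b).im} : Set ℝ) →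
      Metric.infDist z (im ⁻¹' {(g a).im, (g b).im}) ≤ |z.im - t| := fun t ht => by
    refine (Metric.infDist_le_dist_of_mem (y := ⟨z.re, t⟩) ht).trans_eq ?_
    rw [Complex.dist_of_re_eq (show z.re = (⟨z.re, t⟩ : ℂ).re from rfl), dist_eq]
  refine le_antisymm (le_min ?_ ?_) ((Metric.le_infDist
    (s := im ⁻¹' {(g a).im, (g b).im}) ⟨⟨0, (g a).im⟩, Or.inl rfl⟩).2 ?_)
  · exact (hd _ (Or.inl rfl)).trans_eq (abs_of_nonneg (sub_nonneg.2 hz.1))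
  · exact (hd _ (Or.inr rfl)).trans_eq ((abs_sub_comm _ _).trans (abs_of_nonneg (sub_nonneg.2 hz.2)))
  · intro w hw
    have h1 := abs_im_le_norm (z - w)
    rw [sub_im] at h1
    rw [dist_eq_norm]
    rcases hw with hw | hw
    · rw [hw] at h1
      exact (min_le_left _ _).trans ((le_abs_self _).trans h1)
    · rw [Set.mem_singleton_iff.1 hw, abs_sub_comm] at h1
      exact (min_le_right _ _).trans ((le_abs_self _).trans h1)

theorem turningPair (hg : IsPotential g a b) (hX : Hill.IsInverse (profile g a) (b - a) X)
    (hX' : Hill.IsInverse (fun x => profile g a (2 * π - x)) (2 * π - (b - a)) X') {z : ℂ}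
    (hz : z.im ∈ Ioo (g a).im (g b).im) (k : ℤ) :
    IsTurningPair g z (a - X' z.im + k * (2 * π)) (a + X z.im + k * (2 * π)) := by
  obtain ⟨a1, a2, -⟩ := hX z.im (by rwa [profile_zero, profile_sub])
  obtain ⟨b1, b2, -⟩ := hX' z.im (by
    simp only [sub_zero, sub_sub_cancel, profile_sub, hg.profile_two_pi, profile_zero]; exact hz)
  refine ⟨?_, ?_, ?_, ?_, by linarith [a1.2, b1.2], by linarith [a1.1, b1.1]⟩
  · rw [hg.periodic.int_mul k]
    exact (congrFun hg.profile_reflect _).symm.trans b2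
  · rw [hg.periodic.int_mul k]; exact a2
  · rw [hg.periodic_deriv.int_mul k]
    have := hg.hill_reflect.deriv_pos _ b1
    rw [hg.deriv_reflect] at this
    linarith
  · rw [hg.periodic_deriv.int_mul k, ← deriv_profile]
    exact hg.hill.deriv_pos _ a1

theorem eq_of_turningPair (hg : IsPotential g a b) (hX : Hill.IsInverse (profile g a) (b - a) X)
    (hX' : Hill.IsInverse (fun x => profile g a (2 * π - x)) (2 * π - (b - a)) X') {z : ℂ}
    (hz : z.im ∈ Ioo (g a).im (g b).im) {xp xm : ℝ} (H : IsTurningPair g z xp xm) :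
    ∃ k : ℤ, xp = a - X' z.im + k * (2 * π) ∧ xm = a + X z.im + k * (2 * π) := by
  have hb := hg.b_lt
  have hab := hg.a_lt_b
  obtain ⟨a1, a2, -⟩ := hX z.im (by rwa [profile_zero, profile_sub])
  obtain ⟨b1, b2, -⟩ := hX' z.im (by
    simp only [sub_zero, sub_sub_cancel, profile_sub, hg.profile_two_pi, profile_zero]; exact hz)
  obtain ⟨h1, h2, h3, h4, h5, h6⟩ := H
  obtain ⟨k, s, hs, rfl⟩ := exists_shift xm a
  obtain ⟨j, t, ht, rfl⟩ := exists_shift xp a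
  rw [hg.periodic.int_mul] at h1 h2
  rw [hg.periodic_deriv.int_mul] at h3 h4
  have hsX : s = X z.im := by
    rcases le_or_gt s (b - a) with h | h
    · exact hg.hill.strictMonoOn.injOn ⟨hs.1, h⟩ (Ioo_subset_Icc_self a1) (h2.trans a2.symm)
    · have := hg.hill_reflect.deriv_pos (2 * π - s) ⟨by linarith [hs.2], by linarith⟩
      rw [hg.deriv_reflect, ← hg.periodic_deriv, show a - (2 * π - s) + 2 * π = a + s by ring] at this
      linarith
  have htX : 2 * π - t = X' z.im := by
    rcases lt_or_ge t (b - a) with h | h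
    · rcases ht.1.eq_or_lt with h0 | h0
      · rw [← h0, ← deriv_profile] at h3
        exact absurd h3 (by rw [hg.hill.deriv_zero]; exact lt_irrefl 0)
      · have := hg.hill.deriv_pos t ⟨h0, h⟩
        rw [deriv_profile] at this
        linarith
    · refine hg.hill_reflect.strictMonoOn.injOn ⟨by linarith [ht.2], by linarith⟩
        (Ioo_subset_Icc_self b1) (Eq.trans ?_ b2.symm)
      simp only [sub_sub_cancel]; exact h1
  have e : j + 1 = k := by
    have p := two_pi_pos
    have i1 : ((j + 1 - k : ℤ) : ℝ) * (2 * π) < 1 * (2 * π) := by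
      push_cast; nlinarith only [h5, h6, hsX, htX, a1.2, b1.2, a1.1, b1.1]
    have i2 : (-1 : ℝ) * (2 * π) < ((j + 1 - k : ℤ) : ℝ) * (2 * π) := by
      push_cast; nlinarith only [h5, h6, hsX, htX, a1.2, b1.2, a1.1, b1.1, hb, hab]
    have i3 := lt_of_mul_lt_mul_right i1 p.le
    have i4 := lt_of_mul_lt_mul_right i2 p.le
    have i5 : (j + 1 - k : ℤ) < 1 := by exact_mod_cast i3
    have i6 : -1 < (j + 1 - k : ℤ) := by exact_mod_cast i4
    omega
  refine ⟨k, ?_, by rw [hsX]⟩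
  rw [← htX, ← e]; push_cast; ring

theorem action_of_turningPair (hg : IsPotential g a b) {z : ℂ} (hz : z.im ≤ meanIm g) (k : ℤ) :
    action g z (a - X' z.im + k * (2 * π)) (a + X z.im + k * (2 * π)) =
      Hill.actionOf (profile g a) X X' (2 * π) z.im := by
  set f : ℝ → ℝ := fun y => z.im - (g y).im with hf
  have hfc : Continuous f := continuous_const.sub hg.smooth_im.continuous
  have hfp : Periodic f (2 * π) := fun y => by simp only [hf, hg.periodic y]
  have hi : ∀ s t, IntervalIntegrable f volume s t := hfc.intervalIntegrable
  have hc := hg.hill.smooth.continuous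
  have hφ : ∀ x, (∫ y in a..a + x, f y) = z.im * x - ∫ t in 0..x, profile g a t := fun x => by
    have := integral_comp_add_left (a := 0) (b := x) f a
    rw [add_zero] at this
    rw [← this]
    change (∫ t in 0..x, (z.im - profile g a t)) = _
    rw [integral_sub (continuous_const.intervalIntegrable _ _)
      (hc.intervalIntegrable _ _), integral_const, sub_zero, smul_eq_mul, mul_comm]
  have hshift : ∀ s t, (∫ y in s + k * (2 * π)..t + k * (2 * π), f y) = ∫ y in s..t, f y :=
    fun s t => by
      rw [← integral_comp_add_right]
      simp only [hfp.int_mul k _]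
  have hmean := hφ (2 * π)
  rw [hg.integral_profile] at hmean
  have e1 : (∫ y in a - X' z.im..a + X z.im, f y) =
      Hill.actionOf (profile g a) X X' (2 * π) z.im := by
    have e2 : (∫ y in a - X' z.im..a, f y) = ∫ y in a + (2 * π - X' z.im)..a + 2 * π, f y := by
      have := integral_comp_add_right (a := a - X' z.im) (b := a) f (2 * π)
      simp only [hfp _] at this
      rw [this]; ring_nf
    rw [← integral_add_adjacent_intervals (hi _ a) (hi _ _), e2,
      ← integral_interval_sub_left (hi a _) (hi a _), hφ, hφ, hφ, Hill.actionOf]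
    ring
  rw [action_eq hg.smooth.continuous, hshift, add_sub_right_comm, hshift, e1]
  refine min_eq_left ?_
  rw [← e1, ← sub_nonneg, integral_interval_sub_left (hi _ _) (hi _ _), integral_symm]
  have := hfp.intervalIntegral_add_eq (a + X z.im - 2 * π) a
  rw [sub_add_cancel, hmean] at this
  rw [this]
  nlinarith only [hz, two_pi_pos]

end IsPotential

/-! ### The expansion for spectral parameters below the mean value -/

theorem div_pow_eq_zpow_mul_rpow {h r : ℝ} (hh : 0 < h) (hr : 0 < r) (n : ℕ) :
    h / r^3 / (h / r)^n = (r^2)^(((n : ℝ) - 3) / 2) * h^(1 - (n : ℤ)) := by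
  rw [← rpow_natCast r 2, ← rpow_mul hr.le, zpow_sub₀ hh.ne', zpow_one, zpow_natCast,
    show ((2 : ℕ) : ℝ) * (((n : ℝ) - 3) / 2) = (n : ℝ) - (3 : ℕ) by push_cast; ring,
    rpow_sub hr, rpow_natCast, rpow_natCast, div_pow]
  field_simp

theorem rpow_le_of_le_mul {s d C e : ℝ} (hd : 0 < d) (hs : d ≤ s) (hC : s ≤ C * d) :
    s^e ≤ C^|e| * d^e := by
  have h1 : 1 ≤ s / d := (one_le_div hd).2 hs
  have h2 : s / d ≤ C := (div_le_iff₀ hd).2 hC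
  rw [← div_mul_cancel₀ s hd.ne', mul_rpow (by linarith) hd.le]
  refine mul_le_mul_of_nonneg_right ?_ (rpow_nonneg hd.le e)
  exact (rpow_le_rpow_of_exponent_le h1 (le_abs_self e)).trans
    (rpow_le_rpow (by linarith) h2 (abs_nonneg e))

theorem le_mul_cube {ε h r : ℝ} (hε : 0 < ε) (hh : 0 < h) (hr : 0 < r)
    (H : ε^(-(2 / 3) : ℝ) * h^(2 / 3 : ℝ) ≤ r^2) : h ≤ ε * r^3 := by
  have h1 := rpow_le_rpow (by positivity) H (by norm_num : (0 : ℝ) ≤ 3 / 2)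
  rw [mul_rpow (by positivity) (by positivity), ← rpow_mul hε.le, ← rpow_mul hh.le,
    ← rpow_natCast r 2, ← rpow_mul hr.le] at h1
  norm_num at h1
  rw [rpow_neg_one] at h1
  exact (inv_mul_le_iff₀ hε).1 h1

namespace IsPotential

variable {g : ℝ → ℂ} {a b : ℝ} {X X' : ℝ → ℝ}

theorem refRate_eq (hg : IsPotential g a b) (hX : Hill.IsInverse (profile g a) (b - a) X)
    (hX' : Hill.IsInverse (fun x => profile g a (2 * π - x)) (2 * π - (b - a)) X') {z : ℂ}
    (hz : z.im ∈ Ioo (g a).im (g b).im) (hm : z.im ≤ meanIm g) {xp xm h : ℝ} (hh : 0 < h)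
    (H : IsTurningPair g z xp xm) : refRate (profile g a) X X' (2 * π) h z.im =
      √h * (bracketProd g z xp xm / π^2)^(1 / 4 : ℝ) * exp (-action g z xp xm / h) := by
  obtain ⟨k, rfl, rfl⟩ := hg.eq_of_turningPair hX hX' hz H
  obtain ⟨a1, -⟩ := hX z.im (by rwa [profile_zero, profile_sub])
  obtain ⟨b1, -⟩ := hX' z.im (by
    simp only [sub_zero, sub_sub_cancel, profile_sub, hg.profile_two_pi, profile_zero]; exact hz)
  have κm := hg.hill.deriv_pos _ a1
  have κp := hg.hill_reflect.deriv_pos _ b1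
  have hpi := pi_pos
  rw [hg.action_of_turningPair hm k, bracketProd_eq (hg.smooth.differentiable (by simp)),
    hg.periodic_deriv.int_mul k, hg.periodic_deriv.int_mul k, ← hg.deriv_reflect, ← deriv_profile,
    refRate, Hill.logSlope, exp_add, ← log_mul κm.ne' κp.ne', mul_comm (1 / 4 : ℝ),
    ← rpow_def_of_pos (mul_pos κm κp), mul_comm (deriv (profile g a) _),
    div_rpow (mul_pos κp κm).le (by positivity), ← rpow_natCast π 2,
    ← rpow_mul hpi.le, show ((2 : ℕ) : ℝ) * (1 / 4) = 1 / 2 by norm_num, ← sqrt_eq_rpow,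
    sqrt_div hh.le, neg_mul, neg_div, div_eq_inv_mul (Hill.actionOf _ _ _ _ _)]
  ring

theorem exists_expansion_of_lt (hg : IsPotential g a b) {C c M : ℝ} (hC : 0 < C) (hc : 0 < c)
    (hM : 0 ≤ M) : ∃ A > 0, ∃ B : ℕ → ℝ, ∀ h : ℝ, 0 < h → ∀ Ω ⊆ sigma g,
      (∀ z ∈ Ω, A * h^(2 / 3 : ℝ) ≤ bdist g z) → ∀ χ : ℝ → ℂ, IsCutoff g Ω c M χ →
      ∃ K : ℂ → ℝ, ∀ z ∈ Ω, z.im < meanIm g - 1 / C → ContDiffAt ℝ ∞ K z ∧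
        (∀ n : ℕ, ‖iteratedFDeriv ℝ n K z‖ ≤
          B n * bdist g z^(((n : ℝ) - 3) / 2) * h^(1 - (n : ℤ))) ∧
        ∀ xp xm : ℝ, IsTurningPair g z xp xm → ∀ e0 f0 : ℝ → ℂ, IsGroundState (Q h g z) e0 →
          IsGroundState (Qtilde h g z) f0 → ‖scalar (commutator h g χ e0) f0‖ =
            √h * (bracketProd g z xp xm / π^2)^(1 / 4 : ℝ) * (1 + K z) *
              exp (-action g z xp xm / h) := by
  obtain ⟨X, hX⟩ := hg.hill.exists_inverse
  obtain ⟨X', hX'⟩ := hg.hill_reflect.exists_inverse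
  have hlt := hg.im_lt
  set C' := 1 + ((g b).im - (g a).im) * C with hC'
  have hC1 : 1 ≤ C' := by
    have := mul_pos (sub_pos.2 hlt) hC
    linarith
  have hC0 : 0 < √C' := sqrt_pos.2 (by linarith)
  obtain ⟨ε0, hε0, hε1, B, hB, H⟩ := hg.exists_local_rate hC (div_pos hc hC0) hM hX hX'
  choose C1 HC1 using fun n => norm_iteratedFDeriv_exp_sub_one_le n
    (∑ i ∈ Finset.range (n + 1), B i) (Finset.sum_nonneg fun i _ => hB i)
  refine ⟨ε0^(-(2 / 3) : ℝ), by positivity, fun n => |C1 n| * C'^|((n : ℝ) - 3) / 2|,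
    fun h hh Ω hΩ hd χ hχ => ?_⟩
  set R := fun z : ℂ => refRate (profile g a) X X' (2 * π) h z.im with hR
  have hRpos : ∀ z, 0 < R z := fun z => mul_pos (sqrt_pos.2 (div_pos hh pi_pos)) (exp_pos _)
  refine ⟨fun z => Classical.epsilon (IsRate h hh g hg.smooth.continuous a χ z) / R z - 1,
    fun z hz hzC => ?_⟩
  have hdz := hg.bdist_eq (hΩ hz)
  have hd0 : 0 < bdist g z := lt_of_lt_of_le (by positivity) (hd z hz)
  have hda : bdist g z ≤ z.im - (g a).im := hdz.trans_le (min_le_left _ _)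
  have hdb : bdist g z ≤ (g b).im - z.im := hdz.trans_le (min_le_right _ _)
  have hzI : z.im ∈ Ioo (g a).im (g b).im := ⟨by linarith, by linarith⟩
  set r := √(z.im - (g a).im) with hr
  have hr0 : 0 < r := sqrt_pos.2 (by linarith)
  have hr2 : r^2 = z.im - (g a).im := sq_sqrt (by linarith)
  have hrd : r^2 ≤ C' * bdist g z := by
    rw [hr2]
    rcases min_cases (z.im - (g a).im) ((g b).im - z.im) with h1 | h1
    · rw [hdz, h1.1]
      exact le_mul_of_one_le_left (by linarith) hC1
    · have h2 : 1 / C ≤ bdist g z := by rw [hdz, h1.1]; linarith [hg.meanIm_le]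
      have h3 := (div_le_iff₀ hC).1 h2
      nlinarith only [h3, hC', hd0, hzI.2, hlt]
  have hhr : h ≤ ε0 * r^3 := le_mul_cube hε0 hh hr0 ((hd z hz).trans (hda.trans_eq hr2.symm))
  have hcr : c / √C' * r ≤ c * √(bdist g z) := by
    rw [div_mul_eq_mul_div, div_le_iff₀ hC0, mul_assoc, mul_comm (√(bdist g z)),
      ← sqrt_mul (by linarith)]
    exact mul_le_mul_of_nonneg_left (le_sqrt_of_sq_le hrd) hc.le
  have hcχ := hχ.smooth.continuous
  obtain ⟨u, hu, hub, hur⟩ := H h hh hcχ hχ.bound z r hzI.1 hzC.le rfl hhr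
    (fun x hx => hχ.eq_one z hz _ _ (hg.turningPair hX hX' hzI 0) x
      (le_trans (by simpa using hx) hcr))
    (fun x hx => hχ.eq_zero z hz _ _ (hg.turningPair hX hX' hzI 1) x (le_trans (by
        rwa [show a - X' z.im + ((1 : ℤ) : ℝ) * (2 * π) = a + (2 * π - X' z.im) by
          push_cast; ring]) hcr))
  have hev : (fun z => Classical.epsilon (IsRate h hh g hg.smooth.continuous a χ z) / R z - 1)
      =ᶠ[nhds z] fun z => exp (u z) - 1 := by
    filter_upwards [hur] with w hw
    rw [(Classical.epsilon_spec ⟨_, hw⟩ : IsRate h hh g _ a χ w _).unique hcχ hw,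
      mul_div_cancel_left₀ _ (hRpos w).ne']
  refine ⟨ContDiffAt.congr_of_eventuallyEq (hu.exp.sub contDiffAt_const) hev, fun n => ?_, ?_⟩
  · rw [(Filter.EventuallyEq.iteratedFDeriv ℝ hev n).self_of_nhds]
    have hε : 0 < h / r^3 := by positivity
    refine (HC1 n hε ((div_le_one (by positivity)).2 (hhr.trans
      (mul_le_of_le_one_left (by positivity) hε1))) (div_pos hh hr0) hu fun i hi => ?_).trans ?_
    · refine (hub i).trans ?_
      gcongr
      exact Finset.single_le_sum (f := B) (fun j _ => hB j) (Finset.mem_range.2 (by omega))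
    · rw [mul_div_assoc, div_pow_eq_zpow_mul_rpow hh hr0]
      have hs := rpow_le_of_le_mul (e := ((n : ℝ) - 3) / 2) hd0 (hda.trans_eq hr2.symm) hrd
      calc _ ≤ |C1 n| * (C'^|((n : ℝ) - 3) / 2| * bdist g z^(((n : ℝ) - 3) / 2) *
            h^(1 - (n : ℤ))) := by gcongr; exact le_abs_self _
        _ = _ := by ring
  · intro xp xm hp e0 f0 he hf
    have hz' := (Classical.epsilon_spec ⟨_, hur.self_of_nhds⟩ :
      IsRate h hh g hg.smooth.continuous a χ z _)
    set t := Classical.epsilon (IsRate h hh g hg.smooth.continuous a χ z)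
    obtain ⟨v, hv⟩ := exists_cutoff h hh g hg.smooth.continuous a hcχ
    obtain ⟨l, l1, l2, l3, l4, l5, l6⟩ := hz'
    rw [norm_scalar_commutator hh hg.smooth.continuous a hg.smooth hg.periodic l1 l2 l3 l4 l5 hχ.smooth hχ.periodic v hv
      he hf, ← l6 v hv]
    have e := hg.refRate_eq hX hX' hzI (by linarith [one_div_pos.2 hC]) hh hp
    rw [mul_right_comm, ← e, add_sub_cancel]
    exact (mul_div_cancel₀ t (hRpos z).ne').symm

end IsPotential

/-! ### Complex conjugation exchanges the two halves of the picture -/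

/-- The conjugate potential. -/
def conjPot (g : ℝ → ℂ) (x : ℝ) : ℂ := conj (g x)

theorem conjPot_conjPot (g : ℝ → ℂ) : conjPot (conjPot g) = g := funext fun _ => conj_conj _

theorem deriv_im_conjPot (g : ℝ → ℂ) :
    deriv (fun y => (conjPot g y).im) = fun x => -deriv (fun y => (g y).im) x :=
  funext fun x => by simp only [conjPot, conj_im]; exact deriv.fun_neg

theorem IsTurningPair.conjPot {g : ℝ → ℂ} {z : ℂ} {xp xm : ℝ} (H : IsTurningPair g z xp xm)
    (hg : Periodic g (2 * π)) :
    IsTurningPair (conjPot g) (conj z) xm (xp + 2 * π) where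
  im_xp := by rw [Hager.conjPot, conj_im, conj_im, H.im_xm]
  im_xm := by rw [Hager.conjPot, hg, conj_im, conj_im, H.im_xp]
  deriv_xp := by rw [deriv_im_conjPot]; linarith [H.deriv_xm]
  deriv_xm := by
    have : deriv (fun y => (g y).im) (xp + 2 * π) = deriv (fun y => (g y).im) xp := by
      rw [← deriv_comp_add_const]; simp only [hg _]
    rw [deriv_im_conjPot]
    simp only [this]
    linarith [H.deriv_xp]
  lower := by linarith [H.upper]
  upper := by linarith [H.lower]

theorem commutator_eq {h : ℝ} {g χ u : ℝ → ℂ} (hχ : Differentiable ℝ χ) (hu : Differentiable ℝ u)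
    (x : ℝ) : commutator h g χ u x = h * (1 / I * (deriv χ x * u x)) := by
  have : deriv (fun y => χ y * u y) x = deriv χ x * u x + χ x * deriv u x :=
    ((hχ x).hasDerivAt.mul (hu x).hasDerivAt).deriv
  rw [commutator, P, P, this]; ring

theorem norm_scalar_commutator_conjPot {h : ℝ} {g χ e f : ℝ → ℂ} (hχ : Differentiable ℝ χ)
    (he : Differentiable ℝ e) (hf : Differentiable ℝ f) :
    ‖scalar (commutator h (conjPot g) (fun x => 1 - conj (χ x)) f) e‖ =
      ‖scalar (commutator h g χ e) f‖ := by
  have hχ' : Differentiable ℝ fun x => 1 - conj (χ x) := (differentiable_const _).sub hχ.star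
  have hd : ∀ x, deriv (fun x => 1 - conj (χ x)) x = -conj (deriv χ x) := fun x => by
    rw [deriv_const_sub]; exact congrArg _ (deriv.star (f := χ) (x := x))
  rw [← norm_conj (scalar (commutator h g χ e) f), scalar, scalar, ← intervalIntegral_conj]
  congr 2
  funext x
  simp only [commutator_eq hχ he, commutator_eq hχ' hf, hd, map_mul, map_div₀, map_one,
    conj_I, conj_ofReal, conj_conj, div_neg]
  ring

theorem Qtilde_conjPot (h : ℝ) (g : ℝ → ℂ) (z : ℂ) :
    Q h (conjPot g) (conj z) = Qtilde h g z ∧ Qtilde h (conjPot g) (conj z) = Q h g z := by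
  have := Qtilde_eq (h := h) (g := conjPot g) (z := conj z)
  rw [conj_conj] at this
  refine ⟨Qtilde_eq.symm, this.trans ?_⟩
  exact congrArg (Q h · z) (conjPot_conjPot g)

namespace IsPotential

variable {g : ℝ → ℂ} {a b : ℝ}

theorem conjPot (hg : IsPotential g a b) : IsPotential (conjPot g) b (a + 2 * π) where
  smooth := conjCLE.contDiff.comp hg.smooth
  periodic x := congrArg conj (hg.periodic x)
  a_lt_b := hg.b_lt
  b_lt := by linarith [hg.a_lt_b]
  im_lt := by
    rw [Hager.conjPot, Hager.conjPot, hg.periodic, conj_im, conj_im]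
    exact neg_lt_neg hg.im_lt
  crit_iff x hx := by
    have hab := hg.a_lt_b
    have hb := hg.b_lt
    rw [deriv_im_conjPot, neg_eq_zero]
    rcases lt_or_ge x (a + 2 * π) with h | h
    · rw [hg.crit_iff x ⟨by linarith [hx.1], h⟩]
      constructor
      · rintro (h1 | h1)
        · linarith [hx.1]
        · exact Or.inl h1
      · rintro (h1 | h1)
        · exact Or.inr h1
        · linarith
    · have h1 := hg.periodic_deriv (x - 2 * π)
      rw [sub_add_cancel] at h1
      rw [h1, hg.crit_iff _ ⟨by linarith, by linarith [hx.2]⟩]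
      constructor
      · rintro (h1 | h1)
        · exact Or.inr (by linarith)
        · linarith [hx.2]
      · rintro (h1 | h1)
        · linarith
        · exact Or.inl (by linarith)
  nondeg_a := by rw [deriv_im_conjPot, deriv.fun_neg]; exact neg_ne_zero.2 hg.nondeg_b
  nondeg_b := by
    rw [deriv_im_conjPot, deriv.fun_neg, ← deriv_comp_add_const]
    simp only [hg.periodic_deriv _]
    exact neg_ne_zero.2 hg.nondeg_a

theorem meanIm_conjPot (g : ℝ → ℂ) : meanIm (Hager.conjPot g) = -meanIm g := by
  simp only [meanIm, Hager.conjPot, conj_im]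
  rw [integral_neg, mul_neg]

theorem conj_mem_sigma (hg : IsPotential g a b) {z : ℂ} :
    conj z ∈ sigma (Hager.conjPot g) ↔ z ∈ sigma g := by
  rw [hg.sigma_eq, hg.conjPot.sigma_eq]
  simp only [Hager.conjPot, hg.periodic a, Set.mem_preimage, conj_im, mem_Icc, neg_le_neg_iff]
  exact and_comm

theorem bdist_conj (hg : IsPotential g a b) {z : ℂ} (hz : z ∈ sigma g) :
    bdist (Hager.conjPot g) (conj z) = bdist g z := by
  rw [hg.bdist_eq hz, hg.conjPot.bdist_eq (hg.conj_mem_sigma.2 hz), min_comm]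
  simp only [Hager.conjPot, hg.periodic a, conj_im]
  congr 1 <;> ring

theorem action_conj (hg : IsPotential g a b) (z : ℂ) (xp xm : ℝ) :
    action (Hager.conjPot g) (conj z) xm (xp + 2 * π) = action g z xp xm := by
  have hf : Periodic (fun y => z.im - (g y).im) (2 * π) := fun y => by simp only [hg.periodic y]
  have e : ∀ s t, (∫ y in s..t, ((conj z).im - (Hager.conjPot g y).im)) =
      ∫ y in t..s, (z.im - (g y).im) := fun s t => by
    rw [integral_symm, ← integral_neg]
    simp only [Hager.conjPot, conj_im, neg_sub, sub_neg_eq_add]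
    congr 1; funext y; ring
  rw [action_eq hg.smooth.continuous, action_eq hg.conjPot.smooth.continuous, e, e,
    add_sub_cancel_right, min_comm]
  congr 1
  have := integral_comp_add_right (a := xp) (b := xm - 2 * π) (fun y => z.im - (g y).im) (2 * π)
  rw [sub_add_cancel] at this
  rw [← this]
  simp only [hg.periodic _]

theorem bracketProd_conj (hg : IsPotential g a b) (z : ℂ) (xp xm : ℝ) :
    bracketProd (Hager.conjPot g) (conj z) xm (xp + 2 * π) = bracketProd g z xp xm := by
  rw [bracketProd_eq (hg.smooth.differentiable (by simp)),
    bracketProd_eq (hg.conjPot.smooth.differentiable (by simp)), deriv_im_conjPot]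
  simp only [hg.periodic_deriv xp]
  ring

theorem isCutoff_conj (hg : IsPotential g a b) {Ω : Set ℂ} (hΩ : Ω ⊆ sigma g) {c M : ℝ}
    {χ : ℝ → ℂ} (hχ : IsCutoff g Ω c M χ) :
    IsCutoff (Hager.conjPot g) (conj ⁻¹' Ω) c (1 + M) fun x => 1 - conj (χ x) := by
  have hd : ∀ z, conj z ∈ Ω → bdist (Hager.conjPot g) z = bdist g (conj z) := fun z hz => by
    have := hg.bdist_conj (hΩ hz)
    rwa [conj_conj] at this
  have hp : ∀ {z xp xm}, IsTurningPair (Hager.conjPot g) z xp xm →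
      IsTurningPair g (conj z) xm (xp + 2 * π) := fun H => by
    have := H.conjPot hg.conjPot.periodic
    rwa [conjPot_conjPot] at this
  refine ⟨contDiff_const.sub (conjCLE.contDiff.comp hχ.smooth),
    fun x => by simp only [hχ.periodic x], fun x => ?_, fun z hz xp xm H x hx => ?_,
    fun z hz xp xm H x hx => ?_⟩
  · exact norm_sub_le_of_le norm_one.le ((norm_conj _).trans_le (hχ.bound x))
  · rw [hd z hz] at hx
    rw [hχ.eq_zero _ hz _ _ (hp H) x hx, map_zero, sub_zero]
  · rw [hd z hz] at hx
    rw [← hχ.periodic, hχ.eq_one _ hz _ _ (hp H) (x + 2 * π)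
      (by rwa [add_sub_add_right_eq_sub]), map_one, sub_self]

theorem exists_expansion (hg : IsPotential g a b) {C c M : ℝ} (hC : 0 < C) (hc : 0 < c) :
    ∃ A > 0, ∃ B : ℕ → ℝ, ∀ h : ℝ, 0 < h → ∀ Ω ⊆ sigma g,
      (∀ z ∈ Ω, A * h^(2 / 3 : ℝ) ≤ bdist g z) → ∀ χ : ℝ → ℂ, IsCutoff g Ω c M χ →
      ∃ K : ℂ → ℝ, ∀ z ∈ Ω, 1 / C < |z.im - meanIm g| → ContDiffAt ℝ ∞ K z ∧
        (∀ n : ℕ, ‖iteratedFDeriv ℝ n K z‖ ≤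
          B n * bdist g z^(((n : ℝ) - 3) / 2) * h^(1 - (n : ℤ))) ∧
        ∀ xp xm : ℝ, IsTurningPair g z xp xm → ∀ e0 f0 : ℝ → ℂ, IsGroundState (Q h g z) e0 →
          IsGroundState (Qtilde h g z) f0 → ‖scalar (commutator h g χ e0) f0‖ =
            √h * (bracketProd g z xp xm / π^2)^(1 / 4 : ℝ) * (1 + K z) *
              exp (-action g z xp xm / h) := by
  obtain ⟨A1, hA1, B1, H1⟩ := hg.exists_expansion_of_lt hC hc (abs_nonneg M)
  obtain ⟨A2, hA2, B2, H2⟩ := hg.conjPot.exists_expansion_of_lt hC hc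
    (add_nonneg zero_le_one (abs_nonneg M))
  refine ⟨max A1 A2, lt_max_of_lt_left hA1, fun n => max (B1 n) (B2 n), fun h hh Ω hΩ hd χ hχ => ?_⟩
  have hχM : IsCutoff g Ω c |M| χ :=
    ⟨hχ.smooth, hχ.periodic, fun x => (hχ.bound x).trans (le_abs_self M), hχ.eq_one, hχ.eq_zero⟩
  obtain ⟨K1, HK1⟩ := H1 h hh Ω hΩ (fun z hz => (mul_le_mul_of_nonneg_right (le_max_left _ _)
    (by positivity)).trans (hd z hz)) χ hχM
  obtain ⟨K2, HK2⟩ := H2 h hh (conj ⁻¹' Ω)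
    (fun z hz => by rw [← conj_conj z]; exact hg.conj_mem_sigma.2 (hΩ hz))
    (fun z hz => by
      have := hg.bdist_conj (hΩ hz)
      rw [conj_conj] at this
      rw [this]
      exact (mul_le_mul_of_nonneg_right (le_max_right _ _) (by positivity)).trans (hd _ hz))
    _ (hg.isCutoff_conj hΩ hχM)
  refine ⟨fun z => if z.im < meanIm g then K1 z else K2 (conj z), fun z hz hzC => ?_⟩
  have hd0 : 0 < bdist g z := lt_of_lt_of_le (by positivity) (hd z hz)
  have hmono : ∀ n : ℕ, ∀ {t : ℝ}, t ≤ max (B1 n) (B2 n) →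
      t * bdist g z^(((n : ℝ) - 3) / 2) * h^(1 - (n : ℤ)) ≤
        max (B1 n) (B2 n) * bdist g z^(((n : ℝ) - 3) / 2) * h^(1 - (n : ℤ)) :=
    fun n t ht => by gcongr
  rcases lt_abs.1 hzC with h1 | h1
  · have hgt : meanIm g < z.im := by linarith [one_div_pos.2 hC]
    have hev : (fun z => if z.im < meanIm g then K1 z else K2 (conj z)) =ᶠ[nhds z]
        K2 ∘ conjLIE := by
      filter_upwards [continuous_im.continuousAt.eventually (lt_mem_nhds hgt)] with w hw
      rw [if_neg (not_lt.2 hw.le)]; rfl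
    obtain ⟨c1, c2, c3⟩ := HK2 (conj z) (by simpa using hz)
      (by rw [meanIm_conjPot, conj_im]; linarith)
    refine ⟨ContDiffAt.congr_of_eventuallyEq
      (ContDiffAt.comp z c1 conjLIE.contDiff.contDiffAt) hev, fun n => ?_, ?_⟩
    · rw [(Filter.EventuallyEq.iteratedFDeriv ℝ hev n).self_of_nhds,
        LinearIsometryEquiv.norm_iteratedFDeriv_comp_right]
      have := c2 n
      rw [hg.bdist_conj (hΩ hz)] at this
      exact this.trans (hmono n (le_max_right _ _))
    · intro xp xm hp e0 f0 he hf
      have := c3 _ _ (hp.conjPot hg.periodic) f0 e0 (by rwa [(Qtilde_conjPot h g z).1])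
        (by rwa [(Qtilde_conjPot h g z).2])
      obtain ⟨_, he', -⟩ := he
      obtain ⟨_, hf', -⟩ := hf
      rw [norm_scalar_commutator_conjPot (hχ.smooth.differentiable (by simp)) he'.1.2.1 hf'.1.2.1,
        hg.action_conj, hg.bracketProd_conj] at this
      simp only [this, if_neg (not_lt.2 hgt.le)]
  · have hlt : z.im < meanIm g := by linarith [one_div_pos.2 hC]
    have hev : (fun z => if z.im < meanIm g then K1 z else K2 (conj z)) =ᶠ[nhds z] K1 := by
      filter_upwards [continuous_im.continuousAt.eventually (gt_mem_nhds hlt)] with w hw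
      rw [if_pos hw]
    obtain ⟨c1, c2, c3⟩ := HK1 z hz (by linarith)
    refine ⟨c1.congr_of_eventuallyEq hev, fun n => ?_, ?_⟩
    · rw [(Filter.EventuallyEq.iteratedFDeriv ℝ hev n).self_of_nhds]
      exact (c2 n).trans (hmono n (le_max_left _ _))
    · simp only [if_pos hlt]
      exact c3

end IsPotential

end Hager

end

theorem mainTheorem8 (g : ℝ → ℂ) (a b : ℝ) (hg : Hager.IsPotential g a b)
    (R C c M : ℝ) (hC : 0 < C) (hc : 0 < c) :
    ∃ A > 0, ∃ h₀ > 0, ∃ B : ℕ → ℕ → ℝ,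
      ∀ h : ℝ, 0 < h → h < h₀ →
      ∀ Ω : Set ℂ, IsOpen Ω → Ω ⊆ Hager.sigma g → Ω ⊆ Metric.ball 0 R →
        (∀ z ∈ Ω, A * h ^ (2 / 3 : ℝ) ≤ Hager.bdist g z) →
      ∀ χ : ℝ → ℂ, Hager.IsCutoff g Ω c M χ →
      ∃ K : ℂ → ℝ,
        ContDiffOn ℝ ∞ K {z ∈ Ω | 1 / C < |z.im - Hager.meanIm g|} ∧
        (∀ z ∈ Ω, 1 / C < |z.im - Hager.meanIm g| → ∀ β₁ β₂ : ℕ,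
          ‖(Hager.dz^[β₁] (Hager.dzbar^[β₂] fun w => (K w : ℂ))) z‖ ≤
            B β₁ β₂ * Hager.bdist g z ^ ((((β₁ + β₂ : ℕ) : ℝ) - 3) / 2)
              * h ^ (1 - ((β₁ + β₂ : ℕ) : ℤ))) ∧
        (∀ z ∈ Ω, 1 / C < |z.im - Hager.meanIm g| →
          ∀ xp xm : ℝ, Hager.IsTurningPair g z xp xm →
          ∀ e₀ f₀ : ℝ → ℂ, Hager.IsGroundState (Hager.Q h g z) e₀ →
            Hager.IsGroundState (Hager.Qtilde h g z) f₀ →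
            ‖Hager.scalar (Hager.commutator h g χ e₀) f₀‖ =
              √h * (Hager.bracketProd g z xp xm / Real.pi ^ 2) ^ (1 / 4 : ℝ) * (1 + K z)
                * Real.exp (-Hager.action g z xp xm / h)) := by
  obtain ⟨A, hA, B, H⟩ := hg.exists_expansion (M := M) hC hc
  refine ⟨A, hA, 1, one_pos, fun j k => B (j + k), fun h hh _ Ω _ hΩ _ hd χ hχ => ?_⟩
  obtain ⟨K, HK⟩ := H h hh Ω hΩ hd χ hχ
  refine ⟨K, fun z hz => (HK z hz.1 hz.2).1.contDiffWithinAt, fun z hz hzC j k => ?_,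
    fun z hz hzC => (HK z hz hzC).2.2⟩
  obtain ⟨h1, h2, -⟩ := HK z hz hzC
  refine (Hager.norm_dz_dzbar_le (Complex.ofRealCLM.contDiff.contDiffAt.comp z h1) j k).trans
    (le_trans ?_ (h2 (j + k)))
  exact (Complex.ofRealLI.norm_iteratedFDeriv_comp_left
    (h1.of_le (show ((j + k : ℕ) : WithTop ℕ∞) ≤ ∞ by exact_mod_cast le_top)) le_rfl).le
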